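/- **Critical reflection for a beam wave.** Let $0<\gamma<\frac\pi2$, $\gamma\neq\frac\pi4$, $\nu_0,\kappa_0>0$. Write wavenumbers as $k=\rho\sin(\theta+\gamma)$, $m=\rho\cos(\theta+\gamma)$, $\rho=|(k,m)|$, and put $\omega=\omega_{k,m}=\frac{k\cos\gamma-m\sin\gamma}{\sqrt{k^2+m^2}}\,(=\sin\theta)$ and $\zeta=\omega^2-\sin^2\gamma$. Fix $\eta>0$, $x_0\in\mathbb R$, $0<\mu<\frac18$, $R>0$, and consider parameters $0<\varepsilon<\varepsilon_0$ and $\varepsilon^{\mu}<\sigma<1$. Let $\chi=\chi_{\varepsilon,\sigma}$, $\psi=\psi_{\varepsilon,\sigma}\in C^\infty(\mathbb R)$ be supported in $[-R,R]$ and bounded uniformly in $\varepsilon,\sigma$, and let $$\Psi(\rho,\theta)=\chi(\sigma\rho)\Big(\psi\big(\tfrac{\sin\theta-\sin\gamma}{\varepsilon^{1/3}}\big)\psi\big(\tfrac{\cos\theta-\cos\gamma}{\varepsilon^{1/3}}\big)+\psi\big(\tfrac{\sin\theta+\sin\gamma}{\varepsilon^{1/3}}\big)\psi\big(\tfrac{\cos\theta+\cos\gamma}{\varepsilon^{1/3}}\big)\Big).$$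 The window is the set of $(\rho,\theta)$ with $\eta\le\rho\le R/\sigma$, $\theta\in[0,2\pi]$ and either $|\sin\theta-\sin\gamma|,|\cos\theta-\cos\gamma|\le R\varepsilon^{1/3}$ or $|\sin\theta+\sin\gamma|,|\cos\theta+\cos\gamma|\le R\varepsilon^{1/3}$; the part $\rho\ge\eta$ of the support of $\Psi$ lies in it. For $y\ge0$ the incident beam, with components $(u,w,b,p)$, is $$W_{\rm inc}=\frac{\sigma}{\varepsilon^{1/6}}\int_0^{2\pi}\!\!\int_\eta^\infty\Psi\,X_{k,m}\,e^{-i\omega t+ik(x-x_0)+imy}\rho\,d\rho\,d\theta,$$ $$X_{k,m}=\Big(1,\;-\tfrac km,\;\tfrac{i(k\cos\gamma-m\sin\gamma)}{m\omega},\;\tfrac1k\big[\omega+\sin\gamma\tfrac{k\cos\gamma-m\sin\gamma}{m\omega}\big]\Big)^T.$$ The linear system with right-hand side $(r_u,r_w,r_b)$ is, for $y>0$, $$\partial_tu-b\sin\gamma+\partial_xp-\nu_0\varepsilon\Delta u=r_u,\qquad \partial_tw-b\cos\gamma+\partial_yp-\nu_0\varepsilon\Delta w=r_w,$$ $$\partial_tb+u\sin\gamma+w\cos\gamma-\kappa_0\varepsilon\Delta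 b=r_b,\qquad \partial_xu+\partial_yw=0.$$ Its characteristic polynomial for waves $e^{-i\omega t+ikx-\lambda y}$ is $$\mathcal P(\lambda)=-\varepsilon^2\kappa_0\nu_0\lambda^6+(-i\varepsilon\omega(\kappa_0+\nu_0)+3\nu_0\kappa_0\varepsilon^2k^2)\lambda^4+(\zeta+2i\omega(\kappa_0+\nu_0)\varepsilon k^2-3\nu_0\kappa_0\varepsilon^2k^4)\lambda^2$$ $$\qquad-2i\lambda k\sin\gamma\cos\gamma+k^2(\cos^2\gamma-\omega^2-i\varepsilon\omega(\nu_0+\kappa_0)k^2+\nu_0\kappa_0\varepsilon^2k^4),$$ with kernel vector $$X_{k,\lambda}=\Big(1,\;\tfrac{ik}{\lambda},\;\tfrac{\lambda\sin\gamma+ik\cos\gamma}{\lambda(i\omega-\varepsilon\kappa_0(k^2-\lambda^2))},\;\tfrac1{ik}\big[i\omega+\varepsilon\nu_0(\lambda^2-k^2)+\sin\gamma\tfrac{\sin\gamma+ik\lambda^{-1}\cos\gamma}{i\omega+\varepsilon\kappa_0(\lambda^2-k^2)}\big]\Big)^T.$$ A *linear boundary layer beam wave of order $(\alpha,\beta,p,q)$*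 ($\alpha>0$) with decay $\lambda=\lambda(\varepsilon,\rho,\theta)$ is a family, given for $y\ge0$ by $$\frac{\sigma}{\varepsilon^{1/6}}\int_0^{2\pi}\!\!\int_\eta^\infty a\,\Psi\,X_{k,\lambda}\,e^{-i\omega t+ik(x-x_0)-\lambda y}\rho\,d\rho\,d\theta,$$ whose components $(u,w,b)(t)$ belong to $L^2(\mathbb R^2_+)$ for every $t$, which solves the linear system exactly (zero right-hand side), and for which, on the window and uniformly in the parameters, $\lambda$ and $a=a(\varepsilon,\rho,\theta)$ are $C^\infty$ in $(\rho,\theta)$, $|a|\le C\varepsilon^p\rho^q$, ${\rm Re}\,\lambda\ge c\,\varepsilon^{-\alpha}\rho^\beta$ and $|\lambda|\le C\varepsilon^{-\alpha}\rho^\beta$ with $c>0$; moreover there is $\ell(\theta)$, smooth with ${\rm Re}\,\ell>0$ on the angles of the window, such that $\lim_{\varepsilon\to0}\varepsilon^\alpha\lambda=\ell(\theta)\rho^\beta$ at each fixed $(\rho,\theta)$ which lies in the window for all small $\varepsilon$. Then there are functions $\ell_1,\ell_2,\ell_3$ of $\theta$, depending only on $\gamma,\nu_0,\kappa_0$, such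 that for all data as above there exist $\varepsilon_0>0$ and $C$ with the following properties. 1. For $(\rho,\theta)$ in the window, $\mathcal P$ has exactly three roots with positive real part. They are distinct, and they can be labelled $\lambda_1,\lambda_2,\lambda_3$ so that $$\big|\lambda_j-\varepsilon^{-1/3}\rho^{1/3}\ell_j(\theta)\big|\le C\big(\rho+|\zeta|\varepsilon^{-2/3}\rho^{-1/3}\big)\ (j=1,2),\qquad \big|\lambda_3-\varepsilon^{-1/2}\ell_3(\theta)\big|\le C\varepsilon^{-1/6}.$$ 2. There is $W^0=W_{\rm inc}+W_{{\rm BL},\varepsilon^{1/3}}+W_{{\rm BL},\varepsilon^{1/2}}$, where $W_{{\rm BL},\varepsilon^{1/3}}$ is the sum of two linear boundary layer beam waves of order $(\frac13,\frac13,-\frac13,-\frac23)$ with decays $\lambda_1,\lambda_2$ and profiles $\ell_1,\ell_2$, and $W_{{\rm BL},\varepsilon^{1/2}}$ is a linear boundary layer beam wave of order $(\frac12,0,-\frac16,-\frac13)$ with decay $\lambda_3$ and profile $\ell_3$. The components $(u,w,b)$ of $W_{\rm inc}$ belong to $L^2(\mathbb R^2_+)$ for every $t$. 3. $W^0$ is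 of class $C^2$ up to $y=0$, it satisfies the linear system with a remainder such that, uniformly in $t$, $$\|(r_u,r_w,r_b)(t)\|_{L^2(\mathbb R^2_+)}\le C\varepsilon\sigma^{-2},$$ and exactly $u=w=\partial_yb=0$ at $y=0$. -/

import Mathlib

open Filter Topology MeasureTheory Set
open scoped ContDiff

noncomputable section

namespace CriticalReflection

/-! ### Wavenumbers and the dispersion relation

A wavenumber `(k, m)` is written in the polar coordinates `k = ρ sin (θ + γ)`,
`m = ρ cos (θ + γ)`, where `γ` is the angle of the slope and `ρ = |(k, m)|`. -/

def waveK (γ ρ θ : ℝ) : ℝ := ρ * Real.sin (θ + γ)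

def waveM (γ ρ θ : ℝ) : ℝ := ρ * Real.cos (θ + γ)

/-- The branch `ω₊` of the dispersion relation. -/
def omega (γ k m : ℝ) : ℝ :=
  (k * Real.cos γ - m * Real.sin γ) / Real.sqrt (k ^ 2 + m ^ 2)

def freq (γ ρ θ : ℝ) : ℝ := omega γ (waveK γ ρ θ) (waveM γ ρ θ)

/-- The criticality parameter `ζ = ω² - sin² γ`. -/
def zeta (γ ρ θ : ℝ) : ℝ := freq γ ρ θ ^ 2 - Real.sin γ ^ 2

/-- On `ρ > 0` the frequency is `sin θ`: it depends on the direction of the wavenumber only. -/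
theorem freq_eq_sin {γ ρ θ : ℝ} (hρ : 0 < ρ) : freq γ ρ θ = Real.sin θ := by
  have h1 : waveK γ ρ θ ^ 2 + waveM γ ρ θ ^ 2 = ρ ^ 2 := by
    unfold waveK waveM
    linear_combination ρ ^ 2 * Real.sin_sq_add_cos_sq (θ + γ)
  have h2 : Real.sin θ = Real.sin (θ + γ) * Real.cos γ - Real.cos (θ + γ) * Real.sin γ := by
    rw [← Real.sin_sub]; congr 1; ring
  unfold freq omega
  rw [h1, Real.sqrt_sq hρ.le, h2]
  unfold waveK waveM
  field_simp

/-- `ω₊` is the incident branch: its vertical group velocity is negative as soon as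
`k` and `m cos γ + k sin γ` have the same sign. -/
theorem hasDerivAt_omega (γ k m : ℝ) (hk : k ≠ 0) :
    HasDerivAt (fun m => omega γ k m)
      (-(k * (m * Real.cos γ + k * Real.sin γ)) /
        ((k ^ 2 + m ^ 2) * Real.sqrt (k ^ 2 + m ^ 2))) m := by
  have hp : 0 < k ^ 2 + m ^ 2 := by positivity
  have hs : 0 < Real.sqrt (k ^ 2 + m ^ 2) := Real.sqrt_pos.mpr hp
  have hsq : Real.sqrt (k ^ 2 + m ^ 2) ^ 2 = k ^ 2 + m ^ 2 := Real.sq_sqrt hp.le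
  have h1 : HasDerivAt (fun m : ℝ => k * Real.cos γ - m * Real.sin γ) (-(1 * Real.sin γ)) m :=
    ((hasDerivAt_id m).mul_const _).const_sub _
  have h2 : HasDerivAt (fun m : ℝ => k ^ 2 + m ^ 2) (2 * m) m := by
    simpa using (hasDerivAt_pow 2 m).const_add (k ^ 2)
  refine (h1.div (h2.sqrt hp.ne') hs.ne').congr_deriv ?_
  have hne := hs.ne'
  have hpne := hp.ne'
  rw [hsq, div_eq_div_iff hpne (mul_ne_zero hpne hne)]
  field_simp
  rw [hsq]
  ring

/-! ### Amplitudes -/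

/-- `f` is a smooth cutoff, supported in `[-R, R]` and bounded by `B`. -/
def IsCutoff (R B : ℝ) (f : ℝ → ℂ) : Prop :=
  ContDiff ℝ ∞ f ∧ (∀ s, R < |s| → f s = 0) ∧ ∀ s, ‖f s‖ ≤ B

/-- The amplitude `Ψ`: it localizes `ρ` at the scale `σ⁻¹`, and `θ` at distance `O(ε^{1/3})` of
`γ` or of `γ + π`. -/
def amplitude (γ ε σ : ℝ) (χ ψ : ℝ → ℂ) (ρ θ : ℝ) : ℂ :=
  χ (σ * ρ) *
    (ψ ((Real.sin θ - Real.sin γ) / ε ^ (1 / 3 : ℝ)) *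
        ψ ((Real.cos θ - Real.cos γ) / ε ^ (1 / 3 : ℝ)) +
      ψ ((Real.sin θ + Real.sin γ) / ε ^ (1 / 3 : ℝ)) *
        ψ ((Real.cos θ + Real.cos γ) / ε ^ (1 / 3 : ℝ)))

/-- The near-critical angles, to which the amplitude localizes when its cutoffs are supported in
`[-R, R]`. -/
def angularWindow (γ R ε : ℝ) : Set ℝ :=
  {θ | θ ∈ Icc 0 (2 * Real.pi) ∧
    ((|Real.sin θ - Real.sin γ| ≤ R * ε ^ (1 / 3 : ℝ) ∧
        |Real.cos θ - Real.cos γ| ≤ R * ε ^ (1 / 3 : ℝ)) ∨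
      (|Real.sin θ + Real.sin γ| ≤ R * ε ^ (1 / 3 : ℝ) ∧
        |Real.cos θ + Real.cos γ| ≤ R * ε ^ (1 / 3 : ℝ)))}

/-- The pairs `(ρ, θ)`, `ρ ≥ η`, to which the amplitude localizes. -/
def window (γ η R ε σ : ℝ) : Set (ℝ × ℝ) :=
  {z | η ≤ z.1 ∧ σ * z.1 ≤ R ∧ z.2 ∈ angularWindow γ R ε}

/-- The range of the small parameters. -/
def Admissible (μ ε₀ ε σ : ℝ) : Prop := 0 < ε ∧ ε < ε₀ ∧ ε ^ μ < σ ∧ σ < 1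

/-! ### The linear viscous and diffusive Boussinesq system -/

/-- `(t, x, y) ↦ (u, w, b, p)`: velocity, buoyancy and pressure. -/
abbrev Flow := ℝ → ℝ → ℝ → Fin 4 → ℂ

def dt (W : Flow) (i : Fin 4) (t x y : ℝ) : ℂ := deriv (fun s => W s x y i) t

def dx (W : Flow) (i : Fin 4) (t x y : ℝ) : ℂ := deriv (fun s => W t s y i) x

def dy (W : Flow) (i : Fin 4) (t x y : ℝ) : ℂ := deriv (fun s => W t x s i) y

def laplacian (W : Flow) (i : Fin 4) (t x y : ℝ) : ℂ :=
  iteratedDeriv 2 (fun s => W t s y i) x + iteratedDeriv 2 (fun s => W t x s i) y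

/-- Left-hand side of the momentum and buoyancy equations, with viscosity `ν₀ ε` and diffusivity
`κ₀ ε`. -/
def linearOperator (γ ν₀ κ₀ ε : ℝ) (W : Flow) (t x y : ℝ) : Fin 3 → ℂ :=
  ![dt W 0 t x y - W t x y 2 * Real.sin γ + dx W 3 t x y - ν₀ * ε * laplacian W 0 t x y,
    dt W 1 t x y - W t x y 2 * Real.cos γ + dy W 3 t x y - ν₀ * ε * laplacian W 1 t x y,
    dt W 2 t x y + W t x y 0 * Real.sin γ + W t x y 1 * Real.cos γ
      - κ₀ * ε * laplacian W 2 t x y]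

/-- `W` is of class `C²` up to the boundary `y = 0` and it is a divergence-free classical solution
of the linear system in the half-plane `y > 0`, with right-hand side `r`. -/
structure SolvesLinear (γ ν₀ κ₀ ε : ℝ) (W : Flow) (r : ℝ → ℝ → ℝ → Fin 3 → ℂ) : Prop where
  regular : ∀ i, ContDiffOn ℝ 2 (fun z : ℝ × ℝ × ℝ => W z.1 z.2.1 z.2.2 i) {z | 0 ≤ z.2.2}
  equations : ∀ t x y, 0 < y → linearOperator γ ν₀ κ₀ ε W t x y = r t x y
  divergence_free : ∀ t x y, 0 < y → dx W 0 t x y + dy W 1 t x y = 0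

/-- `u = w = ∂_y b = 0` at `y = 0`. -/
def BoundaryConditions (W : Flow) : Prop :=
  ∀ t x, W t x 0 0 = 0 ∧ W t x 0 1 = 0 ∧
    HasDerivWithinAt (fun y => W t x y 2) 0 (Ici 0) 0

/-- Lebesgue measure on the half-plane `y > 0`. -/
def halfPlane : Measure (ℝ × ℝ) := volume.restrict {z | 0 < z.2}

/-- `(u, w, b)` is square integrable in space at each time. -/
def SquareIntegrable (W : Flow) : Prop :=
  ∀ t, ∀ i : Fin 3, MemLp (fun z : ℝ × ℝ => W t z.1 z.2 i.castSucc) 2 halfPlane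

/-! ### Beams -/

/-- Superposition, for `ρ ≥ η`, of the waves `A(ρ, θ) exp (-i ω t + i k (x - x₀) + Y(ρ, θ) y)`,
normalized by `σ ε^{-1/6}` and set to zero for `y < 0`. -/
def wavePacket (γ ε σ η x₀ : ℝ) (A : ℝ → ℝ → Fin 4 → ℂ) (Y : ℝ → ℝ → ℂ) : Flow :=
  fun t x y i =>
    if 0 ≤ y then
      ((σ / ε ^ (1 / 6 : ℝ) : ℝ) : ℂ) *
        ∫ θ in (0 : ℝ)..2 * Real.pi, ∫ ρ in Ioi η,
          A ρ θ i *
            Complex.exp (-Complex.I * freq γ ρ θ * t + Complex.I * waveK γ ρ θ * (x - x₀)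
              + Y ρ θ * y) * ρ
    else 0

/-- The eigenvector of the inviscid plane wave with wavenumber `(k, m)`. -/
def incidentVector (γ k m : ℝ) : Fin 4 → ℂ :=
  ![1,
    -k / m,
    Complex.I * (k * Real.cos γ - m * Real.sin γ) / (m * omega γ k m),
    1 / k * (omega γ k m +
      Real.sin γ * ((k * Real.cos γ - m * Real.sin γ) / (m * omega γ k m)))]

/-- The incident beam wave. -/
def incidentBeam (γ η x₀ ε σ : ℝ) (χ ψ : ℝ → ℂ) : Flow :=
  wavePacket γ ε σ η x₀
    (fun ρ θ i => amplitude γ ε σ χ ψ ρ θ * incidentVector γ (waveK γ ρ θ) (waveM γ ρ θ) i)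
    (fun ρ θ => Complex.I * waveM γ ρ θ)

/-- The matrix of the algebraic system obtained by inserting
`(U, W, B, P) exp (-i Ω t + i k x - lam y)` in the linear system. -/
def layerMatrix (γ ν₀ κ₀ ε Ω k : ℝ) (lam : ℂ) : Matrix (Fin 4) (Fin 4) ℂ :=
  !![-Complex.I * Ω - ν₀ * ε * (lam ^ 2 - k ^ 2), 0, -Real.sin γ, Complex.I * k;
     0, -Complex.I * Ω - ν₀ * ε * (lam ^ 2 - k ^ 2), -Real.cos γ, -lam;
     Real.sin γ, Real.cos γ, -Complex.I * Ω - κ₀ * ε * (lam ^ 2 - k ^ 2), 0;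
     Complex.I * k, -lam, 0, 0]

/-- The characteristic polynomial of the linear system, with `ζ = Ω² - sin² γ`. -/
def charPoly (γ ν₀ κ₀ ε Ω k : ℝ) (lam : ℂ) : ℂ :=
  -ε ^ 2 * κ₀ * ν₀ * lam ^ 6
    + (-Complex.I * ε * Ω * (κ₀ + ν₀) + 3 * ν₀ * κ₀ * ε ^ 2 * k ^ 2) * lam ^ 4
    + ((Ω ^ 2 - Real.sin γ ^ 2) + 2 * Complex.I * Ω * (κ₀ + ν₀) * ε * k ^ 2
        - 3 * ν₀ * κ₀ * ε ^ 2 * k ^ 4) * lam ^ 2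
    - 2 * Complex.I * lam * k * Real.sin γ * Real.cos γ
    + k ^ 2 * (Real.cos γ ^ 2 - Ω ^ 2 - Complex.I * ε * Ω * (ν₀ + κ₀) * k ^ 2
        + ν₀ * κ₀ * ε ^ 2 * k ^ 4)

theorem det_layerMatrix (γ ν₀ κ₀ ε Ω k : ℝ) (lam : ℂ) :
    (layerMatrix γ ν₀ κ₀ ε Ω k lam).det = charPoly γ ν₀ κ₀ ε Ω k lam := by
  have h := Complex.I_sq
  have hk : Complex.I ^ 4 = 1 := by rw [show (4 : ℕ) = 2 * 2 from rfl, pow_mul, h]; norm_num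
  have hk3 : Complex.I ^ 3 = -Complex.I := by rw [pow_succ, h]; ring
  simp [layerMatrix, charPoly, Matrix.det_succ_row_zero, Fin.sum_univ_succ, Fin.succAbove]
  ring_nf
  simp only [h, hk, hk3]
  ring

/-- The kernel vector of `layerMatrix`, normalized by `U = 1`. -/
def layerVector (γ ν₀ κ₀ ε Ω k : ℝ) (lam : ℂ) : Fin 4 → ℂ :=
  ![1,
    Complex.I * k / lam,
    (lam * Real.sin γ + Complex.I * k * Real.cos γ) /
      (lam * (Complex.I * Ω - ε * κ₀ * (k ^ 2 - lam ^ 2))),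
    1 / (Complex.I * k) * (Complex.I * Ω + ε * ν₀ * (lam ^ 2 - k ^ 2) +
      Real.sin γ * ((Real.sin γ + Complex.I * k * lam⁻¹ * Real.cos γ) /
        (Complex.I * Ω + ε * κ₀ * (lam ^ 2 - k ^ 2))))]

/-- The boundary layer packet with decay `lam` and with amplitude `a Ψ` in front of the
eigenvector. -/
def layerBeam (γ ν₀ κ₀ η x₀ ε σ : ℝ) (χ ψ : ℝ → ℂ) (a lam : ℝ → ℝ → ℂ) : Flow :=
  wavePacket γ ε σ η x₀
    (fun ρ θ i => a ρ θ * amplitude γ ε σ χ ψ ρ θ *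
      layerVector γ ν₀ κ₀ ε (freq γ ρ θ) (waveK γ ρ θ) (lam ρ θ) i)
    (fun ρ θ => -lam ρ θ)

/-- The family `W ε σ` is a linear boundary layer beam wave of order `(α, β, p, q)`, with
decay `lam ε ρ θ ∼ ε^{-α} ρ^β ℓ(θ)`. All bounds are uniform in the admissible `(ε, σ)` and on the
window. -/
structure IsLinearLayerBeam (γ ν₀ κ₀ η x₀ μ R ε₀ : ℝ) (χ ψ : ℝ → ℝ → ℝ → ℂ) (α β p q : ℝ)
    (lam : ℝ → ℝ → ℝ → ℂ) (ℓ : ℝ → ℂ) (W : ℝ → ℝ → Flow) : Prop where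
  alpha_pos : 0 < α
  /-- The decay is smooth, with positive real part. -/
  decay_smooth : ∀ ε σ, Admissible μ ε₀ ε σ →
    ContDiffOn ℝ ∞ (fun z : ℝ × ℝ => lam ε z.1 z.2) (window γ η R ε σ)
  decay_pos : ∀ ε σ, Admissible μ ε₀ ε σ → ∀ ρ θ, (ρ, θ) ∈ window γ η R ε σ →
    0 < (lam ε ρ θ).re
  /-- The decay and its real part are of the exact order `ε^{-α} ρ^β`. -/
  decay_size : ∃ c C : ℝ, 0 < c ∧ ∀ ε σ, Admissible μ ε₀ ε σ →
    ∀ ρ θ, (ρ, θ) ∈ window γ η R ε σ →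
      c * ε ^ (-α) * ρ ^ β ≤ (lam ε ρ θ).re ∧ ‖lam ε ρ θ‖ ≤ C * ε ^ (-α) * ρ ^ β
  /-- The limit profile is smooth on the near-critical angles, with positive real part. -/
  profile_smooth : ∀ ε, 0 < ε → ε < ε₀ → ContDiffOn ℝ ∞ ℓ (angularWindow γ R ε)
  profile_pos : ∀ ε, 0 < ε → ε < ε₀ → ∀ θ ∈ angularWindow γ R ε, 0 < (ℓ θ).re
  /-- `ε^α lam → ℓ(θ) ρ^β` as `ε → 0`, at each `(ρ, θ)` that stays in the window. -/
  decay_limit : ∀ ρ θ, η ≤ ρ → (∀ᶠ ε in 𝓝[>] (0 : ℝ), θ ∈ angularWindow γ R ε) →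
    Tendsto (fun ε : ℝ => ((ε ^ α : ℝ) : ℂ) * lam ε ρ θ) (𝓝[>] 0)
      (𝓝 (((ρ ^ β : ℝ) : ℂ) * ℓ θ))
  /-- The packet has the amplitude `a Ψ` with `a` smooth and `a = O(ε^p ρ^q)`. -/
  packet : ∃ a : ℝ → ℝ → ℝ → ℂ,
    (∀ ε σ, Admissible μ ε₀ ε σ →
      ContDiffOn ℝ ∞ (fun z : ℝ × ℝ => a ε z.1 z.2) (window γ η R ε σ)) ∧
    (∃ C : ℝ, ∀ ε σ, Admissible μ ε₀ ε σ → ∀ ρ θ, (ρ, θ) ∈ window γ η R ε σ →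
      ‖a ε ρ θ‖ ≤ C * ε ^ p * ρ ^ q) ∧
    ∀ ε σ, Admissible μ ε₀ ε σ →
      W ε σ = layerBeam γ ν₀ κ₀ η x₀ ε σ (χ ε σ) (ψ ε σ) (a ε) (lam ε)
  /-- It solves the linear system exactly, and it has finite energy. -/
  solves : ∀ ε σ, Admissible μ ε₀ ε σ → SolvesLinear γ ν₀ κ₀ ε (W ε σ) 0
  square_integrable : ∀ ε σ, Admissible μ ε₀ ε σ → SquareIntegrable (W ε σ)

end CriticalReflection

end

/-! For the unit wavenumber (K, m) = (sin(θ+γ), cos(θ+γ)) the characteristic polynomial depends on ε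
and ρ only through d = (ε ρ²)^{1/6}, called `layerScale`: dividing the decay by ρ replaces ε by d⁶
(`charPoly_rescale`). On the window d tends to 0 uniformly, because ρ = O(ε^{-1/8}), and ζ = d² z
with z bounded, because |ζ| = O(ε^{1/3}) while d² ≥ ε^{1/3} η^{2/3}. So one small parameter d is
left, and the others run through a compact set, `parSet`.

The Newton polygon in d gives the six roots. Five of them lie at two singular scales. At λ = x/d²
the limit is −i x (Ω(κ₀+ν₀) x³ + i z x + 2K sin γ cos γ). Since ΩK > 0, the cubic factor has one
root in the open first quadrant, one in the fourth and one with negative real part, for every real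
z. At λ = x/d³ the limit equation is κ₀ν₀ x² = −iΩ(κ₀+ν₀), with two opposite roots off the imaginary
axis. The sixth root continues the incident wave, λ = −im. Its first-order correction is
−d⁶(κ₀+ν₀)/(2(mΩ+sin γ)), where mΩ + sin γ = K(m cos γ + K sin γ) > 0 says that the wave travels
towards the wall; so its real part is negative. The six roots are told apart by size, sign of the
real part or quadrant. Hence they are all the roots, they are simple, and exactly three have
positive real part (`exists_roots`). The passage from d = 0 to d > 0 is quantitative through
`exists_root_near`, and uniform through compactness (`exists_eventually_norm_le`,
`exists_eventually_le_norm`).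

The amplitudes of the three layers solve a 3 × 3 system expressing u = w = ∂_y b = 0 for each
wavenumber. With the unknowns scaled as a₁ = A₁/d², a₂ = A₂/d², a₃ = A₃/d, its determinant has a
nonzero limit at d = 0, because the two intermediate roots are distinct; so the A's are bounded and
the orders of the layers follow (`exists_amplitude_bound`, `amplitudes_cancel`). Each root is the
only one in an open region independent of (ρ, θ), so the implicit function theorem makes it smooth
(`contDiffOn_of_unique_root`).

Every packet is an integral of exponentials over the compact window, and can be differentiated under
the integral sign (`IsBeam.solvesLinear`). The layer vectors lie in the kernel of the symbol, so the
layers are exact solutions. The incident wave solves the inviscid system, and its remainder is the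
superposition with the extra factors ν₀ερ² and κ₀ερ². All traces at y = 0 have the same phases, so
pointwise cancellation of the amplitudes gives the boundary conditions.

The L² bounds come from a Plancherel inequality, proved by a weighted Schur test for Gaussian-damped
integrals (`lintegral_superposition_le`). It is used along horizontal lines for the decaying layers,
and in the plane, in polar wavenumbers, for the oscillating incident beam. There the area
O(ε^{1/3}/σ) of the window cancels the normalization ε^{-1/6} and leaves ε σ^{-2}
(`incidentRemainder_bound`). -/

namespace CriticalReflection

/-! ### Roots of polynomials -/

/-- Near a point where `p` is small with respect to `p'` there is a root of `p`. -/
theorem exists_root_near {p : Polynomial ℂ} {z : ℂ} (hz : p.derivative.eval z ≠ 0) :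
    ∃ r, p.eval r = 0 ∧
      ‖r - z‖ * ‖p.derivative.eval z‖ ≤ p.natDegree * ‖p.eval z‖ := by
  by_cases h0 : p.eval z = 0
  · exact ⟨z, h0, by simp [h0]⟩
  by_contra! hcon
  -- The logarithmic derivative p′/p at z is the sum of 1/(z − r) over the roots. If every root were
  -- farther from z than n·V/D, with n the degree, each of the at most n terms would be below
  -- D/(nV), and the sum below D/V, which is its norm.
  have hs := (IsAlgClosed.splits p).eval_derivative_eq_eval_mul_sum h0
  have hp0 : p ≠ 0 := by rintro rfl; simp at h0
  set D := ‖p.derivative.eval z‖ with hD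
  set V := ‖p.eval z‖ with hV
  have hDpos : 0 < D := norm_pos_iff.mpr hz
  have hVpos : 0 < V := norm_pos_iff.mpr h0
  have hcard : (p.roots.card : ℝ) ≤ p.natDegree := by exact_mod_cast p.card_roots'
  have hne : p.roots ≠ 0 := by
    intro h
    rw [h] at hs
    simp at hs
    exact hz hs
  have hbound : ∀ r ∈ p.roots, ‖1 / (z - r)‖ < D / (p.natDegree * V) := by
    intro r hr
    have h1 := hcon r ((Polynomial.mem_roots hp0).1 hr)
    have hn : (0 : ℝ) < p.natDegree := by
      have : 0 < p.roots.card := Multiset.card_pos.mpr hne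
      have : (0 : ℝ) < p.roots.card := by exact_mod_cast this
      linarith
    have h2 : 0 < ‖r - z‖ := by
      by_contra! h
      have : ‖r - z‖ = 0 := le_antisymm h (norm_nonneg _)
      rw [this] at h1
      nlinarith [mul_pos hn hVpos]
    rw [norm_div, norm_one, norm_sub_rev, div_lt_div_iff₀ h2 (by positivity)]
    linarith
  have hsum : ‖(p.roots.map fun r ↦ 1 / (z - r)).sum‖ < D / V := by
    have hle := norm_multiset_sum_le (p.roots.map fun r ↦ 1 / (z - r))
    rw [Multiset.map_map] at hle
    have h3 : (p.roots.map (fun r ↦ ‖1 / (z - r)‖)).sum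
        < (p.roots.map (fun _ ↦ D / (p.natDegree * V))).sum :=
      Multiset.sum_lt_sum_of_nonempty hne hbound
    have h4 : (p.roots.map (fun _ ↦ D / (p.natDegree * V))).sum ≤ D / V := by
      simp only [Multiset.map_const', Multiset.sum_replicate, nsmul_eq_mul]
      have hn : (0 : ℝ) < p.natDegree := by
        have : 0 < p.roots.card := Multiset.card_pos.mpr hne
        have : (0 : ℝ) < p.roots.card := by exact_mod_cast this
        linarith
      calc (p.roots.card : ℝ) * (D / (p.natDegree * V))
          ≤ p.natDegree * (D / (p.natDegree * V)) := by gcongr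
        _ = D / V := by field_simp
    exact lt_of_le_of_lt hle (lt_of_lt_of_le h3 h4)
  have : D = V * ‖(p.roots.map fun r ↦ 1 / (z - r)).sum‖ := by
    rw [hD, hs, norm_mul]
  rw [this] at hsum
  rw [mul_div_cancel_left₀ _ hVpos.ne'] at hsum
  exact lt_irrefl _ hsum

/-- The sextics without terms of order `5` and `3`. -/
def sextic (c₆ c₄ c₂ c₁ c₀ z : ℂ) : ℂ := c₆ * z ^ 6 + c₄ * z ^ 4 + c₂ * z ^ 2 + c₁ * z + c₀

def sexticDeriv (c₆ c₄ c₂ c₁ z : ℂ) : ℂ := 6 * c₆ * z ^ 5 + 4 * c₄ * z ^ 3 + 2 * c₂ * z + c₁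

theorem hasDerivAt_sextic (c₆ c₄ c₂ c₁ c₀ z : ℂ) :
    HasDerivAt (sextic c₆ c₄ c₂ c₁ c₀) (sexticDeriv c₆ c₄ c₂ c₁ z) z := by
  have := (((((hasDerivAt_pow 6 z).const_mul c₆).add ((hasDerivAt_pow 4 z).const_mul c₄)).add
    ((hasDerivAt_pow 2 z).const_mul c₂)).add ((hasDerivAt_id z).const_mul c₁)).add_const c₀
  refine this.congr_deriv ?_
  simp [sexticDeriv]
  ring

open Polynomial in
noncomputable def sexticPolynomial (c₆ c₄ c₂ c₁ c₀ : ℂ) : ℂ[X] :=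
  C c₆ * X ^ 6 + C c₄ * X ^ 4 + C c₂ * X ^ 2 + C c₁ * X + C c₀

theorem eval_sexticPolynomial (c₆ c₄ c₂ c₁ c₀ z : ℂ) :
    (sexticPolynomial c₆ c₄ c₂ c₁ c₀).eval z = sextic c₆ c₄ c₂ c₁ c₀ z := by
  simp [sexticPolynomial, sextic]

theorem eval_derivative_sexticPolynomial (c₆ c₄ c₂ c₁ c₀ z : ℂ) :
    (sexticPolynomial c₆ c₄ c₂ c₁ c₀).derivative.eval z = sexticDeriv c₆ c₄ c₂ c₁ z := by
  simp [sexticPolynomial, sexticDeriv]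
  ring

theorem natDegree_sexticPolynomial_le (c₆ c₄ c₂ c₁ c₀ : ℂ) :
    (sexticPolynomial c₆ c₄ c₂ c₁ c₀).natDegree ≤ 6 := by
  unfold sexticPolynomial
  compute_degree

theorem exists_sextic_root_near {c₆ c₄ c₂ c₁ c₀ z : ℂ} (hz : sexticDeriv c₆ c₄ c₂ c₁ z ≠ 0) :
    ∃ r, sextic c₆ c₄ c₂ c₁ c₀ r = 0 ∧
      ‖r - z‖ * ‖sexticDeriv c₆ c₄ c₂ c₁ z‖ ≤ 6 * ‖sextic c₆ c₄ c₂ c₁ c₀ z‖ := by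
  rw [← eval_derivative_sexticPolynomial _ _ _ _ c₀] at hz
  obtain ⟨r, h1, h2⟩ := exists_root_near hz
  rw [eval_sexticPolynomial] at h1 h2
  rw [eval_derivative_sexticPolynomial] at h2
  refine ⟨r, h1, h2.trans ?_⟩
  gcongr
  exact_mod_cast natDegree_sexticPolynomial_le _ _ _ _ _

/-- Six distinct roots of a sextic are all its roots, and they are simple. -/
theorem sextic_roots {c₆ c₄ c₂ c₁ c₀ : ℂ} (h6 : c₆ ≠ 0) {r : Fin 6 → ℂ}
    (hr : Function.Injective r) (h : ∀ i, sextic c₆ c₄ c₂ c₁ c₀ (r i) = 0) :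
    (∀ z, sextic c₆ c₄ c₂ c₁ c₀ z = 0 → ∃ i, z = r i) ∧
      ∀ i, sexticDeriv c₆ c₄ c₂ c₁ (r i) ≠ 0 := by
  classical
  set p := sexticPolynomial c₆ c₄ c₂ c₁ c₀ with hp
  have hp0 : p ≠ 0 := by
    intro h0
    have : p.coeff 6 = c₆ := by
      simp [hp, sexticPolynomial]
    rw [h0] at this
    exact h6 (by simpa using this.symm)
  have hroots : p.roots = (Finset.univ.image r).val := by
    refine Polynomial.roots_eq_of_natDegree_le_card_of_ne_zero ?_ ?_ hp0
    · intro x hx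
      obtain ⟨i, -, rfl⟩ := Finset.mem_image.1 hx
      rw [eval_sexticPolynomial, h]
    · rw [Finset.card_image_of_injective _ hr]
      simpa using natDegree_sexticPolynomial_le _ _ _ _ _
  constructor
  · intro z hz
    have : z ∈ p.roots := (Polynomial.mem_roots hp0).2 (by
      rw [Polynomial.IsRoot, eval_sexticPolynomial, hz])
    rw [hroots] at this
    obtain ⟨i, -, hi⟩ := Finset.mem_image.1 (Finset.mem_def.2 this)
    exact ⟨i, hi.symm⟩
  · intro i hi
    have hroot : p.IsRoot (r i) := by rw [Polynomial.IsRoot, eval_sexticPolynomial, h]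
    -- A root shared with the derivative has multiplicity at least two, but the multiset of roots
    -- has just been identified with a set of six points.
    have h1 : 1 < p.rootMultiplicity (r i) :=
      (Polynomial.one_lt_rootMultiplicity_iff_isRoot hp0).2
        ⟨hroot, by rw [Polynomial.IsRoot, eval_derivative_sexticPolynomial, hi]⟩
    rw [← Polynomial.count_roots, hroots] at h1
    exact absurd (Multiset.nodup_iff_count_le_one.1 (Finset.univ.image r).nodup (r i)) (by omega)

/-! ### Uniform bounds on compact sets -/

/-- A tube argument: continuity is required only at the points (0, p), and compactness of S turns a
bound on the slice d = 0 into a bound with one constant for all small d. -/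
theorem exists_eventually_norm_le {P E : Type*} [TopologicalSpace P] [NormedAddCommGroup E]
    {S : Set P} (hS : IsCompact S) {F : ℝ × P → E} (hF : ∀ p ∈ S, ContinuousAt F (0, p)) :
    ∃ C > 0, ∀ᶠ d in 𝓝 (0 : ℝ), ∀ p ∈ S, ‖F (d, p)‖ ≤ C := by
  have h0 : ContinuousOn (fun p => F (0, p)) S := fun p hp =>
    (ContinuousAt.comp (f := fun p : P => ((0 : ℝ), p)) (hF p hp)
      (by fun_prop)).continuousWithinAt
  obtain ⟨C, hC⟩ := hS.exists_bound_of_continuousOn h0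
  refine ⟨max C 0 + 1, by positivity, ?_⟩
  refine hS.eventually_forall_of_forall_eventually (P := fun d p => ‖F (d, p)‖ ≤ max C 0 + 1) ?_
  intro p hp
  have h1 : ‖F (0, p)‖ < max C 0 + 1 :=
    (hC p hp).trans_lt ((le_max_left _ _).trans_lt (lt_add_one _))
  filter_upwards [(hF p hp).norm.eventually_lt continuousAt_const h1] with z hz
  exact hz.le

/-- This is the upper bound applied to 1/F. Nonvanishing for small d is obtained separately, since
the inverse of zero is zero and would hide a zero of F. -/
theorem exists_eventually_le_norm {P : Type*} [TopologicalSpace P]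
    {S : Set P} (hS : IsCompact S) {F : ℝ × P → ℂ} (hF : ∀ p ∈ S, ContinuousAt F (0, p))
    (h0 : ∀ p ∈ S, F (0, p) ≠ 0) :
    ∃ c > 0, ∀ᶠ d in 𝓝 (0 : ℝ), ∀ p ∈ S, c ≤ ‖F (d, p)‖ := by
  obtain ⟨C, hC, h⟩ := exists_eventually_norm_le hS (F := fun z => (F z)⁻¹)
    (fun p hp => (hF p hp).inv₀ (h0 p hp))
  have h2 : ∀ᶠ d in 𝓝 (0 : ℝ), ∀ p ∈ S, F (d, p) ≠ 0 :=
    hS.eventually_forall_of_forall_eventually (P := fun d p => F (d, p) ≠ 0)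
      (fun p hp => (hF p hp).eventually_ne (h0 p hp))
  refine ⟨C⁻¹, by positivity, ?_⟩
  filter_upwards [h, h2] with d h h2 p hp
  have h3 := h p hp
  rw [norm_inv] at h3
  exact inv_le_of_inv_le₀ (norm_pos_iff.2 (h2 p hp)) h3

theorem exists_pos_le_of_isCompact {P : Type*} [TopologicalSpace P] {S : Set P}
    (hS : IsCompact S) {f : P → ℝ} (hf : Continuous f) (h0 : ∀ p ∈ S, 0 < f p) :
    ∃ c > 0, ∀ p ∈ S, c ≤ f p := by
  rcases S.eq_empty_or_nonempty with rfl | hne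
  · exact ⟨1, one_pos, by simp⟩
  obtain ⟨p, hp, hmin⟩ := hS.exists_isMinOn hne hf.continuousOn
  exact ⟨f p, h0 p hp, fun q hq => hmin hq⟩

/-! ### The limit cubic -/

/-- Write a = x + iy. The combination x·Re + y·Im of the two real equations eliminates p and gives
y⁴ = x⁴ + qx. With y = √(S x) on this curve, H x is minus the imaginary part of the equation; it
changes sign on x > 0, so the intermediate value theorem gives a root. -/
theorem exists_cubic_root_pos (p : ℝ) {q : ℝ} (hq : 0 < q) :
    ∃ a : ℂ, a ^ 3 + Complex.I * p * a + q = 0 ∧ 0 < a.re ∧ 0 < a.im := by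
  let S : ℝ → ℝ := fun x => √(x ^ 4 + q * x)
  let H : ℝ → ℝ := fun x => √(S x) * (S x - 3 * x ^ 2) - p * x
  have hH : Continuous H := by
    simp only [H, S]; fun_prop
  -- The left end point is taken as x = q v⁴, so that the leading behaviour (qx)^{1/4} of y becomes
  -- √q·v and no fractional power is needed.
  obtain ⟨v, hv, hv1, hv2⟩ : ∃ v : ℝ, 0 < v ∧ 0 < 1 - 3 * q * v ^ 6 ∧
      0 < √q * (1 - 3 * q * v ^ 6) - p * v := by
    have h1 : ∀ᶠ v in 𝓝[>] (0 : ℝ), 0 < 1 - 3 * q * v ^ 6 := by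
      refine Filter.Eventually.filter_mono nhdsWithin_le_nhds ?_
      refine continuousAt_const.eventually_lt (by fun_prop) (by norm_num)
    have h2 : ∀ᶠ v in 𝓝[>] (0 : ℝ), 0 < √q * (1 - 3 * q * v ^ 6) - p * v := by
      refine Filter.Eventually.filter_mono nhdsWithin_le_nhds ?_
      refine continuousAt_const.eventually_lt (by fun_prop) (by norm_num [hq])
    obtain ⟨v, ⟨h1, h2⟩, h3⟩ := ((h1.and h2).and self_mem_nhdsWithin).exists
    exact ⟨v, h3, h1, h2⟩
  have hup : 0 ≤ H (q * v ^ 4) := by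
    have hS1 : q * v ^ 2 ≤ S (q * v ^ 4) := by
      refine Real.le_sqrt_of_sq_le ?_
      have : 0 ≤ (q * v ^ 4) ^ 4 := by positivity
      nlinarith
    have hS2 : √q * v ≤ √(S (q * v ^ 4)) := by
      refine Real.le_sqrt_of_sq_le ?_
      rw [mul_pow, Real.sq_sqrt hq.le]
      exact hS1
    have h3 : q * v ^ 2 * (1 - 3 * q * v ^ 6) ≤ S (q * v ^ 4) - 3 * (q * v ^ 4) ^ 2 := by
      nlinarith
    have h4 : √q * v * (q * v ^ 2 * (1 - 3 * q * v ^ 6)) ≤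
        √(S (q * v ^ 4)) * (S (q * v ^ 4) - 3 * (q * v ^ 4) ^ 2) := by
      gcongr
    have h5 : 0 < q * v ^ 3 * (√q * (1 - 3 * q * v ^ 6) - p * v) := by positivity
    simp only [H]
    nlinarith
  have hdown : H (1 + q + |p|) ≤ 0 := by
    set x := 1 + q + |p| with hx
    have hx1 : 1 ≤ x := by rw [hx]; linarith [abs_nonneg p]
    have hxp : |p| ≤ x := by rw [hx]; linarith
    have hxq : q ≤ x := by rw [hx]; linarith [abs_nonneg p]
    have hqx : q * x ≤ x ^ 4 := by nlinarith [pow_le_pow_right₀ hx1 (show 2 ≤ 4 by norm_num)]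
    have hS1 : S x ≤ 2 * x ^ 2 := by
      refine Real.sqrt_le_iff.2 ⟨by positivity, by nlinarith [pow_pos (by linarith : 0 < x) 4]⟩
    have hS2 : x ≤ √(S x) := by
      refine Real.le_sqrt_of_sq_le (Real.le_sqrt_of_sq_le ?_)
      nlinarith [mul_pos hq (by linarith : 0 < x)]
    have h3 : √(S x) * (S x - 3 * x ^ 2) ≤ x * (-x ^ 2) := by
      have : S x - 3 * x ^ 2 ≤ -x ^ 2 := by linarith
      nlinarith [sq_nonneg x]
    simp only [H]
    have h4 : -(p * x) ≤ x * x := by nlinarith [neg_abs_le p]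
    nlinarith
  have hle : q * v ^ 4 ≤ 1 + q + |p| := by
    have : v ^ 6 * (3 * q) < 1 := by linarith
    have hv0 : 0 < q := hq
    by_cases hv1 : v ≤ 1
    · have : v ^ 4 ≤ 1 := pow_le_one₀ hv.le hv1
      nlinarith [abs_nonneg p]
    · have : v ^ 4 ≤ v ^ 6 := pow_le_pow_right₀ (not_le.1 hv1).le (by norm_num)
      nlinarith [abs_nonneg p]
  obtain ⟨x, ⟨hx1, -⟩, hx⟩ := intermediate_value_Icc' hle hH.continuousOn
    (show (0 : ℝ) ∈ Icc _ _ from ⟨hdown, hup⟩)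
  have hx0 : 0 < x := lt_of_lt_of_le (by positivity) hx1
  have hS0 : 0 < S x := Real.sqrt_pos.2 (by positivity)
  have hy0 : 0 < √(S x) := Real.sqrt_pos.2 hS0
  set y := √(S x) with hy
  have hy2 : y ^ 2 = S x := Real.sq_sqrt hS0.le
  have hy4 : y ^ 4 = x ^ 4 + q * x := by
    have : S x ^ 2 = x ^ 4 + q * x := Real.sq_sqrt (by positivity)
    rw [← this, ← hy2]; ring
  have him : 3 * x ^ 2 * y - y ^ 3 + p * x = 0 := by
    have : y * (S x - 3 * x ^ 2) - p * x = 0 := hx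
    rw [← hy2] at this
    linarith
  have hre : x ^ 3 - 3 * x * y ^ 2 - p * y + q = 0 := by
    -- The elimination is undone: the real part times x is recovered from y⁴ = x⁴ + qx and the
    -- imaginary part, and x > 0.
    have : x * (x ^ 3 - 3 * x * y ^ 2 - p * y + q) = 0 := by
      linear_combination (-1 : ℝ) * hy4 - y * him
    exact (mul_eq_zero.1 this).resolve_left hx0.ne'
  refine ⟨⟨x, y⟩, ?_, hx0, hy0⟩
  apply Complex.ext
  · simp [pow_succ]
    linarith
  · simp [pow_succ]
    linarith

/-- Conjugation replaces p by −p and exchanges the first and fourth quadrants. -/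
theorem exists_cubic_root_neg (p : ℝ) {q : ℝ} (hq : 0 < q) :
    ∃ a : ℂ, a ^ 3 + Complex.I * p * a + q = 0 ∧ 0 < a.re ∧ a.im < 0 := by
  obtain ⟨a, h, h1, h2⟩ := exists_cubic_root_pos (-p) hq
  refine ⟨(starRingEnd ℂ) a, ?_, by simpa using h1, by simpa using h2⟩
  have := congrArg (starRingEnd ℂ) h
  simp at this
  linear_combination this

/-- At a = iy the imaginary part of the equation is −y³, so y = 0, and then the real part forces q =
0. -/
theorem cubic_re_ne_zero {p q : ℝ} (hq : 0 < q) {a : ℂ}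
    (h : a ^ 3 + Complex.I * p * a + q = 0) : a.re ≠ 0 := by
  intro hre
  have him := congrArg Complex.im h
  have hr := congrArg Complex.re h
  simp [pow_succ, hre] at him hr
  rw [him] at hr
  simp at hr
  exact hq.ne' hr

/-- On the positive real axis the real part of the cubic is a³ + q > 0. -/
theorem cubic_im_ne_zero {p q : ℝ} (hq : 0 < q) {a : ℂ}
    (h : a ^ 3 + Complex.I * p * a + q = 0) (hre : 0 < a.re) : a.im ≠ 0 := by
  intro h0
  have hr := congrArg Complex.re h
  simp [pow_succ, h0] at hr
  nlinarith [pow_pos hre 3]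

/-- The derivative of the limit cubic does not vanish at its roots. -/
theorem cubic_deriv_ne_zero {p q : ℝ} (hq : 0 < q) {a : ℂ}
    (h : a ^ 3 + Complex.I * p * a + q = 0) : 3 * a ^ 2 + Complex.I * p ≠ 0 := by
  intro h1
  have h2 : 2 * a ^ 3 = q := by linear_combination a * h1 - h
  -- Eliminating a from the cubic and its derivative leaves the vanishing of the discriminant: a
  -- real number equal to an imaginary one, so q = 0.
  have h3 : (27 * q ^ 2 : ℂ) = 4 * (Complex.I * p ^ 3) := by
    have h4 : (a ^ 2) = -Complex.I * p / 3 := by linear_combination h1 / 3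
    have : (q : ℂ) ^ 2 = 4 * (a ^ 2) ^ 3 := by rw [← h2]; ring
    rw [this, h4]
    have hI : Complex.I ^ 3 = -Complex.I := by rw [pow_succ, Complex.I_sq]; ring
    linear_combination (-4 * (p : ℂ) ^ 3) * hI
  have := congrArg Complex.re h3
  simp [← Complex.ofReal_pow] at this
  exact hq.ne' this

/-- There is no quadratic term, so the third root is −(a₁ + a₂). -/
theorem cubic_factor {α z β a₁ a₂ : ℂ} (h1 : α * a₁ ^ 3 + z * a₁ + β = 0)
    (h2 : α * a₂ ^ 3 + z * a₂ + β = 0) (hne : a₁ ≠ a₂) (x : ℂ) :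
    α * x ^ 3 + z * x + β = α * (x - a₁) * (x - a₂) * (x + a₁ + a₂) := by
  have h3 : α * (a₁ ^ 2 + a₁ * a₂ + a₂ ^ 2) + z = 0 := by
    have : (a₁ - a₂) * (α * (a₁ ^ 2 + a₁ * a₂ + a₂ ^ 2) + z) = 0 := by
      linear_combination h1 - h2
    exact (mul_eq_zero.1 this).resolve_left (sub_ne_zero.2 hne)
  linear_combination h1 + (x - a₁) * h3

end CriticalReflection

noncomputable section
namespace CriticalReflection

@[fun_prop]
theorem continuousAt_ofReal_comp {X : Type*} [TopologicalSpace X] {f : X → ℝ} {x : X}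
    (hf : ContinuousAt f x) : ContinuousAt (fun y => (f y : ℂ)) x :=
  Complex.continuous_ofReal.continuousAt.comp hf

/-! ### Parameters of the rescaled characteristic polynomial -/

/-- The near-critical parameters `(Ω, K, m, z)`, where `(K, m)` is the unit wavenumber and `z` is
the rescaled criticality parameter. -/
def parSet (γ c₀ M : ℝ) : Set (ℝ × ℝ × ℝ × ℝ) :=
  {p | p.1 = p.2.1 * Real.cos γ - p.2.2.1 * Real.sin γ ∧ p.2.1 ^ 2 + p.2.2.1 ^ 2 = 1 ∧
    c₀ ≤ p.1 * p.2.1 ∧ c₀ ≤ p.2.2.1 * p.1 + Real.sin γ ∧ c₀ ≤ |p.2.2.1| ∧ |p.2.2.2| ≤ M}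

theorem parSet_bounds {γ c₀ M Ω K m z : ℝ} (hc : 0 < c₀) (h : (Ω, K, m, z) ∈ parSet γ c₀ M) :
    |Ω| ≤ 2 ∧ |K| ≤ 1 ∧ |m| ≤ 1 ∧ |z| ≤ M ∧ c₀ / 2 ≤ |Ω| ∧ c₀ / 2 ≤ |K| ∧ Ω ≠ 0 ∧ K ≠ 0 := by
  obtain ⟨h1, h2, h3, -, -, h6⟩ := h
  simp only at h1 h2 h3 h6
  have hK : |K| ≤ 1 := abs_le_one_iff_mul_self_le_one.2 (by nlinarith)
  have hm : |m| ≤ 1 := abs_le_one_iff_mul_self_le_one.2 (by nlinarith)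
  have hΩ : |Ω| ≤ 2 := by
    rw [h1]
    calc |K * Real.cos γ - m * Real.sin γ| ≤ |K * Real.cos γ| + |m * Real.sin γ| := abs_sub _ _
      _ ≤ 1 * 1 + 1 * 1 := by
          rw [abs_mul, abs_mul]
          gcongr
          · exact Real.abs_cos_le_one _
          · exact Real.abs_sin_le_one _
      _ = 2 := by norm_num
  have h7 : c₀ ≤ |Ω| * |K| := by rw [← abs_mul]; exact h3.trans (le_abs_self _)
  refine ⟨hΩ, hK, hm, h6, by nlinarith [abs_nonneg Ω], by nlinarith [abs_nonneg K], ?_, ?_⟩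
  · rintro rfl; simp at h3; linarith
  · rintro rfl; simp at h3; linarith

theorem isCompact_parSet (γ M : ℝ) {c₀ : ℝ} (hc : 0 < c₀) : IsCompact (parSet γ c₀ M) := by
  have hcl : IsClosed (parSet γ c₀ M) := by
    simp only [parSet, Set.ofPred_and]
    refine (isClosed_eq (by fun_prop) (by fun_prop)).inter
      ((isClosed_eq (by fun_prop) (by fun_prop)).inter
      ((isClosed_le (by fun_prop) (by fun_prop)).inter
      ((isClosed_le (by fun_prop) (by fun_prop)).inter
      ((isClosed_le (by fun_prop) (by fun_prop)).inter
      (isClosed_le (by fun_prop) (by fun_prop))))))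
  refine IsCompact.of_isClosed_subset (isCompact_closedBall (0 : ℝ × ℝ × ℝ × ℝ) (max 2 M)) hcl ?_
  rintro ⟨Ω, K, m, z⟩ h
  obtain ⟨h1, h2, h3, h4, -⟩ := parSet_bounds hc h
  simp only [mem_closedBall_zero_iff, Prod.norm_def, Real.norm_eq_abs, sup_le_iff]
  exact ⟨h1.trans (le_max_left _ _), h2.trans (by norm_num), h3.trans (by norm_num),
    h4.trans (le_max_right _ _)⟩

/-! ### Rescalings of the characteristic polynomial -/

section

variable (γ ν₀ κ₀ : ℝ)

theorem charPoly_eq_sextic (ε Ω k : ℝ) (lam : ℂ) :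
    charPoly γ ν₀ κ₀ ε Ω k lam = sextic (-ε ^ 2 * κ₀ * ν₀)
      (-Complex.I * ε * Ω * (κ₀ + ν₀) + 3 * ν₀ * κ₀ * ε ^ 2 * k ^ 2)
      ((Ω ^ 2 - Real.sin γ ^ 2) + 2 * Complex.I * Ω * (κ₀ + ν₀) * ε * k ^ 2
        - 3 * ν₀ * κ₀ * ε ^ 2 * k ^ 4)
      (-2 * Complex.I * k * Real.sin γ * Real.cos γ)
      (k ^ 2 * (Real.cos γ ^ 2 - Ω ^ 2 - Complex.I * ε * Ω * (ν₀ + κ₀) * k ^ 2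
        + ν₀ * κ₀ * ε ^ 2 * k ^ 4)) lam := by
  unfold charPoly sextic
  ring

/-- Viscous and diffusive terms are quadratic in the wavenumber and the others scale together, so
the radius enters only through ε ρ². This reduces everything to unit wavenumbers and a single small
parameter. -/
theorem charPoly_rescale (ε Ω k ρ : ℝ) (lam : ℂ) :
    charPoly γ ν₀ κ₀ ε Ω (ρ * k) (ρ * lam) = ρ ^ 2 * charPoly γ ν₀ κ₀ (ε * ρ ^ 2) Ω k lam := by
  unfold charPoly
  push_cast
  ring

/-- The constant coefficient. -/
def lowCoeff (d Ω K : ℝ) : ℂ :=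
  K ^ 2 * (Real.cos γ ^ 2 - Ω ^ 2 - Complex.I * d ^ 6 * Ω * (ν₀ + κ₀) * K ^ 2
    + ν₀ * κ₀ * d ^ 12 * K ^ 4)

/-- The scale λ = x/d² is the one at which the terms of degree 4, 2 and 1 balance. The coefficients
of degree 6 and 0 carry a factor d², and at d = 0 what remains is −i x times the limit cubic. -/
def midSextic (d Ω K z : ℝ) (x : ℂ) : ℂ :=
  sextic (-(d ^ 2 * κ₀ * ν₀)) (-Complex.I * Ω * (κ₀ + ν₀) + 3 * ν₀ * κ₀ * d ^ 6 * K ^ 2)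
    (z + 2 * Complex.I * Ω * (κ₀ + ν₀) * d ^ 4 * K ^ 2 - 3 * ν₀ * κ₀ * d ^ 10 * K ^ 4)
    (-2 * Complex.I * K * Real.sin γ * Real.cos γ) (d ^ 2 * lowCoeff γ ν₀ κ₀ d Ω K) x

def midSexticDeriv (d Ω K z : ℝ) (x : ℂ) : ℂ :=
  sexticDeriv (-(d ^ 2 * κ₀ * ν₀)) (-Complex.I * Ω * (κ₀ + ν₀) + 3 * ν₀ * κ₀ * d ^ 6 * K ^ 2)
    (z + 2 * Complex.I * Ω * (κ₀ + ν₀) * d ^ 4 * K ^ 2 - 3 * ν₀ * κ₀ * d ^ 10 * K ^ 4)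
    (-2 * Complex.I * K * Real.sin γ * Real.cos γ) x

theorem charPoly_mid {d Ω K z : ℝ} (hd : d ≠ 0) (hz : Ω ^ 2 - Real.sin γ ^ 2 = d ^ 2 * z)
    (x : ℂ) : d ^ 2 * charPoly γ ν₀ κ₀ (d ^ 6) Ω K (x / d ^ 2) = midSextic γ ν₀ κ₀ d Ω K z x := by
  have hd' : (d : ℂ) ≠ 0 := by exact_mod_cast hd
  have hz' : (Ω : ℂ) ^ 2 - Real.sin γ ^ 2 = d ^ 2 * z := by exact_mod_cast hz
  unfold charPoly midSextic sextic lowCoeff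
  rw [hz']
  push_cast
  field_simp
  ring

/-- At λ = x/d³ the terms of degree 6 and 4 balance. At d = 0 this is −x⁴(κ₀ν₀x² + iΩ(κ₀+ν₀)); the
quadruple root 0 stands for the four smaller roots. -/
def largeSextic (d Ω K z : ℝ) (x : ℂ) : ℂ :=
  sextic (-(κ₀ * ν₀)) (-Complex.I * Ω * (κ₀ + ν₀) + 3 * ν₀ * κ₀ * d ^ 6 * K ^ 2)
    (d ^ 2 * z + 2 * Complex.I * Ω * (κ₀ + ν₀) * d ^ 6 * K ^ 2 - 3 * ν₀ * κ₀ * d ^ 12 * K ^ 4)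
    (d ^ 3 * (-2 * Complex.I * K * Real.sin γ * Real.cos γ)) (d ^ 6 * lowCoeff γ ν₀ κ₀ d Ω K) x

def largeSexticDeriv (d Ω K z : ℝ) (x : ℂ) : ℂ :=
  sexticDeriv (-(κ₀ * ν₀)) (-Complex.I * Ω * (κ₀ + ν₀) + 3 * ν₀ * κ₀ * d ^ 6 * K ^ 2)
    (d ^ 2 * z + 2 * Complex.I * Ω * (κ₀ + ν₀) * d ^ 6 * K ^ 2 - 3 * ν₀ * κ₀ * d ^ 12 * K ^ 4)
    (d ^ 3 * (-2 * Complex.I * K * Real.sin γ * Real.cos γ)) x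

theorem charPoly_large {d Ω K z : ℝ} (hd : d ≠ 0) (hz : Ω ^ 2 - Real.sin γ ^ 2 = d ^ 2 * z)
    (x : ℂ) :
    d ^ 6 * charPoly γ ν₀ κ₀ (d ^ 6) Ω K (x / d ^ 3) = largeSextic γ ν₀ κ₀ d Ω K z x := by
  have hd' : (d : ℂ) ≠ 0 := by exact_mod_cast hd
  have hz' : (Ω : ℂ) ^ 2 - Real.sin γ ^ 2 = d ^ 2 * z := by exact_mod_cast hz
  unfold charPoly largeSextic sextic lowCoeff
  rw [hz']
  push_cast
  field_simp
  ring

end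

/-! ### Roots of intermediate size -/

/-- The rescaled limit cubic. -/
def limitCubic (γ ν₀ κ₀ Ω K z : ℝ) (x : ℂ) : ℂ :=
  Ω * (κ₀ + ν₀) * x ^ 3 + Complex.I * z * x + 2 * K * Real.sin γ * Real.cos γ

/-- The limit roots are made part of the compact parameter, so that perturbation constants are
uniform without choosing the roots continuously. -/
def cubicSet (γ ν₀ κ₀ c₀ M : ℝ) : Set ((ℝ × ℝ × ℝ × ℝ) × ℂ) :=
  {q | q.1 ∈ parSet γ c₀ M ∧ limitCubic γ ν₀ κ₀ q.1.1 q.1.2.1 q.1.2.2.2 q.2 = 0}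

section

variable {γ ν₀ κ₀ c₀ M : ℝ}

/-- The leading coefficient is at least s in modulus and the other coefficients are bounded by M and
2; beyond the stated radius the cubic term would dominate. -/
theorem isCompact_cubicSet (hν : 0 < ν₀) (hκ : 0 < κ₀) (hc : 0 < c₀) :
    IsCompact (cubicSet γ ν₀ κ₀ c₀ M) := by
  have hP := isCompact_parSet γ M hc
  have hcl : IsClosed (cubicSet γ ν₀ κ₀ c₀ M) :=
    (hP.isClosed.preimage continuous_fst).inter
      (isClosed_eq (by unfold limitCubic; fun_prop) continuous_const)
  set s := c₀ / 2 * (κ₀ + ν₀) with hs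
  have hs0 : 0 < s := by positivity
  refine IsCompact.of_isClosed_subset
    (hP.prod (isCompact_closedBall (0 : ℂ) (1 + (M + 2) / s))) hcl ?_
  rintro ⟨⟨Ω, K, m, z⟩, x⟩ ⟨hp, hx⟩
  refine ⟨hp, ?_⟩
  simp only at hp hx
  obtain ⟨-, hK, -, hz, hΩ, -⟩ := parSet_bounds hc hp
  have hM : 0 ≤ M := (abs_nonneg z).trans hz
  rw [mem_closedBall_zero_iff]
  by_contra! hcon
  have h0 : 0 ≤ (M + 2) / s := by positivity
  have hx1 : 1 ≤ ‖x‖ := by linarith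
  have hx2 : (M + 2) < s * ‖x‖ := by
    have : (M + 2) / s < ‖x‖ := by linarith
    rw [div_lt_iff₀ hs0] at this
    linarith
  have h1 : Ω * (κ₀ + ν₀) * x ^ 3 =
      -(Complex.I * z * x + 2 * K * Real.sin γ * Real.cos γ) := by
    unfold limitCubic at hx; linear_combination hx
  have h2 : s * ‖x‖ ^ 3 ≤ ‖(Ω * (κ₀ + ν₀) * x ^ 3 : ℂ)‖ := by
    rw [norm_mul, norm_mul, norm_pow, ← Complex.ofReal_add, Complex.norm_real, Complex.norm_real,
      Real.norm_eq_abs, Real.norm_eq_abs, abs_of_pos (by positivity : 0 < κ₀ + ν₀), hs]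
    gcongr
  have h3 : ‖(Complex.I * z * x + 2 * K * Real.sin γ * Real.cos γ : ℂ)‖ ≤ M * ‖x‖ + 2 := by
    refine (norm_add_le _ _).trans ?_
    simp only [norm_mul, Complex.norm_I, Complex.norm_real, Real.norm_eq_abs, Complex.norm_ofNat,
      one_mul]
    have := mul_le_mul (mul_le_mul hK (Real.abs_sin_le_one γ) (abs_nonneg _) zero_le_one)
      (Real.abs_cos_le_one γ) (abs_nonneg _) (by norm_num)
    gcongr
    nlinarith
  rw [h1, norm_neg] at h2
  have h4 : s * ‖x‖ ^ 3 ≤ (M + 2) * ‖x‖ := by nlinarith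
  have h5 : (M + 2) * ‖x‖ < s * ‖x‖ * ‖x‖ := by
    gcongr
  have h6 : s * ‖x‖ * ‖x‖ ≤ s * ‖x‖ ^ 3 := by
    have : ‖x‖ * ‖x‖ ≤ ‖x‖ ^ 3 := by nlinarith [mul_nonneg (norm_nonneg x) (norm_nonneg x)]
    nlinarith
  linarith

/-- The limit cubic in normalized form. -/
theorem limitCubic_eq_zero_iff (hs : κ₀ + ν₀ ≠ 0) {Ω K z : ℝ} (hΩ : Ω ≠ 0) (x : ℂ) :
    limitCubic γ ν₀ κ₀ Ω K z x = 0 ↔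
      x ^ 3 + Complex.I * ((z / (Ω * (κ₀ + ν₀)) : ℝ) : ℂ) * x
        + ((2 * K * Real.sin γ * Real.cos γ / (Ω * (κ₀ + ν₀)) : ℝ) : ℂ) = 0 := by
  have h1 : (Ω : ℂ) ≠ 0 := by exact_mod_cast hΩ
  have h2 : (κ₀ + ν₀ : ℂ) ≠ 0 := by exact_mod_cast hs
  have h3 : limitCubic γ ν₀ κ₀ Ω K z x = Ω * (κ₀ + ν₀) * (x ^ 3
      + Complex.I * ((z / (Ω * (κ₀ + ν₀)) : ℝ) : ℂ) * x
        + ((2 * K * Real.sin γ * Real.cos γ / (Ω * (κ₀ + ν₀)) : ℝ) : ℂ)) := by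
    unfold limitCubic
    push_cast
    field_simp
  rw [h3, mul_eq_zero, or_iff_right (mul_ne_zero h1 h2)]

/-- The sign of the constant term is that of ΩK. Its positivity is what places exactly two roots of
the cubic in the right half-plane. -/
theorem cubic_const_pos (hγ₀ : 0 < γ) (hγ₁ : γ < Real.pi / 2) (hs : 0 < κ₀ + ν₀) {Ω K : ℝ}
    (hΩK : 0 < Ω * K) : 0 < 2 * K * Real.sin γ * Real.cos γ / (Ω * (κ₀ + ν₀)) := by
  have h1 := Real.sin_pos_of_pos_of_lt_pi hγ₀ (by linarith [Real.pi_pos])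
  have h2 := Real.cos_pos_of_mem_Ioo ⟨by linarith, hγ₁⟩
  have hΩ : Ω ≠ 0 := by rintro rfl; simp at hΩK
  have : 2 * K * Real.sin γ * Real.cos γ / (Ω * (κ₀ + ν₀)) =
      2 * (Ω * K) * Real.sin γ * Real.cos γ / (Ω ^ 2 * (κ₀ + ν₀)) := by
    field_simp
  rw [this]
  positivity

/-- A limit root a is an approximate root with defect O(d²), and the derivative at a stays away from
zero uniformly on the compact set of pairs (parameters, a); `exists_sextic_root_near` then applies
with uniform constants. -/
theorem exists_mid_root_near (hγ₀ : 0 < γ) (hγ₁ : γ < Real.pi / 2) (hν : 0 < ν₀) (hκ : 0 < κ₀)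
    (hc : 0 < c₀) :
    ∃ C > 0, ∀ᶠ d in 𝓝 (0 : ℝ), ∀ q ∈ cubicSet γ ν₀ κ₀ c₀ M,
      ∃ x, midSextic γ ν₀ κ₀ d q.1.1 q.1.2.1 q.1.2.2.2 x = 0 ∧ ‖x - q.2‖ ≤ C * d ^ 2 := by
  have hcomp := isCompact_cubicSet (γ := γ) (M := M) hν hκ hc
  obtain ⟨C, hC, hC'⟩ := exists_eventually_norm_le hcomp
    (F := fun u : ℝ × ((ℝ × ℝ × ℝ × ℝ) × ℂ) => -κ₀ * ν₀ * u.2.2 ^ 6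
      + 3 * ν₀ * κ₀ * u.1 ^ 4 * u.2.1.2.1 ^ 2 * u.2.2 ^ 4
      + (2 * Complex.I * u.2.1.1 * (κ₀ + ν₀) * u.1 ^ 2 * u.2.1.2.1 ^ 2
        - 3 * ν₀ * κ₀ * u.1 ^ 8 * u.2.1.2.1 ^ 4) * u.2.2 ^ 2
      + lowCoeff γ ν₀ κ₀ u.1 u.2.1.1 u.2.1.2.1)
    (fun p _ => by unfold lowCoeff; fun_prop)
  obtain ⟨c, hc0, hc'⟩ := exists_eventually_le_norm hcomp
    (F := fun u : ℝ × ((ℝ × ℝ × ℝ × ℝ) × ℂ) =>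
      midSexticDeriv γ ν₀ κ₀ u.1 u.2.1.1 u.2.1.2.1 u.2.1.2.2.2 u.2.2)
    (fun p _ => by unfold midSexticDeriv sexticDeriv; fun_prop) (by
      rintro ⟨⟨Ω, K, m, z⟩, a⟩ ⟨hp, ha⟩
      simp only at hp ha ⊢
      obtain ⟨-, -, -, -, -, -, hΩ, -⟩ := parSet_bounds hc hp
      have hq := cubic_const_pos hγ₀ hγ₁ (by positivity : 0 < κ₀ + ν₀) (hc.trans_le hp.2.2.1)
      have hcub := (limitCubic_eq_zero_iff (by positivity) hΩ a).1 ha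
      have h1 := cubic_deriv_ne_zero hq hcub
      have h2 : a ≠ 0 := by
        rintro rfl
        exact cubic_re_ne_zero hq hcub (by simp)
      -- At d = 0 the sextic is −i x times the cubic, so at a root a of the cubic only the
      -- derivative of the cubic factor survives.
      have h3 : midSexticDeriv γ ν₀ κ₀ 0 Ω K z a = -Complex.I * a * (Ω * (κ₀ + ν₀)) *
          (3 * a ^ 2 + Complex.I * ((z / (Ω * (κ₀ + ν₀)) : ℝ) : ℂ)) := by
        have e1 : (Ω : ℂ) ≠ 0 := by exact_mod_cast hΩ
        have e2 : (κ₀ + ν₀ : ℂ) ≠ 0 := by exact_mod_cast (by positivity : κ₀ + ν₀ ≠ 0)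
        unfold limitCubic at ha
        unfold midSexticDeriv sexticDeriv
        push_cast at ha ⊢
        field_simp
        linear_combination (-Complex.I) * ha + (2 * z * a) * Complex.I_sq
      rw [h3]
      have e1 : (Ω : ℂ) ≠ 0 := by exact_mod_cast hΩ
      have e2 : (κ₀ + ν₀ : ℂ) ≠ 0 := by exact_mod_cast (by positivity : κ₀ + ν₀ ≠ 0)
      exact mul_ne_zero (mul_ne_zero (mul_ne_zero (by simp) h2) (mul_ne_zero e1 e2)) h1)
  refine ⟨6 * C / c, by positivity, ?_⟩
  filter_upwards [hC', hc'] with d h1 h2 q hq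
  specialize h1 q hq
  specialize h2 q hq
  obtain ⟨⟨Ω, K, m, z⟩, a⟩ := q
  obtain ⟨hp, ha⟩ := hq
  simp only at hp ha h1 h2 ⊢
  obtain ⟨x, hx, hxa⟩ := exists_sextic_root_near (c₀ := d ^ 2 * lowCoeff γ ν₀ κ₀ d Ω K)
    (norm_pos_iff.1 (hc0.trans_le h2))
  refine ⟨x, hx, ?_⟩
  have h3 : midSextic γ ν₀ κ₀ d Ω K z a = d ^ 2 * (-κ₀ * ν₀ * a ^ 6
      + 3 * ν₀ * κ₀ * d ^ 4 * K ^ 2 * a ^ 4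
      + (2 * Complex.I * Ω * (κ₀ + ν₀) * d ^ 2 * K ^ 2
        - 3 * ν₀ * κ₀ * d ^ 8 * K ^ 4) * a ^ 2
      + lowCoeff γ ν₀ κ₀ d Ω K) := by
    unfold limitCubic at ha
    unfold midSextic sextic
    linear_combination (-Complex.I * a) * ha + (z * a ^ 2) * Complex.I_sq
  have h4 : ‖midSextic γ ν₀ κ₀ d Ω K z a‖ ≤ d ^ 2 * C := by
    rw [h3, norm_mul, norm_pow, Complex.norm_real, Real.norm_eq_abs, sq_abs]
    gcongr
  have h5 : ‖x - a‖ * c ≤ 6 * (d ^ 2 * C) :=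
    (mul_le_mul_of_nonneg_left h2 (norm_nonneg _)).trans
      (hxa.trans (mul_le_mul_of_nonneg_left h4 (by norm_num)))
  rw [div_mul_eq_mul_div, le_div_iff₀ hc0]
  linarith

/-! ### Large roots -/

def largeSet (γ ν₀ κ₀ c₀ M : ℝ) : Set ((ℝ × ℝ × ℝ × ℝ) × ℂ) :=
  {q | q.1 ∈ parSet γ c₀ M ∧ κ₀ * ν₀ * q.2 ^ 2 = -Complex.I * q.1.1 * (κ₀ + ν₀)}

theorem isCompact_largeSet (hν : 0 < ν₀) (hκ : 0 < κ₀) (hc : 0 < c₀) :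
    IsCompact (largeSet γ ν₀ κ₀ c₀ M) := by
  have hP := isCompact_parSet γ M hc
  have hcl : IsClosed (largeSet γ ν₀ κ₀ c₀ M) :=
    (hP.isClosed.preimage continuous_fst).inter
      (isClosed_eq (by fun_prop) (by fun_prop))
  refine IsCompact.of_isClosed_subset
    (hP.prod (isCompact_closedBall (0 : ℂ) (1 + 2 * (κ₀ + ν₀) / (κ₀ * ν₀)))) hcl ?_
  rintro ⟨⟨Ω, K, m, z⟩, x⟩ ⟨hp, hx⟩
  refine ⟨hp, ?_⟩
  simp only at hp hx
  obtain ⟨hΩ, -⟩ := parSet_bounds hc hp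
  rw [mem_closedBall_zero_iff]
  have h1 := congrArg norm hx
  rw [← Complex.ofReal_add] at h1
  simp only [norm_mul, norm_neg, Complex.norm_I, Complex.norm_real, Real.norm_eq_abs, one_mul,
    norm_pow, abs_of_pos hν, abs_of_pos hκ, abs_of_pos (by positivity : 0 < κ₀ + ν₀)] at h1
  have h2 : ‖x‖ ^ 2 ≤ 2 * (κ₀ + ν₀) / (κ₀ * ν₀) := by
    rw [le_div_iff₀ (by positivity), mul_comm, h1]
    gcongr
  nlinarith [norm_nonneg x, sq_nonneg (‖x‖ - 1)]

/-- The contribution d²|z| = |ζ| is kept apart instead of being bounded by d² M: after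
multiplication by ρ/d³ the latter would give ε^{-1/6} ρ^{2/3}, which is not O(ε^{-1/6}) for large ρ.
-/
theorem exists_large_root_near (hν : 0 < ν₀) (hκ : 0 < κ₀) (hc : 0 < c₀) :
    ∃ C > 0, ∀ᶠ d in 𝓝 (0 : ℝ), ∀ q ∈ largeSet γ ν₀ κ₀ c₀ M,
      ∃ x, largeSextic γ ν₀ κ₀ d q.1.1 q.1.2.1 q.1.2.2.2 x = 0 ∧
        ‖x - q.2‖ ≤ C * (d ^ 2 * |q.1.2.2.2| + |d| ^ 3) := by
  have hcomp := isCompact_largeSet (γ := γ) (M := M) hν hκ hc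
  obtain ⟨C₁, hC₁, hC₁'⟩ := exists_eventually_norm_le hcomp
    (F := fun u : ℝ × ((ℝ × ℝ × ℝ × ℝ) × ℂ) => u.2.2 ^ 2) (fun p _ => by fun_prop)
  obtain ⟨C, hC, hC'⟩ := exists_eventually_norm_le hcomp
    (F := fun u : ℝ × ((ℝ × ℝ × ℝ × ℝ) × ℂ) =>
      3 * ν₀ * κ₀ * u.1 ^ 3 * u.2.1.2.1 ^ 2 * u.2.2 ^ 4
      + (2 * Complex.I * u.2.1.1 * (κ₀ + ν₀) * u.1 ^ 3 * u.2.1.2.1 ^ 2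
        - 3 * ν₀ * κ₀ * u.1 ^ 9 * u.2.1.2.1 ^ 4) * u.2.2 ^ 2
      - 2 * Complex.I * u.2.1.2.1 * Real.sin γ * Real.cos γ * u.2.2
      + u.1 ^ 3 * lowCoeff γ ν₀ κ₀ u.1 u.2.1.1 u.2.1.2.1)
    (fun p _ => by unfold lowCoeff; fun_prop)
  obtain ⟨c, hc0, hc'⟩ := exists_eventually_le_norm hcomp
    (F := fun u : ℝ × ((ℝ × ℝ × ℝ × ℝ) × ℂ) =>
      largeSexticDeriv γ ν₀ κ₀ u.1 u.2.1.1 u.2.1.2.1 u.2.1.2.2.2 u.2.2)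
    (fun p _ => by unfold largeSexticDeriv sexticDeriv; fun_prop) (by
      rintro ⟨⟨Ω, K, m, z⟩, a⟩ ⟨hp, ha⟩
      simp only at hp ha ⊢
      obtain ⟨-, -, -, -, -, -, hΩ, -⟩ := parSet_bounds hc hp
      have e1 : (Ω : ℂ) ≠ 0 := by exact_mod_cast hΩ
      have e2 : (κ₀ + ν₀ : ℂ) ≠ 0 := by exact_mod_cast (by positivity : κ₀ + ν₀ ≠ 0)
      have h2 : a ≠ 0 := by
        rintro rfl
        simp [e1, e2] at ha
      have h3 : largeSexticDeriv γ ν₀ κ₀ 0 Ω K z a =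
          2 * Complex.I * (Ω * (κ₀ + ν₀)) * a ^ 3 := by
        unfold largeSexticDeriv sexticDeriv
        push_cast
        linear_combination (-6 * a ^ 3) * ha
      rw [h3]
      exact mul_ne_zero (mul_ne_zero (by simp) (mul_ne_zero e1 e2)) (pow_ne_zero _ h2))
  refine ⟨6 * (C₁ + C) / c, by positivity, ?_⟩
  filter_upwards [hC₁', hC', hc'] with d h0 h1 h2 q hq
  specialize h0 q hq
  specialize h1 q hq
  specialize h2 q hq
  obtain ⟨⟨Ω, K, m, z⟩, a⟩ := q
  obtain ⟨hp, ha⟩ := hq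
  simp only at hp ha h0 h1 h2 ⊢
  obtain ⟨x, hx, hxa⟩ := exists_sextic_root_near (c₀ := d ^ 6 * lowCoeff γ ν₀ κ₀ d Ω K)
    (norm_pos_iff.1 (hc0.trans_le h2))
  refine ⟨x, hx, ?_⟩
  have h3 : largeSextic γ ν₀ κ₀ d Ω K z a = d ^ 2 * z * a ^ 2 + d ^ 3 * (
      3 * ν₀ * κ₀ * d ^ 3 * K ^ 2 * a ^ 4
      + (2 * Complex.I * Ω * (κ₀ + ν₀) * d ^ 3 * K ^ 2
        - 3 * ν₀ * κ₀ * d ^ 9 * K ^ 4) * a ^ 2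
      - 2 * Complex.I * K * Real.sin γ * Real.cos γ * a
      + d ^ 3 * lowCoeff γ ν₀ κ₀ d Ω K) := by
    unfold largeSextic sextic
    linear_combination (-a ^ 4) * ha
  have h4 : ‖largeSextic γ ν₀ κ₀ d Ω K z a‖ ≤ (C₁ + C) * (d ^ 2 * |z| + |d| ^ 3) := by
    rw [h3]
    refine (norm_add_le _ _).trans ?_
    rw [norm_mul, norm_mul, norm_mul, norm_pow, norm_pow (d : ℂ), Complex.norm_real,
      Complex.norm_real, Real.norm_eq_abs, Real.norm_eq_abs, sq_abs]
    have e1 : d ^ 2 * |z| * ‖a ^ 2‖ ≤ d ^ 2 * |z| * C₁ := by gcongr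
    have e2 := mul_le_mul_of_nonneg_left h1 (pow_nonneg (abs_nonneg d) 3)
    have e3 : 0 ≤ d ^ 2 * |z| * C := by positivity
    have e4 : 0 ≤ |d| ^ 3 * C₁ := by positivity
    linarith
  have h5 : ‖x - a‖ * c ≤ 6 * ((C₁ + C) * (d ^ 2 * |z| + |d| ^ 3)) :=
    (mul_le_mul_of_nonneg_left h2 (norm_nonneg _)).trans
      (hxa.trans (mul_le_mul_of_nonneg_left h4 (by norm_num)))
  rw [div_mul_eq_mul_div, le_div_iff₀ hc0]
  linarith

/-! ### The root of the incident wave -/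

/-- The value y for which −im − d⁶ y solves the characteristic equation to first order in d⁶: that
order reads iΩ(2y(mΩ + sin γ) − (κ₀ + ν₀)) = 0. -/
def incidentShift (γ ν₀ κ₀ : ℝ) (p : ℝ × ℝ × ℝ × ℝ) : ℝ :=
  (κ₀ + ν₀) / (2 * (p.2.2.1 * p.1 + Real.sin γ))

def incidentApprox (γ ν₀ κ₀ : ℝ) (u : ℝ × ℝ × ℝ × ℝ × ℝ) : ℂ :=
  -Complex.I * u.2.2.2.1 - u.1 ^ 6 * incidentShift γ ν₀ κ₀ u.2

/-- At the approximate root x one has K² − x² = 1 + d⁶·(this quantity), since K² + m² = 1. -/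
def incidentDefect (γ ν₀ κ₀ : ℝ) (u : ℝ × ℝ × ℝ × ℝ × ℝ) : ℂ :=
  -2 * Complex.I * u.2.2.2.1 * incidentShift γ ν₀ κ₀ u.2
    - u.1 ^ 6 * (incidentShift γ ν₀ κ₀ u.2 : ℂ) ^ 2

theorem continuousAt_incidentShift (hc : 0 < c₀) {p : ℝ × ℝ × ℝ × ℝ} (hp : p ∈ parSet γ c₀ M) :
    ContinuousAt (fun u : ℝ × ℝ × ℝ × ℝ × ℝ => incidentShift γ ν₀ κ₀ u.2) (0, p) :=
  ContinuousAt.div (by fun_prop) (by fun_prop)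
    (mul_ne_zero two_ne_zero (hc.trans_le hp.2.2.2.1).ne')

theorem continuousAt_incidentApprox (hc : 0 < c₀) {p : ℝ × ℝ × ℝ × ℝ} (hp : p ∈ parSet γ c₀ M) :
    ContinuousAt (incidentApprox γ ν₀ κ₀) (0, p) := by
  have := continuousAt_incidentShift (ν₀ := ν₀) (κ₀ := κ₀) hc hp
  unfold incidentApprox
  fun_prop

theorem continuousAt_incidentDefect (hc : 0 < c₀) {p : ℝ × ℝ × ℝ × ℝ} (hp : p ∈ parSet γ c₀ M) :
    ContinuousAt (incidentDefect γ ν₀ κ₀) (0, p) := by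
  have := continuousAt_incidentShift (ν₀ := ν₀) (κ₀ := κ₀) hc hp
  unfold incidentDefect
  fun_prop

/-- Written in k² − x², the symbol of minus the Laplacian, the polynomial shows its inviscid part
−Ω²(k² − x²) + (k cos γ − i x sin γ)², which vanishes at the incident wave. -/
theorem charPoly_factor (ε Ω k : ℝ) (x : ℂ) :
    charPoly γ ν₀ κ₀ ε Ω k x =
      (k ^ 2 - x ^ 2) * (ε * ν₀ * (k ^ 2 - x ^ 2) - Complex.I * Ω) *
        (ε * κ₀ * (k ^ 2 - x ^ 2) - Complex.I * Ω)
      + (k * Real.cos γ - Complex.I * x * Real.sin γ) ^ 2 := by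
  unfold charPoly
  linear_combination (-(k ^ 2 - x ^ 2) * Ω ^ 2 - x ^ 2 * Real.sin γ ^ 2) * Complex.I_sq

/-- The order zero in d⁶ cancels by the dispersion relation and the order one by the choice of the
shift, so the defect carries a factor d¹². -/
theorem charPoly_incidentApprox (hc : 0 < c₀) {d Ω K m z : ℝ}
    (hp : (Ω, K, m, z) ∈ parSet γ c₀ M) :
    charPoly γ ν₀ κ₀ (d ^ 6) Ω K (incidentApprox γ ν₀ κ₀ (d, Ω, K, m, z)) = (d ^ 6) ^ 2 *
      ((incidentShift γ ν₀ κ₀ (Ω, K, m, z) : ℂ) ^ 2 * Ω ^ 2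
      - Complex.I * Ω * (κ₀ + ν₀) * (2 * incidentDefect γ ν₀ κ₀ (d, Ω, K, m, z)
        + d ^ 6 * incidentDefect γ ν₀ κ₀ (d, Ω, K, m, z) ^ 2)
      + ν₀ * κ₀ * (1 + d ^ 6 * incidentDefect γ ν₀ κ₀ (d, Ω, K, m, z)) ^ 3
      - (incidentShift γ ν₀ κ₀ (Ω, K, m, z) : ℂ) ^ 2 * Real.sin γ ^ 2) := by
  have hne : m * Ω + Real.sin γ ≠ 0 := (hc.trans_le hp.2.2.2.1).ne'
  have hh : 2 * (incidentShift γ ν₀ κ₀ (Ω, K, m, z) : ℂ) * (m * Ω + Real.sin γ) = κ₀ + ν₀ := by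
    have : 2 * incidentShift γ ν₀ κ₀ (Ω, K, m, z) * (m * Ω + Real.sin γ) = κ₀ + ν₀ := by
      simp only [incidentShift]
      field_simp
    exact_mod_cast this
  have h1 : (Ω : ℂ) = K * Real.cos γ - m * Real.sin γ := by exact_mod_cast hp.1
  have h2 : (K : ℂ) ^ 2 + m ^ 2 = 1 := by exact_mod_cast hp.2.1
  rw [charPoly_factor]
  simp only [incidentApprox, incidentDefect]
  generalize (incidentShift γ ν₀ κ₀ (Ω, K, m, z) : ℂ) = y at hh ⊢
  push_cast
  generalize (d : ℂ) ^ 6 = e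
  have hD : (K : ℂ) ^ 2 - (-Complex.I * m - e * y) ^ 2
      = 1 + e * (-2 * Complex.I * m * y - e * y ^ 2) := by
    linear_combination h2 - m ^ 2 * Complex.I_sq
  have hT : K * Complex.cos γ - Complex.I * (-Complex.I * m - e * y) * Complex.sin γ
      = Ω + Complex.I * e * y * Complex.sin γ := by
    push_cast at h1
    linear_combination -h1 + (m * Complex.sin γ : ℂ) * Complex.I_sq
  rw [hD, hT]
  set w : ℂ := -2 * Complex.I * m * y - e * y ^ 2 with hw
  have hw' : w + 2 * Complex.I * m * y + e * y ^ 2 = 0 := by rw [hw]; ring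
  push_cast at hh
  linear_combination (Complex.I * e * Ω) * hh - e * Ω ^ 2 * hw' +
    ((1 + e * w) * Ω ^ 2 + e ^ 2 * y ^ 2 * Complex.sin γ ^ 2) * Complex.I_sq

/-- The root that continues the incident wave has negative real part. -/
theorem exists_incident_root (hν : 0 < ν₀) (hκ : 0 < κ₀) (hc : 0 < c₀) :
    ∃ B > 0, ∀ᶠ d in 𝓝[>] (0 : ℝ), ∀ p ∈ parSet γ c₀ M,
      ∃ x, charPoly γ ν₀ κ₀ (d ^ 6) p.1 p.2.1 x = 0 ∧ x.re < 0 ∧ ‖x‖ ≤ B := by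
  have hcomp := isCompact_parSet γ M hc
  obtain ⟨C, hC, hC'⟩ := exists_eventually_norm_le hcomp
    (F := fun u : ℝ × ℝ × ℝ × ℝ × ℝ => (incidentShift γ ν₀ κ₀ u.2 : ℂ) ^ 2 * u.2.1 ^ 2
      - Complex.I * u.2.1 * (κ₀ + ν₀) * (2 * incidentDefect γ ν₀ κ₀ u
        + u.1 ^ 6 * incidentDefect γ ν₀ κ₀ u ^ 2)
      + ν₀ * κ₀ * (1 + u.1 ^ 6 * incidentDefect γ ν₀ κ₀ u) ^ 3
      - (incidentShift γ ν₀ κ₀ u.2 : ℂ) ^ 2 * Real.sin γ ^ 2)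
    (fun p hp => by
      have h1 := continuousAt_incidentShift (ν₀ := ν₀) (κ₀ := κ₀) hc hp
      have h2 := continuousAt_incidentDefect (ν₀ := ν₀) (κ₀ := κ₀) hc hp
      fun_prop)
  obtain ⟨B, hB, hB'⟩ := exists_eventually_norm_le hcomp
    (fun p hp => continuousAt_incidentApprox (ν₀ := ν₀) (κ₀ := κ₀) hc hp)
  obtain ⟨c, hc0, hc'⟩ := exists_eventually_le_norm hcomp
    (F := fun u : ℝ × ℝ × ℝ × ℝ × ℝ => sexticDeriv (-((u.1 ^ 6 : ℝ) : ℂ) ^ 2 * κ₀ * ν₀)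
      (-Complex.I * ((u.1 ^ 6 : ℝ) : ℂ) * u.2.1 * (κ₀ + ν₀)
        + 3 * ν₀ * κ₀ * ((u.1 ^ 6 : ℝ) : ℂ) ^ 2 * u.2.2.1 ^ 2)
      ((u.2.1 ^ 2 - Real.sin γ ^ 2) + 2 * Complex.I * u.2.1 * (κ₀ + ν₀) * ((u.1 ^ 6 : ℝ) : ℂ)
        * u.2.2.1 ^ 2 - 3 * ν₀ * κ₀ * ((u.1 ^ 6 : ℝ) : ℂ) ^ 2 * u.2.2.1 ^ 4)
      (-2 * Complex.I * u.2.2.1 * Real.sin γ * Real.cos γ) (incidentApprox γ ν₀ κ₀ u))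
    (fun p hp => by
      have h1 := continuousAt_incidentApprox (ν₀ := ν₀) (κ₀ := κ₀) hc hp
      unfold sexticDeriv
      fun_prop) (by
      rintro ⟨Ω, K, m, z⟩ hp
      have hΩne : (Ω : ℂ) ≠ 0 := by exact_mod_cast (parSet_bounds hc hp).2.2.2.2.2.2.1
      have hmΩ : ((m * Ω + Real.sin γ : ℝ) : ℂ) ≠ 0 := by
        exact_mod_cast (hc.trans_le hp.2.2.2.1).ne'
      have h1' : (Ω : ℂ) = K * Real.cos γ - m * Real.sin γ := by exact_mod_cast hp.1
      -- At d = 0 the derivative at −im equals −2iΩ(mΩ + sin γ), by the dispersion relation.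
      convert mul_ne_zero (mul_ne_zero (by simp : -2 * Complex.I ≠ 0) hΩne) hmΩ using 1
      simp only [incidentApprox, sexticDeriv]
      push_cast at h1' ⊢
      linear_combination (2 * Complex.I * Complex.sin γ) * h1')
  obtain ⟨b, hb, hb'⟩ : ∃ b > 0, ∀ p ∈ parSet γ c₀ M, b ≤ incidentShift γ ν₀ κ₀ p := by
    refine ⟨(κ₀ + ν₀) / (2 * 3), by positivity, ?_⟩
    rintro ⟨Ω, K, m, z⟩ hp
    obtain ⟨hΩ, -, hm, -⟩ := parSet_bounds hc hp
    have h1 : 0 < m * Ω + Real.sin γ := hc.trans_le hp.2.2.2.1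
    have h2 : m * Ω + Real.sin γ ≤ 3 := by
      have : |m * Ω| ≤ 1 * 2 := by rw [abs_mul]; gcongr
      linarith [le_abs_self (m * Ω), Real.sin_le_one γ]
    simp only [incidentShift]
    gcongr
  refine ⟨B + 1, by positivity, ?_⟩
  have hsmall : ∀ᶠ d in 𝓝[>] (0 : ℝ), 6 * C / c * d ^ 6 < min b 1 ∧ d < 1 := by
    refine Filter.Eventually.filter_mono nhdsWithin_le_nhds ?_
    have h1 : ContinuousAt (fun d : ℝ => 6 * C / c * d ^ 6) 0 := by fun_prop
    exact (h1.eventually_lt continuousAt_const (by simp [hb])).and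
      (continuousAt_id.eventually_lt continuousAt_const one_pos)
  filter_upwards [nhdsWithin_le_nhds hC', nhdsWithin_le_nhds hB', nhdsWithin_le_nhds hc', hsmall,
    self_mem_nhdsWithin] with d h1 h2 h3 ⟨h4, h4'⟩ h5 p hp
  specialize h1 p hp
  specialize h2 p hp
  specialize h3 p hp
  have hbp := hb' p hp
  have hd : 0 < d := h5
  obtain ⟨Ω, K, m, z⟩ := p
  simp only at h1 h3 ⊢
  obtain ⟨x, hx, hxa⟩ := exists_sextic_root_near (c₀ := K ^ 2 * (Real.cos γ ^ 2 - Ω ^ 2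
      - Complex.I * ((d ^ 6 : ℝ) : ℂ) * Ω * (ν₀ + κ₀) * K ^ 2
      + ν₀ * κ₀ * ((d ^ 6 : ℝ) : ℂ) ^ 2 * K ^ 4)) (norm_pos_iff.1 (hc0.trans_le h3))
  rw [← charPoly_eq_sextic] at hx hxa
  rw [charPoly_incidentApprox hc hp, norm_mul, norm_pow, norm_pow, Complex.norm_real,
    Real.norm_eq_abs, abs_of_pos hd] at hxa
  set a := incidentApprox γ ν₀ κ₀ (d, Ω, K, m, z) with ha
  have h6 : ‖x - a‖ * c ≤ 6 * ((d ^ 6) ^ 2 * C) :=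
    (mul_le_mul_of_nonneg_left h3 (norm_nonneg _)).trans
      (hxa.trans (by gcongr))
  have hd6 : 0 < d ^ 6 := by positivity
  -- The error is O(d¹²), while the real part of the approximation is at most −b d⁶; for small d the
  -- error cannot change the sign.
  have h7 : ‖x - a‖ ≤ d ^ 6 * (6 * C / c * d ^ 6) := by
    have : d ^ 6 * (6 * C / c * d ^ 6) = 6 * ((d ^ 6) ^ 2 * C) / c := by field_simp
    rw [this, le_div_iff₀ hc0]
    exact h6
  have h8 : ‖x - a‖ < d ^ 6 * min b 1 := h7.trans_lt (by gcongr)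
  refine ⟨x, hx, ?_, ?_⟩
  · have h9 : a.re = -(d ^ 6 * incidentShift γ ν₀ κ₀ (Ω, K, m, z)) := by
      rw [ha]
      simp [incidentApprox, ← Complex.ofReal_pow]
    have h10 : x.re - a.re ≤ ‖x - a‖ := by
      rw [← Complex.sub_re]; exact Complex.re_le_norm _
    have h11 : d ^ 6 * min b 1 ≤ d ^ 6 * incidentShift γ ν₀ κ₀ (Ω, K, m, z) := by
      gcongr
      exact (min_le_left _ _).trans hbp
    linarith
  · have h9 : d ^ 6 * min b 1 ≤ 1 := by
      have : d ^ 6 ≤ 1 := pow_le_one₀ hd.le h4'.le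
      nlinarith [min_le_right b 1, lt_min hb one_pos]
    have h10 : ‖x‖ ≤ ‖a‖ + ‖x - a‖ := by
      have := norm_add_le a (x - a)
      simpa using this
    linarith

end
/-! ### The three roots with positive real part -/

section

variable (γ ν₀ κ₀ : ℝ)

/-- The limit, in the first quadrant, of the rescaled intermediate roots. -/
def midProfile (Ω K : ℝ) : ℂ :=
  ((2 * K * Real.sin γ * Real.cos γ / (Ω * (κ₀ + ν₀))) ^ (1 / 3 : ℝ) : ℝ) *
    ((1 + Complex.I * √3) / 2)

/-- The limit of the rescaled large root. -/
def largeProfile (Ω : ℝ) : ℂ :=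
  (√(|Ω * (κ₀ + ν₀) / (κ₀ * ν₀)| / 2) : ℝ) *
    (1 - Complex.I * (Ω * (κ₀ + ν₀) / (κ₀ * ν₀) / |Ω * (κ₀ + ν₀) / (κ₀ * ν₀)| : ℝ))

end

variable {γ ν₀ κ₀ c₀ M : ℝ}

theorem midProfile_re_im {Ω K : ℝ} (hq : 0 < 2 * K * Real.sin γ * Real.cos γ / (Ω * (κ₀ + ν₀))) :
    0 < (midProfile γ ν₀ κ₀ Ω K).re ∧ 0 < (midProfile γ ν₀ κ₀ Ω K).im := by
  have h := Real.rpow_pos_of_pos hq (1 / 3 : ℝ)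
  have h3 : (0 : ℝ) < √3 := by positivity
  unfold midProfile
  rw [Complex.re_ofReal_mul, Complex.im_ofReal_mul]
  constructor
  · refine mul_pos h ?_
    simp
  · refine mul_pos h ?_
    simp

/-- The complex factor is e^{iπ/3}, whose cube is −1. -/
theorem midProfile_pow_three {Ω K : ℝ}
    (hq : 0 < 2 * K * Real.sin γ * Real.cos γ / (Ω * (κ₀ + ν₀))) :
    midProfile γ ν₀ κ₀ Ω K ^ 3 =
      -((2 * K * Real.sin γ * Real.cos γ / (Ω * (κ₀ + ν₀)) : ℝ) : ℂ) := by
  unfold midProfile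
  rw [mul_pow, ← Complex.ofReal_pow, ← Real.rpow_natCast, ← Real.rpow_mul hq.le]
  have h3 : ((√3 : ℝ) : ℂ) ^ 2 = 3 := by
    rw [← Complex.ofReal_pow, Real.sq_sqrt (by norm_num)]; norm_num
  have h4 : ((1 + Complex.I * √3) / 2 : ℂ) ^ 3 = -1 := by
    linear_combination (3 / 8 * (√3 : ℂ) ^ 2 + Complex.I * (√3 : ℂ) ^ 3 / 8) * Complex.I_sq
      - (3 / 8 + Complex.I * √3 / 8) * h3
  rw [h4]
  norm_num

theorem limitCubic_midProfile (hs : κ₀ + ν₀ ≠ 0) {Ω K : ℝ} (hΩ : Ω ≠ 0)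
    (hq : 0 < 2 * K * Real.sin γ * Real.cos γ / (Ω * (κ₀ + ν₀))) :
    limitCubic γ ν₀ κ₀ Ω K 0 (midProfile γ ν₀ κ₀ Ω K) = 0 := by
  rw [limitCubic_eq_zero_iff hs hΩ, midProfile_pow_three hq]
  simp

/-- At z = 0 the cubic has real coefficients, which yields the fourth-quadrant profile from the
first-quadrant one. -/
theorem limitCubic_conj (Ω K z : ℝ) (x : ℂ) :
    limitCubic γ ν₀ κ₀ Ω K z ((starRingEnd ℂ) x) =
      (starRingEnd ℂ) (limitCubic γ ν₀ κ₀ Ω K (-z) x) := by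
  simp [limitCubic, ← Complex.cos_conj, ← Complex.sin_conj, map_ofNat (starRingEnd ℂ) 2]

theorem largeProfile_re (hν : 0 < ν₀) (hκ : 0 < κ₀) {Ω : ℝ} (hΩ : Ω ≠ 0) :
    0 < (largeProfile ν₀ κ₀ Ω).re := by
  unfold largeProfile
  rw [Complex.re_ofReal_mul]
  have h : 0 < |Ω * (κ₀ + ν₀) / (κ₀ * ν₀)| := by
    have := hν.ne'
    have := hκ.ne'
    have : κ₀ + ν₀ ≠ 0 := by positivity
    positivity
  refine mul_pos (Real.sqrt_pos.2 (by positivity)) ?_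
  simp only [Complex.sub_re, Complex.one_re, Complex.mul_re, Complex.I_re, Complex.I_im,
    Complex.ofReal_im, Complex.ofReal_re]
  norm_num

/-- With s = ±1 the sign of Ω, (1 − i s)² = −2 i s; the factor √(|w|/2) turns this into −i w. -/
theorem largeProfile_sq (hν : 0 < ν₀) (hκ : 0 < κ₀) {Ω : ℝ} (hΩ : Ω ≠ 0) :
    κ₀ * ν₀ * largeProfile ν₀ κ₀ Ω ^ 2 = -Complex.I * Ω * (κ₀ + ν₀) := by
  unfold largeProfile
  set w := Ω * (κ₀ + ν₀) / (κ₀ * ν₀) with hw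
  have hw0 : |w| ≠ 0 := by
    have := hν.ne'
    have := hκ.ne'
    have : κ₀ + ν₀ ≠ 0 := by positivity
    rw [hw]; positivity
  have e1 : ((√(|w| / 2) : ℝ) : ℂ) ^ 2 = (|w| : ℝ) / 2 := by
    rw [← Complex.ofReal_pow, Real.sq_sqrt (by positivity)]; push_cast; rfl
  have e2 : (((w / |w| : ℝ)) : ℂ) ^ 2 = 1 := by
    rw [← Complex.ofReal_pow, div_pow, sq_abs, div_self (by simpa using hw0)]; simp
  have e3 : ((|w| : ℝ) : ℂ) * ((w / |w| : ℝ) : ℂ) = w := by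
    rw [← Complex.ofReal_mul]; congr 1; field_simp
  have e4 : (κ₀ : ℂ) * ν₀ * w = Ω * (κ₀ + ν₀) := by
    have : κ₀ * ν₀ * w = Ω * (κ₀ + ν₀) := by rw [hw]; field_simp
    exact_mod_cast this
  rw [mul_pow, e1]
  linear_combination (κ₀ * ν₀ * (|w| : ℝ) / 2 * ((w / |w| : ℝ) : ℂ) ^ 2 : ℂ) * Complex.I_sq
    - (κ₀ * ν₀ * (|w| : ℝ) / 2 : ℂ) * e2 - (Complex.I * κ₀ * ν₀) * e3 - Complex.I * e4

/-- Nonvanishing real and imaginary parts become uniform gaps on compact sets. The imaginary part is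
minimized over the closed part where Re ≥ 0, on which in fact Re > 0. -/
theorem cubicSet_bounds (hγ₀ : 0 < γ) (hγ₁ : γ < Real.pi / 2) (hν : 0 < ν₀) (hκ : 0 < κ₀)
    (hc : 0 < c₀) :
    ∃ c > 0, ∃ B > 0, ∀ q ∈ cubicSet γ ν₀ κ₀ c₀ M,
      ‖q.2‖ ≤ B ∧ c ≤ |q.2.re| ∧ (0 < q.2.re → c ≤ |q.2.im|) := by
  have hcomp := isCompact_cubicSet (γ := γ) (M := M) hν hκ hc
  have key : ∀ q ∈ cubicSet γ ν₀ κ₀ c₀ M, q.2.re ≠ 0 ∧ (0 < q.2.re → q.2.im ≠ 0) := by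
    rintro ⟨⟨Ω, K, m, z⟩, a⟩ ⟨hp, ha⟩
    obtain ⟨-, -, -, -, -, -, hΩ, -⟩ := parSet_bounds hc hp
    have hq := cubic_const_pos hγ₀ hγ₁ (by positivity : 0 < κ₀ + ν₀) (hc.trans_le hp.2.2.1)
    have hcub := (limitCubic_eq_zero_iff (by positivity) hΩ a).1 ha
    exact ⟨cubic_re_ne_zero hq hcub, cubic_im_ne_zero hq hcub⟩
  obtain ⟨B, hB⟩ := hcomp.exists_bound_of_continuousOn (f := fun q => q.2) (by fun_prop)
  obtain ⟨c₁, hc₁, h1⟩ := exists_pos_le_of_isCompact hcomp (f := fun q => |q.2.re|)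
    (by fun_prop) (fun q hq => abs_pos.2 (key q hq).1)
  obtain ⟨c₂, hc₂, h2⟩ := exists_pos_le_of_isCompact
    (hcomp.inter_right (isClosed_le continuous_const (by fun_prop) :
      IsClosed {q : (ℝ × ℝ × ℝ × ℝ) × ℂ | 0 ≤ q.2.re})) (f := fun q => |q.2.im|)
    (by fun_prop) (fun q hq => abs_pos.2 ((key q hq.1).2
      (lt_of_le_of_ne hq.2 (key q hq.1).1.symm)))
  exact ⟨min c₁ c₂, lt_min hc₁ hc₂, max B 1, by positivity, fun q hq =>
    ⟨(hB q hq).trans (le_max_left _ _), (min_le_left _ _).trans (h1 q hq),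
      fun h => (min_le_right _ _).trans (h2 q ⟨hq, h.le⟩)⟩⟩

/-- The three roots of the limit cubic. -/
theorem exists_cubic_roots (hγ₀ : 0 < γ) (hγ₁ : γ < Real.pi / 2) (hν : 0 < ν₀) (hκ : 0 < κ₀)
    (hc : 0 < c₀) :
    ∃ c > 0, ∃ B > 0, ∀ Ω K m z, (Ω, K, m, z) ∈ parSet γ c₀ M → ∃ a₁ a₂ a₃ : ℂ,
      limitCubic γ ν₀ κ₀ Ω K z a₁ = 0 ∧ limitCubic γ ν₀ κ₀ Ω K z a₂ = 0 ∧
      limitCubic γ ν₀ κ₀ Ω K z a₃ = 0 ∧ ‖a₁‖ ≤ B ∧ ‖a₂‖ ≤ B ∧ ‖a₃‖ ≤ B ∧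
      c ≤ a₁.re ∧ c ≤ a₁.im ∧ c ≤ a₂.re ∧ a₂.im ≤ -c ∧ a₃.re ≤ -c ∧
      ‖a₁ - midProfile γ ν₀ κ₀ Ω K‖ ≤ B * |z| ∧
      ‖a₂ - (starRingEnd ℂ) (midProfile γ ν₀ κ₀ Ω K)‖ ≤ B * |z| := by
  obtain ⟨c, hc1, B, hB, h⟩ := cubicSet_bounds (M := M) hγ₀ hγ₁ hν hκ hc
  set s := c₀ / 2 * (κ₀ + ν₀) with hs
  have hs0 : 0 < s := by positivity
  refine ⟨c, hc1, max B (B / (s * c * c)), by positivity, ?_⟩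
  intro Ω K m z hp
  have hsum : κ₀ + ν₀ ≠ 0 := by positivity
  obtain ⟨-, -, -, -, hΩ', -, hΩ, -⟩ := parSet_bounds hc hp
  have hq := cubic_const_pos hγ₀ hγ₁ (by positivity : 0 < κ₀ + ν₀) (hc.trans_le hp.2.2.1)
  simp only at hq
  obtain ⟨a₁, h1, h1r, h1i⟩ := exists_cubic_root_pos (z / (Ω * (κ₀ + ν₀))) hq
  obtain ⟨a₂, h2, h2r, h2i⟩ := exists_cubic_root_neg (z / (Ω * (κ₀ + ν₀))) hq
  rw [← limitCubic_eq_zero_iff hsum hΩ] at h1 h2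
  have hne : a₁ ≠ a₂ := by rintro rfl; linarith
  have hfac : ∀ x, limitCubic γ ν₀ κ₀ Ω K z x =
      Ω * (κ₀ + ν₀) * (x - a₁) * (x - a₂) * (x + a₁ + a₂) := by
    intro x
    have := cubic_factor (α := Ω * (κ₀ + ν₀)) (z := Complex.I * z)
      (β := 2 * K * Real.sin γ * Real.cos γ) (a₁ := a₁) (a₂ := a₂)
      (by unfold limitCubic at h1; linear_combination h1)
      (by unfold limitCubic at h2; linear_combination h2) hne x
    unfold limitCubic
    linear_combination this
  have h3 : limitCubic γ ν₀ κ₀ Ω K z (-(a₁ + a₂)) = 0 := by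
    rw [hfac]; ring
  obtain ⟨b1, r1, i1⟩ := h ((Ω, K, m, z), a₁) ⟨hp, h1⟩
  obtain ⟨b2, r2, i2⟩ := h ((Ω, K, m, z), a₂) ⟨hp, h2⟩
  obtain ⟨b3, r3, -⟩ := h ((Ω, K, m, z), -(a₁ + a₂)) ⟨hp, h3⟩
  simp only [Complex.neg_re, Complex.add_re] at b1 r1 i1 b2 r2 i2 b3 r3
  rw [abs_of_pos h1r] at r1
  rw [abs_of_pos h2r] at r2
  rw [abs_neg, abs_of_pos (by linarith)] at r3
  specialize i1 h1r
  specialize i2 h2r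
  rw [abs_of_pos h1i] at i1
  rw [abs_of_neg h2i] at i2
  have hp0 : (Ω, K, m, 0) ∈ parSet γ c₀ M := by
    obtain ⟨e1, e2, e3, e4, e5, e6⟩ := hp
    exact ⟨e1, e2, e3, e4, e5, by simpa using (abs_nonneg z).trans e6⟩
  obtain ⟨mr, mi⟩ := midProfile_re_im hq
  have hmid := limitCubic_midProfile hsum hΩ hq
  have hmid' : limitCubic γ ν₀ κ₀ Ω K 0 ((starRingEnd ℂ) (midProfile γ ν₀ κ₀ Ω K)) = 0 := by
    rw [limitCubic_conj, neg_zero, hmid, map_zero]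
  set P := midProfile γ ν₀ κ₀ Ω K with hP
  -- comparison of the roots with the roots of the unperturbed cubic
  have hcmp : ∀ x y y' : ℂ, limitCubic γ ν₀ κ₀ Ω K 0 x = 0 → 0 < x.re →
      (∀ x, limitCubic γ ν₀ κ₀ Ω K z x =
        Ω * (κ₀ + ν₀) * (x - y) * (x - y') * (x + y + y')) →
      c ≤ y.re → c ≤ y'.re → c ≤ |x.im - y'.im| → ‖y - x‖ ≤ B / (s * c * c) * |z| := by
    intro x y y' hx hxr hf hy hy' hd
    have e0 : ‖x‖ ≤ B := (h ((Ω, K, m, 0), x) ⟨hp0, hx⟩).1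
    -- A root of the cubic with z = 0 gives the full cubic the value i z x. In the factored form two
    -- of the three factors are at least c in modulus, so the remaining one, x − y, is O(|z|).
    have e1 : limitCubic γ ν₀ κ₀ Ω K z x = Complex.I * z * x := by
      unfold limitCubic at hx ⊢
      push_cast at hx ⊢
      linear_combination hx
    rw [hf] at e1
    have e2 := congrArg norm e1
    rw [← Complex.ofReal_add] at e2
    simp only [norm_mul, Complex.norm_I, Complex.norm_real, Real.norm_eq_abs, one_mul] at e2
    rw [abs_of_pos (by positivity : 0 < κ₀ + ν₀)] at e2
    have e3 : c ≤ ‖x - y'‖ := hd.trans (by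
      rw [← Complex.sub_im]; exact Complex.abs_im_le_norm _)
    have e4 : c ≤ ‖x + y + y'‖ := by
      have := Complex.re_le_norm (x + y + y')
      simp only [Complex.add_re] at this
      linarith
    have e5 : s * ‖x - y‖ * c * c ≤ |z| * B := by
      calc s * ‖x - y‖ * c * c ≤ |Ω| * (κ₀ + ν₀) * ‖x - y‖ * ‖x - y'‖ * ‖x + y + y'‖ := by
            rw [hs]; gcongr
        _ = |z| * ‖x‖ := e2
        _ ≤ |z| * B := by gcongr
    rw [norm_sub_rev, div_mul_eq_mul_div, le_div_iff₀ (by positivity)]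
    linarith
  refine ⟨a₁, a₂, -(a₁ + a₂), h1, h2, h3, b1.trans (le_max_left _ _), b2.trans (le_max_left _ _),
    b3.trans (le_max_left _ _), r1, i1, r2, by linarith, by simp; linarith, ?_, ?_⟩
  · refine (hcmp P a₁ a₂ hmid mr hfac r1 r2 ?_).trans ?_
    · rw [abs_of_pos (by linarith)]; linarith
    · gcongr; exact le_max_right _ _
  · refine (hcmp _ a₂ a₁ hmid' (by simpa using mr) (fun x => by rw [hfac]; ring) r2 r1 ?_).trans ?_
    · rw [Complex.conj_im, abs_of_neg (by linarith)]; linarith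
    · gcongr; exact le_max_right _ _

theorem largeProfile_bounds (γ M : ℝ) (hν : 0 < ν₀) (hκ : 0 < κ₀) (hc : 0 < c₀) :
    ∃ c > 0, ∃ B > 0, ∀ Ω K m z, (Ω, K, m, z) ∈ parSet γ c₀ M →
      c ≤ (largeProfile ν₀ κ₀ Ω).re ∧ ‖largeProfile ν₀ κ₀ Ω‖ ≤ B := by
  have hcomp := isCompact_largeSet (γ := γ) (M := M) hν hκ hc
  obtain ⟨B, hB⟩ := hcomp.exists_bound_of_continuousOn (f := fun q => q.2) (by fun_prop)
  obtain ⟨c, hc', h⟩ := exists_pos_le_of_isCompact hcomp (f := fun q => |q.2.re|)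
    (by fun_prop) (by
      rintro ⟨⟨Ω, K, m, z⟩, a⟩ ⟨hp, ha⟩
      obtain ⟨-, -, -, -, -, -, hΩ, -⟩ := parSet_bounds hc hp
      simp only at ha ⊢
      rw [abs_pos]
      intro h0
      rw [← largeProfile_sq hν hκ hΩ] at ha
      have h1 : (a - largeProfile ν₀ κ₀ Ω) * (a + largeProfile ν₀ κ₀ Ω) = 0 := by
        have e : (κ₀ * ν₀ : ℂ) ≠ 0 := by exact_mod_cast (by positivity : κ₀ * ν₀ ≠ 0)
        have := mul_left_cancel₀ e ha
        linear_combination this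
      have h2 := largeProfile_re hν hκ hΩ
      rcases mul_eq_zero.1 h1 with h3 | h3
      · have := congrArg Complex.re h3
        simp [h0] at this
        linarith
      · have := congrArg Complex.re h3
        simp [h0] at this
        linarith)
  refine ⟨c, hc', max B 1, by positivity, fun Ω K m z hp => ?_⟩
  obtain ⟨-, -, -, -, -, -, hΩ, -⟩ := parSet_bounds hc hp
  have hmem : ((Ω, K, m, z), largeProfile ν₀ κ₀ Ω) ∈ largeSet γ ν₀ κ₀ c₀ M :=
    ⟨hp, largeProfile_sq hν hκ hΩ⟩
  refine ⟨?_, (hB _ hmem).trans (le_max_left _ _)⟩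
  have := h _ hmem
  rwa [abs_of_pos (largeProfile_re hν hκ hΩ)] at this

theorem charPoly_roots {ε Ω k : ℝ} (hε : ε ≠ 0) (hν : 0 < ν₀) (hκ : 0 < κ₀) {r : Fin 6 → ℂ}
    (hr : Function.Injective r) (h : ∀ i, charPoly γ ν₀ κ₀ ε Ω k (r i) = 0) :
    (∀ y, charPoly γ ν₀ κ₀ ε Ω k y = 0 → ∃ i, y = r i) ∧
      ∀ i, deriv (charPoly γ ν₀ κ₀ ε Ω k) (r i) ≠ 0 := by
  have hε' : (ε : ℂ) ≠ 0 := by exact_mod_cast hε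
  have hν' : (ν₀ : ℂ) ≠ 0 := by exact_mod_cast hν.ne'
  have hκ' : (κ₀ : ℂ) ≠ 0 := by exact_mod_cast hκ.ne'
  have e := funext (charPoly_eq_sextic γ ν₀ κ₀ ε Ω k)
  rw [e] at h ⊢
  obtain ⟨h1, h2⟩ := sextic_roots (by simp [hε', hν', hκ']) hr h
  exact ⟨h1, fun i => by rw [(hasDerivAt_sextic _ _ _ _ _ _).deriv]; exact h2 i⟩

/-- Six roots of suitable sizes, three of them with positive real part, are all the roots. -/
theorem roots_of_sizes {d B c Ω K : ℝ} (hν : 0 < ν₀) (hκ : 0 < κ₀) (hd : 0 < d) (hd1 : d < 1)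
    (hc : 0 < c) (hB : 0 ≤ B) (hBd : B * d < c) {x₁ x₂ x₃ x₄ x₅ x₆ : ℂ}
    (hx₁ : charPoly γ ν₀ κ₀ (d ^ 6) Ω K (x₁ / d ^ 2) = 0)
    (hx₂ : charPoly γ ν₀ κ₀ (d ^ 6) Ω K (x₂ / d ^ 2) = 0)
    (hx₃ : charPoly γ ν₀ κ₀ (d ^ 6) Ω K (x₃ / d ^ 3) = 0)
    (hx₄ : charPoly γ ν₀ κ₀ (d ^ 6) Ω K (x₄ / d ^ 3) = 0)
    (hx₅ : charPoly γ ν₀ κ₀ (d ^ 6) Ω K (x₅ / d ^ 2) = 0)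
    (hx₆ : charPoly γ ν₀ κ₀ (d ^ 6) Ω K x₆ = 0)
    (h₁ : 0 < x₁.re) (h₂ : 0 < x₂.re) (h₁₂ : x₁ ≠ x₂) (h₃ : c ≤ x₃.re) (h₄ : x₄.re ≤ -c)
    (h₅ : x₅.re ≤ -c) (h₆ : x₆.re < 0)
    (n₁ : ‖x₁‖ ≤ B) (n₂ : ‖x₂‖ ≤ B) (n₅ : ‖x₅‖ ≤ B) (n₆ : ‖x₆‖ ≤ B) :
    (∀ y, charPoly γ ν₀ κ₀ (d ^ 6) Ω K y = 0 ∧ 0 < y.re ↔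
        y = x₁ / d ^ 2 ∨ y = x₂ / d ^ 2 ∨ y = x₃ / d ^ 3) ∧
      (∀ y, charPoly γ ν₀ κ₀ (d ^ 6) Ω K y = 0 →
        deriv (charPoly γ ν₀ κ₀ (d ^ 6) Ω K) y ≠ 0) := by
  have hdC : (d : ℂ) ≠ 0 := by exact_mod_cast hd.ne'
  have hre2 : ∀ x : ℂ, (x / d ^ 2).re = x.re / d ^ 2 := fun x => by
    rw [← Complex.ofReal_pow, Complex.div_ofReal_re]
  have hre3 : ∀ x : ℂ, (x / d ^ 3).re = x.re / d ^ 3 := fun x => by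
    rw [← Complex.ofReal_pow, Complex.div_ofReal_re]
  -- The condition B d < c separates the scales d⁻² and d⁻³; the same condition later gives B <
  -- c/d², which separates the bounded root from the others.
  have hmidn : ∀ x : ℂ, ‖x‖ ≤ B → ‖x / d ^ 2‖ < c / d ^ 3 := fun x hx => by
    rw [norm_div, norm_pow, Complex.norm_real, Real.norm_eq_abs, abs_of_pos hd,
      div_lt_div_iff₀ (by positivity) (by positivity)]
    have : ‖x‖ * d < c := lt_of_le_of_lt (by gcongr) hBd
    calc ‖x‖ * d ^ 3 = ‖x‖ * d * d ^ 2 := by ring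
      _ < c * d ^ 2 := by gcongr
  have hlargen : ∀ x : ℂ, c ≤ |x.re| → c / d ^ 3 ≤ ‖x / d ^ 3‖ := fun x hx => by
    rw [norm_div, norm_pow, Complex.norm_real, Real.norm_eq_abs, abs_of_pos hd]
    gcongr
    exact hx.trans (Complex.abs_re_le_norm _)
  have p1re : 0 < (x₁ / d ^ 2).re := by rw [hre2]; exact div_pos h₁ (by positivity)
  have p2re : 0 < (x₂ / d ^ 2).re := by rw [hre2]; exact div_pos h₂ (by positivity)
  have p3re : 0 < (x₃ / d ^ 3).re := by rw [hre3]; exact div_pos (hc.trans_le h₃) (by positivity)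
  have p4re : (x₄ / d ^ 3).re < 0 := by
    rw [hre3]; exact div_neg_of_neg_of_pos (by linarith) (by positivity)
  have p5re : (x₅ / d ^ 2).re < 0 := by
    rw [hre2]; exact div_neg_of_neg_of_pos (by linarith) (by positivity)
  have q1 := hmidn _ n₁
  have q2 := hmidn _ n₂
  have q5 := hmidn _ n₅
  have q3 := hlargen x₃ (h₃.trans (le_abs_self _))
  have q4 := hlargen x₄ (by rw [abs_of_neg (by linarith)]; linarith)
  have q6 : B < c / d ^ 2 := by
    rw [lt_div_iff₀ (by positivity)]
    calc B * d ^ 2 = B * d * d := by ring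
      _ ≤ B * d * 1 := by gcongr
      _ < c := by linarith
  have q5' : c / d ^ 2 ≤ ‖x₅ / d ^ 2‖ := by
    refine le_trans ?_ (Complex.abs_re_le_norm _)
    rw [hre2, abs_div, abs_of_neg (by linarith : x₅.re < 0), abs_of_pos (pow_pos hd 2)]
    gcongr
    linarith
  have q46 : c / d ^ 2 < c / d ^ 3 :=
    div_lt_div_of_pos_left hc (by positivity) (pow_lt_pow_right_of_lt_one₀ hd hd1 (by norm_num))
  have n12 : x₁ / (d : ℂ) ^ 2 ≠ x₂ / d ^ 2 := fun h =>
    h₁₂ ((div_left_inj' (pow_ne_zero 2 hdC)).1 h)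
  have hpn : ∀ x y : ℂ, 0 < x.re → y.re < 0 → x ≠ y := by rintro x y h h' rfl; linarith
  have hnn : ∀ x y : ℂ, ‖x‖ < ‖y‖ → x ≠ y := by rintro x y h rfl; exact lt_irrefl _ h
  set r : Fin 6 → ℂ := ![x₁ / d ^ 2, x₂ / d ^ 2, x₃ / d ^ 3, x₄ / d ^ 3, x₅ / d ^ 2, x₆] with hrdef
  -- Roots on opposite sides of the imaginary axis differ by sign, and those on the same side by
  -- size, except for the two intermediate ones, which are distinct by hypothesis.
  have hrinj : Function.Injective r := by
    have n13 := hnn _ _ (q1.trans_le q3)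
    have n23 := hnn _ _ (q2.trans_le q3)
    have n14 := hpn _ _ p1re p4re
    have n15 := hpn _ _ p1re p5re
    have n16 := hpn _ _ p1re h₆
    have n24 := hpn _ _ p2re p4re
    have n25 := hpn _ _ p2re p5re
    have n26 := hpn _ _ p2re h₆
    have n34 := hpn _ _ p3re p4re
    have n35 := hpn _ _ p3re p5re
    have n36 := hpn _ _ p3re h₆
    have n54 := hnn _ _ (q5.trans_le q4)
    have n64 := hnn x₆ (x₄ / d ^ 3) (by linarith)
    have n65 := hnn x₆ (x₅ / d ^ 2) (by linarith)
    rw [← List.nodup_ofFn]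
    change [x₁ / (d : ℂ) ^ 2, x₂ / d ^ 2, x₃ / d ^ 3, x₄ / d ^ 3, x₅ / d ^ 2, x₆].Nodup
    simp only [List.nodup_cons, List.mem_cons, List.not_mem_nil, or_false, not_or, not_false_eq_true,
      List.nodup_nil, and_true]
    exact ⟨⟨n12, n13, n14, n15, n16⟩, ⟨n23, n24, n25, n26⟩, ⟨n34, n35, n36⟩,
      ⟨n54.symm, n64.symm⟩, n65.symm⟩
  have hroot : ∀ i, charPoly γ ν₀ κ₀ (d ^ 6) Ω K (r i) = 0 := by
    intro i
    fin_cases i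
    exacts [hx₁, hx₂, hx₃, hx₄, hx₅, hx₆]
  obtain ⟨hall, hsimple⟩ := charPoly_roots (by positivity) hν hκ hrinj hroot
  constructor
  · intro y
    constructor
    · rintro ⟨hy, hyre⟩
      obtain ⟨i, rfl⟩ := hall y hy
      fin_cases i
      · exact Or.inl rfl
      · exact Or.inr (Or.inl rfl)
      · exact Or.inr (Or.inr rfl)
      · exact absurd hyre (not_lt.2 p4re.le)
      · exact absurd hyre (not_lt.2 p5re.le)
      · exact absurd hyre (not_lt.2 h₆.le)
    · rintro (rfl | rfl | rfl)
      exacts [⟨hx₁, p1re⟩, ⟨hx₂, p2re⟩, ⟨hx₃, p3re⟩]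
  · intro y hy
    obtain ⟨i, rfl⟩ := hall y hy
    exact hsimple i

set_option maxHeartbeats 400000 in
/-- For small `d` exactly three roots have positive real part: two of size `d⁻²`, in different
quadrants, and one of size `d⁻³`. -/
theorem exists_roots (hγ₀ : 0 < γ) (hγ₁ : γ < Real.pi / 2) (hν : 0 < ν₀) (hκ : 0 < κ₀)
    (hc : 0 < c₀) :
    ∃ c > 0, ∃ B > 0, ∀ᶠ d in 𝓝[>] (0 : ℝ), B * d < c ∧ ∀ Ω K m z, (Ω, K, m, z) ∈ parSet γ c₀ M →
      Ω ^ 2 - Real.sin γ ^ 2 = d ^ 2 * z → ∃ x₁ x₂ x₃ : ℂ,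
      (∀ y, charPoly γ ν₀ κ₀ (d ^ 6) Ω K y = 0 ∧ 0 < y.re ↔
        y = x₁ / d ^ 2 ∨ y = x₂ / d ^ 2 ∨ y = x₃ / d ^ 3) ∧
      (∀ y, charPoly γ ν₀ κ₀ (d ^ 6) Ω K y = 0 →
        deriv (charPoly γ ν₀ κ₀ (d ^ 6) Ω K) y ≠ 0) ∧
      (c ≤ x₁.re ∧ c ≤ x₁.im ∧ ‖x₁‖ ≤ B) ∧ (c ≤ x₂.re ∧ x₂.im ≤ -c ∧ ‖x₂‖ ≤ B) ∧
      (c ≤ x₃.re ∧ ‖x₃‖ ≤ B) ∧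
      ‖x₁ - midProfile γ ν₀ κ₀ Ω K‖ ≤ B * (d ^ 2 + |z|) ∧
      ‖x₂ - (starRingEnd ℂ) (midProfile γ ν₀ κ₀ Ω K)‖ ≤ B * (d ^ 2 + |z|) ∧
      ‖x₃ - largeProfile ν₀ κ₀ Ω‖ ≤ B * (d ^ 2 * |z| + d ^ 3) := by
  obtain ⟨c₁, hc₁, B₁, hB₁, hcub⟩ := exists_cubic_roots (M := M) hγ₀ hγ₁ hν hκ hc
  obtain ⟨c₂, hc₂, B₂, hB₂, hlarge⟩ := largeProfile_bounds γ M hν hκ hc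
  obtain ⟨C₁, hC₁, hmid⟩ := exists_mid_root_near (M := M) hγ₀ hγ₁ hν hκ hc
  obtain ⟨C₂, hC₂, hbig⟩ := exists_large_root_near (γ := γ) (M := M) hν hκ hc
  obtain ⟨B₃, hB₃, hinc⟩ := exists_incident_root (γ := γ) (M := M) hν hκ hc
  -- The limit roots keep a distance 2c from the relevant axes and the perturbations are smaller
  -- than c, so a margin c remains.
  set c := min c₁ c₂ / 2 with hcdef
  have hc0 : 0 < c := by positivity
  have hcc₁ : 2 * c ≤ c₁ := by rw [hcdef]; linarith [min_le_left c₁ c₂]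
  have hcc₂ : 2 * c ≤ c₂ := by rw [hcdef]; linarith [min_le_right c₁ c₂]
  set B := B₁ + B₂ + B₃ + C₁ + C₂ + c with hBdef
  have hB0 : 0 < B := by positivity
  refine ⟨c, hc0, B, hB0, ?_⟩
  have hsmall : ∀ᶠ d in 𝓝[>] (0 : ℝ), (B * d < c ∧ d < 1) ∧ C₁ * d ^ 2 < c ∧
      C₂ * (d ^ 2 * M + |d| ^ 3) < c := by
    refine Filter.Eventually.filter_mono nhdsWithin_le_nhds ?_
    have h1 : ContinuousAt (fun d : ℝ => B * d) 0 := by fun_prop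
    have h2 : ContinuousAt (fun d : ℝ => C₁ * d ^ 2) 0 := by fun_prop
    have h3 : ContinuousAt (fun d : ℝ => C₂ * (d ^ 2 * M + |d| ^ 3)) 0 := by fun_prop
    exact ((h1.eventually_lt continuousAt_const (by simpa using hc0)).and
      (continuousAt_id.eventually_lt continuousAt_const one_pos)).and
      ((h2.eventually_lt continuousAt_const (by simpa using hc0)).and
      (h3.eventually_lt continuousAt_const (by simpa using hc0)))
  filter_upwards [nhdsWithin_le_nhds hmid, nhdsWithin_le_nhds hbig, hinc, hsmall,
    self_mem_nhdsWithin] with d hmid hbig hinc ⟨⟨hd1, hd1'⟩, hd2, hd3⟩ hd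
  refine ⟨hd1, ?_⟩
  replace hd : 0 < d := hd
  intro Ω K m z hp hz
  obtain ⟨-, -, -, hzM, -, -, hΩ, -⟩ := parSet_bounds hc hp
  obtain ⟨a₁, a₂, a₃, h1, h2, h3, b1, b2, b3, r1, i1, r2, i2, r3, p1, p2⟩ := hcub Ω K m z hp
  obtain ⟨hl1, hl2⟩ := hlarge Ω K m z hp
  obtain ⟨x₁, hx₁, hxa₁⟩ := hmid ((Ω, K, m, z), a₁) ⟨hp, h1⟩
  obtain ⟨x₂, hx₂, hxa₂⟩ := hmid ((Ω, K, m, z), a₂) ⟨hp, h2⟩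
  obtain ⟨x₅, hx₅, hxa₅⟩ := hmid ((Ω, K, m, z), a₃) ⟨hp, h3⟩
  have hlsq := largeProfile_sq hν hκ hΩ
  obtain ⟨x₃, hx₃, hxa₃⟩ := hbig ((Ω, K, m, z), largeProfile ν₀ κ₀ Ω) ⟨hp, hlsq⟩
  obtain ⟨x₄, hx₄, hxa₄⟩ := hbig ((Ω, K, m, z), -largeProfile ν₀ κ₀ Ω)
    ⟨hp, by simpa using hlsq⟩
  obtain ⟨r₆, hr₆, hr₆re, hr₆n⟩ := hinc _ hp
  simp only at hx₁ hx₂ hx₃ hx₄ hx₅ hxa₁ hxa₂ hxa₃ hxa₄ hxa₅ hr₆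
  rw [← charPoly_mid γ ν₀ κ₀ hd.ne' hz] at hx₁ hx₂ hx₅
  rw [← charPoly_large γ ν₀ κ₀ hd.ne' hz] at hx₃ hx₄
  have hdC : (d : ℂ) ≠ 0 := by exact_mod_cast hd.ne'
  replace hx₁ := (mul_eq_zero.1 hx₁).resolve_left (pow_ne_zero _ hdC)
  replace hx₂ := (mul_eq_zero.1 hx₂).resolve_left (pow_ne_zero _ hdC)
  replace hx₅ := (mul_eq_zero.1 hx₅).resolve_left (pow_ne_zero _ hdC)
  replace hx₃ := (mul_eq_zero.1 hx₃).resolve_left (pow_ne_zero _ hdC)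
  replace hx₄ := (mul_eq_zero.1 hx₄).resolve_left (pow_ne_zero _ hdC)
  rw [abs_of_pos hd] at hd3 hxa₃ hxa₄
  have hxa₃' : ‖x₃ - largeProfile ν₀ κ₀ Ω‖ < c := lt_of_le_of_lt (hxa₃.trans (by gcongr)) hd3
  have hxa₄' : ‖x₄ - -largeProfile ν₀ κ₀ Ω‖ < c := lt_of_le_of_lt (hxa₄.trans (by gcongr)) hd3
  have hre : ∀ x a : ℂ, ‖x - a‖ < c → |x.re - a.re| < c ∧ |x.im - a.im| < c := fun x a h =>
    ⟨by rw [← Complex.sub_re]; exact (Complex.abs_re_le_norm _).trans_lt h,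
      by rw [← Complex.sub_im]; exact (Complex.abs_im_le_norm _).trans_lt h⟩
  obtain ⟨u1, v1⟩ := hre _ _ (hxa₁.trans_lt hd2)
  obtain ⟨u2, v2⟩ := hre _ _ (hxa₂.trans_lt hd2)
  obtain ⟨u5, v5⟩ := hre _ _ (hxa₅.trans_lt hd2)
  obtain ⟨u3, v3⟩ := hre _ _ hxa₃'
  obtain ⟨u4, v4⟩ := hre _ _ hxa₄'
  rw [abs_lt] at u1 v1 u2 v2 u3 u4 u5
  rw [Complex.neg_re] at u4
  have hn : ∀ x a : ℂ, ‖x - a‖ < c → ‖x‖ ≤ ‖a‖ + c := fun x a h => by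
    have := norm_add_le a (x - a)
    rw [add_sub_cancel] at this
    linarith
  have n1 := hn _ _ (hxa₁.trans_lt hd2)
  have n2 := hn _ _ (hxa₂.trans_lt hd2)
  have n5 := hn _ _ (hxa₅.trans_lt hd2)
  have n3 := hn _ _ hxa₃'
  have hB1 : ‖x₁‖ ≤ B := by linarith only [n1, b1, hBdef, hB₂, hB₃, hC₁, hC₂]
  have hB2 : ‖x₂‖ ≤ B := by linarith only [n2, b2, hBdef, hB₂, hB₃, hC₁, hC₂]
  have hB3 : ‖x₃‖ ≤ B := by linarith only [n3, hl2, hBdef, hB₁, hB₃, hC₁, hC₂]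
  have hB5 : ‖x₅‖ ≤ B := by linarith only [n5, b3, hBdef, hB₂, hB₃, hC₁, hC₂]
  have hB6 : ‖r₆‖ ≤ B := by linarith only [hr₆n, hBdef, hB₁, hB₂, hc0, hC₁, hC₂]
  have hx₁re : c ≤ x₁.re := by linarith only [u1.1, r1, hcc₁]
  have hx₁im : c ≤ x₁.im := by linarith only [v1.1, i1, hcc₁]
  have hx₂re : c ≤ x₂.re := by linarith only [u2.1, r2, hcc₁]
  have hx₂im : x₂.im ≤ -c := by linarith only [v2.2, i2, hcc₁]
  have hx₃re : c ≤ x₃.re := by linarith only [u3.1, hl1, hcc₂]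
  have hx₄re : x₄.re ≤ -c := by linarith only [u4.2, hl1, hcc₂]
  have hx₅re : x₅.re ≤ -c := by linarith only [u5.2, r3, hcc₁]
  obtain ⟨hiff, hsimple⟩ := roots_of_sizes hν hκ hd hd1' hc0 hB0.le hd1 hx₁ hx₂ hx₃ hx₄ hx₅ hr₆
    (hc0.trans_le hx₁re) (hc0.trans_le hx₂re) (by rintro rfl; linarith only [hx₁im, hx₂im, hc0])
    hx₃re hx₄re hx₅re hr₆re hB1 hB2 hB5 hB6
  refine ⟨x₁, x₂, x₃, hiff, hsimple, ⟨hx₁re, hx₁im, hB1⟩, ⟨hx₂re, hx₂im, hB2⟩,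
    ⟨hx₃re, hB3⟩, ?_, ?_, ?_⟩
  · have := norm_sub_le_norm_sub_add_norm_sub x₁ a₁ (midProfile γ ν₀ κ₀ Ω K)
    have h5 : C₁ * d ^ 2 ≤ B * d ^ 2 := by gcongr; linarith
    have h6 : B₁ * |z| ≤ B * |z| := by gcongr; linarith
    linarith
  · have := norm_sub_le_norm_sub_add_norm_sub x₂ a₂ ((starRingEnd ℂ) (midProfile γ ν₀ κ₀ Ω K))
    have h5 : C₁ * d ^ 2 ≤ B * d ^ 2 := by gcongr; linarith
    have h6 : B₁ * |z| ≤ B * |z| := by gcongr; linarith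
    linarith
  · refine hxa₃.trans ?_
    gcongr
    linarith

/-! ### Cramer's rule -/

def det3 (a b c d e f g h i : ℂ) : ℂ := a * (e * i - f * h) - b * (d * i - f * g) + c * (d * h - e * g)

theorem cramer3 {a b c d e f g h i p q r : ℂ} (hD : det3 a b c d e f g h i ≠ 0) :
    let D := det3 a b c d e f g h i
    let x := det3 p b c q e f r h i / D
    let y := det3 a p c d q f g r i / D
    let z := det3 a b p d e q g h r / D
    a * x + b * y + c * z = p ∧ d * x + e * y + f * z = q ∧ g * x + h * y + i * z = r := by
  refine ⟨?_, ?_, ?_⟩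
  all_goals
    field_simp
    unfold det3
    ring

/-! ### Amplitudes of the layers -/

section

variable (γ κ₀ : ℝ)

/-- The denominators of the buoyancy components, in rescaled variables. -/
def midDenom (d Ω K : ℝ) (x : ℂ) : ℂ := Complex.I * Ω - d ^ 6 * κ₀ * K ^ 2 + κ₀ * d ^ 2 * x ^ 2

def largeDenom (d Ω K : ℝ) (x : ℂ) : ℂ := Complex.I * Ω - d ^ 6 * κ₀ * K ^ 2 + κ₀ * x ^ 2

/-- Up to the factor ρ/d², this is the decay times the buoyancy component of the layer vector, that
is, its contribution to −∂_y b at the wall. For `largeFlux` the factor is ρ/d³. -/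
def midFlux (d Ω K : ℝ) (x : ℂ) : ℂ :=
  (x * Real.sin γ + Complex.I * K * Real.cos γ * d ^ 2) / midDenom κ₀ d Ω K x

def largeFlux (d Ω K : ℝ) (x : ℂ) : ℂ :=
  (x * Real.sin γ + Complex.I * K * Real.cos γ * d ^ 3) / largeDenom κ₀ d Ω K x

/-- The rows are the conditions on u, w and ∂_y b; rows and columns carry the powers of d that give
the matrix a finite invertible limit at d = 0. -/
def layerDet (d Ω K : ℝ) (x₁ x₂ x₃ : ℂ) : ℂ :=
  det3 1 1 d (1 / x₁) (1 / x₂) (d ^ 2 / x₃)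
    (midFlux γ κ₀ d Ω K x₁) (midFlux γ κ₀ d Ω K x₂) (largeFlux γ κ₀ d Ω K x₃)

/-- The rescaled amplitudes, which solve the rescaled boundary conditions. -/
def amp₁ (d Ω K m : ℝ) (x₁ x₂ x₃ : ℂ) : ℂ :=
  det3 (-d ^ 2) 1 d (1 / (Complex.I * m)) (1 / x₂) (d ^ 2 / x₃)
    (-d ^ 4) (midFlux γ κ₀ d Ω K x₂) (largeFlux γ κ₀ d Ω K x₃) / layerDet γ κ₀ d Ω K x₁ x₂ x₃

def amp₂ (d Ω K m : ℝ) (x₁ x₂ x₃ : ℂ) : ℂ :=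
  det3 1 (-d ^ 2) d (1 / x₁) (1 / (Complex.I * m)) (d ^ 2 / x₃)
    (midFlux γ κ₀ d Ω K x₁) (-d ^ 4) (largeFlux γ κ₀ d Ω K x₃) / layerDet γ κ₀ d Ω K x₁ x₂ x₃

def amp₃ (d Ω K m : ℝ) (x₁ x₂ x₃ : ℂ) : ℂ :=
  det3 1 1 (-d ^ 2) (1 / x₁) (1 / x₂) (1 / (Complex.I * m))
    (midFlux γ κ₀ d Ω K x₁) (midFlux γ κ₀ d Ω K x₂) (-d ^ 4) / layerDet γ κ₀ d Ω K x₁ x₂ x₃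

/-- Near-critical parameters and rescaled roots. -/
abbrev LayerPar := (ℝ × ℝ × ℝ × ℝ) × ℂ × ℂ × ℂ × ℂ

/-- The range of the rescaled roots; the large root is written `y + d e`. -/
def layerSet (ν₀ c₀ M c B : ℝ) : Set ((ℝ × ℝ × ℝ × ℝ) × ℂ × ℂ × ℂ × ℂ) :=
  {q | (q.1, q.2.2.2.1) ∈ largeSet γ ν₀ κ₀ c₀ M ∧ ‖q.2.2.2.2‖ ≤ 1 ∧
    (c ≤ q.2.1.re ∧ c ≤ q.2.1.im ∧ ‖q.2.1‖ ≤ B) ∧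
    (c ≤ q.2.2.1.re ∧ q.2.2.1.im ≤ -c ∧ ‖q.2.2.1‖ ≤ B)}

end

variable {γ ν₀ κ₀ c₀ M : ℝ}

theorem isCompact_layerSet (hν : 0 < ν₀) (hκ : 0 < κ₀) (hc : 0 < c₀) (c B : ℝ) :
    IsCompact (layerSet γ κ₀ ν₀ c₀ M c B) := by
  have h1 := isCompact_largeSet (γ := γ) (M := M) hν hκ hc
  have hcl : IsClosed (layerSet γ κ₀ ν₀ c₀ M c B) := by
    simp only [layerSet, Set.ofPred_and]
    refine (h1.isClosed.preimage (by fun_prop)).inter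
      ((isClosed_le (by fun_prop) (by fun_prop)).inter
      (((isClosed_le (by fun_prop) (by fun_prop)).inter
      ((isClosed_le (by fun_prop) (by fun_prop)).inter
      (isClosed_le (by fun_prop) (by fun_prop)))).inter
      ((isClosed_le (by fun_prop) (by fun_prop)).inter
      ((isClosed_le (by fun_prop) (by fun_prop)).inter
      (isClosed_le (by fun_prop) (by fun_prop))))))
  refine IsCompact.of_isClosed_subset
    (((h1.image continuous_fst)).prod ((isCompact_closedBall (0 : ℂ) B).prod
      ((isCompact_closedBall (0 : ℂ) B).prod ((h1.image continuous_snd).prod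
        (isCompact_closedBall (0 : ℂ) 1))))) hcl ?_
  rintro ⟨p, x, x', y, e⟩ ⟨g1, g2, ⟨-, -, g3⟩, -, -, g4⟩
  exact ⟨⟨_, g1, rfl⟩, by simpa using g3, by simpa using g4, ⟨_, g1, rfl⟩, by simpa using g2⟩

/-- At d = 0 the intermediate denominators reduce to iΩ, and ν₀ times the large one is −iΩκ₀. The
determinant becomes (1/x₂ − 1/x₁) times the large flux, which is nonzero because x₁ and x₂ lie in
different quadrants. -/
theorem layerSet_ne_zero (hγ₀ : 0 < γ) (hγ₁ : γ < Real.pi / 2) (hν : 0 < ν₀) (hκ : 0 < κ₀)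
    (hc₀ : 0 < c₀) {c B : ℝ} (hc : 0 < c) {q : LayerPar}
    (hq : q ∈ layerSet γ κ₀ ν₀ c₀ M c B) :
    midDenom κ₀ 0 q.1.1 q.1.2.1 q.2.1 ≠ 0 ∧ midDenom κ₀ 0 q.1.1 q.1.2.1 q.2.2.1 ≠ 0 ∧
      largeDenom κ₀ 0 q.1.1 q.1.2.1 (q.2.2.2.1 + (0 : ℝ) * q.2.2.2.2) ≠ 0 ∧
      q.2.2.2.1 + (0 : ℝ) * q.2.2.2.2 ≠ 0 ∧ q.2.1 ≠ 0 ∧ q.2.2.1 ≠ 0 ∧ q.1.2.2.1 ≠ 0 ∧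
      layerDet γ κ₀ 0 q.1.1 q.1.2.1 q.2.1 q.2.2.1 (q.2.2.2.1 + (0 : ℝ) * q.2.2.2.2) ≠ 0 := by
  have hs : 0 < Real.sin γ := Real.sin_pos_of_pos_of_lt_pi hγ₀ (by linarith [Real.pi_pos])
  revert q
  rintro ⟨⟨Ω, K, m, z⟩, x₁, x₂, y, e⟩ ⟨⟨hp, hy⟩, -, ⟨r1, i1, -⟩, ⟨r2, i2, -⟩⟩
  simp only at hp hy r1 i1 r2 i2 ⊢
  have hΩ : (Ω : ℂ) ≠ 0 := by exact_mod_cast (parSet_bounds hc₀ hp).2.2.2.2.2.2.1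
  have hν' : (ν₀ : ℂ) ≠ 0 := by exact_mod_cast hν.ne'
  have hκ' : (κ₀ : ℂ) ≠ 0 := by exact_mod_cast hκ.ne'
  have hs' : (Real.sin γ : ℂ) ≠ 0 := by exact_mod_cast hs.ne'
  have hsum : (κ₀ + ν₀ : ℂ) ≠ 0 := by exact_mod_cast (by positivity : κ₀ + ν₀ ≠ 0)
  have hx1 : x₁ ≠ 0 := by rintro rfl; simp at r1; linarith
  have hx2 : x₂ ≠ 0 := by rintro rfl; simp at r2; linarith
  have hx12 : x₁ ≠ x₂ := by rintro rfl; linarith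
  have hy0 : y ≠ 0 := by
    rintro rfl
    simp [hΩ, hsum] at hy
  have hm0 : m ≠ 0 := by
    have : c₀ ≤ |m| := hp.2.2.2.2.1
    intro h0
    rw [h0, abs_zero] at this
    linarith
  have d1 : midDenom κ₀ 0 Ω K x₁ ≠ 0 := by simp [midDenom, hΩ]
  have d2 : midDenom κ₀ 0 Ω K x₂ ≠ 0 := by simp [midDenom, hΩ]
  have d3 : largeDenom κ₀ 0 Ω K y ≠ 0 := by
    have : ν₀ * largeDenom κ₀ 0 Ω K y = -Complex.I * Ω * κ₀ := by
      simp only [largeDenom]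
      push_cast
      linear_combination hy
    intro h0
    rw [h0, mul_zero] at this
    exact (mul_ne_zero (mul_ne_zero (by simp) hΩ) hκ') this.symm
  simp only [Complex.ofReal_zero, zero_mul, add_zero]
  refine ⟨d1, d2, d3, hy0, hx1, hx2, hm0, ?_⟩
  have hdet : layerDet γ κ₀ 0 Ω K x₁ x₂ y =
      (1 / x₂ - 1 / x₁) * (y * Real.sin γ / largeDenom κ₀ 0 Ω K y) := by
    simp only [layerDet, det3, largeFlux]
    push_cast
    ring
  rw [hdet]
  refine mul_ne_zero ?_ (div_ne_zero (mul_ne_zero hy0 hs') d3)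
  rw [sub_ne_zero]
  intro h
  exact hx12 (by simpa using h.symm)

/-- The building blocks of the rescaled boundary conditions are continuous at `d = 0`. -/
theorem continuousAt_layer (hγ₀ : 0 < γ) (hγ₁ : γ < Real.pi / 2) (hν : 0 < ν₀) (hκ : 0 < κ₀)
    (hc₀ : 0 < c₀) {c B : ℝ} (hc : 0 < c) {q : LayerPar}
    (hq : q ∈ layerSet γ κ₀ ν₀ c₀ M c B) :
    ContinuousAt (fun u : ℝ × LayerPar => midFlux γ κ₀ u.1 u.2.1.1 u.2.1.2.1 u.2.2.1) (0, q) ∧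
    ContinuousAt (fun u : ℝ × LayerPar => midFlux γ κ₀ u.1 u.2.1.1 u.2.1.2.1 u.2.2.2.1) (0, q) ∧
    ContinuousAt (fun u : ℝ × LayerPar =>
      largeFlux γ κ₀ u.1 u.2.1.1 u.2.1.2.1 (u.2.2.2.2.1 + u.1 * u.2.2.2.2.2)) (0, q) ∧
    ContinuousAt (fun u : ℝ × LayerPar => 1 / u.2.2.1) (0, q) ∧
    ContinuousAt (fun u : ℝ × LayerPar => 1 / u.2.2.2.1) (0, q) ∧
    ContinuousAt (fun u : ℝ × LayerPar =>
      (u.1 : ℂ) ^ 2 / (u.2.2.2.2.1 + u.1 * u.2.2.2.2.2)) (0, q) ∧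
    ContinuousAt (fun u : ℝ × LayerPar => 1 / (Complex.I * u.2.1.2.2.1)) (0, q) := by
  obtain ⟨k1, k2, k3, k4, k5, k6, k7, -⟩ := layerSet_ne_zero hγ₀ hγ₁ hν hκ hc₀ hc hq
  refine ⟨?_, ?_, ?_, ContinuousAt.div (by fun_prop) (by fun_prop) k5,
    ContinuousAt.div (by fun_prop) (by fun_prop) k6,
    ContinuousAt.div (by fun_prop) (by fun_prop) k4,
    ContinuousAt.div (by fun_prop) (by fun_prop)
      (mul_ne_zero Complex.I_ne_zero (by exact_mod_cast k7))⟩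
  · unfold midFlux
    exact ContinuousAt.div (by fun_prop) (by unfold midDenom; fun_prop) k1
  · unfold midFlux
    exact ContinuousAt.div (by fun_prop) (by unfold midDenom; fun_prop) k2
  · unfold largeFlux
    exact ContinuousAt.div (by fun_prop) (by unfold largeDenom; fun_prop) k3

theorem continuousAt_layerDet (hγ₀ : 0 < γ) (hγ₁ : γ < Real.pi / 2) (hν : 0 < ν₀) (hκ : 0 < κ₀)
    (hc₀ : 0 < c₀) {c B : ℝ} (hc : 0 < c) {q : LayerPar}
    (hq : q ∈ layerSet γ κ₀ ν₀ c₀ M c B) :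
    ContinuousAt (fun u : ℝ × LayerPar => layerDet γ κ₀ u.1 u.2.1.1 u.2.1.2.1 u.2.2.1 u.2.2.2.1
      (u.2.2.2.2.1 + u.1 * u.2.2.2.2.2)) (0, q) := by
  obtain ⟨c1, c2, c3, c4, c5, c6, -⟩ := continuousAt_layer hγ₀ hγ₁ hν hκ hc₀ hc hq
  unfold layerDet det3
  fun_prop

theorem continuousAt_amp₁ (hγ₀ : 0 < γ) (hγ₁ : γ < Real.pi / 2) (hν : 0 < ν₀) (hκ : 0 < κ₀)
    (hc₀ : 0 < c₀) {c B : ℝ} (hc : 0 < c) {q : LayerPar}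
    (hq : q ∈ layerSet γ κ₀ ν₀ c₀ M c B) :
    ContinuousAt (fun u : ℝ × LayerPar => amp₁ γ κ₀ u.1 u.2.1.1 u.2.1.2.1 u.2.1.2.2.1 u.2.2.1
      u.2.2.2.1 (u.2.2.2.2.1 + u.1 * u.2.2.2.2.2)) (0, q) := by
  obtain ⟨c1, c2, c3, c4, c5, c6, c7⟩ := continuousAt_layer hγ₀ hγ₁ hν hκ hc₀ hc hq
  unfold amp₁
  refine ContinuousAt.div ?_ (continuousAt_layerDet hγ₀ hγ₁ hν hκ hc₀ hc hq)
    (layerSet_ne_zero hγ₀ hγ₁ hν hκ hc₀ hc hq).2.2.2.2.2.2.2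
  unfold det3
  fun_prop

theorem continuousAt_amp₂ (hγ₀ : 0 < γ) (hγ₁ : γ < Real.pi / 2) (hν : 0 < ν₀) (hκ : 0 < κ₀)
    (hc₀ : 0 < c₀) {c B : ℝ} (hc : 0 < c) {q : LayerPar}
    (hq : q ∈ layerSet γ κ₀ ν₀ c₀ M c B) :
    ContinuousAt (fun u : ℝ × LayerPar => amp₂ γ κ₀ u.1 u.2.1.1 u.2.1.2.1 u.2.1.2.2.1 u.2.2.1
      u.2.2.2.1 (u.2.2.2.2.1 + u.1 * u.2.2.2.2.2)) (0, q) := by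
  obtain ⟨c1, c2, c3, c4, c5, c6, c7⟩ := continuousAt_layer hγ₀ hγ₁ hν hκ hc₀ hc hq
  unfold amp₂
  refine ContinuousAt.div ?_ (continuousAt_layerDet hγ₀ hγ₁ hν hκ hc₀ hc hq)
    (layerSet_ne_zero hγ₀ hγ₁ hν hκ hc₀ hc hq).2.2.2.2.2.2.2
  unfold det3
  fun_prop

theorem continuousAt_amp₃ (hγ₀ : 0 < γ) (hγ₁ : γ < Real.pi / 2) (hν : 0 < ν₀) (hκ : 0 < κ₀)
    (hc₀ : 0 < c₀) {c B : ℝ} (hc : 0 < c) {q : LayerPar}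
    (hq : q ∈ layerSet γ κ₀ ν₀ c₀ M c B) :
    ContinuousAt (fun u : ℝ × LayerPar => amp₃ γ κ₀ u.1 u.2.1.1 u.2.1.2.1 u.2.1.2.2.1 u.2.2.1
      u.2.2.2.1 (u.2.2.2.2.1 + u.1 * u.2.2.2.2.2)) (0, q) := by
  obtain ⟨c1, c2, c3, c4, c5, c6, c7⟩ := continuousAt_layer hγ₀ hγ₁ hν hκ hc₀ hc hq
  unfold amp₃
  refine ContinuousAt.div ?_ (continuousAt_layerDet hγ₀ hγ₁ hν hκ hc₀ hc hq)
    (layerSet_ne_zero hγ₀ hγ₁ hν hκ hc₀ hc hq).2.2.2.2.2.2.2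
  unfold det3
  fun_prop

/-- The rescaled amplitudes are continuous at d = 0 on a compact set, since the limit determinant
does not vanish there; dividing them by d² or d gives the orders of the layers. -/
theorem exists_amplitude_bound (hγ₀ : 0 < γ) (hγ₁ : γ < Real.pi / 2) (hν : 0 < ν₀) (hκ : 0 < κ₀)
    (hc₀ : 0 < c₀) {c : ℝ} (hc : 0 < c) (B : ℝ) :
    ∃ C > 0, ∀ᶠ d in 𝓝 (0 : ℝ), ∀ q ∈ layerSet γ κ₀ ν₀ c₀ M c B,
      midDenom κ₀ d q.1.1 q.1.2.1 q.2.1 ≠ 0 ∧ midDenom κ₀ d q.1.1 q.1.2.1 q.2.2.1 ≠ 0 ∧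
      largeDenom κ₀ d q.1.1 q.1.2.1 (q.2.2.2.1 + d * q.2.2.2.2) ≠ 0 ∧
      q.2.2.2.1 + d * q.2.2.2.2 ≠ 0 ∧
      layerDet γ κ₀ d q.1.1 q.1.2.1 q.2.1 q.2.2.1 (q.2.2.2.1 + d * q.2.2.2.2) ≠ 0 ∧
      ‖amp₁ γ κ₀ d q.1.1 q.1.2.1 q.1.2.2.1 q.2.1 q.2.2.1 (q.2.2.2.1 + d * q.2.2.2.2)‖ ≤ C ∧
      ‖amp₂ γ κ₀ d q.1.1 q.1.2.1 q.1.2.2.1 q.2.1 q.2.2.1 (q.2.2.2.1 + d * q.2.2.2.2)‖ ≤ C ∧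
      ‖amp₃ γ κ₀ d q.1.1 q.1.2.1 q.1.2.2.1 q.2.1 q.2.2.1 (q.2.2.2.1 + d * q.2.2.2.2)‖ ≤ C := by
  have hcomp := isCompact_layerSet (γ := γ) (M := M) hν hκ hc₀ c B
  have key := fun q hq => layerSet_ne_zero (M := M) (B := B) (q := q) hγ₀ hγ₁ hν hκ hc₀ hc hq
  obtain ⟨C₁, hC₁, b1⟩ := exists_eventually_norm_le hcomp
    (fun q hq => continuousAt_amp₁ hγ₀ hγ₁ hν hκ hc₀ hc hq)
  obtain ⟨C₂, hC₂, b2⟩ := exists_eventually_norm_le hcomp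
    (fun q hq => continuousAt_amp₂ hγ₀ hγ₁ hν hκ hc₀ hc hq)
  obtain ⟨C₃, hC₃, b3⟩ := exists_eventually_norm_le hcomp
    (fun q hq => continuousAt_amp₃ hγ₀ hγ₁ hν hκ hc₀ hc hq)
  obtain ⟨e1, he1, g1⟩ := exists_eventually_le_norm hcomp
    (F := fun u : ℝ × (LayerPar) =>
      midDenom κ₀ u.1 u.2.1.1 u.2.1.2.1 u.2.2.1)
    (fun q _ => by unfold midDenom; fun_prop) (fun q hq => (key q hq).1)
  obtain ⟨e2, he2, g2⟩ := exists_eventually_le_norm hcomp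
    (F := fun u : ℝ × (LayerPar) =>
      midDenom κ₀ u.1 u.2.1.1 u.2.1.2.1 u.2.2.2.1)
    (fun q _ => by unfold midDenom; fun_prop) (fun q hq => (key q hq).2.1)
  obtain ⟨e3, he3, g3⟩ := exists_eventually_le_norm hcomp
    (F := fun u : ℝ × (LayerPar) =>
      largeDenom κ₀ u.1 u.2.1.1 u.2.1.2.1 (u.2.2.2.2.1 + u.1 * u.2.2.2.2.2))
    (fun q _ => by unfold largeDenom; fun_prop) (fun q hq => (key q hq).2.2.1)
  obtain ⟨e4, he4, g4⟩ := exists_eventually_le_norm hcomp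
    (F := fun u : ℝ × (LayerPar) => u.2.2.2.2.1 + u.1 * u.2.2.2.2.2)
    (fun q _ => by fun_prop) (fun q hq => (key q hq).2.2.2.1)
  obtain ⟨e5, he5, g5⟩ := exists_eventually_le_norm hcomp
    (fun q hq => continuousAt_layerDet hγ₀ hγ₁ hν hκ hc₀ hc hq) (fun q hq => (key q hq).2.2.2.2.2.2.2)
  refine ⟨max C₁ (max C₂ C₃), by positivity, ?_⟩
  filter_upwards [b1, b2, b3, g1, g2, g3, g4, g5] with d b1 b2 b3 g1 g2 g3 g4 g5 q hq
  exact ⟨norm_pos_iff.1 (he1.trans_le (g1 q hq)), norm_pos_iff.1 (he2.trans_le (g2 q hq)),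
    norm_pos_iff.1 (he3.trans_le (g3 q hq)), norm_pos_iff.1 (he4.trans_le (g4 q hq)),
    norm_pos_iff.1 (he5.trans_le (g5 q hq)), (b1 q hq).trans (le_max_left _ _),
    (b2 q hq).trans ((le_max_left _ _).trans (le_max_right _ _)),
    (b3 q hq).trans ((le_max_right _ _).trans (le_max_right _ _))⟩

/-! ### Boundary conditions: from rescaled to original variables. -/

theorem midDenom_eq {d Ω K ε ρ : ℝ} (hd : d ≠ 0) (hερ : ε * ρ ^ 2 = d ^ 6) (x : ℂ) :
    Complex.I * Ω - ε * κ₀ * (((ρ * K : ℝ) : ℂ) ^ 2 - (ρ * (x / d ^ 2)) ^ 2) =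
      midDenom κ₀ d Ω K x := by
  have hd' : (d : ℂ) ≠ 0 := by exact_mod_cast hd
  have hερ' : (ε : ℂ) * ρ ^ 2 = d ^ 6 := by exact_mod_cast hερ
  unfold midDenom
  have : (ε : ℂ) * κ₀ * (((ρ * K : ℝ) : ℂ) ^ 2 - (ρ * (x / d ^ 2)) ^ 2) =
    (ε * ρ ^ 2) * κ₀ * (K ^ 2 - x ^ 2 / d ^ 4) := by push_cast; ring
  rw [this, hερ']
  field_simp
  ring

theorem largeDenom_eq {d Ω K ε ρ : ℝ} (hd : d ≠ 0) (hερ : ε * ρ ^ 2 = d ^ 6) (x : ℂ) :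
    Complex.I * Ω - ε * κ₀ * (((ρ * K : ℝ) : ℂ) ^ 2 - (ρ * (x / d ^ 3)) ^ 2) =
      largeDenom κ₀ d Ω K x := by
  have hd' : (d : ℂ) ≠ 0 := by exact_mod_cast hd
  have hερ' : (ε : ℂ) * ρ ^ 2 = d ^ 6 := by exact_mod_cast hερ
  unfold largeDenom
  have : (ε : ℂ) * κ₀ * (((ρ * K : ℝ) : ℂ) ^ 2 - (ρ * (x / d ^ 3)) ^ 2) =
    (ε * ρ ^ 2) * κ₀ * (K ^ 2 - x ^ 2 / d ^ 6) := by push_cast; ring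
  rw [this, hερ']
  field_simp
  ring

/-- The layers with amplitudes `amp₁ / d²`, `amp₂ / d²`, `amp₃ / d` cancel the traces of the
incident wave. -/
theorem amplitudes_cancel {d Ω K m ε ρ : ℝ} {x₁ x₂ x₃ : ℂ} (hd : d ≠ 0) (hρ : ρ ≠ 0) (hm : m ≠ 0)
    (hK : K ≠ 0) (hερ : ε * ρ ^ 2 = d ^ 6)
    (hx₁ : x₁ ≠ 0) (hx₂ : x₂ ≠ 0) (hx₃ : x₃ ≠ 0) (h₁ : midDenom κ₀ d Ω K x₁ ≠ 0)
    (h₂ : midDenom κ₀ d Ω K x₂ ≠ 0) (h₃ : largeDenom κ₀ d Ω K x₃ ≠ 0)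
    (hD : layerDet γ κ₀ d Ω K x₁ x₂ x₃ ≠ 0) :
    let a₁ := amp₁ γ κ₀ d Ω K m x₁ x₂ x₃ / d ^ 2
    let a₂ := amp₂ γ κ₀ d Ω K m x₁ x₂ x₃ / d ^ 2
    let a₃ := amp₃ γ κ₀ d Ω K m x₁ x₂ x₃ / d
    let l₁ : ℂ := ρ * (x₁ / d ^ 2)
    let l₂ : ℂ := ρ * (x₂ / d ^ 2)
    let l₃ : ℂ := ρ * (x₃ / d ^ 3)
    1 + a₁ + a₂ + a₃ = 0 ∧
    -((ρ * K : ℝ) : ℂ) / ((ρ * m : ℝ) : ℂ) + a₁ * (Complex.I * (ρ * K : ℝ) / l₁)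
      + a₂ * (Complex.I * (ρ * K : ℝ) / l₂) + a₃ * (Complex.I * (ρ * K : ℝ) / l₃) = 0 ∧
    -ρ = a₁ * (l₁ * layerVector γ ν₀ κ₀ ε Ω (ρ * K) l₁ 2)
      + a₂ * (l₂ * layerVector γ ν₀ κ₀ ε Ω (ρ * K) l₂ 2)
      + a₃ * (l₃ * layerVector γ ν₀ κ₀ ε Ω (ρ * K) l₃ 2) := by
  intro a₁ a₂ a₃ l₁ l₂ l₃
  have hd' : (d : ℂ) ≠ 0 := by exact_mod_cast hd
  have hρ' : (ρ : ℂ) ≠ 0 := by exact_mod_cast hρ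
  have hm' : (m : ℂ) ≠ 0 := by exact_mod_cast hm
  have hK' : (K : ℂ) ≠ 0 := by exact_mod_cast hK
  -- The data are the incident traces after scaling: −1 times d² for u; K/m divided by iK for w; and
  -- −ρ, the incident ∂_y b, divided by ρ and multiplied by d⁴ for the flux.
  obtain ⟨e1, e2, e3⟩ := cramer3 (p := -(d : ℂ) ^ 2) (q := 1 / (Complex.I * m))
    (r := -(d : ℂ) ^ 4) hD
  change 1 * amp₁ γ κ₀ d Ω K m x₁ x₂ x₃ + 1 * amp₂ γ κ₀ d Ω K m x₁ x₂ x₃ +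
    d * amp₃ γ κ₀ d Ω K m x₁ x₂ x₃ = _ at e1
  change 1 / x₁ * amp₁ γ κ₀ d Ω K m x₁ x₂ x₃ + 1 / x₂ * amp₂ γ κ₀ d Ω K m x₁ x₂ x₃ +
    d ^ 2 / x₃ * amp₃ γ κ₀ d Ω K m x₁ x₂ x₃ = _ at e2
  change midFlux γ κ₀ d Ω K x₁ * amp₁ γ κ₀ d Ω K m x₁ x₂ x₃ +
    midFlux γ κ₀ d Ω K x₂ * amp₂ γ κ₀ d Ω K m x₁ x₂ x₃ +
    largeFlux γ κ₀ d Ω K x₃ * amp₃ γ κ₀ d Ω K m x₁ x₂ x₃ = _ at e3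
  have f1 : amp₁ γ κ₀ d Ω K m x₁ x₂ x₃ = d ^ 2 * a₁ := by simp only [a₁]; field_simp
  have f2 : amp₂ γ κ₀ d Ω K m x₁ x₂ x₃ = d ^ 2 * a₂ := by simp only [a₂]; field_simp
  have f3 : amp₃ γ κ₀ d Ω K m x₁ x₂ x₃ = d * a₃ := by simp only [a₃]; field_simp
  rw [f1, f2, f3] at e1 e2 e3
  have hmidv : ∀ x, x ≠ 0 → midDenom κ₀ d Ω K x ≠ 0 →
      ρ * (x / d ^ 2) * layerVector γ ν₀ κ₀ ε Ω (ρ * K) (ρ * (x / d ^ 2)) 2 =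
        ρ / d ^ 2 * midFlux γ κ₀ d Ω K x := by
    intro x hx hden
    have hQ : Complex.I * Ω - ε * κ₀ * (((ρ * K : ℝ) : ℂ) ^ 2 - (ρ * (x / d ^ 2)) ^ 2) =
        midDenom κ₀ d Ω K x := midDenom_eq hd hερ x
    have : layerVector γ ν₀ κ₀ ε Ω (ρ * K) (ρ * (x / d ^ 2)) 2 =
        ((ρ * (x / d ^ 2)) * Real.sin γ + Complex.I * ((ρ * K : ℝ) : ℂ) * Real.cos γ) /
        ((ρ * (x / d ^ 2)) * (Complex.I * Ω - ε * κ₀ * (((ρ * K : ℝ) : ℂ) ^ 2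
          - (ρ * (x / d ^ 2)) ^ 2))) := rfl
    rw [this, hQ, midFlux]
    push_cast
    field_simp
  have hlargev : ∀ x, x ≠ 0 → largeDenom κ₀ d Ω K x ≠ 0 →
      ρ * (x / d ^ 3) * layerVector γ ν₀ κ₀ ε Ω (ρ * K) (ρ * (x / d ^ 3)) 2 =
        ρ / d ^ 3 * largeFlux γ κ₀ d Ω K x := by
    intro x hx hden
    have hQ : Complex.I * Ω - ε * κ₀ * (((ρ * K : ℝ) : ℂ) ^ 2 - (ρ * (x / d ^ 3)) ^ 2) =
        largeDenom κ₀ d Ω K x := largeDenom_eq hd hερ x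
    have : layerVector γ ν₀ κ₀ ε Ω (ρ * K) (ρ * (x / d ^ 3)) 2 =
        ((ρ * (x / d ^ 3)) * Real.sin γ + Complex.I * ((ρ * K : ℝ) : ℂ) * Real.cos γ) /
        ((ρ * (x / d ^ 3)) * (Complex.I * Ω - ε * κ₀ * (((ρ * K : ℝ) : ℂ) ^ 2
          - (ρ * (x / d ^ 3)) ^ 2))) := rfl
    rw [this, hQ, largeFlux]
    push_cast
    field_simp
  refine ⟨?_, ?_, ?_⟩
  · have : (d : ℂ) ^ 2 * (1 + a₁ + a₂ + a₃) = 0 := by linear_combination e1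
    exact (mul_eq_zero.1 this).resolve_left (pow_ne_zero _ hd')
  · have e2' : d ^ 2 * a₁ / x₁ + d ^ 2 * a₂ / x₂ + d ^ 3 * a₃ / x₃ = 1 / (Complex.I * m) := by
      rw [← e2]; ring
    have g1 : Complex.I * ((ρ * K : ℝ) : ℂ) / l₁ = Complex.I * K * (d ^ 2 / x₁) := by
      simp only [l₁]; push_cast; field_simp
    have g2 : Complex.I * ((ρ * K : ℝ) : ℂ) / l₂ = Complex.I * K * (d ^ 2 / x₂) := by
      simp only [l₂]; push_cast; field_simp
    have g3 : Complex.I * ((ρ * K : ℝ) : ℂ) / l₃ = Complex.I * K * (d ^ 3 / x₃) := by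
      simp only [l₃]; push_cast; field_simp
    have g4 : -((ρ * K : ℝ) : ℂ) / ((ρ * m : ℝ) : ℂ) = -(Complex.I * K * (1 / (Complex.I * m))) := by
      have := Complex.I_ne_zero
      push_cast; field_simp
    rw [g1, g2, g3, g4]
    linear_combination (Complex.I * K) * e2'
  · simp only [l₁, l₂, l₃]
    rw [hmidv x₁ hx₁ h₁, hmidv x₂ hx₂ h₂, hlargev x₃ hx₃ h₃]
    have e3' : (ρ : ℂ) / d ^ 4 * (midFlux γ κ₀ d Ω K x₁ * (d ^ 2 * a₁)
      + midFlux γ κ₀ d Ω K x₂ * (d ^ 2 * a₂) + largeFlux γ κ₀ d Ω K x₃ * (d * a₃)) = -ρ := by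
      rw [e3]; field_simp
    rw [← e3']
    field_simp

/-! ### Smooth dependence of simple roots -/

@[fun_prop]
theorem contDiffOn_ofReal_comp {E : Type*} [NormedAddCommGroup E] [NormedSpace ℝ E]
    {n : WithTop ℕ∞} {f : E → ℝ} {s : Set E} (hf : ContDiffOn ℝ n f s) :
    ContDiffOn ℝ n (fun y => (f y : ℂ)) s :=
  Complex.ofRealCLM.contDiff.comp_contDiffOn hf

@[fun_prop]
theorem contDiff_ofReal_comp {E : Type*} [NormedAddCommGroup E] [NormedSpace ℝ E]
    {n : WithTop ℕ∞} {f : E → ℝ} (hf : ContDiff ℝ n f) :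
    ContDiff ℝ n (fun y => (f y : ℂ)) :=
  Complex.ofRealCLM.contDiff.comp hf

/-- A function which selects the unique root in an open set is smooth where that root is simple. -/
theorem contDiffOn_of_unique_root {E : Type*} [NormedAddCommGroup E] [NormedSpace ℝ E]
    [CompleteSpace E]
    {f : E × ℂ → ℂ} (hf : ContDiff ℝ ∞ f) {g : E → ℂ} {w : Set E} {S : Set ℂ} (hS : IsOpen S)
    (hg : ∀ p ∈ w, g p ∈ S ∧ f (p, g p) = 0)
    (huniq : ∀ p ∈ w, ∀ y ∈ S, f (p, y) = 0 → y = g p)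
    (hd : ∀ p ∈ w, ∃ D : ℂ, D ≠ 0 ∧ HasDerivAt (fun y => f (p, y)) D (g p)) :
    ContDiffOn ℝ ∞ g w := by
  intro p hp
  obtain ⟨D, hD, hder⟩ := hd p hp
  have hfp : ContDiffAt ℝ ∞ f (p, g p) := hf.contDiffAt
  -- The real partial derivative in the root variable is complex multiplication by D ≠ 0, hence
  -- invertible over ℝ.
  have hinv : (fderiv ℝ f (p, g p) ∘L .inr ℝ E ℂ).IsInvertible := by
    have h1 : HasFDerivAt (fun y => f (p, y)) (fderiv ℝ f (p, g p) ∘L .inr ℝ E ℂ) (g p) :=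
      ((hf.differentiable (by simp)) (p, g p)).hasFDerivAt.comp (g p)
        (hasFDerivAt_prodMk_right p (g p))
    have h2 := hder.hasFDerivAt.restrictScalars ℝ
    rw [h1.unique h2]
    refine ContinuousLinearMap.IsInvertible.of_inverse
      (g := (ContinuousLinearMap.toSpanSingleton ℂ D⁻¹).restrictScalars ℝ) ?_ ?_
    · ext x; simp [hD]
    · ext x; simp [hD]
  set φ := hfp.implicitFunction (by simp) hinv
  have hφs : ContDiffAt ℝ ∞ φ p := hfp.contDiffAt_implicitFunction (by simp) hinv
  have hφp : φ p = g p := hfp.implicitFunction_apply_self (by simp) hinv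
  have hφ0 : ∀ᶠ q in 𝓝 p, f (q, φ q) = f (p, g p) :=
    hfp.eventually_apply_implicitFunction (by simp) hinv
  -- The implicit branch remains in the open set S, where g is the only root, so the two agree near
  -- p on w, which need not be open.
  have hφS : ∀ᶠ q in 𝓝 p, φ q ∈ S :=
    hφs.continuousAt.eventually_mem (hS.mem_nhds (by rw [hφp]; exact (hg p hp).1))
  refine hφs.contDiffWithinAt.congr_of_eventuallyEq ?_ hφp.symm
  filter_upwards [nhdsWithin_le_nhds hφ0, nhdsWithin_le_nhds hφS, self_mem_nhdsWithin]
    with q h1 h2 hq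
  exact (huniq q hq _ h2 (by rw [h1, (hg p hp).2])).symm

open Classical in
/-- A root of `f` in `S`, or `0` if there is none. -/
def selectRoot (S : Set ℂ) (f : ℂ → ℂ) : ℂ := if h : ∃ y ∈ S, f y = 0 then h.choose else 0

theorem selectRoot_eq {S : Set ℂ} {f : ℂ → ℂ} {y : ℂ} (hy : y ∈ S) (hf : f y = 0)
    (huniq : ∀ x ∈ S, f x = 0 → x = y) : selectRoot S f = y := by
  have h : ∃ y ∈ S, f y = 0 := ⟨y, hy, hf⟩
  rw [selectRoot, dif_pos h]
  exact huniq _ h.choose_spec.1 h.choose_spec.2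

/-! ### The window -/

/-- A lower bound for the quantities that do not vanish at the critical angles. -/
def criticalGap (γ : ℝ) : ℝ :=
  min (Real.sin γ ^ 2 * Real.cos γ) (min (Real.sin γ * Real.cos γ ^ 2) (|Real.cos (2 * γ)| / 2))

theorem criticalGap_pos {γ : ℝ} (hγ₀ : 0 < γ) (hγ₁ : γ < Real.pi / 2) (hγ₂ : γ ≠ Real.pi / 4) :
    0 < criticalGap γ := by
  have hs : 0 < Real.sin γ := Real.sin_pos_of_pos_of_lt_pi hγ₀ (by linarith [Real.pi_pos])
  have hc : 0 < Real.cos γ := Real.cos_pos_of_mem_Ioo ⟨by linarith, hγ₁⟩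
  have h2 : Real.cos (2 * γ) ≠ 0 := by
    intro h
    rw [← Real.cos_pi_div_two] at h
    have := Real.injOn_cos ⟨by linarith, by linarith⟩
      ⟨by linarith [Real.pi_pos], by linarith [Real.pi_pos]⟩ h
    exact hγ₂ (by linarith)
  have := abs_pos.2 h2
  unfold criticalGap
  positivity

/-- The sign τ = ±1 distinguishes the angles near γ from those near γ + π. At the critical angles
the first three quantities are 2 sin²γ cos γ, 2 sin γ cos²γ and |cos 2γ|, each at least twice the
gap; they move by at most 3e. -/
theorem near_critical {γ e τ θ : ℝ} (hτ : τ ^ 2 = 1) (hs : |Real.sin θ - τ * Real.sin γ| ≤ e)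
    (hc : |Real.cos θ - τ * Real.cos γ| ≤ e) (he : 3 * e ≤ criticalGap γ) :
    criticalGap γ ≤ Real.sin θ * Real.sin (θ + γ) ∧
      criticalGap γ ≤ Real.cos (θ + γ) * Real.sin θ + Real.sin γ ∧
      criticalGap γ ≤ |Real.cos (θ + γ)| ∧
      |Real.sin θ ^ 2 - Real.sin γ ^ 2| ≤ 2 * e := by
  have he0 : 0 ≤ e := (abs_nonneg _).trans hs
  have hτ1 : |τ| = 1 := by rw [← sq_eq_sq₀ (abs_nonneg _) zero_le_one, sq_abs, hτ, one_pow]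
  have g1 : criticalGap γ ≤ Real.sin γ ^ 2 * Real.cos γ := min_le_left _ _
  have g2 : criticalGap γ ≤ Real.sin γ * Real.cos γ ^ 2 := (min_le_right _ _).trans (min_le_left _ _)
  have g3 : criticalGap γ ≤ |Real.cos (2 * γ)| / 2 := (min_le_right _ _).trans (min_le_right _ _)
  have bs := Real.abs_sin_le_one γ
  have bc := Real.abs_cos_le_one γ
  have hK : |Real.sin (θ + γ) - τ * (2 * Real.sin γ * Real.cos γ)| ≤ 2 * e := by
    have : Real.sin (θ + γ) - τ * (2 * Real.sin γ * Real.cos γ) =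
      (Real.sin θ - τ * Real.sin γ) * Real.cos γ + (Real.cos θ - τ * Real.cos γ) * Real.sin γ := by
      rw [Real.sin_add]; ring
    rw [this]
    refine (abs_add_le _ _).trans ?_
    rw [abs_mul, abs_mul]
    have := mul_le_mul hs bc (abs_nonneg _) he0
    have := mul_le_mul hc bs (abs_nonneg _) he0
    linarith
  have hm : |Real.cos (θ + γ) - τ * Real.cos (2 * γ)| ≤ 2 * e := by
    have : Real.cos (θ + γ) - τ * Real.cos (2 * γ) =
      (Real.cos θ - τ * Real.cos γ) * Real.cos γ - (Real.sin θ - τ * Real.sin γ) * Real.sin γ := by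
      rw [Real.cos_add, Real.cos_two_mul']; ring
    rw [this]
    refine (abs_sub _ _).trans ?_
    rw [abs_mul, abs_mul]
    have := mul_le_mul hs bs (abs_nonneg _) he0
    have := mul_le_mul hc bc (abs_nonneg _) he0
    linarith
  have aux : ∀ x y : ℝ, |x - τ * y| ≤ 2 * e → |x| ≤ 1 →
      |Real.sin θ * x - Real.sin γ * y| ≤ 3 * e := by
    intro x y hxy hx
    have : Real.sin θ * x - Real.sin γ * y =
        (Real.sin θ - τ * Real.sin γ) * x + τ * Real.sin γ * (x - τ * y) := by
      linear_combination (Real.sin γ * y) * hτ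
    rw [this]
    refine (abs_add_le _ _).trans ?_
    rw [abs_mul, abs_mul, abs_mul, hτ1, one_mul]
    have := mul_le_mul hs hx (abs_nonneg _) he0
    have := mul_le_mul bs hxy (abs_nonneg _) zero_le_one
    linarith
  refine ⟨?_, ?_, ?_, ?_⟩
  · have := abs_le.1 (aux _ _ hK (Real.abs_sin_le_one _))
    nlinarith
  · have := abs_le.1 (aux _ _ hm (Real.abs_cos_le_one _))
    rw [Real.cos_two_mul] at this
    nlinarith
  · have h1 := abs_sub_abs_le_abs_sub (τ * Real.cos (2 * γ)) (Real.cos (θ + γ))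
    rw [abs_mul, hτ1, one_mul, abs_sub_comm] at h1
    linarith
  · have : Real.sin θ ^ 2 - Real.sin γ ^ 2 =
        (Real.sin θ - τ * Real.sin γ) * (Real.sin θ + τ * Real.sin γ) := by
      linear_combination (Real.sin γ ^ 2) * hτ
    rw [this, abs_mul]
    have h2 : |Real.sin θ + τ * Real.sin γ| ≤ 2 := by
      refine (abs_add_le _ _).trans ?_
      rw [abs_mul, hτ1]
      linarith [Real.abs_sin_le_one θ]
    nlinarith [abs_nonneg (Real.sin θ - τ * Real.sin γ)]

theorem angularWindow_near {γ R ε θ : ℝ} (h : θ ∈ angularWindow γ R ε)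
    (he : 3 * (R * ε ^ (1 / 3 : ℝ)) ≤ criticalGap γ) :
    criticalGap γ ≤ Real.sin θ * Real.sin (θ + γ) ∧
      criticalGap γ ≤ Real.cos (θ + γ) * Real.sin θ + Real.sin γ ∧
      criticalGap γ ≤ |Real.cos (θ + γ)| ∧
      |Real.sin θ ^ 2 - Real.sin γ ^ 2| ≤ 2 * (R * ε ^ (1 / 3 : ℝ)) := by
  obtain ⟨-, ⟨h1, h2⟩ | ⟨h1, h2⟩⟩ := h
  · exact near_critical (τ := 1) (by norm_num) (by simpa using h1) (by simpa using h2) he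
  · exact near_critical (τ := -1) (by norm_num) (by simpa using h1) (by simpa using h2) he

/-! ### The scale `d = (ε ρ²)^{1/6}` -/

def layerScale (ε ρ : ℝ) : ℝ := ε ^ (1 / 6 : ℝ) * ρ ^ (1 / 3 : ℝ)

section

variable {ε ρ : ℝ}

theorem layerScale_pos (hε : 0 < ε) (hρ : 0 < ρ) : 0 < layerScale ε ρ := by
  unfold layerScale; positivity

theorem layerScale_pow (hε : 0 < ε) (hρ : 0 < ρ) (n : ℕ) :
    layerScale ε ρ ^ n = ε ^ (n / 6 : ℝ) * ρ ^ (n / 3 : ℝ) := by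
  unfold layerScale
  rw [mul_pow, ← Real.rpow_natCast, ← Real.rpow_natCast, ← Real.rpow_mul hε.le,
    ← Real.rpow_mul hρ.le]
  congr 2 <;> ring

theorem layerScale_pow_six (hε : 0 < ε) (hρ : 0 < ρ) : layerScale ε ρ ^ 6 = ε * ρ ^ 2 := by
  rw [layerScale_pow hε hρ, ← Real.rpow_natCast ρ 2]
  norm_num

theorem layerScale_sq (hε : 0 < ε) (hρ : 0 < ρ) :
    layerScale ε ρ ^ 2 = ε ^ (1 / 3 : ℝ) * ρ ^ (2 / 3 : ℝ) := by
  rw [layerScale_pow hε hρ]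
  norm_num

theorem layerScale_cube (hε : 0 < ε) (hρ : 0 < ρ) :
    layerScale ε ρ ^ 3 = ε ^ (1 / 2 : ℝ) * ρ := by
  rw [layerScale_pow hε hρ]
  norm_num

theorem div_layerScale_sq (hε : 0 < ε) (hρ : 0 < ρ) :
    ρ / layerScale ε ρ ^ 2 = ε ^ (-(1 / 3) : ℝ) * ρ ^ (1 / 3 : ℝ) := by
  rw [layerScale_sq hε hρ, div_eq_iff (by positivity)]
  calc ρ = ε ^ (-(1 / 3) + 1 / 3 : ℝ) * ρ ^ (1 / 3 + 2 / 3 : ℝ) := by norm_num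
    _ = _ := by rw [Real.rpow_add hε, Real.rpow_add hρ]; ring

/-- The powers of ρ cancel. Hence the threshold between intermediate and large roots does not depend
on ρ. -/
theorem div_layerScale_cube (hε : 0 < ε) (hρ : 0 < ρ) :
    ρ / layerScale ε ρ ^ 3 = ε ^ (-(1 / 2) : ℝ) := by
  rw [layerScale_cube hε hρ, div_eq_iff (by positivity), ← mul_assoc, ← Real.rpow_add hε]
  norm_num

theorem one_div_layerScale_sq (hε : 0 < ε) (hρ : 0 < ρ) :
    1 / layerScale ε ρ ^ 2 = ε ^ (-(1 / 3) : ℝ) * ρ ^ (-(2 / 3) : ℝ) := by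
  rw [layerScale_sq hε hρ, Real.rpow_neg hε.le, Real.rpow_neg hρ.le, one_div, mul_inv]

theorem one_div_layerScale (hε : 0 < ε) (hρ : 0 < ρ) :
    1 / layerScale ε ρ = ε ^ (-(1 / 6) : ℝ) * ρ ^ (-(1 / 3) : ℝ) := by
  rw [layerScale, Real.rpow_neg hε.le, Real.rpow_neg hρ.le, one_div, mul_inv]

end

theorem contDiffOn_layerScale (ε : ℝ) {w : Set (ℝ × ℝ)} (hw : ∀ z ∈ w, 0 < z.1) :
    ContDiffOn ℝ ∞ (fun z : ℝ × ℝ => layerScale ε z.1) w := by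
  intro z hz
  unfold layerScale
  exact (contDiffWithinAt_const.mul
    ((contDiffAt_fst.rpow_const_of_ne (hw z hz).ne').contDiffWithinAt))

/-- On the window, `ρ = O(ε^{-1/8})`. -/
theorem window_rho_le {γ η μ R ε₀ ε σ ρ θ : ℝ} (hμ : μ < 1 / 8) (hR : 0 < R) (hε₀ : ε₀ ≤ 1)
    (h : Admissible μ ε₀ ε σ) (hw : (ρ, θ) ∈ window γ η R ε σ) :
    ρ ≤ R * ε ^ (-(1 / 8) : ℝ) := by
  obtain ⟨hε, hε1, hσ, -⟩ := h
  have h1 : σ * ρ ≤ R := hw.2.1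
  have hσ0 : 0 < σ := (Real.rpow_pos_of_pos hε μ).trans hσ
  have h2 : ρ ≤ R / σ := by rw [le_div_iff₀ hσ0]; linarith
  have h3 : ε ^ (1 / 8 : ℝ) ≤ σ :=
    (Real.rpow_le_rpow_of_exponent_ge hε (hε1.le.trans hε₀) hμ.le).trans hσ.le
  have h4 : R / σ ≤ R / ε ^ (1 / 8 : ℝ) := by gcongr
  rw [Real.rpow_neg hε.le, ← div_eq_mul_inv]
  exact h2.trans h4

/-- With ρ = O(ε^{-1/8}) the exponent is 1/6 − 1/24 = 1/8, so d is uniformly small on the window. -/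
theorem window_layerScale_le {γ η μ R ε₀ ε σ ρ θ : ℝ} (hη : 0 < η) (hμ : μ < 1 / 8) (hR : 0 < R)
    (hε₀ : ε₀ ≤ 1) (h : Admissible μ ε₀ ε σ) (hw : (ρ, θ) ∈ window γ η R ε σ) :
    layerScale ε ρ ≤ R ^ (1 / 3 : ℝ) * ε ^ (1 / 8 : ℝ) := by
  have h1 := window_rho_le hμ hR hε₀ h hw
  have hε := h.1
  have hρ : 0 < ρ := hη.trans_le hw.1
  calc layerScale ε ρ ≤ ε ^ (1 / 6 : ℝ) * (R * ε ^ (-(1 / 8) : ℝ)) ^ (1 / 3 : ℝ) := by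
        unfold layerScale; gcongr
    _ = R ^ (1 / 3 : ℝ) * (ε ^ (1 / 6 : ℝ) * ε ^ (-(1 / 8) * (1 / 3) : ℝ)) := by
        rw [Real.mul_rpow hR.le (by positivity), ← Real.rpow_mul hε.le]; ring
    _ = R ^ (1 / 3 : ℝ) * ε ^ (1 / 8 : ℝ) := by
        rw [← Real.rpow_add hε]; norm_num

theorem tendsto_const_mul_rpow (A : ℝ) {s : ℝ} (hs : 0 < s) :
    Tendsto (fun ε : ℝ => A * ε ^ s) (𝓝[>] 0) (𝓝 0) := by
  have h : ContinuousAt (fun ε : ℝ => A * ε ^ s) 0 :=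
    (Real.continuousAt_rpow_const 0 s (Or.inr hs.le)).const_mul A
  have := h.tendsto.mono_left (nhdsWithin_le_nhds (s := Ioi 0))
  simpa [Real.zero_rpow hs.ne'] using this

/-- Smallness conditions that hold on all windows once `ε₀` is small. -/
theorem exists_eps0 {γ η μ R d₀ : ℝ} (hgap : 0 < criticalGap γ) (hη : 0 < η) (hμ : μ < 1 / 8)
    (hR : 0 < R) (hd₀ : 0 < d₀) :
    ∃ ε₀ : ℝ, 0 < ε₀ ∧ ε₀ ≤ 1 ∧
      (∀ ε, 0 < ε → ε < ε₀ → 3 * (R * ε ^ (1 / 3 : ℝ)) ≤ criticalGap γ) ∧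
      ∀ ε σ, Admissible μ ε₀ ε σ → ∀ ρ θ, (ρ, θ) ∈ window γ η R ε σ → layerScale ε ρ < d₀ := by
  have h1 := (tendsto_const_mul_rpow (3 * R) (by norm_num : (0 : ℝ) < 1 / 3)).eventually_lt_const
    hgap
  have h2 := (tendsto_const_mul_rpow (R ^ (1 / 3 : ℝ))
    (by norm_num : (0 : ℝ) < 1 / 8)).eventually_lt_const hd₀
  obtain ⟨e, he, h⟩ := mem_nhdsGT_iff_exists_Ioo_subset.1 (h1.and h2)
  have he : 0 < e := he
  refine ⟨min e 1, by positivity, min_le_right _ _, fun ε h0 h1 => ?_, fun ε σ ha ρ θ hw => ?_⟩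
  · have := (h ⟨h0, h1.trans_le (min_le_left _ _)⟩).1
    linarith
  · exact (window_layerScale_le hη hμ hR (min_le_right _ _) ha hw).trans_lt
      (h ⟨ha.1, ha.2.1.trans_le (min_le_left _ _)⟩).2

/-! ### The layers on the window -/

section

variable (γ ν₀ κ₀ : ℝ)

/-- The characteristic polynomial in terms of `(ρ, θ)`. -/
def polarChar (ε ρ θ : ℝ) (y : ℂ) : ℂ :=
  charPoly γ ν₀ κ₀ ε (Real.sin θ) (ρ * Real.sin (θ + γ)) y

/-- With t = c ε^{-1/2}, this region and the next two are open, disjoint and independent of (ρ, θ),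
and each isolates one of the three roots. The size bound excludes the large root, whose quadrant
depends on the sign of the frequency. -/
def quadrantOne (t : ℝ) : Set ℂ := {y | 0 < y.re ∧ 0 < y.im ∧ ‖y‖ < t}

def quadrantFour (t : ℝ) : Set ℂ := {y | 0 < y.re ∧ y.im < 0 ∧ ‖y‖ < t}

def farRight (t : ℝ) : Set ℂ := {y | 0 < y.re ∧ t < ‖y‖}

/-- Selecting the root by its region makes the decay a function of (ε, ρ, θ) alone, independent of σ
and of the labelling obtained at each point. -/
def decay₁ (c ε ρ θ : ℝ) : ℂ :=
  selectRoot (quadrantOne (c * ε ^ (-(1 / 2) : ℝ))) (polarChar γ ν₀ κ₀ ε ρ θ)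

def decay₂ (c ε ρ θ : ℝ) : ℂ :=
  selectRoot (quadrantFour (c * ε ^ (-(1 / 2) : ℝ))) (polarChar γ ν₀ κ₀ ε ρ θ)

def decay₃ (c ε ρ θ : ℝ) : ℂ :=
  selectRoot (farRight (c * ε ^ (-(1 / 2) : ℝ))) (polarChar γ ν₀ κ₀ ε ρ θ)

/-- The amplitude of a layer, for a rescaled amplitude `A` and the exponent `j` of the scale. -/
def scaledAmp (A : ℝ → ℝ → ℝ → ℝ → ℂ → ℂ → ℂ → ℂ) (j : ℕ) (c ε ρ θ : ℝ) : ℂ :=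
  A (layerScale ε ρ) (Real.sin θ) (Real.sin (θ + γ)) (Real.cos (θ + γ))
    (decay₁ γ ν₀ κ₀ c ε ρ θ * layerScale ε ρ ^ 2 / ρ)
    (decay₂ γ ν₀ κ₀ c ε ρ θ * layerScale ε ρ ^ 2 / ρ)
    (decay₃ γ ν₀ κ₀ c ε ρ θ * layerScale ε ρ ^ 3 / ρ) / layerScale ε ρ ^ j

def layerAmp₁ : ℝ → ℝ → ℝ → ℝ → ℂ := scaledAmp γ ν₀ κ₀ (amp₁ γ κ₀) 2

def layerAmp₂ : ℝ → ℝ → ℝ → ℝ → ℂ := scaledAmp γ ν₀ κ₀ (amp₂ γ κ₀) 2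

def layerAmp₃ : ℝ → ℝ → ℝ → ℝ → ℂ := scaledAmp γ ν₀ κ₀ (amp₃ γ κ₀) 1

/-- Rescaled description of the roots and amplitudes at a point of the window. -/
structure LayerPoint (c B C ε ρ θ : ℝ) (x₁ x₂ x₃ : ℂ) : Prop where
  gap : criticalGap γ ≤ Real.sin θ * Real.sin (θ + γ)
  gap_cos : criticalGap γ ≤ |Real.cos (θ + γ)|
  roots : ∀ y, polarChar γ ν₀ κ₀ ε ρ θ y = 0 ∧ 0 < y.re ↔
    y = ρ * (x₁ / layerScale ε ρ ^ 2) ∨ y = ρ * (x₂ / layerScale ε ρ ^ 2) ∨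
      y = ρ * (x₃ / layerScale ε ρ ^ 3)
  simple : ∀ y, polarChar γ ν₀ κ₀ ε ρ θ y = 0 → ∃ D, D ≠ 0 ∧ HasDerivAt (polarChar γ ν₀ κ₀ ε ρ θ) D y
  small : B * layerScale ε ρ < c
  size₁ : 2 * c ≤ x₁.re ∧ 2 * c ≤ x₁.im ∧ ‖x₁‖ ≤ B
  size₂ : 2 * c ≤ x₂.re ∧ x₂.im ≤ -(2 * c) ∧ ‖x₂‖ ≤ B
  size₃ : 2 * c ≤ x₃.re ∧ ‖x₃‖ ≤ B
  asymp₁ : ‖x₁ - midProfile γ ν₀ κ₀ (Real.sin θ) (Real.sin (θ + γ))‖ ≤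
    B * (layerScale ε ρ ^ 2 + |Real.sin θ ^ 2 - Real.sin γ ^ 2| / layerScale ε ρ ^ 2)
  asymp₂ : ‖x₂ - (starRingEnd ℂ) (midProfile γ ν₀ κ₀ (Real.sin θ) (Real.sin (θ + γ)))‖ ≤
    B * (layerScale ε ρ ^ 2 + |Real.sin θ ^ 2 - Real.sin γ ^ 2| / layerScale ε ρ ^ 2)
  asymp₃ : ‖x₃ - largeProfile ν₀ κ₀ (Real.sin θ)‖ ≤
    B * (|Real.sin θ ^ 2 - Real.sin γ ^ 2| + layerScale ε ρ ^ 3)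
  denom₁ : midDenom κ₀ (layerScale ε ρ) (Real.sin θ) (Real.sin (θ + γ)) x₁ ≠ 0
  denom₂ : midDenom κ₀ (layerScale ε ρ) (Real.sin θ) (Real.sin (θ + γ)) x₂ ≠ 0
  denom₃ : largeDenom κ₀ (layerScale ε ρ) (Real.sin θ) (Real.sin (θ + γ)) x₃ ≠ 0
  det : layerDet γ κ₀ (layerScale ε ρ) (Real.sin θ) (Real.sin (θ + γ)) x₁ x₂ x₃ ≠ 0
  bound₁ : ‖amp₁ γ κ₀ (layerScale ε ρ) (Real.sin θ) (Real.sin (θ + γ)) (Real.cos (θ + γ))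
    x₁ x₂ x₃‖ ≤ C
  bound₂ : ‖amp₂ γ κ₀ (layerScale ε ρ) (Real.sin θ) (Real.sin (θ + γ)) (Real.cos (θ + γ))
    x₁ x₂ x₃‖ ≤ C
  bound₃ : ‖amp₃ γ κ₀ (layerScale ε ρ) (Real.sin θ) (Real.sin (θ + γ)) (Real.cos (θ + γ))
    x₁ x₂ x₃‖ ≤ C

end

variable {γ ν₀ κ₀ : ℝ}

theorem polarChar_rescale {ε ρ : ℝ} (hε : 0 < ε) (hρ : 0 < ρ) (θ : ℝ) (y : ℂ) :
    polarChar γ ν₀ κ₀ ε ρ θ y =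
      ρ ^ 2 * charPoly γ ν₀ κ₀ (layerScale ε ρ ^ 6) (Real.sin θ) (Real.sin (θ + γ)) (y / ρ) := by
  have hρ' : (ρ : ℂ) ≠ 0 := by exact_mod_cast hρ.ne'
  rw [layerScale_pow_six hε hρ, ← charPoly_rescale, mul_div_cancel₀ _ hρ', polarChar]

theorem differentiable_charPoly (ε Ω k : ℝ) : Differentiable ℂ (charPoly γ ν₀ κ₀ ε Ω k) := by
  rw [funext (charPoly_eq_sextic γ ν₀ κ₀ ε Ω k)]
  exact fun y => (hasDerivAt_sextic _ _ _ _ _ y).differentiableAt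

/-- The root and amplitude estimates for small d are transported to the window; one ε₀ makes both d
and the width of the angular window small enough. -/
theorem exists_layerPoint (hγ₀ : 0 < γ) (hγ₁ : γ < Real.pi / 2) (hγ₂ : γ ≠ Real.pi / 4)
    (hν : 0 < ν₀) (hκ : 0 < κ₀) {η μ R : ℝ} (hη : 0 < η) (hμ : μ < 1 / 8) (hR : 0 < R) :
    ∃ ε₀ > 0, ε₀ ≤ 1 ∧ (∀ ε, 0 < ε → ε < ε₀ → 3 * (R * ε ^ (1 / 3 : ℝ)) ≤ criticalGap γ) ∧
      ∃ c > 0, ∃ B > 0, ∃ C > 0, ∀ ε σ, Admissible μ ε₀ ε σ →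
        ∀ ρ θ, (ρ, θ) ∈ window γ η R ε σ → ∃ x₁ x₂ x₃, LayerPoint γ ν₀ κ₀ c B C ε ρ θ x₁ x₂ x₃ := by
  have hgap := criticalGap_pos hγ₀ hγ₁ hγ₂
  -- This bounds z = ζ/d², since |ζ| ≤ 2R ε^{1/3} and d² = ε^{1/3} ρ^{2/3} with ρ ≥ η.
  set M := 2 * R / η ^ (2 / 3 : ℝ) with hM
  have hM0 : 0 < M := by positivity
  obtain ⟨c, hc, B, hB, hroots⟩ := exists_roots (M := M) hγ₀ hγ₁ hν hκ hgap
  obtain ⟨C, hC, hamp⟩ := exists_amplitude_bound (M := M) hγ₀ hγ₁ hν hκ hgap hc B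
  have hsmall : ∀ᶠ d in 𝓝[>] (0 : ℝ), B * d < c / 2 ∧ B * (d * M + d ^ 2) < 1 := by
    refine Filter.Eventually.filter_mono nhdsWithin_le_nhds ?_
    have h1 : ContinuousAt (fun d : ℝ => B * d) 0 := by fun_prop
    have h2 : ContinuousAt (fun d : ℝ => B * (d * M + d ^ 2)) 0 := by fun_prop
    exact (h1.eventually_lt continuousAt_const (by simpa using hc)).and
      (h2.eventually_lt continuousAt_const (by simp))
  have hamp' := Filter.Eventually.filter_mono (nhdsWithin_le_nhds (s := Ioi (0 : ℝ))) hamp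
  obtain ⟨d₀, hd₀, hd⟩ := mem_nhdsGT_iff_exists_Ioo_subset.1
    (hroots.and (hamp'.and hsmall))
  replace hd₀ : 0 < d₀ := hd₀
  obtain ⟨ε₀, hε₀, hε₀1, hsm, hwin⟩ := exists_eps0 (η := η) hgap hη hμ hR hd₀
  -- Halving c leaves room for a strict threshold between the intermediate roots, below c, and the
  -- large one, above 2c, in the scale ρ/d³.
  refine ⟨ε₀, hε₀, hε₀1, hsm, c / 2, by positivity, B, hB, C, hC, ?_⟩
  intro ε σ ha ρ θ hw
  have hε : 0 < ε := ha.1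
  have hρ : 0 < ρ := hη.trans_le hw.1
  have hd0 := layerScale_pos hε hρ
  obtain ⟨⟨-, hroots⟩, hamp, hs1, hs2⟩ := hd ⟨hd0, hwin ε σ ha ρ θ hw⟩
  obtain ⟨g1, g2, g3, g4⟩ := angularWindow_near hw.2.2 (hsm ε hε ha.2.1)
  have hdsq := layerScale_sq hε hρ
  set d := layerScale ε ρ with hddef
  set z := (Real.sin θ ^ 2 - Real.sin γ ^ 2) / d ^ 2 with hz
  have hzd : Real.sin θ ^ 2 - Real.sin γ ^ 2 = d ^ 2 * z := by rw [hz]; field_simp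
  have hzabs : |z| = |Real.sin θ ^ 2 - Real.sin γ ^ 2| / d ^ 2 := by
    rw [hz, abs_div, abs_of_pos (pow_pos hd0 2)]
  have hzM : |z| ≤ M := by
    rw [hzabs, hM, div_le_div_iff₀ (by positivity) (by positivity), hdsq]
    calc |Real.sin θ ^ 2 - Real.sin γ ^ 2| * η ^ (2 / 3 : ℝ)
        ≤ 2 * (R * ε ^ (1 / 3 : ℝ)) * ρ ^ (2 / 3 : ℝ) := by
          have := hw.1
          gcongr
      _ = 2 * R * (ε ^ (1 / 3 : ℝ) * ρ ^ (2 / 3 : ℝ)) := by ring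
  have hpar : (Real.sin θ, Real.sin (θ + γ), Real.cos (θ + γ), z) ∈ parSet γ (criticalGap γ) M := by
    refine ⟨?_, Real.sin_sq_add_cos_sq _, g1, g2, g3, hzM⟩
    simp only
    rw [← Real.sin_sub]; congr 1; ring
  obtain ⟨x₁, x₂, x₃, hiff, hsimp, b1, b2, b3, p1, p2, p3⟩ := hroots _ _ _ _ hpar hzd
  have hdC : (d : ℂ) ≠ 0 := by exact_mod_cast hd0.ne'
  have hρC : (ρ : ℂ) ≠ 0 := by exact_mod_cast hρ.ne'
  have hΩ : Real.sin θ ≠ 0 := (parSet_bounds hgap hpar).2.2.2.2.2.2.1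
  -- The defect of the large root is O(d²), so it is at most d for small d. Writing it as d e with
  -- ‖e‖ ≤ 1 keeps the parameters in a compact set on which the limit d → 0 is explicit.
  set e := (x₃ - largeProfile ν₀ κ₀ (Real.sin θ)) / d with he
  have hx₃ : x₃ = largeProfile ν₀ κ₀ (Real.sin θ) + d * e := by rw [he]; field_simp; ring
  have hq : ((Real.sin θ, Real.sin (θ + γ), Real.cos (θ + γ), z), x₁, x₂,
      largeProfile ν₀ κ₀ (Real.sin θ), e) ∈ layerSet γ κ₀ ν₀ (criticalGap γ) M c B := by
    refine ⟨⟨hpar, largeProfile_sq hν hκ hΩ⟩, ?_, b1, b2⟩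
    simp only
    rw [he, norm_div, Complex.norm_real, Real.norm_eq_abs, abs_of_pos hd0, div_le_one hd0]
    refine p3.trans ?_
    have h1 : d ^ 2 * |z| ≤ d ^ 2 * M := by gcongr
    calc B * (d ^ 2 * |z| + d ^ 3) ≤ B * (d ^ 2 * M + d ^ 3) := by gcongr
      _ = d * (B * (d * M + d ^ 2)) := by ring
      _ ≤ d * 1 := by gcongr
      _ = d := mul_one d
  obtain ⟨d1, d2, d3, -, hdet, a1, a2, a3⟩ := hamp _ hq
  simp only [← hx₃] at d1 d2 d3 hdet a1 a2 a3
  refine ⟨x₁, x₂, x₃, ⟨g1, g3, ?_, ?_, by linarith, ?_, ?_, ?_, ?_, ?_, ?_, d1, d2, d3, hdet, a1,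
    a2, a3⟩⟩
  · intro y
    rw [polarChar_rescale hε hρ]
    have h1 : (ρ : ℂ) ^ 2 * charPoly γ ν₀ κ₀ (d ^ 6) (Real.sin θ) (Real.sin (θ + γ)) (y / ρ) = 0 ↔
        charPoly γ ν₀ κ₀ (d ^ 6) (Real.sin θ) (Real.sin (θ + γ)) (y / ρ) = 0 := by
      simp [hρC]
    have h2 : 0 < y.re ↔ 0 < (y / ρ).re := by
      rw [Complex.div_ofReal_re, div_pos_iff_of_pos_right hρ]
    rw [← hddef, h1, h2, hiff, div_eq_iff hρC, div_eq_iff hρC, div_eq_iff hρC, mul_comm (ρ : ℂ),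
      mul_comm (ρ : ℂ), mul_comm (ρ : ℂ)]
  · intro y hy
    rw [polarChar_rescale hε hρ, ← hddef] at hy
    have h1 := (mul_eq_zero.1 hy).resolve_left (pow_ne_zero 2 hρC)
    have h2 := hsimp _ h1
    have h3 := (differentiable_charPoly (γ := γ) (ν₀ := ν₀) (κ₀ := κ₀) (d ^ 6) (Real.sin θ)
      (Real.sin (θ + γ)) (y / ρ)).hasDerivAt
    have h4 : HasDerivAt (fun y : ℂ => y / ρ) (1 / ρ : ℂ) y := (hasDerivAt_id y).div_const _
    have h5 := (h3.comp y h4).const_mul ((ρ : ℂ) ^ 2)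
    refine ⟨_, ?_, (funext (polarChar_rescale hε hρ θ) :
      polarChar γ ν₀ κ₀ ε ρ θ = _) ▸ h5⟩
    exact mul_ne_zero (pow_ne_zero 2 hρC) (mul_ne_zero h2 (one_div_ne_zero hρC))
  · simpa [mul_div_cancel₀] using b1
  · simpa [mul_div_cancel₀] using b2
  · simpa [mul_div_cancel₀] using b3
  · rw [← hzabs]; exact p1
  · rw [← hzabs]; exact p2
  · rw [hzd, abs_mul, abs_of_pos (pow_pos hd0 2)]; exact p3

section

variable {c B C ε ρ θ : ℝ} {x₁ x₂ x₃ : ℂ}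

theorem LayerPoint.ne_zero (hgap : 0 < criticalGap γ)
    (h : LayerPoint γ ν₀ κ₀ c B C ε ρ θ x₁ x₂ x₃) :
    Real.sin θ ≠ 0 ∧ Real.sin (θ + γ) ≠ 0 ∧ Real.cos (θ + γ) ≠ 0 := by
  refine ⟨?_, ?_, ?_⟩
  · intro h0; have := h.gap; rw [h0, zero_mul] at this; linarith
  · intro h0; have := h.gap; rw [h0, mul_zero] at this; linarith
  · intro h0; have := h.gap_cos; rw [h0, abs_zero] at this; linarith

theorem re_mul_div (ρ d : ℝ) (n : ℕ) (x : ℂ) :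
    ((ρ : ℂ) * (x / d ^ n)).re = ρ / d ^ n * x.re ∧
    ((ρ : ℂ) * (x / d ^ n)).im = ρ / d ^ n * x.im := by
  have : (ρ : ℂ) * (x / d ^ n) = ((ρ / d ^ n : ℝ) : ℂ) * x := by push_cast; ring
  rw [this, Complex.re_ofReal_mul, Complex.im_ofReal_mul]
  exact ⟨rfl, rfl⟩

theorem norm_mul_div (hρ : 0 < ρ) {d : ℝ} (hd : 0 < d) (n : ℕ) (x : ℂ) :
    ‖(ρ : ℂ) * (x / d ^ n)‖ = ρ / d ^ n * ‖x‖ := by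
  have : (ρ : ℂ) * (x / d ^ n) = ((ρ / d ^ n : ℝ) : ℂ) * x := by push_cast; ring
  rw [this, norm_mul, Complex.norm_real, Real.norm_eq_abs, abs_of_pos (by positivity)]

/-- The regions of the three roots. -/
theorem LayerPoint.regions (hc : 0 < c) (hε : 0 < ε) (hρ : 0 < ρ)
    (h : LayerPoint γ ν₀ κ₀ c B C ε ρ θ x₁ x₂ x₃) :
    (ρ * (x₁ / layerScale ε ρ ^ 2) : ℂ) ∈ quadrantOne (c * ε ^ (-(1 / 2) : ℝ)) ∧
    (ρ * (x₂ / layerScale ε ρ ^ 2) : ℂ) ∈ quadrantFour (c * ε ^ (-(1 / 2) : ℝ)) ∧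
    (ρ * (x₃ / layerScale ε ρ ^ 3) : ℂ) ∈ farRight (c * ε ^ (-(1 / 2) : ℝ)) := by
  have hd := layerScale_pos hε hρ
  rw [← div_layerScale_cube hε hρ]
  have hsm := h.small
  have h1 := h.size₁
  have h2 := h.size₂
  have h3 := h.size₃
  set d := layerScale ε ρ
  have key : ∀ x : ℂ, ‖x‖ ≤ B → ‖(ρ : ℂ) * (x / d ^ 2)‖ < c * (ρ / d ^ 3) := by
    intro x hx
    rw [norm_mul_div hρ hd]
    have : ‖x‖ * d < c := lt_of_le_of_lt (by gcongr) hsm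
    calc ρ / d ^ 2 * ‖x‖ = ρ / d ^ 3 * (‖x‖ * d) := by field_simp
      _ < ρ / d ^ 3 * c := by gcongr
      _ = c * (ρ / d ^ 3) := by ring
  refine ⟨⟨?_, ?_, key _ h1.2.2⟩, ⟨?_, ?_, key _ h2.2.2⟩, ⟨?_, ?_⟩⟩
  · rw [(re_mul_div _ _ _ _).1]; exact mul_pos (by positivity) (by linarith [h1.1])
  · rw [(re_mul_div _ _ _ _).2]; exact mul_pos (by positivity) (by linarith [h1.2.1])
  · rw [(re_mul_div _ _ _ _).1]; exact mul_pos (by positivity) (by linarith [h2.1])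
  · rw [(re_mul_div _ _ _ _).2]
    exact mul_neg_of_pos_of_neg (by positivity) (by linarith [h2.2.1])
  · rw [(re_mul_div _ _ _ _).1]; exact mul_pos (by positivity) (by linarith [h3.1])
  · rw [norm_mul_div hρ hd, mul_comm]
    gcongr
    linarith [h3.1, Complex.re_le_norm x₃]

theorem quadrants_disjoint {t : ℝ} {y : ℂ} :
    (y ∈ quadrantOne t → y ∉ quadrantFour t) ∧ (y ∈ quadrantOne t → y ∉ farRight t) ∧
      (y ∈ quadrantFour t → y ∉ farRight t) :=
  ⟨fun h h' => lt_asymm h.2.1 h'.2.1, fun h h' => lt_asymm h.2.2 h'.2,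
    fun h h' => lt_asymm h.2.2 h'.2⟩

/-- The three right half-plane roots lie in three disjoint regions, each contained in that
half-plane. -/
theorem LayerPoint.unique (hc : 0 < c) (hε : 0 < ε) (hρ : 0 < ρ)
    (h : LayerPoint γ ν₀ κ₀ c B C ε ρ θ x₁ x₂ x₃) :
    (∀ y ∈ quadrantOne (c * ε ^ (-(1 / 2) : ℝ)), polarChar γ ν₀ κ₀ ε ρ θ y = 0 →
      y = ρ * (x₁ / layerScale ε ρ ^ 2)) ∧
    (∀ y ∈ quadrantFour (c * ε ^ (-(1 / 2) : ℝ)), polarChar γ ν₀ κ₀ ε ρ θ y = 0 →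
      y = ρ * (x₂ / layerScale ε ρ ^ 2)) ∧
    (∀ y ∈ farRight (c * ε ^ (-(1 / 2) : ℝ)), polarChar γ ν₀ κ₀ ε ρ θ y = 0 →
      y = ρ * (x₃ / layerScale ε ρ ^ 3)) := by
  obtain ⟨r1, r2, r3⟩ := h.regions hc hε hρ
  refine ⟨fun y hy h0 => ?_, fun y hy h0 => ?_, fun y hy h0 => ?_⟩
  · rcases (h.roots y).1 ⟨h0, hy.1⟩ with e | e | e
    · exact e
    · rw [← e] at r2; exact absurd r2 (quadrants_disjoint.1 hy)
    · rw [← e] at r3; exact absurd r3 (quadrants_disjoint.2.1 hy)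
  · rcases (h.roots y).1 ⟨h0, hy.1⟩ with e | e | e
    · rw [← e] at r1; exact absurd hy (quadrants_disjoint.1 r1)
    · exact e
    · rw [← e] at r3; exact absurd r3 (quadrants_disjoint.2.2 hy)
  · rcases (h.roots y).1 ⟨h0, hy.1⟩ with e | e | e
    · rw [← e] at r1; exact absurd hy (quadrants_disjoint.2.1 r1)
    · rw [← e] at r2; exact absurd hy (quadrants_disjoint.2.2 r2)
    · exact e

theorem LayerPoint.isRoot (h : LayerPoint γ ν₀ κ₀ c B C ε ρ θ x₁ x₂ x₃) :
    polarChar γ ν₀ κ₀ ε ρ θ (ρ * (x₁ / layerScale ε ρ ^ 2)) = 0 ∧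
    polarChar γ ν₀ κ₀ ε ρ θ (ρ * (x₂ / layerScale ε ρ ^ 2)) = 0 ∧
    polarChar γ ν₀ κ₀ ε ρ θ (ρ * (x₃ / layerScale ε ρ ^ 3)) = 0 :=
  ⟨((h.roots _).2 (Or.inl rfl)).1, ((h.roots _).2 (Or.inr (Or.inl rfl))).1,
    ((h.roots _).2 (Or.inr (Or.inr rfl))).1⟩

theorem LayerPoint.decay_eq (hc : 0 < c) (hε : 0 < ε) (hρ : 0 < ρ)
    (h : LayerPoint γ ν₀ κ₀ c B C ε ρ θ x₁ x₂ x₃) :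
    decay₁ γ ν₀ κ₀ c ε ρ θ = ρ * (x₁ / layerScale ε ρ ^ 2) ∧
    decay₂ γ ν₀ κ₀ c ε ρ θ = ρ * (x₂ / layerScale ε ρ ^ 2) ∧
    decay₃ γ ν₀ κ₀ c ε ρ θ = ρ * (x₃ / layerScale ε ρ ^ 3) := by
  obtain ⟨r1, r2, r3⟩ := h.regions hc hε hρ
  obtain ⟨u1, u2, u3⟩ := h.unique hc hε hρ
  obtain ⟨i1, i2, i3⟩ := h.isRoot
  exact ⟨selectRoot_eq r1 i1 u1, selectRoot_eq r2 i2 u2, selectRoot_eq r3 i3 u3⟩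

theorem LayerPoint.unscale (hc : 0 < c) (hε : 0 < ε) (hρ : 0 < ρ)
    (h : LayerPoint γ ν₀ κ₀ c B C ε ρ θ x₁ x₂ x₃) :
    decay₁ γ ν₀ κ₀ c ε ρ θ * layerScale ε ρ ^ 2 / ρ = x₁ ∧
    decay₂ γ ν₀ κ₀ c ε ρ θ * layerScale ε ρ ^ 2 / ρ = x₂ ∧
    decay₃ γ ν₀ κ₀ c ε ρ θ * layerScale ε ρ ^ 3 / ρ = x₃ := by
  obtain ⟨h1, h2, h3⟩ := h.decay_eq hc hε hρ
  have hd : (layerScale ε ρ : ℂ) ≠ 0 := by exact_mod_cast (layerScale_pos hε hρ).ne'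
  have hρ' : (ρ : ℂ) ≠ 0 := by exact_mod_cast hρ.ne'
  rw [h1, h2, h3]
  refine ⟨?_, ?_, ?_⟩ <;> field_simp

theorem LayerPoint.amp_eq (hc : 0 < c) (hε : 0 < ε) (hρ : 0 < ρ)
    (h : LayerPoint γ ν₀ κ₀ c B C ε ρ θ x₁ x₂ x₃) :
    layerAmp₁ γ ν₀ κ₀ c ε ρ θ = amp₁ γ κ₀ (layerScale ε ρ) (Real.sin θ) (Real.sin (θ + γ))
      (Real.cos (θ + γ)) x₁ x₂ x₃ / layerScale ε ρ ^ 2 ∧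
    layerAmp₂ γ ν₀ κ₀ c ε ρ θ = amp₂ γ κ₀ (layerScale ε ρ) (Real.sin θ) (Real.sin (θ + γ))
      (Real.cos (θ + γ)) x₁ x₂ x₃ / layerScale ε ρ ^ 2 ∧
    layerAmp₃ γ ν₀ κ₀ c ε ρ θ = amp₃ γ κ₀ (layerScale ε ρ) (Real.sin θ) (Real.sin (θ + γ))
      (Real.cos (θ + γ)) x₁ x₂ x₃ / layerScale ε ρ := by
  obtain ⟨h1, h2, h3⟩ := h.unscale hc hε hρ
  simp only [layerAmp₁, layerAmp₂, layerAmp₃, scaledAmp, h1, h2, h3, pow_one, and_self]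

theorem LayerPoint.amp_bound (hc : 0 < c) (hε : 0 < ε) (hρ : 0 < ρ)
    (h : LayerPoint γ ν₀ κ₀ c B C ε ρ θ x₁ x₂ x₃) :
    ‖layerAmp₁ γ ν₀ κ₀ c ε ρ θ‖ ≤ C * ε ^ (-(1 / 3) : ℝ) * ρ ^ (-(2 / 3) : ℝ) ∧
    ‖layerAmp₂ γ ν₀ κ₀ c ε ρ θ‖ ≤ C * ε ^ (-(1 / 3) : ℝ) * ρ ^ (-(2 / 3) : ℝ) ∧
    ‖layerAmp₃ γ ν₀ κ₀ c ε ρ θ‖ ≤ C * ε ^ (-(1 / 6) : ℝ) * ρ ^ (-(1 / 3) : ℝ) := by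
  obtain ⟨h1, h2, h3⟩ := h.amp_eq hc hε hρ
  have hd := layerScale_pos hε hρ
  rw [mul_assoc, mul_assoc, ← one_div_layerScale_sq hε hρ, ← one_div_layerScale hε hρ, h1, h2, h3,
    norm_div, norm_div, norm_div, norm_pow, Complex.norm_real, Real.norm_eq_abs, abs_of_pos hd,
    mul_one_div, mul_one_div]
  exact ⟨by gcongr; exact h.bound₁, by gcongr; exact h.bound₂, by gcongr; exact h.bound₃⟩

theorem LayerPoint.decay_size (hc : 0 < c) (hε : 0 < ε) (hρ : 0 < ρ)
    (h : LayerPoint γ ν₀ κ₀ c B C ε ρ θ x₁ x₂ x₃) :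
    (c * ε ^ (-(1 / 3) : ℝ) * ρ ^ (1 / 3 : ℝ) ≤ (decay₁ γ ν₀ κ₀ c ε ρ θ).re ∧
      ‖decay₁ γ ν₀ κ₀ c ε ρ θ‖ ≤ B * ε ^ (-(1 / 3) : ℝ) * ρ ^ (1 / 3 : ℝ)) ∧
    (c * ε ^ (-(1 / 3) : ℝ) * ρ ^ (1 / 3 : ℝ) ≤ (decay₂ γ ν₀ κ₀ c ε ρ θ).re ∧
      ‖decay₂ γ ν₀ κ₀ c ε ρ θ‖ ≤ B * ε ^ (-(1 / 3) : ℝ) * ρ ^ (1 / 3 : ℝ)) ∧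
    (c * ε ^ (-(1 / 2) : ℝ) ≤ (decay₃ γ ν₀ κ₀ c ε ρ θ).re ∧
      ‖decay₃ γ ν₀ κ₀ c ε ρ θ‖ ≤ B * ε ^ (-(1 / 2) : ℝ)) := by
  obtain ⟨h1, h2, h3⟩ := h.decay_eq hc hε hρ
  have hd := layerScale_pos hε hρ
  have s1 := h.size₁
  have s2 := h.size₂
  have s3 := h.size₃
  rw [mul_assoc, mul_assoc, ← div_layerScale_sq hε hρ, ← div_layerScale_cube hε hρ, h1, h2, h3,
    (re_mul_div _ _ _ _).1, (re_mul_div _ _ _ _).1, (re_mul_div _ _ _ _).1, norm_mul_div hρ hd,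
    norm_mul_div hρ hd, norm_mul_div hρ hd, mul_comm c, mul_comm B, mul_comm c, mul_comm B]
  refine ⟨⟨?_, ?_⟩, ⟨?_, ?_⟩, ⟨?_, ?_⟩⟩
  · gcongr; linarith
  · gcongr; exact s1.2.2
  · gcongr; linarith
  · gcongr; exact s2.2.2
  · gcongr; linarith
  · gcongr; exact s3.2

/-- The rescaled estimates are multiplied by ρ/d² or ρ/d³; the exponents on ζ come from ρ/d⁴ =
ε^{-2/3} ρ^{-1/3} and ρ/d³ = ε^{-1/2}. -/
theorem LayerPoint.asymptotics (hc : 0 < c) (hε : 0 < ε) (hρ : 0 < ρ)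
    (h : LayerPoint γ ν₀ κ₀ c B C ε ρ θ x₁ x₂ x₃) :
    ‖decay₁ γ ν₀ κ₀ c ε ρ θ - ((ε ^ (-(1 / 3) : ℝ) * ρ ^ (1 / 3 : ℝ) : ℝ) : ℂ) *
      midProfile γ ν₀ κ₀ (Real.sin θ) (Real.sin (θ + γ))‖ ≤
      B * (ρ + |Real.sin θ ^ 2 - Real.sin γ ^ 2| * ε ^ (-(2 / 3) : ℝ) * ρ ^ (-(1 / 3) : ℝ)) ∧
    ‖decay₂ γ ν₀ κ₀ c ε ρ θ - ((ε ^ (-(1 / 3) : ℝ) * ρ ^ (1 / 3 : ℝ) : ℝ) : ℂ) *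
      (starRingEnd ℂ) (midProfile γ ν₀ κ₀ (Real.sin θ) (Real.sin (θ + γ)))‖ ≤
      B * (ρ + |Real.sin θ ^ 2 - Real.sin γ ^ 2| * ε ^ (-(2 / 3) : ℝ) * ρ ^ (-(1 / 3) : ℝ)) ∧
    ‖decay₃ γ ν₀ κ₀ c ε ρ θ - ((ε ^ (-(1 / 2) : ℝ) : ℝ) : ℂ) * largeProfile ν₀ κ₀ (Real.sin θ)‖ ≤
      B * (|Real.sin θ ^ 2 - Real.sin γ ^ 2| * ε ^ (-(1 / 2) : ℝ) + ρ) := by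
  obtain ⟨h1, h2, h3⟩ := h.decay_eq hc hε hρ
  have hd := layerScale_pos hε hρ
  have e4 : ε ^ (-(2 / 3) : ℝ) * ρ ^ (-(1 / 3) : ℝ) = ρ / layerScale ε ρ ^ 4 := by
    have : layerScale ε ρ ^ 4 = layerScale ε ρ ^ 2 * layerScale ε ρ ^ 2 := by ring
    rw [this, ← div_div, div_layerScale_sq hε hρ,
      div_eq_mul_one_div (_ * _) (layerScale ε ρ ^ 2), one_div_layerScale_sq hε hρ]
    calc ε ^ (-(2 / 3) : ℝ) * ρ ^ (-(1 / 3) : ℝ)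
        = ε ^ (-(1 / 3) + -(1 / 3) : ℝ) * ρ ^ (1 / 3 + -(2 / 3) : ℝ) := by norm_num
      _ = _ := by rw [Real.rpow_add hε, Real.rpow_add hρ]; ring
  rw [mul_assoc |Real.sin θ ^ 2 - Real.sin γ ^ 2|, e4, ← div_layerScale_sq hε hρ,
    ← div_layerScale_cube hε hρ, h1, h2, h3]
  have a1 := h.asymp₁
  have a2 := h.asymp₂
  have a3 := h.asymp₃
  set d := layerScale ε ρ
  have key : ∀ (n : ℕ) (x ℓ : ℂ), ‖(ρ : ℂ) * (x / d ^ n) - ((ρ / d ^ n : ℝ) : ℂ) * ℓ‖ =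
      ρ / d ^ n * ‖x - ℓ‖ := by
    intro n x ℓ
    rw [← norm_mul_div hρ hd n]
    congr 1
    push_cast
    ring
  rw [key, key, key]
  set Z := |Real.sin θ ^ 2 - Real.sin γ ^ 2|
  have f1 : ρ / d ^ 2 * (B * (d ^ 2 + Z / d ^ 2)) = B * (ρ + Z * (ρ / d ^ 4)) := by field_simp
  have f2 : ρ / d ^ 3 * (B * (Z + d ^ 3)) = B * (Z * (ρ / d ^ 3) + ρ) := by field_simp
  refine ⟨?_, ?_, ?_⟩
  · rw [← f1]; gcongr
  · rw [← f1]; gcongr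
  · rw [← f2]; gcongr

end

/-! ### Smoothness of the decays, amplitudes and profiles -/

section

variable {E : Type*} [NormedAddCommGroup E] [NormedSpace ℝ E] {s : Set E} {n : WithTop ℕ∞}

theorem contDiffOn_div {f g : E → ℂ} (hf : ContDiffOn ℝ n f s)
    (hg : ContDiffOn ℝ n g s) (h0 : ∀ z ∈ s, g z ≠ 0) : ContDiffOn ℝ n (fun z => f z / g z) s := by
  simp only [div_eq_mul_inv]
  exact hf.mul (hg.inv h0)

theorem contDiffOn_det3 {f₁ f₂ f₃ f₄ f₅ f₆ f₇ f₈ f₉ : E → ℂ} (h₁ : ContDiffOn ℝ n f₁ s)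
    (h₂ : ContDiffOn ℝ n f₂ s) (h₃ : ContDiffOn ℝ n f₃ s) (h₄ : ContDiffOn ℝ n f₄ s)
    (h₅ : ContDiffOn ℝ n f₅ s) (h₆ : ContDiffOn ℝ n f₆ s) (h₇ : ContDiffOn ℝ n f₇ s)
    (h₈ : ContDiffOn ℝ n f₈ s) (h₉ : ContDiffOn ℝ n f₉ s) :
    ContDiffOn ℝ n (fun z => det3 (f₁ z) (f₂ z) (f₃ z) (f₄ z) (f₅ z) (f₆ z) (f₇ z) (f₈ z) (f₉ z))
      s := by
  unfold det3
  fun_prop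

variable {γ κ₀ : ℝ} {d Ω K m : E → ℝ} {x₁ x₂ x₃ : E → ℂ}

theorem contDiffOn_midFlux (hd : ContDiffOn ℝ n d s) (hΩ : ContDiffOn ℝ n Ω s)
    (hK : ContDiffOn ℝ n K s) (hx : ContDiffOn ℝ n x₁ s)
    (h0 : ∀ z ∈ s, midDenom κ₀ (d z) (Ω z) (K z) (x₁ z) ≠ 0) :
    ContDiffOn ℝ n (fun z => midFlux γ κ₀ (d z) (Ω z) (K z) (x₁ z)) s := by
  unfold midFlux
  refine contDiffOn_div (by fun_prop) ?_ h0
  unfold midDenom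
  fun_prop

theorem contDiffOn_largeFlux (hd : ContDiffOn ℝ n d s) (hΩ : ContDiffOn ℝ n Ω s)
    (hK : ContDiffOn ℝ n K s) (hx : ContDiffOn ℝ n x₁ s)
    (h0 : ∀ z ∈ s, largeDenom κ₀ (d z) (Ω z) (K z) (x₁ z) ≠ 0) :
    ContDiffOn ℝ n (fun z => largeFlux γ κ₀ (d z) (Ω z) (K z) (x₁ z)) s := by
  unfold largeFlux
  refine contDiffOn_div (by fun_prop) ?_ h0
  unfold largeDenom
  fun_prop

theorem contDiffOn_amp (hd : ContDiffOn ℝ n d s) (hΩ : ContDiffOn ℝ n Ω s)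
    (hK : ContDiffOn ℝ n K s) (hm : ContDiffOn ℝ n m s) (hx₁ : ContDiffOn ℝ n x₁ s)
    (hx₂ : ContDiffOn ℝ n x₂ s) (hx₃ : ContDiffOn ℝ n x₃ s)
    (h₁ : ∀ z ∈ s, midDenom κ₀ (d z) (Ω z) (K z) (x₁ z) ≠ 0)
    (h₂ : ∀ z ∈ s, midDenom κ₀ (d z) (Ω z) (K z) (x₂ z) ≠ 0)
    (h₃ : ∀ z ∈ s, largeDenom κ₀ (d z) (Ω z) (K z) (x₃ z) ≠ 0)
    (hD : ∀ z ∈ s, layerDet γ κ₀ (d z) (Ω z) (K z) (x₁ z) (x₂ z) (x₃ z) ≠ 0)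
    (hm0 : ∀ z ∈ s, m z ≠ 0) (n₁ : ∀ z ∈ s, x₁ z ≠ 0) (n₂ : ∀ z ∈ s, x₂ z ≠ 0)
    (n₃ : ∀ z ∈ s, x₃ z ≠ 0) :
    ContDiffOn ℝ n (fun z => amp₁ γ κ₀ (d z) (Ω z) (K z) (m z) (x₁ z) (x₂ z) (x₃ z)) s ∧
    ContDiffOn ℝ n (fun z => amp₂ γ κ₀ (d z) (Ω z) (K z) (m z) (x₁ z) (x₂ z) (x₃ z)) s ∧
    ContDiffOn ℝ n (fun z => amp₃ γ κ₀ (d z) (Ω z) (K z) (m z) (x₁ z) (x₂ z) (x₃ z)) s := by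
  have f₁ := contDiffOn_midFlux (γ := γ) hd hΩ hK hx₁ h₁
  have f₂ := contDiffOn_midFlux (γ := γ) hd hΩ hK hx₂ h₂
  have f₃ := contDiffOn_largeFlux (γ := γ) hd hΩ hK hx₃ h₃
  have i₁ := contDiffOn_div (f := fun _ => (1 : ℂ)) contDiffOn_const hx₁ n₁
  have i₂ := contDiffOn_div (f := fun _ => (1 : ℂ)) contDiffOn_const hx₂ n₂
  have i₃ := contDiffOn_div (f := fun z => ((d z : ℂ)) ^ 2) (by fun_prop) hx₃ n₃
  have im := contDiffOn_div (n := n) (s := s) (f := fun _ => (1 : ℂ)) (g := fun z => Complex.I * (m z : ℂ))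
    contDiffOn_const (by fun_prop) (fun z hz => mul_ne_zero Complex.I_ne_zero
      (by exact_mod_cast hm0 z hz))
  have c1 : ContDiffOn ℝ n (fun _ : E => (1 : ℂ)) s := contDiffOn_const
  have cd : ContDiffOn ℝ n (fun z => (d z : ℂ)) s := by fun_prop
  have cd2 : ContDiffOn ℝ n (fun z => -(d z : ℂ) ^ 2) s := by fun_prop
  have cd4 : ContDiffOn ℝ n (fun z => -(d z : ℂ) ^ 4) s := by fun_prop
  have hdet : ContDiffOn ℝ n
      (fun z => layerDet γ κ₀ (d z) (Ω z) (K z) (x₁ z) (x₂ z) (x₃ z)) s :=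
    contDiffOn_det3 c1 c1 cd i₁ i₂ i₃ f₁ f₂ f₃
  exact ⟨contDiffOn_div (contDiffOn_det3 cd2 c1 cd im i₂ i₃ cd4 f₂ f₃) hdet hD,
    contDiffOn_div (contDiffOn_det3 c1 cd2 cd i₁ im i₃ f₁ cd4 f₃) hdet hD,
    contDiffOn_div (contDiffOn_det3 c1 c1 cd2 i₁ i₂ im f₁ f₂ cd4) hdet hD⟩

end

theorem isOpen_quadrantOne (t : ℝ) : IsOpen (quadrantOne t) := by
  simp only [quadrantOne, Set.ofPred_and]
  exact (isOpen_lt (by fun_prop) (by fun_prop)).inter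
    ((isOpen_lt (by fun_prop) (by fun_prop)).inter (isOpen_lt (by fun_prop) (by fun_prop)))

theorem isOpen_quadrantFour (t : ℝ) : IsOpen (quadrantFour t) := by
  simp only [quadrantFour, Set.ofPred_and]
  exact (isOpen_lt (by fun_prop) (by fun_prop)).inter
    ((isOpen_lt (by fun_prop) (by fun_prop)).inter (isOpen_lt (by fun_prop) (by fun_prop)))

theorem isOpen_farRight (t : ℝ) : IsOpen (farRight t) := by
  simp only [farRight, Set.ofPred_and]
  exact (isOpen_lt (by fun_prop) (by fun_prop)).inter (isOpen_lt (by fun_prop) (by fun_prop))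

theorem contDiff_polarChar (γ ν₀ κ₀ ε : ℝ) :
    ContDiff ℝ ∞ (fun z : (ℝ × ℝ) × ℂ => polarChar γ ν₀ κ₀ ε z.1.1 z.1.2 z.2) := by
  have hs : ContDiff ℝ ∞ (fun z : (ℝ × ℝ) × ℂ => Real.sin z.1.2) :=
    Real.contDiff_sin.comp (by fun_prop)
  have hs' : ContDiff ℝ ∞ (fun z : (ℝ × ℝ) × ℂ => Real.sin (z.1.2 + γ)) :=
    Real.contDiff_sin.comp (by fun_prop)
  unfold polarChar charPoly
  fun_prop

section

variable {γ ν₀ κ₀ c B C ε : ℝ} {w : Set (ℝ × ℝ)}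

theorem LayerPoint.selects (hc : 0 < c) (hε : 0 < ε) {ρ θ : ℝ} (hρ : 0 < ρ) {x₁ x₂ x₃ : ℂ}
    (h : LayerPoint γ ν₀ κ₀ c B C ε ρ θ x₁ x₂ x₃) :
    (decay₁ γ ν₀ κ₀ c ε ρ θ ∈ quadrantOne (c * ε ^ (-(1 / 2) : ℝ)) ∧
      polarChar γ ν₀ κ₀ ε ρ θ (decay₁ γ ν₀ κ₀ c ε ρ θ) = 0 ∧
      ∀ y ∈ quadrantOne (c * ε ^ (-(1 / 2) : ℝ)), polarChar γ ν₀ κ₀ ε ρ θ y = 0 →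
        y = decay₁ γ ν₀ κ₀ c ε ρ θ) ∧
    (decay₂ γ ν₀ κ₀ c ε ρ θ ∈ quadrantFour (c * ε ^ (-(1 / 2) : ℝ)) ∧
      polarChar γ ν₀ κ₀ ε ρ θ (decay₂ γ ν₀ κ₀ c ε ρ θ) = 0 ∧
      ∀ y ∈ quadrantFour (c * ε ^ (-(1 / 2) : ℝ)), polarChar γ ν₀ κ₀ ε ρ θ y = 0 →
        y = decay₂ γ ν₀ κ₀ c ε ρ θ) ∧
    (decay₃ γ ν₀ κ₀ c ε ρ θ ∈ farRight (c * ε ^ (-(1 / 2) : ℝ)) ∧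
      polarChar γ ν₀ κ₀ ε ρ θ (decay₃ γ ν₀ κ₀ c ε ρ θ) = 0 ∧
      ∀ y ∈ farRight (c * ε ^ (-(1 / 2) : ℝ)), polarChar γ ν₀ κ₀ ε ρ θ y = 0 →
        y = decay₃ γ ν₀ κ₀ c ε ρ θ) := by
  obtain ⟨e1, e2, e3⟩ := h.decay_eq hc hε hρ
  obtain ⟨r1, r2, r3⟩ := h.regions hc hε hρ
  obtain ⟨u1, u2, u3⟩ := h.unique hc hε hρ
  obtain ⟨i1, i2, i3⟩ := h.isRoot
  rw [e1, e2, e3]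
  exact ⟨⟨r1, i1, u1⟩, ⟨r2, i2, u2⟩, ⟨r3, i3, u3⟩⟩

theorem contDiffOn_decay (hc : 0 < c) (hε : 0 < ε) (hw : ∀ z ∈ w, 0 < z.1 ∧
    ∃ x₁ x₂ x₃, LayerPoint γ ν₀ κ₀ c B C ε z.1 z.2 x₁ x₂ x₃) :
    ContDiffOn ℝ ∞ (fun z : ℝ × ℝ => decay₁ γ ν₀ κ₀ c ε z.1 z.2) w ∧
    ContDiffOn ℝ ∞ (fun z : ℝ × ℝ => decay₂ γ ν₀ κ₀ c ε z.1 z.2) w ∧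
    ContDiffOn ℝ ∞ (fun z : ℝ × ℝ => decay₃ γ ν₀ κ₀ c ε z.1 z.2) w := by
  have key : ∀ (S : Set ℂ) (g : ℝ × ℝ → ℂ), IsOpen S → (∀ z ∈ w, g z ∈ S ∧
      polarChar γ ν₀ κ₀ ε z.1 z.2 (g z) = 0 ∧
      ∀ y ∈ S, polarChar γ ν₀ κ₀ ε z.1 z.2 y = 0 → y = g z) → ContDiffOn ℝ ∞ g w := by
    intro S g hS hg
    refine contDiffOn_of_unique_root (contDiff_polarChar γ ν₀ κ₀ ε) hS
      (fun z hz => ⟨(hg z hz).1, (hg z hz).2.1⟩) (fun z hz => (hg z hz).2.2) fun z hz => ?_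
    obtain ⟨-, x₁, x₂, x₃, h⟩ := hw z hz
    exact h.simple _ (hg z hz).2.1
  refine ⟨key _ _ (isOpen_quadrantOne (c * ε ^ (-(1 / 2) : ℝ))) fun z hz => ?_,
    key _ _ (isOpen_quadrantFour (c * ε ^ (-(1 / 2) : ℝ))) fun z hz => ?_, key _ _ (isOpen_farRight (c * ε ^ (-(1 / 2) : ℝ))) fun z hz => ?_⟩
  all_goals obtain ⟨hρ, x₁, x₂, x₃, h⟩ := hw z hz
  · exact (h.selects hc hε hρ).1
  · exact (h.selects hc hε hρ).2.1
  · exact (h.selects hc hε hρ).2.2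

theorem LayerPoint.root_ne_zero (hc : 0 < c) {ρ θ : ℝ} {x₁ x₂ x₃ : ℂ}
    (h : LayerPoint γ ν₀ κ₀ c B C ε ρ θ x₁ x₂ x₃) : x₁ ≠ 0 ∧ x₂ ≠ 0 ∧ x₃ ≠ 0 := by
  refine ⟨?_, ?_, ?_⟩
  · rintro rfl; have := h.size₁.1; simp at this; linarith
  · rintro rfl; have := h.size₂.1; simp at this; linarith
  · rintro rfl; have := h.size₃.1; simp at this; linarith

theorem contDiffOn_layerAmp (hgap : 0 < criticalGap γ) (hc : 0 < c) (hε : 0 < ε)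
    (hw : ∀ z ∈ w, 0 < z.1 ∧ ∃ x₁ x₂ x₃, LayerPoint γ ν₀ κ₀ c B C ε z.1 z.2 x₁ x₂ x₃) :
    ContDiffOn ℝ ∞ (fun z : ℝ × ℝ => layerAmp₁ γ ν₀ κ₀ c ε z.1 z.2) w ∧
    ContDiffOn ℝ ∞ (fun z : ℝ × ℝ => layerAmp₂ γ ν₀ κ₀ c ε z.1 z.2) w ∧
    ContDiffOn ℝ ∞ (fun z : ℝ × ℝ => layerAmp₃ γ ν₀ κ₀ c ε z.1 z.2) w := by
  obtain ⟨s1, s2, s3⟩ := contDiffOn_decay hc hε hw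
  have hd : ContDiffOn ℝ ∞ (fun z : ℝ × ℝ => layerScale ε z.1) w :=
    contDiffOn_layerScale ε fun z hz => (hw z hz).1
  have hd0 : ∀ z ∈ w, (layerScale ε z.1 : ℂ) ≠ 0 := fun z hz => by
    exact_mod_cast (layerScale_pos hε (hw z hz).1).ne'
  have hdC : ContDiffOn ℝ ∞ (fun z : ℝ × ℝ => (layerScale ε z.1 : ℂ)) w := by fun_prop
  have hρ0 : ∀ z ∈ w, (z.1 : ℂ) ≠ 0 := fun z hz => by exact_mod_cast (hw z hz).1.ne'
  have hρs : ContDiffOn ℝ ∞ (fun z : ℝ × ℝ => (z.1 : ℂ)) w := by fun_prop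
  have hx₁ := contDiffOn_div (s1.mul (hdC.pow 2)) hρs hρ0
  have hx₂ := contDiffOn_div (s2.mul (hdC.pow 2)) hρs hρ0
  have hx₃ := contDiffOn_div (s3.mul (hdC.pow 3)) hρs hρ0
  have hΩ : ContDiffOn ℝ ∞ (fun z : ℝ × ℝ => Real.sin z.2) w :=
    (Real.contDiff_sin.comp (by fun_prop)).contDiffOn
  have hK : ContDiffOn ℝ ∞ (fun z : ℝ × ℝ => Real.sin (z.2 + γ)) w :=
    (Real.contDiff_sin.comp (by fun_prop)).contDiffOn
  have hm : ContDiffOn ℝ ∞ (fun z : ℝ × ℝ => Real.cos (z.2 + γ)) w :=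
    (Real.contDiff_cos.comp (by fun_prop)).contDiffOn
  have hall : ∀ z ∈ w, ∃ x₁ x₂ x₃, LayerPoint γ ν₀ κ₀ c B C ε z.1 z.2 x₁ x₂ x₃ ∧
      decay₁ γ ν₀ κ₀ c ε z.1 z.2 * layerScale ε z.1 ^ 2 / z.1 = x₁ ∧
      decay₂ γ ν₀ κ₀ c ε z.1 z.2 * layerScale ε z.1 ^ 2 / z.1 = x₂ ∧
      decay₃ γ ν₀ κ₀ c ε z.1 z.2 * layerScale ε z.1 ^ 3 / z.1 = x₃ := fun z hz => by
    obtain ⟨hρ, x₁, x₂, x₃, h⟩ := hw z hz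
    exact ⟨x₁, x₂, x₃, h, h.unscale hc hε hρ⟩
  have key := contDiffOn_amp (γ := γ) (κ₀ := κ₀) hd hΩ hK hm hx₁ hx₂ hx₃ ?_ ?_ ?_ ?_ ?_ ?_ ?_ ?_
  · obtain ⟨k1, k2, k3⟩ := key
    exact ⟨contDiffOn_div k1 (hdC.pow 2) fun z hz => pow_ne_zero 2 (hd0 z hz),
      contDiffOn_div k2 (hdC.pow 2) fun z hz => pow_ne_zero 2 (hd0 z hz),
      contDiffOn_div k3 (hdC.pow 1) fun z hz => pow_ne_zero 1 (hd0 z hz)⟩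
  all_goals
    intro z hz
    obtain ⟨x₁, x₂, x₃, h, e1, e2, e3⟩ := hall z hz
  · simpa only [e1] using h.denom₁
  · simpa only [e2] using h.denom₂
  · simpa only [e3] using h.denom₃
  · simpa only [e1, e2, e3] using h.det
  · exact (h.ne_zero hgap).2.2
  · simpa only [e1] using (h.root_ne_zero hc).1
  · simpa only [e2] using (h.root_ne_zero hc).2.1
  · simpa only [e3] using (h.root_ne_zero hc).2.2

end

/-! ### Smoothness and positivity of the limit profiles. -/

section

variable {γ ν₀ κ₀ : ℝ} {s : Set ℝ}

theorem contDiffOn_midProfile (hγ₀ : 0 < γ) (hγ₁ : γ < Real.pi / 2) (hs : 0 < κ₀ + ν₀)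
    (h : ∀ θ ∈ s, 0 < Real.sin θ * Real.sin (θ + γ)) :
    ContDiffOn ℝ ∞ (fun θ => midProfile γ ν₀ κ₀ (Real.sin θ) (Real.sin (θ + γ))) s := by
  have hK : ContDiffOn ℝ ∞ (fun θ : ℝ => Real.sin (θ + γ)) s :=
    (Real.contDiff_sin.comp (by fun_prop)).contDiffOn
  have hΩ : ContDiffOn ℝ ∞ (fun θ : ℝ => Real.sin θ) s := Real.contDiff_sin.contDiffOn
  have h1 : ContDiffOn ℝ ∞ (fun θ : ℝ => 2 * Real.sin (θ + γ) * Real.sin γ * Real.cos γ /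
      (Real.sin θ * (κ₀ + ν₀))) s := by
    refine ContDiffOn.div (by fun_prop) (by fun_prop) fun θ hθ => mul_ne_zero ?_ hs.ne'
    exact left_ne_zero_of_mul (h θ hθ).ne'
  have h2 := h1.rpow_const_of_ne (p := 1 / 3)
    fun θ hθ => (cubic_const_pos hγ₀ hγ₁ hs (h θ hθ)).ne'
  unfold midProfile
  fun_prop

theorem contDiffOn_largeProfile (hν : 0 < ν₀) (hκ : 0 < κ₀) (h : ∀ θ ∈ s, Real.sin θ ≠ 0) :
    ContDiffOn ℝ ∞ (fun θ => largeProfile ν₀ κ₀ (Real.sin θ)) s := by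
  have hΩ : ContDiffOn ℝ ∞ (fun θ : ℝ => Real.sin θ * (κ₀ + ν₀) / (κ₀ * ν₀)) s :=
    ((Real.contDiff_sin.mul contDiff_const).div_const _).contDiffOn
  have h0 : ∀ θ ∈ s, Real.sin θ * (κ₀ + ν₀) / (κ₀ * ν₀) ≠ 0 := fun θ hθ =>
    div_ne_zero (mul_ne_zero (h θ hθ) (by positivity)) (by positivity)
  have habs := hΩ.abs h0
  have h1 := (habs.div_const 2).sqrt
    fun θ hθ => (half_pos (abs_pos.2 (h0 θ hθ))).ne'
  have h2 := hΩ.div habs fun θ hθ => (abs_pos.2 (h0 θ hθ)).ne'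
  exact (contDiffOn_ofReal_comp h1).mul
    (contDiffOn_const.sub (contDiffOn_const.mul (contDiffOn_ofReal_comp h2)))

theorem midProfile_re_pos (hγ₀ : 0 < γ) (hγ₁ : γ < Real.pi / 2) (hs : 0 < κ₀ + ν₀) {θ : ℝ}
    (h : 0 < Real.sin θ * Real.sin (θ + γ)) :
    0 < (midProfile γ ν₀ κ₀ (Real.sin θ) (Real.sin (θ + γ))).re :=
  (midProfile_re_im (cubic_const_pos hγ₀ hγ₁ hs h)).1

end

/-! ### The limit of the decays -/

/-- One fixed σ works for all small ε: it satisfies σρ ≤ R, and ε^μ drops below it. -/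
theorem exists_admissible_window {γ η μ R ε₀ ρ θ : ℝ} (hη : 0 < η) (hμ : 0 < μ) (hR : 0 < R)
    (hε₀ : 0 < ε₀) (hρ : η ≤ ρ) (hθ : ∀ᶠ ε in 𝓝[>] (0 : ℝ), θ ∈ angularWindow γ R ε) :
    ∃ σ, ∀ᶠ ε in 𝓝[>] (0 : ℝ), Admissible μ ε₀ ε σ ∧ (ρ, θ) ∈ window γ η R ε σ := by
  have hρ0 : 0 < ρ := hη.trans_le hρ
  have hσ : 0 < min (1 / 2) (R / ρ) := by positivity
  refine ⟨min (1 / 2) (R / ρ), ?_⟩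
  have h1 := (tendsto_const_mul_rpow 1 hμ).eventually_lt_const hσ
  have h2 : ∀ᶠ ε in 𝓝[>] (0 : ℝ), ε ∈ Ioo 0 ε₀ := Ioo_mem_nhdsGT hε₀
  filter_upwards [h1, h2, hθ] with ε h1 h2 h3
  refine ⟨⟨h2.1, h2.2, by simpa using h1, (min_le_left _ _).trans_lt (by norm_num)⟩, hρ, ?_, h3⟩
  calc min (1 / 2) (R / ρ) * ρ ≤ R / ρ * ρ := by gcongr; exact min_le_right _ _
    _ = R := by field_simp

/-- An angle that stays in windows of width O(ε^{1/3}) is exactly critical, so ζ drops out of the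
pointwise limits of the decays. -/
theorem critical_of_eventually {γ R ε₀ θ : ℝ} (hε₀ : 0 < ε₀)
    (hsm : ∀ ε, 0 < ε → ε < ε₀ → 3 * (R * ε ^ (1 / 3 : ℝ)) ≤ criticalGap γ)
    (hθ : ∀ᶠ ε in 𝓝[>] (0 : ℝ), θ ∈ angularWindow γ R ε) :
    |Real.sin θ ^ 2 - Real.sin γ ^ 2| = 0 := by
  have h2 : ∀ᶠ ε in 𝓝[>] (0 : ℝ), ε ∈ Ioo 0 ε₀ := Ioo_mem_nhdsGT hε₀
  refine le_antisymm (ge_of_tendsto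
    (tendsto_const_mul_rpow (2 * R) (by norm_num : (0 : ℝ) < 1 / 3)) ?_) (abs_nonneg _)
  filter_upwards [h2, hθ] with ε h2 h3
  have := (angularWindow_near h3 (hsm ε h2.1 h2.2)).2.2.2
  linarith

theorem tendsto_rescaled {α ρ A : ℝ} {lam : ℝ → ℂ} {r : ℝ} {ℓ : ℂ} (hα : 0 < α)
    (h : ∀ᶠ ε in 𝓝[>] (0 : ℝ), ‖lam ε - ((ε ^ (-α) * r : ℝ) : ℂ) * ℓ‖ ≤ A * ρ) :
    Tendsto (fun ε : ℝ => ((ε ^ α : ℝ) : ℂ) * lam ε) (𝓝[>] 0) (𝓝 ((r : ℂ) * ℓ)) := by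
  rw [tendsto_iff_norm_sub_tendsto_zero]
  refine squeeze_zero' (Eventually.of_forall fun _ => norm_nonneg _) ?_
    (tendsto_const_mul_rpow (A * ρ) hα)
  filter_upwards [h, self_mem_nhdsWithin] with ε h hε
  have hε : 0 < ε := hε
  have e1 : ε ^ α * ε ^ (-α) = 1 := by rw [← Real.rpow_add hε]; simp
  have e2 : ((ε ^ α : ℝ) : ℂ) * lam ε - (r : ℂ) * ℓ =
      ((ε ^ α : ℝ) : ℂ) * (lam ε - ((ε ^ (-α) * r : ℝ) : ℂ) * ℓ) := by
    rw [mul_sub, ← mul_assoc, ← Complex.ofReal_mul, ← mul_assoc, e1, one_mul]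
  rw [e2, norm_mul, Complex.norm_real, Real.norm_eq_abs, abs_of_nonneg (by positivity),
    mul_comm (A * ρ)]
  gcongr

/-- The two terms are at most 2R ε^{1/3 − 1/2} and R ε^{-1/8}, and both are absorbed by ε^{-1/6}. -/
theorem large_remainder_le {γ η μ R ε₀ ε σ ρ θ B : ℝ} (hμ : μ < 1 / 8) (hR : 0 < R) (hε₀ : ε₀ ≤ 1)
    (hB : 0 ≤ B) (hsm : 3 * (R * ε ^ (1 / 3 : ℝ)) ≤ criticalGap γ)
    (ha : Admissible μ ε₀ ε σ) (hw : (ρ, θ) ∈ window γ η R ε σ) :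
    B * (|Real.sin θ ^ 2 - Real.sin γ ^ 2| * ε ^ (-(1 / 2) : ℝ) + ρ) ≤
      B * (3 * R) * ε ^ (-(1 / 6) : ℝ) := by
  have hε := ha.1
  have h1 := (angularWindow_near hw.2.2 hsm).2.2.2
  have h2 := window_rho_le hμ hR hε₀ ha hw
  have h3 : ε ^ (-(1 / 8) : ℝ) ≤ ε ^ (-(1 / 6) : ℝ) :=
    Real.rpow_le_rpow_of_exponent_ge hε (ha.2.1.le.trans hε₀) (by norm_num)
  have h4 : ε ^ (1 / 3 : ℝ) * ε ^ (-(1 / 2) : ℝ) = ε ^ (-(1 / 6) : ℝ) := by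
    rw [← Real.rpow_add hε]; norm_num
  rw [mul_assoc B]
  gcongr
  calc |Real.sin θ ^ 2 - Real.sin γ ^ 2| * ε ^ (-(1 / 2) : ℝ) + ρ
      ≤ 2 * (R * ε ^ (1 / 3 : ℝ)) * ε ^ (-(1 / 2) : ℝ) + R * ε ^ (-(1 / 6) : ℝ) := by
        gcongr
        exact h2.trans (by gcongr)
    _ = 2 * R * (ε ^ (1 / 3 : ℝ) * ε ^ (-(1 / 2) : ℝ)) + R * ε ^ (-(1 / 6) : ℝ) := by ring
    _ = 3 * R * ε ^ (-(1 / 6) : ℝ) := by rw [h4]; ring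

/-! ### The symbol of the linear system -/

/-- The symbol of the momentum and buoyancy equations on `X exp (-i Ω t + i k x + Y y)`. -/
def beamSymbol (γ ν₀ κ₀ ε Ω k : ℝ) (Y : ℂ) (X : Fin 4 → ℂ) : Fin 3 → ℂ :=
  ![-Complex.I * Ω * X 0 - X 2 * Real.sin γ + Complex.I * k * X 3
      - ν₀ * ε * ((Complex.I * k) ^ 2 * X 0 + Y ^ 2 * X 0),
    -Complex.I * Ω * X 1 - X 2 * Real.cos γ + Y * X 3
      - ν₀ * ε * ((Complex.I * k) ^ 2 * X 1 + Y ^ 2 * X 1),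
    -Complex.I * Ω * X 2 + X 0 * Real.sin γ + X 1 * Real.cos γ
      - κ₀ * ε * ((Complex.I * k) ^ 2 * X 2 + Y ^ 2 * X 2)]

theorem beamSymbol_smul (γ ν₀ κ₀ ε Ω k : ℝ) (Y b : ℂ) (X : Fin 4 → ℂ) :
    beamSymbol γ ν₀ κ₀ ε Ω k Y (fun i => b * X i) =
      fun i => b * beamSymbol γ ν₀ κ₀ ε Ω k Y X i := by
  funext i
  fin_cases i <;> simp [beamSymbol] <;> ring

/-- The divergence, buoyancy and first momentum equations define the components w, b and p
successively from u = 1. Only the second momentum equation uses that the decay is a root. -/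
theorem layerVector_kernel {γ ν₀ κ₀ ε Ω k : ℝ} {lam : ℂ} (hk : k ≠ 0) (hl : lam ≠ 0)
    (hden : Complex.I * Ω - ε * κ₀ * (k ^ 2 - lam ^ 2) ≠ 0)
    (hP : charPoly γ ν₀ κ₀ ε Ω k lam = 0) :
    beamSymbol γ ν₀ κ₀ ε Ω k (-lam) (layerVector γ ν₀ κ₀ ε Ω k lam) = 0 ∧
    Complex.I * k * layerVector γ ν₀ κ₀ ε Ω k lam 0 +
      -lam * layerVector γ ν₀ κ₀ ε Ω k lam 1 = 0 := by
  have hk' : (k : ℂ) ≠ 0 := by exact_mod_cast hk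
  have hI := Complex.I_ne_zero
  have hQ : Complex.I * Ω + ε * κ₀ * (lam ^ 2 - k ^ 2) =
      Complex.I * Ω - ε * κ₀ * (k ^ 2 - lam ^ 2) := by ring
  set Q := Complex.I * Ω - ε * κ₀ * (k ^ 2 - lam ^ 2) with hQd
  have e0 : layerVector γ ν₀ κ₀ ε Ω k lam 0 = 1 := rfl
  have e1 : layerVector γ ν₀ κ₀ ε Ω k lam 1 = Complex.I * k / lam := rfl
  have e2 : layerVector γ ν₀ κ₀ ε Ω k lam 2 =
      (lam * Real.sin γ + Complex.I * k * Real.cos γ) / (lam * Q) := rfl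
  have e3 : layerVector γ ν₀ κ₀ ε Ω k lam 3 =
      1 / (Complex.I * k) * (Complex.I * Ω + ε * ν₀ * (lam ^ 2 - k ^ 2) +
      Real.sin γ * ((Real.sin γ + Complex.I * k * lam⁻¹ * Real.cos γ) / Q)) := by
    rw [← hQ]; rfl
  have hI2 := Complex.I_sq
  have e3' : Complex.I * k * layerVector γ ν₀ κ₀ ε Ω k lam 3 =
      Complex.I * Ω + ε * ν₀ * (lam ^ 2 - k ^ 2) +
      Real.sin γ * ((Real.sin γ + Complex.I * k * lam⁻¹ * Real.cos γ) / Q) := by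
    rw [e3, ← mul_assoc, mul_one_div_cancel (mul_ne_zero hI hk'), one_mul]
  rw [charPoly] at hP
  refine ⟨?_, ?_⟩
  · unfold beamSymbol
    generalize layerVector γ ν₀ κ₀ ε Ω k lam = X at *
    generalize (Real.sin γ : ℂ) = s at *
    generalize (Real.cos γ : ℂ) = c at *
    funext i
    fin_cases i
    · change -Complex.I * Ω * X 0 - X 2 * s + Complex.I * k * X 3
        - ν₀ * ε * ((Complex.I * k) ^ 2 * X 0 + (-lam) ^ 2 * X 0) = 0
      rw [e0, e2, e3']
      field_simp
      linear_combination (-ν₀ * ε * k ^ 2 * lam * Q) * hI2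
    · change -Complex.I * Ω * X 1 - X 2 * c + -lam * X 3
        - ν₀ * ε * ((Complex.I * k) ^ 2 * X 1 + (-lam) ^ 2 * X 1) = 0
      have h : Complex.I * k * lam * Q * (-Complex.I * Ω * X 1 - X 2 * c + -lam * X 3
        - ν₀ * ε * ((Complex.I * k) ^ 2 * X 1 + (-lam) ^ 2 * X 1)) =
          -Complex.I * k * lam * Q * (Complex.I * Ω + ν₀ * ε * (lam ^ 2 - k ^ 2)) * X 1
          - Complex.I * k * lam * Q * c * X 2 - lam ^ 2 * Q * (Complex.I * k * X 3) := by
        linear_combination (-ν₀ * ε * k ^ 2 * X 1 * Complex.I * k * lam * Q) * hI2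
      have h' : Complex.I * k * lam * Q ≠ 0 :=
        mul_ne_zero (mul_ne_zero (mul_ne_zero hI hk') hl) hden
      refine (mul_eq_zero.1 ?_).resolve_left h'
      rw [h, e1, e2, e3']
      field_simp
      rw [hQd]
      linear_combination hP - (k ^ 2 * (Complex.I * Ω - ε * κ₀ * (k ^ 2 - lam ^ 2)) *
        (Complex.I * Ω + ν₀ * ε * (lam ^ 2 - k ^ 2)) + (lam ^ 2 - k ^ 2) * Ω ^ 2
          + k ^ 2 * c ^ 2) * hI2
    · change -Complex.I * Ω * X 2 + X 0 * s + X 1 * c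
        - κ₀ * ε * ((Complex.I * k) ^ 2 * X 2 + (-lam) ^ 2 * X 2) = 0
      rw [e0, e1, e2]
      field_simp
      rw [hQd]
      linear_combination (-κ₀ * ε * k ^ 2 * (lam * s + Complex.I * k * c)) * hI2
  · rw [e0, e1]
    field_simp
    ring

/-- The plane wave solves the inviscid equations, and minus the Laplacian multiplies it by k² + m² =
ρ²; that is all that is left. -/
theorem incidentVector_symbol {γ ν₀ κ₀ ε ρ θ : ℝ} (hρ : ρ ≠ 0) (hΩ : Real.sin θ ≠ 0)
    (hK : Real.sin (θ + γ) ≠ 0) (hm : Real.cos (θ + γ) ≠ 0)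
    (ho : omega γ (waveK γ ρ θ) (waveM γ ρ θ) = Real.sin θ) :
    let X := incidentVector γ (waveK γ ρ θ) (waveM γ ρ θ)
    (X 0 = 1 ∧ X 1 = -(Real.sin (θ + γ) : ℂ) / Real.cos (θ + γ) ∧
      X 2 = Complex.I / Real.cos (θ + γ)) ∧
    beamSymbol γ ν₀ κ₀ ε (Real.sin θ) (waveK γ ρ θ) (Complex.I * waveM γ ρ θ) X =
      ![ν₀ * ε * ρ ^ 2 * X 0, ν₀ * ε * ρ ^ 2 * X 1, κ₀ * ε * ρ ^ 2 * X 2] ∧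
    Complex.I * waveK γ ρ θ * X 0 + Complex.I * waveM γ ρ θ * X 1 = 0 := by
  intro X
  have hI := Complex.I_ne_zero
  have hI2 := Complex.I_sq
  have hρ' : (ρ : ℂ) ≠ 0 := by exact_mod_cast hρ
  have hΩ' : (Real.sin θ : ℂ) ≠ 0 := by exact_mod_cast hΩ
  have hK' : (Real.sin (θ + γ) : ℂ) ≠ 0 := by exact_mod_cast hK
  have hm' : (Real.cos (θ + γ) : ℂ) ≠ 0 := by exact_mod_cast hm
  have hs : (Real.sin (θ + γ) : ℂ) ^ 2 + (Real.cos (θ + γ) : ℂ) ^ 2 = 1 := by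
    exact_mod_cast Real.sin_sq_add_cos_sq (θ + γ)
  have hd : (Real.sin θ : ℂ) = (Real.sin (θ + γ) : ℂ) * Real.cos γ
      - Real.cos (θ + γ) * Real.sin γ := by
    have : Real.sin θ = Real.sin (θ + γ) * Real.cos γ - Real.cos (θ + γ) * Real.sin γ := by
      rw [← Real.sin_sub]; congr 1; ring
    exact_mod_cast this
  have hkm : (waveK γ ρ θ : ℂ) * Real.cos γ - waveM γ ρ θ * Real.sin γ = ρ * Real.sin θ := by
    rw [hd, waveK, waveM]; push_cast; ring
  have e0 : X 0 = 1 := rfl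
  have e1 : X 1 = -(Real.sin (θ + γ) : ℂ) / Real.cos (θ + γ) := by
    have : X 1 = -(waveK γ ρ θ : ℂ) / waveM γ ρ θ := rfl
    rw [this, waveK, waveM, Complex.ofReal_mul, Complex.ofReal_mul]
    field_simp
  have e2 : X 2 = Complex.I / Real.cos (θ + γ) := by
    have : X 2 = Complex.I * (waveK γ ρ θ * Real.cos γ - waveM γ ρ θ * Real.sin γ) /
      (waveM γ ρ θ * omega γ (waveK γ ρ θ) (waveM γ ρ θ)) := rfl
    rw [this, hkm, ho, waveM, Complex.ofReal_mul]
    field_simp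
  have e3 : X 3 = 1 / (ρ * Real.sin (θ + γ)) * (Real.sin θ + Real.sin γ / Real.cos (θ + γ)) := by
    have : X 3 = 1 / (waveK γ ρ θ : ℂ) * (omega γ (waveK γ ρ θ) (waveM γ ρ θ) +
      Real.sin γ * ((waveK γ ρ θ * Real.cos γ - waveM γ ρ θ * Real.sin γ) /
        (waveM γ ρ θ * omega γ (waveK γ ρ θ) (waveM γ ρ θ)))) := rfl
    rw [this, hkm, ho, waveM, waveK, Complex.ofReal_mul, Complex.ofReal_mul]
    field_simp
  refine ⟨⟨e0, e1, e2⟩, ?_, ?_⟩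
  · simp only [beamSymbol, waveK, waveM, Complex.ofReal_mul]
    clear_value X
    generalize (Real.sin γ : ℂ) = s at *
    generalize (Real.cos γ : ℂ) = c at *
    generalize (Real.sin (θ + γ) : ℂ) = K at *
    generalize (Real.cos (θ + γ) : ℂ) = m at *
    funext i
    fin_cases i
    · change -Complex.I * Real.sin θ * X 0 - X 2 * s + Complex.I * (ρ * K) * X 3
        - ν₀ * ε * ((Complex.I * (ρ * K)) ^ 2 * X 0 + (Complex.I * (ρ * m)) ^ 2 * X 0) =
        ν₀ * ε * ρ ^ 2 * X 0
      rw [e0, e2, e3, hd]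
      field_simp
      linear_combination (-(m * ρ ^ 2 * ν₀ * ε)) * hI2 + (-Complex.I ^ 2 * (m * ρ ^ 2 * ν₀ * ε)) * hs
    · change -Complex.I * Real.sin θ * X 1 - X 2 * c + Complex.I * (ρ * m) * X 3
        - ν₀ * ε * ((Complex.I * (ρ * K)) ^ 2 * X 1 + (Complex.I * (ρ * m)) ^ 2 * X 1) =
        ν₀ * ε * ρ ^ 2 * X 1
      rw [e1, e2, e3, hd]
      field_simp
      linear_combination (K ^ 2 * ρ ^ 2 * ν₀ * ε) * hI2 +
        (Complex.I ^ 2 * (K ^ 2 * ρ ^ 2 * ν₀ * ε) + Complex.I * (K * c - m * s)) * hs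
    · change -Complex.I * Real.sin θ * X 2 + X 0 * s + X 1 * c
        - κ₀ * ε * ((Complex.I * (ρ * K)) ^ 2 * X 2 + (Complex.I * (ρ * m)) ^ 2 * X 2) =
        κ₀ * ε * ρ ^ 2 * X 2
      rw [e0, e1, e2, hd]
      field_simp
      linear_combination (-(K * c - m * s) - Complex.I * (κ₀ * ε * ρ ^ 2)) * hI2
        + (-Complex.I ^ 3 * (κ₀ * ε * ρ ^ 2)) * hs
  · rw [e0, e1, waveK, waveM, Complex.ofReal_mul, Complex.ofReal_mul]
    field_simp
    ring

/-! ### Superpositions of exponentials over a compact set of wavenumbers -/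

section

variable {Z V G : Type} [TopologicalSpace Z]
  [NormedAddCommGroup V] [NormedSpace ℝ V] [NormedAddCommGroup G] [NormedSpace ℂ G]
  {w : Set Z} {L : Z → V →L[ℝ] ℂ} {A : Z → G}

/-- The derivative of `v ↦ exp (L z v) • A z` at the origin. -/
def phaseDeriv (L : Z → V →L[ℝ] ℂ) (A : Z → G) (z : Z) : V →L[ℝ] G :=
  ((ContinuousLinearMap.lsmul ℝ ℂ).flip (A z)).comp (L z)

theorem continuousOn_phaseDeriv (hL : ContinuousOn L w) (hA : ContinuousOn A w) :
    ContinuousOn (phaseDeriv L A) w :=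
  ((ContinuousLinearMap.lsmul ℝ ℂ).flip.continuous.comp_continuousOn hA).clm_comp hL

theorem continuousOn_exp_smul (hL : ContinuousOn L w) (hA : ContinuousOn A w) (v : V) :
    ContinuousOn (fun z => Complex.exp (L z v) • A z) w :=
  (Complex.continuous_exp.comp_continuousOn (hL.clm_apply continuousOn_const)).smul hA

variable [MeasurableSpace Z] [OpensMeasurableSpace Z] [T2Space Z]
  {ν : Measure Z} [IsFiniteMeasureOnCompacts ν]

/-- Differentiation under the integral, dominated on the unit ball around v by a function continuous
on the compact set w. -/
theorem hasFDerivAt_superposition (hw : IsCompact w) (hL : ContinuousOn L w)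
    (hA : ContinuousOn A w) (v : V) :
    HasFDerivAt (fun v => ∫ z in w, Complex.exp (L z v) • A z ∂ν)
      (∫ z in w, Complex.exp (L z v) • phaseDeriv L A z ∂ν) v := by
  have hA' := continuousOn_phaseDeriv hL hA
  have hint : ∀ v, IntegrableOn (fun z => Complex.exp (L z v) • A z) w ν := fun v =>
    (continuousOn_exp_smul hL hA v).integrableOn_compact hw
  have hint' : ∀ v, IntegrableOn (fun z => Complex.exp (L z v) • phaseDeriv L A z) w ν := fun v =>
    (continuousOn_exp_smul hL hA' v).integrableOn_compact hw
  refine hasFDerivAt_integral_of_dominated_of_fderiv_le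
    (F' := fun v z => Complex.exp (L z v) • phaseDeriv L A z)
    (bound := fun z => Real.exp (‖L z‖ * (‖v‖ + 1)) * ‖phaseDeriv L A z‖)
    (Metric.ball_mem_nhds v one_pos) (Eventually.of_forall fun v => (hint v).aestronglyMeasurable)
    (hint v) (hint' v).aestronglyMeasurable ?_ ?_ ?_
  · refine Eventually.of_forall fun z x hx => ?_
    rw [norm_smul, Complex.norm_exp]
    gcongr
    calc (L z x).re ≤ ‖L z x‖ := Complex.re_le_norm _
      _ ≤ ‖L z‖ * ‖x‖ := (L z).le_opNorm x
      _ ≤ ‖L z‖ * (‖v‖ + 1) := by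
        gcongr
        have h1 : ‖x - v‖ < 1 := by simpa [dist_eq_norm] using hx
        have h2 := norm_add_le v (x - v)
        rw [add_sub_cancel] at h2
        linarith
  · refine ContinuousOn.integrableOn_compact hw ?_
    exact (Real.continuous_exp.comp_continuousOn (hL.norm.mul continuousOn_const)).mul hA'.norm
  · refine Eventually.of_forall fun z x _ => ?_
    have h1 : HasFDerivAt (fun x => Complex.exp (L z x)) (Complex.exp (L z x) • L z) x :=
      ((L z).hasFDerivAt).cexp
    convert h1.smul_const (A z) using 1
    ext u
    simp [phaseDeriv, smul_smul]

/-- The derivative is again a superposition, with an operator-valued amplitude; the induction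
therefore runs over all target spaces at once. -/
theorem contDiff_superposition (hw : IsCompact w) (hL : ContinuousOn L w) (n : ℕ) :
    ∀ {G : Type} [NormedAddCommGroup G] [NormedSpace ℂ G] {A : Z → G}, ContinuousOn A w →
      ContDiff ℝ n (fun v => ∫ z in w, Complex.exp (L z v) • A z ∂ν) := by
  induction n with
  | zero =>
    intro G _ _ A hA
    refine contDiff_zero.2 (continuous_iff_continuousAt.2 fun v => ?_)
    exact (hasFDerivAt_superposition hw hL hA v).continuousAt
  | succ n ih =>
    intro G _ _ A hA
    refine contDiff_succ_iff_hasFDerivAt.2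
      ⟨_, ih (continuousOn_phaseDeriv hL hA), hasFDerivAt_superposition hw hL hA⟩

theorem hasDerivAt_superposition (hw : IsCompact w) (hL : ContinuousOn L w) {A : Z → ℂ}
    (hA : ContinuousOn A w) {c : ℝ → V} {e : V} {s : ℝ} (hc : HasDerivAt c e s) :
    HasDerivAt (fun s => ∫ z in w, Complex.exp (L z (c s)) * A z ∂ν)
      (∫ z in w, Complex.exp (L z (c s)) * (L z e * A z) ∂ν) s := by
  have h := (hasFDerivAt_superposition (ν := ν) hw hL hA (c s)).comp_hasDerivAt s hc
  refine h.congr_deriv ?_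
  rw [ContinuousLinearMap.integral_apply
    ((continuousOn_exp_smul hL (continuousOn_phaseDeriv hL hA) (c s)).integrableOn_compact hw)]
  refine integral_congr_ae (Eventually.of_forall fun z => ?_)
  simp [phaseDeriv]

end

/-! ### Beams -/

/-- The phase of a beam wave with vertical exponent `Y`. -/
def beamPhase (γ : ℝ) (Y : ℝ × ℝ → ℂ) (z : ℝ × ℝ) : ℝ × ℝ × ℝ →L[ℝ] ℂ :=
  (-Complex.I * Real.sin z.2 : ℂ) • Complex.ofRealCLM.comp (.fst ℝ ℝ (ℝ × ℝ)) +
    ((Complex.I * waveK γ z.1 z.2 : ℂ) • Complex.ofRealCLM.comp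
      ((ContinuousLinearMap.fst ℝ ℝ ℝ).comp (.snd ℝ ℝ (ℝ × ℝ))) +
    Y z • Complex.ofRealCLM.comp ((ContinuousLinearMap.snd ℝ ℝ ℝ).comp (.snd ℝ ℝ (ℝ × ℝ))))

theorem beamPhase_apply (γ : ℝ) (Y : ℝ × ℝ → ℂ) (z : ℝ × ℝ) (t x y : ℝ) :
    beamPhase γ Y z (t, x, y) =
      -Complex.I * Real.sin z.2 * t + Complex.I * waveK γ z.1 z.2 * x + Y z * y := by
  simp [beamPhase, add_assoc]

/-- Superposition of beam waves with wavenumbers in `w`. -/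
def beamIntegral (γ : ℝ) (w : Set (ℝ × ℝ)) (Y A : ℝ × ℝ → ℂ) (t x y : ℝ) : ℂ :=
  ∫ z in w, Complex.exp (beamPhase γ Y z (t, x, y)) * A z

section

variable {γ : ℝ} {w : Set (ℝ × ℝ)} {Y A A' : ℝ × ℝ → ℂ}

theorem continuous_waveK (γ : ℝ) : Continuous fun z : ℝ × ℝ => waveK γ z.1 z.2 := by
  unfold waveK
  fun_prop

theorem continuous_waveM (γ : ℝ) : Continuous fun z : ℝ × ℝ => waveM γ z.1 z.2 := by
  unfold waveM
  fun_prop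

theorem continuousOn_beamPhase (hY : ContinuousOn Y w) : ContinuousOn (beamPhase γ Y) w := by
  have h1 : Continuous fun z : ℝ × ℝ => (-Complex.I * Real.sin z.2 : ℂ) := by fun_prop
  have h2 : Continuous fun z : ℝ × ℝ => (Complex.I * waveK γ z.1 z.2 : ℂ) :=
    continuous_const.mul (Complex.continuous_ofReal.comp (continuous_waveK γ))
  exact (h1.continuousOn.smul continuousOn_const).add
    ((h2.continuousOn.smul continuousOn_const).add (hY.smul continuousOn_const))

theorem contDiff_beamIntegral (hw : IsCompact w) (hY : ContinuousOn Y w) (hA : ContinuousOn A w)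
    (n : ℕ) : ContDiff ℝ n (fun z : ℝ × ℝ × ℝ => beamIntegral γ w Y A z.1 z.2.1 z.2.2) :=
  contDiff_superposition hw (continuousOn_beamPhase hY) n hA

theorem hasDerivAt_beamIntegral_t (hw : IsCompact w) (hY : ContinuousOn Y w)
    (hA : ContinuousOn A w) (t x y : ℝ) : HasDerivAt (fun s => beamIntegral γ w Y A s x y)
      (beamIntegral γ w Y (fun z => -Complex.I * Real.sin z.2 * A z) t x y) t := by
  have hc : HasDerivAt (fun s : ℝ => (s, x, y)) (1, 0, 0) t :=
    (hasDerivAt_id t).prodMk (hasDerivAt_const t (x, y))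
  have h := hasDerivAt_superposition (ν := volume) hw (continuousOn_beamPhase (γ := γ) hY) hA hc
  refine h.congr_deriv ?_
  simp [beamIntegral, beamPhase_apply]

theorem hasDerivAt_beamIntegral_x (hw : IsCompact w) (hY : ContinuousOn Y w)
    (hA : ContinuousOn A w) (t x y : ℝ) : HasDerivAt (fun s => beamIntegral γ w Y A t s y)
      (beamIntegral γ w Y (fun z => Complex.I * waveK γ z.1 z.2 * A z) t x y) x := by
  have hc : HasDerivAt (fun s : ℝ => (t, s, y)) (0, 1, 0) x :=
    (hasDerivAt_const x t).prodMk ((hasDerivAt_id x).prodMk (hasDerivAt_const x y))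
  have h := hasDerivAt_superposition (ν := volume) hw (continuousOn_beamPhase (γ := γ) hY) hA hc
  refine h.congr_deriv ?_
  simp [beamIntegral, beamPhase_apply]

theorem hasDerivAt_beamIntegral_y (hw : IsCompact w) (hY : ContinuousOn Y w)
    (hA : ContinuousOn A w) (t x y : ℝ) : HasDerivAt (fun s => beamIntegral γ w Y A t x s)
      (beamIntegral γ w Y (fun z => Y z * A z) t x y) y := by
  have hc : HasDerivAt (fun s : ℝ => (t, x, s)) (0, 0, 1) y :=
    (hasDerivAt_const y t).prodMk ((hasDerivAt_const y x).prodMk (hasDerivAt_id y))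
  have h := hasDerivAt_superposition (ν := volume) hw (continuousOn_beamPhase (γ := γ) hY) hA hc
  refine h.congr_deriv ?_
  simp [beamIntegral, beamPhase_apply]

theorem integrableOn_beam (hw : IsCompact w) (hY : ContinuousOn Y w) (hA : ContinuousOn A w)
    (t x y : ℝ) :
    IntegrableOn (fun z => Complex.exp (beamPhase γ Y z (t, x, y)) * A z) w :=
  (continuousOn_exp_smul (continuousOn_beamPhase hY) hA (t, x, y)).integrableOn_compact hw

theorem beamIntegral_add (hw : IsCompact w) (hY : ContinuousOn Y w) (hA : ContinuousOn A w)
    (hA' : ContinuousOn A' w) (t x y : ℝ) : beamIntegral γ w Y (fun z => A z + A' z) t x y =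
      beamIntegral γ w Y A t x y + beamIntegral γ w Y A' t x y := by
  unfold beamIntegral
  rw [← integral_add (integrableOn_beam hw hY hA t x y) (integrableOn_beam hw hY hA' t x y)]
  simp only [mul_add]

theorem beamIntegral_const_mul (c : ℂ) (t x y : ℝ) :
    beamIntegral γ w Y (fun z => c * A z) t x y = c * beamIntegral γ w Y A t x y := by
  unfold beamIntegral
  rw [← integral_const_mul]
  simp only [mul_left_comm]

theorem beamIntegral_add_four {A₁ A₂ A₃ A₄ : ℝ × ℝ → ℂ} (hw : IsCompact w) (hY : ContinuousOn Y w)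
    (c₁ c₂ c₃ c₄ : ℂ) (t x y : ℝ) (h₁ : ContinuousOn A₁ w) (h₂ : ContinuousOn A₂ w)
    (h₃ : ContinuousOn A₃ w) (h₄ : ContinuousOn A₄ w) :
    c₁ * beamIntegral γ w Y A₁ t x y + c₂ * beamIntegral γ w Y A₂ t x y
      + c₃ * beamIntegral γ w Y A₃ t x y + c₄ * beamIntegral γ w Y A₄ t x y =
      beamIntegral γ w Y (fun z => c₁ * A₁ z + c₂ * A₂ z + c₃ * A₃ z + c₄ * A₄ z) t x y := by
  have m : ∀ {A : ℝ × ℝ → ℂ} (c : ℂ), ContinuousOn A w → ContinuousOn (fun z => c * A z) w :=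
    fun c h => continuousOn_const.mul h
  simp only [← beamIntegral_const_mul]
  have h12 : ContinuousOn (fun z => c₁ * A₁ z + c₂ * A₂ z) w := (m c₁ h₁).add (m c₂ h₂)
  have h123 : ContinuousOn (fun z => c₁ * A₁ z + c₂ * A₂ z + c₃ * A₃ z) w := h12.add (m c₃ h₃)
  rw [beamIntegral_add hw hY h123 (m c₄ h₄), beamIntegral_add hw hY h12 (m c₃ h₃),
    beamIntegral_add hw hY (m c₁ h₁) (m c₂ h₂)]

theorem beamIntegral_congr (hw : MeasurableSet w) (h : ∀ z ∈ w, A z = A' z) (t x y : ℝ) :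
    beamIntegral γ w Y A t x y = beamIntegral γ w Y A' t x y :=
  setIntegral_congr_fun hw fun z hz => by simp only [h z hz]

theorem beamIntegral_zero (hw : MeasurableSet w) (h : ∀ z ∈ w, A z = 0) (t x y : ℝ) :
    beamIntegral γ w Y A t x y = 0 := by
  rw [beamIntegral_congr hw h]
  simp [beamIntegral]

end

/-! ### The linear system on a beam -/

/-- `W` is given for `y ≥ 0` by superpositions of waves with wavenumbers in `w`. -/
def IsBeam (γ : ℝ) (w : Set (ℝ × ℝ)) (Y : ℝ × ℝ → ℂ) (A : ℝ × ℝ → Fin 4 → ℂ) (W : Flow) : Prop :=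
  ∀ t x y i, 0 ≤ y → W t x y i = beamIntegral γ w Y (fun z => A z i) t x y

section

variable {γ ν₀ κ₀ ε : ℝ} {w : Set (ℝ × ℝ)} {Y : ℝ × ℝ → ℂ} {A : ℝ × ℝ → Fin 4 → ℂ} {W W' : Flow}

theorem IsBeam.contDiffOn (h : IsBeam γ w Y A W) (hw : IsCompact w) (hY : ContinuousOn Y w)
    (hA : ContinuousOn A w) (i : Fin 4) :
    ContDiffOn ℝ 2 (fun z : ℝ × ℝ × ℝ => W z.1 z.2.1 z.2.2 i) {z | 0 ≤ z.2.2} :=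
  (contDiff_beamIntegral hw hY (continuousOn_pi.1 hA i) 2).contDiffOn.congr
    fun _ hz => h _ _ _ _ hz

theorem iteratedDeriv_two_eq {f g h : ℝ → ℂ} {s : ℝ} (h1 : ∀ᶠ r in 𝓝 s, HasDerivAt f (g r) r)
    (h2 : HasDerivAt g (h s) s) : iteratedDeriv 2 f s = h s := by
  rw [iteratedDeriv_succ, iteratedDeriv_one]
  have h3 : deriv f =ᶠ[𝓝 s] g := h1.mono fun r hr => hr.deriv
  rw [h3.deriv_eq, h2.deriv]

theorem IsBeam.derivatives (h : IsBeam γ w Y A W) (hw : IsCompact w) (hY : ContinuousOn Y w)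
    (hA : ContinuousOn A w) (i : Fin 4) {t x y : ℝ} (hy : 0 < y) :
    dt W i t x y = beamIntegral γ w Y (fun z => -Complex.I * Real.sin z.2 * A z i) t x y ∧
    dx W i t x y = beamIntegral γ w Y (fun z => Complex.I * waveK γ z.1 z.2 * A z i) t x y ∧
    dy W i t x y = beamIntegral γ w Y (fun z => Y z * A z i) t x y ∧
    laplacian W i t x y = beamIntegral γ w Y (fun z => (Complex.I * waveK γ z.1 z.2) ^ 2 * A z i
      + Y z ^ 2 * A z i) t x y := by
  have hAi := continuousOn_pi.1 hA i
  have hk : ContinuousOn (fun z : ℝ × ℝ => Complex.I * (waveK γ z.1 z.2 : ℂ)) w :=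
    (continuous_const.mul (Complex.continuous_ofReal.comp (continuous_waveK γ))).continuousOn
  have ht : (fun s => W s x y i) = fun s => beamIntegral γ w Y (fun z => A z i) s x y :=
    funext fun s => h s x y i hy.le
  have hx : (fun s => W t s y i) = fun s => beamIntegral γ w Y (fun z => A z i) t s y :=
    funext fun s => h t s y i hy.le
  -- The flow is given by the integral only for y ≥ 0, so in the vertical variable the two agree
  -- only near y > 0.
  have hyy : (fun s => W t x s i) =ᶠ[𝓝 y] fun s => beamIntegral γ w Y (fun z => A z i) t x s :=
    (lt_mem_nhds hy).mono fun s hs => h t x s i hs.le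
  refine ⟨?_, ?_, ?_, ?_⟩
  · rw [dt, ht, (hasDerivAt_beamIntegral_t hw hY hAi t x y).deriv]
  · rw [dx, hx, (hasDerivAt_beamIntegral_x hw hY hAi t x y).deriv]
  · rw [dy, hyy.deriv_eq, (hasDerivAt_beamIntegral_y hw hY hAi t x y).deriv]
  · have hkA : ContinuousOn (fun z => Complex.I * (waveK γ z.1 z.2 : ℂ) * A z i) w := hk.mul hAi
    have hYA : ContinuousOn (fun z => Y z * A z i) w := hY.mul hAi
    have hk2 : ContinuousOn (fun z => (Complex.I * (waveK γ z.1 z.2 : ℂ)) ^ 2 * A z i) w :=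
      (hk.pow 2).mul hAi
    have hY2 : ContinuousOn (fun z => Y z ^ 2 * A z i) w := (hY.pow 2).mul hAi
    rw [beamIntegral_add hw hY hk2 hY2, laplacian, hx, hyy.iteratedDeriv_eq]
    congr 1
    · refine (iteratedDeriv_two_eq (Eventually.of_forall fun s =>
        hasDerivAt_beamIntegral_x hw hY hAi t s y)
        (h := fun s => beamIntegral γ w Y _ t s y)
        (hasDerivAt_beamIntegral_x hw hY hkA t x y)).trans ?_
      simp only [pow_two, mul_assoc]
    · refine (iteratedDeriv_two_eq (Eventually.of_forall fun s =>
        hasDerivAt_beamIntegral_y hw hY hAi t x s)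
        (h := fun s => beamIntegral γ w Y _ t x s)
        (hasDerivAt_beamIntegral_y hw hY hYA t x y)).trans ?_
      simp only [pow_two, mul_assoc]

/-- A beam of divergence-free waves solves the linear system, with the right-hand side given by the
symbol. -/
theorem IsBeam.solvesLinear (h : IsBeam γ w Y A W) (hw : IsCompact w) (hY : ContinuousOn Y w)
    (hA : ContinuousOn A w)
    (hdiv : ∀ z ∈ w, Complex.I * waveK γ z.1 z.2 * A z 0 + Y z * A z 1 = 0) :
    SolvesLinear γ ν₀ κ₀ ε W (fun t x y i => beamIntegral γ w Y
      (fun z => beamSymbol γ ν₀ κ₀ ε (Real.sin z.2) (waveK γ z.1 z.2) (Y z) (A z) i) t x y) where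
  regular := h.contDiffOn hw hY hA
  equations t x y hy := by
    have hA' := continuousOn_pi.1 hA
    have hk : ContinuousOn (fun z : ℝ × ℝ => Complex.I * (waveK γ z.1 z.2 : ℂ)) w :=
      (continuous_const.mul (Complex.continuous_ofReal.comp (continuous_waveK γ))).continuousOn
    have hΩ : ContinuousOn (fun z : ℝ × ℝ => -Complex.I * (Real.sin z.2 : ℂ)) w := by fun_prop
    have hlap : ∀ i, ContinuousOn (fun z : ℝ × ℝ => (Complex.I * (waveK γ z.1 z.2 : ℂ)) ^ 2 * A z i
        + Y z ^ 2 * A z i) w := fun i => ((hk.pow 2).mul (hA' i)).add ((hY.pow 2).mul (hA' i))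
    have hΩA : ∀ i, ContinuousOn (fun z => -Complex.I * (Real.sin z.2 : ℂ) * A z i) w :=
      fun i => hΩ.mul (hA' i)
    have hkA : ∀ i, ContinuousOn (fun z => Complex.I * (waveK γ z.1 z.2 : ℂ) * A z i) w :=
      fun i => hk.mul (hA' i)
    have hYA : ∀ i, ContinuousOn (fun z => Y z * A z i) w := fun i => hY.mul (hA' i)
    have d := fun i => h.derivatives hw hY hA i (t := t) (x := x) hy
    have e := fun i => h t x y i hy.le
    funext i
    fin_cases i
    · change dt W 0 t x y - W t x y 2 * Real.sin γ + dx W 3 t x y - ν₀ * ε * laplacian W 0 t x y = _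
      rw [(d 0).1, (d 3).2.1, (d 0).2.2.2, e 2]
      refine Eq.trans (by ring) ((beamIntegral_add_four hw hY 1 (-Real.sin γ) 1 (-(ν₀ * ε)) t x y
        (hΩA 0) (hA' 2) (hkA 3) (hlap 0)).trans ?_)
      refine beamIntegral_congr hw.measurableSet (fun z _ => ?_) t x y
      change _ = -Complex.I * Real.sin z.2 * A z 0 - A z 2 * Real.sin γ
        + Complex.I * waveK γ z.1 z.2 * A z 3
        - ν₀ * ε * ((Complex.I * waveK γ z.1 z.2) ^ 2 * A z 0 + Y z ^ 2 * A z 0)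
      ring
    · change dt W 1 t x y - W t x y 2 * Real.cos γ + dy W 3 t x y - ν₀ * ε * laplacian W 1 t x y = _
      rw [(d 1).1, (d 3).2.2.1, (d 1).2.2.2, e 2]
      refine Eq.trans (by ring) ((beamIntegral_add_four hw hY 1 (-Real.cos γ) 1 (-(ν₀ * ε)) t x y
        (hΩA 1) (hA' 2) (hYA 3) (hlap 1)).trans ?_)
      refine beamIntegral_congr hw.measurableSet (fun z _ => ?_) t x y
      change _ = -Complex.I * Real.sin z.2 * A z 1 - A z 2 * Real.cos γ + Y z * A z 3
        - ν₀ * ε * ((Complex.I * waveK γ z.1 z.2) ^ 2 * A z 1 + Y z ^ 2 * A z 1)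
      ring
    · change dt W 2 t x y + W t x y 0 * Real.sin γ + W t x y 1 * Real.cos γ
        - κ₀ * ε * laplacian W 2 t x y = _
      rw [(d 2).1, (d 2).2.2.2, e 0, e 1]
      refine Eq.trans (by ring) ((beamIntegral_add_four hw hY 1 (Real.sin γ) (Real.cos γ)
        (-(κ₀ * ε)) t x y (hΩA 2) (hA' 0) (hA' 1) (hlap 2)).trans ?_)
      refine beamIntegral_congr hw.measurableSet (fun z _ => ?_) t x y
      change _ = -Complex.I * Real.sin z.2 * A z 2 + A z 0 * Real.sin γ + A z 1 * Real.cos γ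
        - κ₀ * ε * ((Complex.I * waveK γ z.1 z.2) ^ 2 * A z 2 + Y z ^ 2 * A z 2)
      ring
  divergence_free t x y hy := by
    have hA' := continuousOn_pi.1 hA
    have hk : ContinuousOn (fun z : ℝ × ℝ => Complex.I * (waveK γ z.1 z.2 : ℂ)) w :=
      (continuous_const.mul (Complex.continuous_ofReal.comp (continuous_waveK γ))).continuousOn
    rw [(h.derivatives hw hY hA 0 hy).2.1, (h.derivatives hw hY hA 1 hy).2.2.1,
      ← beamIntegral_add hw hY (A := fun z => Complex.I * waveK γ z.1 z.2 * A z 0)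
        (A' := fun z => Y z * A z 1) (hk.mul (hA' 0)) (hY.mul (hA' 1)),
      beamIntegral_zero hw.measurableSet hdiv]

theorem SolvesLinear.add {r r' : ℝ → ℝ → ℝ → Fin 3 → ℂ} (h : SolvesLinear γ ν₀ κ₀ ε W r)
    (h' : SolvesLinear γ ν₀ κ₀ ε W' r') : SolvesLinear γ ν₀ κ₀ ε (W + W') (r + r') := by
  have slice : ∀ {W : Flow} {r}, SolvesLinear γ ν₀ κ₀ ε W r → ∀ i {t x y : ℝ}, 0 < y →
      ContDiffAt ℝ 2 (fun s => W s x y i) t ∧ ContDiffAt ℝ 2 (fun s => W t s y i) x ∧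
      ContDiffAt ℝ 2 (fun s => W t x s i) y := by
    intro W r h i t x y hy
    have hn : {z : ℝ × ℝ × ℝ | 0 ≤ z.2.2} ∈ 𝓝 (t, x, y) := by
      have hc : Continuous fun z : ℝ × ℝ × ℝ => z.2.2 := by fun_prop
      exact (hc.continuousAt.eventually (lt_mem_nhds hy)).mono fun z hz => le_of_lt hz
    have h2 := (h.regular i).contDiffAt hn
    exact ⟨h2.comp (f := fun s : ℝ => (s, x, y)) t (by fun_prop),
      h2.comp (f := fun s : ℝ => (t, s, y)) x (by fun_prop),
      h2.comp (f := fun s : ℝ => (t, x, s)) y (by fun_prop)⟩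
  have hd : ∀ i {t x y : ℝ}, 0 < y → dt (W + W') i t x y = dt W i t x y + dt W' i t x y ∧
      dx (W + W') i t x y = dx W i t x y + dx W' i t x y ∧
      dy (W + W') i t x y = dy W i t x y + dy W' i t x y ∧
      laplacian (W + W') i t x y = laplacian W i t x y + laplacian W' i t x y := by
    intro i t x y hy
    obtain ⟨a1, a2, a3⟩ := slice h i (t := t) (x := x) hy
    obtain ⟨b1, b2, b3⟩ := slice h' i (t := t) (x := x) hy
    have n2 : (2 : WithTop ℕ∞) ≠ 0 := by norm_num
    refine ⟨deriv_add (a1.differentiableAt n2) (b1.differentiableAt n2),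
      deriv_add (a2.differentiableAt n2) (b2.differentiableAt n2),
      deriv_add (a3.differentiableAt n2) (b3.differentiableAt n2), ?_⟩
    have e1 := iteratedDeriv_add a2 b2
    have e2 := iteratedDeriv_add a3 b3
    unfold laplacian
    refine (congrArg₂ (· + ·) e1 e2).trans ?_
    ring
  refine ⟨fun i => (h.regular i).add (h'.regular i), fun t x y hy => ?_, fun t x y hy => ?_⟩
  · have e := h.equations t x y hy
    have e' := h'.equations t x y hy
    have d := fun i => hd i (t := t) (x := x) hy
    change _ = r t x y + r' t x y
    rw [← e, ← e']
    unfold linearOperator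
    rw [(d 0).1, (d 1).1, (d 2).1, (d 3).2.1, (d 3).2.2.1, (d 0).2.2.2, (d 1).2.2.2, (d 2).2.2.2]
    have hv : ∀ i, (W + W') t x y i = W t x y i + W' t x y i := fun i => rfl
    rw [hv 0, hv 1, hv 2]
    funext i
    fin_cases i <;> simp <;> ring
  · rw [(hd 0 hy).2.1, (hd 1 hy).2.2.1]
    linear_combination h.divergence_free t x y hy + h'.divergence_free t x y hy

end

/-! ### Mean square bounds for superpositions -/

section

open scoped ComplexConjugate ENNReal

/-- The square of a r − b s is nonnegative. The weights are those of a Schur test. -/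
theorem mul_le_half_weighted {a b : ℝ≥0∞} {s r : ℝ} (hs : 0 < s) (hr : 0 < r)
    (ha : a ≠ ⊤) (hb : b ≠ ⊤) :
    a * b ≤ 2⁻¹ * (a ^ 2 / ENNReal.ofReal s * ENNReal.ofReal r) +
      2⁻¹ * (b ^ 2 / ENNReal.ofReal r * ENNReal.ofReal s) := by
  lift a to NNReal using ha
  lift b to NNReal using hb
  lift s to NNReal using hs.le
  lift r to NNReal using hr.le
  have hs' : s ≠ 0 := by rintro rfl; simp at hs
  have hr' : r ≠ 0 := by rintro rfl; simp at hr
  rw [ENNReal.ofReal_coe_nnreal, ENNReal.ofReal_coe_nnreal]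
  rw [← ENNReal.coe_pow, ← ENNReal.coe_pow, ← ENNReal.coe_div hs', ← ENNReal.coe_div hr']
  have h2 : (2⁻¹ : ℝ≥0∞) = ((2⁻¹ : NNReal) : ℝ≥0∞) := by
    rw [ENNReal.coe_inv two_ne_zero]; rfl
  rw [h2]
  norm_cast
  rw [← NNReal.coe_le_coe]
  push_cast
  have hs0 : (0 : ℝ) < s := hs
  have hr0 : (0 : ℝ) < r := hr
  have e : (2⁻¹ : ℝ) * ((a : ℝ) ^ 2 / s * r) + 2⁻¹ * ((b : ℝ) ^ 2 / r * s) - a * b =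
      (a * r - b * s) ^ 2 / (2 * (s * r)) := by
    field_simp
    ring
  have : 0 ≤ ((a : ℝ) * r - b * s) ^ 2 / (2 * (s * r)) := by positivity
  linarith

variable {Z X : Type*} [MeasurableSpace Z] [MeasurableSpace X] {μ : Measure Z} [IsFiniteMeasure μ]
  {ν : Measure X} [SFinite ν] {A : Z → ℂ} {M : ℝ} {e : Z → X → ℂ} {h : Z → ℝ} {C : ℝ≥0∞}

theorem measurable_superposition (hA : Measurable A) (he : Measurable (Function.uncurry e)) :
    Measurable fun x => ∫ z, A z * e z x ∂μ := by
  have : StronglyMeasurable (Function.uncurry fun x z => A z * e z x) :=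
    ((hA.comp measurable_snd).mul (he.comp measurable_swap)).stronglyMeasurable
  exact this.integral_prod_right.measurable

/-- A weighted Schur test: the damped mean square is the double integral of A(z) conj(A(z′)) G(z,
z′), the product of amplitudes is split by the weighted arithmetic-geometric inequality, and the
symmetry of |G| makes both halves equal. -/
theorem lintegral_damped_superposition_le (hA : Measurable A) (hM : ∀ z, ‖A z‖ ≤ M)
    (he : Measurable (Function.uncurry e)) (he1 : ∀ z x, ‖e z x‖ ≤ 1) (hh : Measurable h)
    (h0 : ∀ z, 0 < h z) {g : X → ℝ} (hg : Measurable g) (hg0 : ∀ x, 0 ≤ g x)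
    (hgi : Integrable g ν)
    (hker : ∀ z, ∫⁻ z', ENNReal.ofReal (h z') * ‖∫ x, (g x : ℂ) * (e z x * conj (e z' x)) ∂ν‖ₑ ∂μ
      ≤ C) :
    ∫⁻ x, ENNReal.ofReal (g x) * ‖∫ z, A z * e z x ∂μ‖ₑ ^ 2 ∂ν ≤
      C * ∫⁻ z, ‖A z‖ₑ ^ 2 / ENNReal.ofReal (h z) ∂μ := by
  set u : X → ℂ := fun x => ∫ z, A z * e z x ∂μ with hu
  set G : Z → Z → ℂ := fun z z' => ∫ x, (g x : ℂ) * (e z x * conj (e z' x)) ∂ν with hG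
  have hum : Measurable u := measurable_superposition hA he
  have hub : ∀ x, ‖u x‖ ≤ M * μ.real univ := fun x => by
    refine norm_integral_le_of_norm_le_const (Eventually.of_forall fun z => ?_)
    rw [norm_mul]
    calc ‖A z‖ * ‖e z x‖ ≤ ‖A z‖ * 1 := by gcongr; exact he1 z x
      _ ≤ M := by rw [mul_one]; exact hM z
  have hGm : Measurable (Function.uncurry G) := by
    have : StronglyMeasurable (Function.uncurry fun (p : Z × Z) x =>
        (g x : ℂ) * (e p.1 x * conj (e p.2 x))) := by
      refine Measurable.stronglyMeasurable ?_
      have h1 : Measurable fun q : (Z × Z) × X => (g q.2 : ℂ) :=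
        Complex.measurable_ofReal.comp (hg.comp measurable_snd)
      have h2 : Measurable fun q : (Z × Z) × X => e q.1.1 q.2 :=
        he.comp ((measurable_fst.comp measurable_fst).prodMk measurable_snd)
      have h3 : Measurable fun q : (Z × Z) × X => e q.1.2 q.2 :=
        he.comp ((measurable_snd.comp measurable_fst).prodMk measurable_snd)
      exact h1.mul (h2.mul (Complex.continuous_conj.measurable.comp h3))
    exact this.integral_prod_right.measurable
  have hGs : ∀ z z', ‖G z z'‖ₑ = ‖G z' z‖ₑ := fun z z' => by
    have : G z z' = conj (G z' z) := by
      rw [hG]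
      simp only
      rw [← integral_conj]
      refine integral_congr_ae (Eventually.of_forall fun x => ?_)
      simp only [map_mul, Complex.conj_ofReal, Complex.conj_conj]
      ring
    rw [this, ← ofReal_norm, ← ofReal_norm, RCLike.norm_conj]
  -- the damped mean square as a double superposition
  have hT : ∫⁻ x, ENNReal.ofReal (g x) * ‖u x‖ₑ ^ 2 ∂ν ≤
      ‖∫ p : Z × Z, A p.1 * conj (A p.2) * G p.1 p.2 ∂(μ.prod μ)‖ₑ := by
    have hint : Integrable (fun x => g x * ‖u x‖ ^ 2) ν := by
      refine (hgi.mul_const ((M * μ.real univ) ^ 2)).mono'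
        (hg.mul (hum.norm.pow_const 2)).aestronglyMeasurable (Eventually.of_forall fun x => ?_)
      rw [norm_mul, Real.norm_of_nonneg (hg0 x), norm_pow, norm_norm]
      have := hg0 x
      gcongr
      exact hub x
    have e1 : ∫⁻ x, ENNReal.ofReal (g x) * ‖u x‖ₑ ^ 2 ∂ν =
        ENNReal.ofReal (∫ x, g x * ‖u x‖ ^ 2 ∂ν) := by
      rw [ofReal_integral_eq_lintegral_ofReal hint
        (Eventually.of_forall fun x => mul_nonneg (hg0 x) (by positivity))]
      refine lintegral_congr fun x => ?_
      rw [ENNReal.ofReal_mul (hg0 x), ENNReal.ofReal_pow (norm_nonneg _), ofReal_norm]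
    have e2 : ((∫ x, g x * ‖u x‖ ^ 2 ∂ν : ℝ) : ℂ) =
        ∫ p : Z × Z, A p.1 * conj (A p.2) * G p.1 p.2 ∂(μ.prod μ) := by
      have s1 : ∀ x, ((g x * ‖u x‖ ^ 2 : ℝ) : ℂ) = ∫ p : Z × Z,
          (g x : ℂ) * ((A p.1 * e p.1 x) * conj (A p.2 * e p.2 x)) ∂(μ.prod μ) := fun x => by
        rw [integral_const_mul, integral_prod_mul (fun z => A z * e z x)
          (fun z => conj (A z * e z x)), integral_conj, Complex.mul_conj, Complex.normSq_eq_norm_sq]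
        push_cast
        rfl
      rw [← integral_complex_ofReal]
      simp only [s1]
      rw [integral_integral_swap]
      · refine integral_congr_ae (Eventually.of_forall fun p => ?_)
        simp only [hG]
        rw [← integral_const_mul]
        refine integral_congr_ae (Eventually.of_forall fun x => ?_)
        simp only [map_mul]
        ring
      · have hb : Integrable (fun q : X × (Z × Z) => g q.1 * M ^ 2) (ν.prod (μ.prod μ)) :=
          hgi.mul_prod (integrable_const (M ^ 2))
        have m1 : Measurable fun q : X × (Z × Z) => (g q.1 : ℂ) :=
          Complex.measurable_ofReal.comp (hg.comp measurable_fst)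
        have m2 : Measurable fun q : X × (Z × Z) => A q.2.1 * e q.2.1 q.1 :=
          (hA.comp (measurable_fst.comp measurable_snd)).mul
            (he.comp ((measurable_fst.comp measurable_snd).prodMk measurable_fst))
        have m3 : Measurable fun q : X × (Z × Z) => A q.2.2 * e q.2.2 q.1 :=
          (hA.comp (measurable_snd.comp measurable_snd)).mul
            (he.comp ((measurable_snd.comp measurable_snd).prodMk measurable_fst))
        refine hb.mono' (m1.mul (m2.mul
          (Complex.continuous_conj.measurable.comp m3))).aestronglyMeasurable
          (Eventually.of_forall fun q => ?_)
        have key : ∀ z x, ‖A z * e z x‖ ≤ M := fun z x => by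
          rw [norm_mul]
          calc ‖A z‖ * ‖e z x‖ ≤ ‖A z‖ * 1 := by gcongr; exact he1 z x
            _ ≤ M := by rw [mul_one]; exact hM z
        have hM0 : 0 ≤ M := (norm_nonneg _).trans (key q.2.1 q.1)
        simp only [Function.uncurry]
        rw [norm_mul, norm_mul, Complex.norm_real, Real.norm_of_nonneg (hg0 _), RCLike.norm_conj,
          pow_two]
        have := hg0 q.1
        gcongr
        · exact key _ _
        · exact key _ _
    rw [e1, ← e2, ← ofReal_norm, Complex.norm_real]
    exact ENNReal.ofReal_le_ofReal (le_abs_self _)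
  refine hT.trans ((enorm_integral_le_lintegral_enorm _).trans ?_)
  have hAm : Measurable fun z => ‖A z‖ₑ := hA.enorm
  have hhm : Measurable fun z => ENNReal.ofReal (h z) := hh.ennreal_ofReal
  set F : Z × Z → ℝ≥0∞ := fun p =>
    ‖A p.1‖ₑ ^ 2 / ENNReal.ofReal (h p.1) * (ENNReal.ofReal (h p.2) * ‖G p.1 p.2‖ₑ) with hF
  have hFm : Measurable F := by
    refine (((hAm.pow_const 2).div hhm).comp measurable_fst).mul
      ((hhm.comp measurable_snd).mul hGm.enorm)
  have hle : ∀ p : Z × Z, ‖A p.1 * conj (A p.2) * G p.1 p.2‖ₑ ≤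
      2⁻¹ * F p + 2⁻¹ * F p.swap := fun p => by
    rw [enorm_mul, enorm_mul]
    have hc : ‖conj (A p.2)‖ₑ = ‖A p.2‖ₑ := by rw [← ofReal_norm, ← ofReal_norm, RCLike.norm_conj]
    rw [hc]
    have := mul_le_half_weighted (a := ‖A p.1‖ₑ) (b := ‖A p.2‖ₑ) (h0 p.1) (h0 p.2)
      enorm_ne_top enorm_ne_top
    calc ‖A p.1‖ₑ * ‖A p.2‖ₑ * ‖G p.1 p.2‖ₑ ≤ _ := mul_le_mul_left this _
      _ = 2⁻¹ * F p + 2⁻¹ * F p.swap := by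
        simp only [hF, Prod.fst_swap, Prod.snd_swap, hGs p.2 p.1]
        ring
  have hI : ∫⁻ p, F p ∂(μ.prod μ) ≤ C * ∫⁻ z, ‖A z‖ₑ ^ 2 / ENNReal.ofReal (h z) ∂μ := by
    have hm : Measurable fun z => ‖A z‖ₑ ^ 2 / ENNReal.ofReal (h z) := (hAm.pow_const 2).div hhm
    rw [lintegral_prod _ hFm.aemeasurable, ← lintegral_const_mul _ hm]
    refine lintegral_mono fun z => ?_
    simp only [hF]
    have hm : Measurable fun z' => ENNReal.ofReal (h z') * ‖G z z'‖ₑ :=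
      hhm.mul hGm.of_uncurry_left.enorm
    rw [lintegral_const_mul _ hm, mul_comm]
    gcongr
    exact hker z
  have hS : ∫⁻ p, F p.swap ∂(μ.prod μ) = ∫⁻ p, F p ∂(μ.prod μ) :=
    lintegral_prod_swap _
  calc ∫⁻ p, ‖A p.1 * conj (A p.2) * G p.1 p.2‖ₑ ∂(μ.prod μ)
      ≤ ∫⁻ p, (2⁻¹ * F p + 2⁻¹ * F p.swap) ∂(μ.prod μ) := lintegral_mono hle
    _ = 2⁻¹ * ∫⁻ p, F p ∂(μ.prod μ) + 2⁻¹ * ∫⁻ p, F p.swap ∂(μ.prod μ) := by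
      have hm : Measurable fun p : Z × Z => F p.swap := hFm.comp measurable_swap
      rw [lintegral_add_left (hFm.const_mul _), lintegral_const_mul _ hFm,
        lintegral_const_mul _ hm]
    _ = ∫⁻ p, F p ∂(μ.prod μ) := by
      rw [hS, ← add_mul, ENNReal.inv_two_add_inv_two, one_mul]
    _ ≤ _ := hI

/-- Fatou's lemma removes the damping, because the kernel bound C does not depend on n. -/
theorem lintegral_superposition_le (hA : Measurable A) (hM : ∀ z, ‖A z‖ ≤ M)
    (he : Measurable (Function.uncurry e)) (he1 : ∀ z x, ‖e z x‖ ≤ 1) (hh : Measurable h)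
    (h0 : ∀ z, 0 < h z) {g : ℕ → X → ℝ} (hg : ∀ n, Measurable (g n)) (hg0 : ∀ n x, 0 ≤ g n x)
    (hgi : ∀ n, Integrable (g n) ν) (hg1 : ∀ x, Tendsto (fun n => g n x) atTop (𝓝 1))
    (hker : ∀ n z, ∫⁻ z', ENNReal.ofReal (h z') *
      ‖∫ x, (g n x : ℂ) * (e z x * conj (e z' x)) ∂ν‖ₑ ∂μ ≤ C) :
    ∫⁻ x, ‖∫ z, A z * e z x ∂μ‖ₑ ^ 2 ∂ν ≤
      C * ∫⁻ z, ‖A z‖ₑ ^ 2 / ENNReal.ofReal (h z) ∂μ := by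
  have hum := measurable_superposition (μ := μ) hA he
  have hlim : ∀ x, Tendsto (fun n => ENNReal.ofReal (g n x) * ‖∫ z, A z * e z x ∂μ‖ₑ ^ 2) atTop
      (𝓝 (‖∫ z, A z * e z x ∂μ‖ₑ ^ 2)) := fun x => by
    have h1 := ENNReal.tendsto_ofReal (hg1 x)
    rw [ENNReal.ofReal_one] at h1
    have h2 := ENNReal.Tendsto.mul_const h1 (b := ‖∫ z, A z * e z x ∂μ‖ₑ ^ 2) (Or.inl one_ne_zero)
    rwa [one_mul] at h2
  calc ∫⁻ x, ‖∫ z, A z * e z x ∂μ‖ₑ ^ 2 ∂ν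
      = ∫⁻ x, liminf (fun n => ENNReal.ofReal (g n x) * ‖∫ z, A z * e z x ∂μ‖ₑ ^ 2) atTop ∂ν :=
        lintegral_congr fun x => (hlim x).liminf_eq.symm
    _ ≤ liminf (fun n => ∫⁻ x, ENNReal.ofReal (g n x) * ‖∫ z, A z * e z x ∂μ‖ₑ ^ 2 ∂ν) atTop :=
        lintegral_liminf_le fun n => (hg n).ennreal_ofReal.mul (hum.enorm.pow_const 2)
    _ ≤ _ := by
        refine liminf_le_of_le (by isBoundedDefault) fun b hb => ?_
        obtain ⟨n, hn⟩ := hb.exists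
        exact hn.trans (lintegral_damped_superposition_le hA hM he he1 hh h0 (hg n) (hg0 n)
          (hgi n) (hker n))

end

section

open scoped ComplexConjugate ENNReal

/-! ### Gaussian dampings -/

theorem enorm_gaussian_transform {b : ℝ} (hb : 0 < b) (k k' : ℝ) :
    ‖∫ x : ℝ, (Real.exp (-b * x ^ 2) : ℂ) *
      (Complex.exp (Complex.I * k * x) * conj (Complex.exp (Complex.I * k' * x)))‖ₑ =
      ENNReal.ofReal (√(Real.pi / b) * Real.exp (-(1 / (4 * b)) * (k - k') ^ 2)) := by
  have h1 : ∀ x : ℝ, (Real.exp (-b * x ^ 2) : ℂ) *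
      (Complex.exp (Complex.I * k * x) * conj (Complex.exp (Complex.I * k' * x))) =
      Complex.exp (Complex.I * ((k - k' : ℝ) : ℂ) * x) * Complex.exp (-(b : ℂ) * x ^ 2) := fun x => by
    rw [← Complex.exp_conj, Complex.ofReal_exp, ← Complex.exp_add, ← Complex.exp_add,
      ← Complex.exp_add]
    congr 1
    simp only [map_mul, Complex.conj_I, Complex.conj_ofReal]
    push_cast
    ring
  simp only [h1]
  rw [fourierIntegral_gaussian (by simpa using hb)]
  have h2 : ((Real.pi : ℂ) / (b : ℂ)) ^ (1 / 2 : ℂ) = ((√(Real.pi / b) : ℝ) : ℂ) := by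
    rw [Real.sqrt_eq_rpow, Complex.ofReal_cpow (by positivity)]
    push_cast
    rfl
  have h3 : Complex.exp (-((k - k' : ℝ) : ℂ) ^ 2 / (4 * (b : ℂ))) =
      ((Real.exp (-(1 / (4 * b)) * (k - k') ^ 2) : ℝ) : ℂ) := by
    rw [Complex.ofReal_exp]
    congr 1
    push_cast
    ring
  rw [h2, h3, ← Complex.ofReal_mul, ← ofReal_norm, Complex.norm_real,
    Real.norm_of_nonneg (by positivity)]

/-- The total mass does not depend on b: the transformed Gaussian is an approximate identity, and
this is where Plancherel's constant 2π comes from. -/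
theorem lintegral_gaussian_transform {b : ℝ} (hb : 0 < b) (k : ℝ) :
    ∫⁻ s : ℝ, ENNReal.ofReal (√(Real.pi / b) * Real.exp (-(1 / (4 * b)) * (k - s) ^ 2)) =
      ENNReal.ofReal (2 * Real.pi) := by
  rw [lintegral_sub_left_eq_self
    (fun s => ENNReal.ofReal (√(Real.pi / b) * Real.exp (-(1 / (4 * b)) * s ^ 2))) k]
  have hb' : 0 < 1 / (4 * b) := by positivity
  rw [← ofReal_integral_eq_lintegral_ofReal ((integrable_exp_neg_mul_sq hb').const_mul _)
    (Eventually.of_forall fun x => by positivity), integral_const_mul, integral_gaussian,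
    ← Real.sqrt_mul (by positivity)]
  congr 1
  rw [show Real.pi / b * (Real.pi / (1 / (4 * b))) = (2 * Real.pi) ^ 2 by field_simp; ring]
  exact Real.sqrt_sq (by positivity)

theorem tendsto_gaussian_one (x : ℝ) :
    Tendsto (fun n : ℕ => Real.exp (-(1 / ((n : ℝ) + 1)) * x ^ 2)) atTop (𝓝 1) := by
  have h : Tendsto (fun n : ℕ => -(1 / ((n : ℝ) + 1)) * x ^ 2) atTop (𝓝 (-0 * x ^ 2)) :=
    (tendsto_one_div_add_atTop_nhds_zero_nat.neg).mul_const _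
  have := (Real.continuous_exp.tendsto _).comp h
  rw [neg_zero, zero_mul, Real.exp_zero] at this
  exact this

variable {Z : Type*} [MeasurableSpace Z] {μ : Measure Z} [IsFiniteMeasure μ]
  {A : Z → ℂ} {M : ℝ} {C : ℝ≥0∞}

theorem norm_exp_I_mul (a b : ℝ) : ‖Complex.exp (Complex.I * a * b)‖ = 1 := by
  rw [show Complex.I * (a : ℂ) * b = ((a * b : ℝ) : ℂ) * Complex.I by push_cast; ring,
    Complex.norm_exp_ofReal_mul_I]

/-- Mean square bound on a line, in terms of the density of the wavenumber. -/
theorem lintegral_line_superposition_le (hA : Measurable A) (hM : ∀ z, ‖A z‖ ≤ M)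
    {k : Z → ℝ} (hk : Measurable k)
    (hpush : ∀ f : ℝ → ℝ≥0∞, Measurable f → ∫⁻ z, f (k z) ∂μ ≤ C * ∫⁻ s, f s) :
    ∫⁻ x : ℝ, ‖∫ z, A z * Complex.exp (Complex.I * k z * x) ∂μ‖ₑ ^ 2 ≤
      C * ENNReal.ofReal (2 * Real.pi) * ∫⁻ z, ‖A z‖ₑ ^ 2 ∂μ := by
  have hb : ∀ n : ℕ, (0 : ℝ) < 1 / ((n : ℝ) + 1) := fun n => by positivity
  have h := lintegral_superposition_le (μ := μ) (ν := (volume : Measure ℝ))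
    (e := fun z x => Complex.exp (Complex.I * k z * x)) (h := fun _ => 1)
    (g := fun n x => Real.exp (-(1 / ((n : ℝ) + 1)) * x ^ 2))
    (C := C * ENNReal.ofReal (2 * Real.pi)) hA hM ?_ ?_ measurable_const (fun _ => one_pos) ?_ ?_ ?_
    tendsto_gaussian_one ?_
  · simpa using h
  · refine Complex.continuous_exp.measurable.comp ?_
    exact (measurable_const.mul (Complex.measurable_ofReal.comp (hk.comp measurable_fst))).mul
      (Complex.measurable_ofReal.comp measurable_snd)
  · exact fun z x => (norm_exp_I_mul _ _).le
  · exact fun n => by fun_prop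
  · exact fun n x => (Real.exp_pos _).le
  · exact fun n => integrable_exp_neg_mul_sq (hb n)
  · intro n z
    simp only [enorm_gaussian_transform (hb n), ENNReal.ofReal_one, one_mul]
    rw [← lintegral_gaussian_transform (hb n) (k z)]
    exact hpush (fun s => ENNReal.ofReal (√(Real.pi / (1 / ((n : ℝ) + 1))) *
      Real.exp (-(1 / (4 * (1 / ((n : ℝ) + 1)))) * (k z - s) ^ 2))) (by fun_prop)

/-- Mean square bound in the plane, in terms of the weighted density of the wavenumber. -/
theorem lintegral_plane_superposition_le (hA : Measurable A) (hM : ∀ z, ‖A z‖ ≤ M)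
    {k m h : Z → ℝ} (hk : Measurable k) (hm : Measurable m) (hh : Measurable h) (h0 : ∀ z, 0 < h z)
    (hpush : ∀ f : ℝ × ℝ → ℝ≥0∞, Measurable f →
      ∫⁻ z, ENNReal.ofReal (h z) * f (k z, m z) ∂μ ≤ C * ∫⁻ s, f s) :
    ∫⁻ x : ℝ × ℝ, ‖∫ z, A z * (Complex.exp (Complex.I * k z * x.1) *
        Complex.exp (Complex.I * m z * x.2)) ∂μ‖ₑ ^ 2 ≤
      C * (ENNReal.ofReal (2 * Real.pi) * ENNReal.ofReal (2 * Real.pi)) *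
        ∫⁻ z, ‖A z‖ₑ ^ 2 / ENNReal.ofReal (h z) ∂μ := by
  have hb : ∀ n : ℕ, (0 : ℝ) < 1 / ((n : ℝ) + 1) := fun n => by positivity
  refine lintegral_superposition_le (μ := μ) (ν := (volume : Measure (ℝ × ℝ)))
    (e := fun z x => Complex.exp (Complex.I * k z * x.1) * Complex.exp (Complex.I * m z * x.2))
    (g := fun n x => Real.exp (-(1 / ((n : ℝ) + 1)) * x.1 ^ 2) *
      Real.exp (-(1 / ((n : ℝ) + 1)) * x.2 ^ 2))
    hA hM ?_ ?_ hh h0 ?_ ?_ ?_ ?_ ?_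
  · have h1 : Measurable fun q : Z × (ℝ × ℝ) => Complex.exp (Complex.I * k q.1 * q.2.1) :=
      Complex.continuous_exp.measurable.comp
        ((measurable_const.mul (Complex.measurable_ofReal.comp (hk.comp measurable_fst))).mul
        (Complex.measurable_ofReal.comp (measurable_fst.comp measurable_snd)))
    have h2 : Measurable fun q : Z × (ℝ × ℝ) => Complex.exp (Complex.I * m q.1 * q.2.2) :=
      Complex.continuous_exp.measurable.comp
        ((measurable_const.mul (Complex.measurable_ofReal.comp (hm.comp measurable_fst))).mul
        (Complex.measurable_ofReal.comp (measurable_snd.comp measurable_snd)))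
    exact h1.mul h2
  · exact fun z x => by rw [norm_mul, norm_exp_I_mul, norm_exp_I_mul, mul_one]
  · exact fun n => by fun_prop
  · exact fun n x => by positivity
  · exact fun n => (integrable_exp_neg_mul_sq (hb n)).mul_prod (integrable_exp_neg_mul_sq (hb n))
  · intro x
    simpa using (tendsto_gaussian_one x.1).mul (tendsto_gaussian_one x.2)
  · intro n z
    have e1 : ∀ z', ‖∫ x : ℝ × ℝ, ((Real.exp (-(1 / ((n : ℝ) + 1)) * x.1 ^ 2) *
        Real.exp (-(1 / ((n : ℝ) + 1)) * x.2 ^ 2) : ℝ) : ℂ) *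
        (Complex.exp (Complex.I * k z * x.1) * Complex.exp (Complex.I * m z * x.2) *
        conj (Complex.exp (Complex.I * k z' * x.1) * Complex.exp (Complex.I * m z' * x.2)))‖ₑ =
        ENNReal.ofReal (√(Real.pi / (1 / ((n : ℝ) + 1))) *
          Real.exp (-(1 / (4 * (1 / ((n : ℝ) + 1)))) * (k z - k z') ^ 2)) *
        ENNReal.ofReal (√(Real.pi / (1 / ((n : ℝ) + 1))) *
          Real.exp (-(1 / (4 * (1 / ((n : ℝ) + 1)))) * (m z - m z') ^ 2)) := fun z' => by
      rw [← enorm_gaussian_transform (hb n), ← enorm_gaussian_transform (hb n), ← enorm_mul,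
        ← integral_prod_mul]
      congr 1
      refine integral_congr_ae (Eventually.of_forall fun x => ?_)
      simp only [map_mul]
      push_cast
      ring
    simp only [e1]
    refine (hpush (fun s => ENNReal.ofReal (√(Real.pi / (1 / ((n : ℝ) + 1))) *
          Real.exp (-(1 / (4 * (1 / ((n : ℝ) + 1)))) * (k z - s.1) ^ 2)) *
        ENNReal.ofReal (√(Real.pi / (1 / ((n : ℝ) + 1))) *
          Real.exp (-(1 / (4 * (1 / ((n : ℝ) + 1)))) * (m z - s.2) ^ 2))) (by fun_prop)).trans ?_
    have hmeas : ∀ r : ℝ, AEMeasurable (fun s : ℝ => ENNReal.ofReal (√(Real.pi / (1 / ((n : ℝ) + 1))) *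
          Real.exp (-(1 / (4 * (1 / ((n : ℝ) + 1)))) * (r - s) ^ 2))) volume := fun r => by fun_prop
    rw [Measure.volume_eq_prod, lintegral_prod_mul (hmeas (k z)) (hmeas (m z)),
      lintegral_gaussian_transform (hb n), lintegral_gaussian_transform (hb n)]

/-! ### Densities of the wavenumbers -/

/-- At a fixed angle, k is linear in ρ with slope at least s₀ in modulus; the angles contribute at
most a length 2π. -/
theorem lintegral_waveK_le {γ s₀ : ℝ} (hs₀ : 0 < s₀) {w : Set (ℝ × ℝ)}
    (hw : ∀ z ∈ w, z.2 ∈ Icc 0 (2 * Real.pi) ∧ s₀ ≤ |Real.sin (z.2 + γ)|)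
    {f : ℝ → ℝ≥0∞} (hf : Measurable f) :
    ∫⁻ z in w, f (waveK γ z.1 z.2) ≤
      ENNReal.ofReal (1 / s₀) * ENNReal.ofReal (2 * Real.pi) * ∫⁻ s, f s := by
  set T : Set ℝ := Icc 0 (2 * Real.pi) ∩ {θ | s₀ ≤ |Real.sin (θ + γ)|} with hT
  have hTm : MeasurableSet T :=
    measurableSet_Icc.inter (isClosed_le (by fun_prop) (by fun_prop)).measurableSet
  have hsub : w ⊆ univ ×ˢ T := fun z hz => ⟨mem_univ _, hw z hz⟩
  refine (lintegral_mono_set hsub).trans ?_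
  have hfm : Measurable fun z : ℝ × ℝ => f (waveK γ z.1 z.2) :=
    hf.comp (continuous_waveK γ).measurable
  rw [Measure.volume_eq_prod, ← Measure.prod_restrict, Measure.restrict_univ,
    lintegral_prod_symm _ hfm.aemeasurable]
  have hin : ∀ θ ∈ T, ∫⁻ ρ, f (waveK γ ρ θ) ≤ ENNReal.ofReal (1 / s₀) * ∫⁻ s, f s := by
    intro θ hθ
    have hs : Real.sin (θ + γ) ≠ 0 := fun h => by
      have := hθ.2
      simp only [mem_ofPred_eq, h, abs_zero] at this
      linarith
    unfold waveK
    rw [← lintegral_map hf (measurable_mul_const (Real.sin (θ + γ))),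
      Real.map_volume_mul_right hs, lintegral_smul_measure, smul_eq_mul]
    gcongr
    rw [abs_inv, one_div]
    gcongr
    exact hθ.2
  calc ∫⁻ θ in T, ∫⁻ ρ, f (waveK γ ρ θ) ≤ ∫⁻ _ in T, ENNReal.ofReal (1 / s₀) * ∫⁻ s, f s :=
        setLIntegral_mono' hTm hin
    _ = ENNReal.ofReal (1 / s₀) * (∫⁻ s, f s) * volume T := by rw [setLIntegral_const]
    _ ≤ ENNReal.ofReal (1 / s₀) * (∫⁻ s, f s) * ENNReal.ofReal (2 * Real.pi) := by
        gcongr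
        refine (measure_mono inter_subset_left).trans ?_
        rw [Real.volume_Icc, sub_zero]
    _ = _ := by ring

/-- Polar coordinates in the wavenumber plane, ρ dρ dθ = dk dm. Periodicity moves the angles from
[0, 2π], shifted by γ, to (−π, π). -/
theorem lintegral_wave_le {γ : ℝ} {w : Set (ℝ × ℝ)}
    (hw : ∀ z ∈ w, 0 < z.1 ∧ z.2 ∈ Icc 0 (2 * Real.pi)) {f : ℝ × ℝ → ℝ≥0∞} (hf : Measurable f) :
    ∫⁻ z in w, ENNReal.ofReal z.1 * f (waveK γ z.1 z.2, waveM γ z.1 z.2) ≤ ∫⁻ s, f s := by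
  have hsub : w ⊆ Ioi 0 ×ˢ Icc 0 (2 * Real.pi) := fun z hz => hw z hz
  refine (lintegral_mono_set hsub).trans ?_
  set Φ : ℝ → ℝ≥0∞ := fun s => ∫⁻ ρ in Ioi (0 : ℝ),
    ENNReal.ofReal ρ * f (ρ * Real.sin s, ρ * Real.cos s) with hΦ
  have hper : ∀ s, Φ (s + 2 * Real.pi) = Φ s := fun s => by
    simp only [hΦ, Real.sin_add_two_pi, Real.cos_add_two_pi]
  have hm : Measurable fun z : ℝ × ℝ => ENNReal.ofReal z.1 *
      f (z.1 * Real.sin z.2, z.1 * Real.cos z.2) :=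
    (by fun_prop : Measurable fun z : ℝ × ℝ => ENNReal.ofReal z.1).mul
      (hf.comp (by fun_prop : Measurable fun z : ℝ × ℝ => (z.1 * Real.sin z.2, z.1 * Real.cos z.2)))
  have hm' : Measurable fun z : ℝ × ℝ => ENNReal.ofReal z.1 *
      f (waveK γ z.1 z.2, waveM γ z.1 z.2) :=
    (by fun_prop : Measurable fun z : ℝ × ℝ => ENNReal.ofReal z.1).mul
      (hf.comp ((continuous_waveK γ).measurable.prodMk (continuous_waveM γ).measurable))
  have hT : (0 : ℝ) < 2 * Real.pi := by positivity
  have hperiodic : Function.Periodic (fun θ => Φ (θ + γ)) (2 * Real.pi) := fun θ => by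
    simp only
    rw [add_right_comm, hper]
  have e1 : ∫⁻ θ in Ioc 0 (2 * Real.pi), Φ (θ + γ) =
      ∫⁻ θ in Ioc (-Real.pi - γ) (Real.pi - γ), Φ (θ + γ) := by
    have := (isAddFundamentalDomain_Ioc hT 0 volume).setLIntegral_eq
      (isAddFundamentalDomain_Ioc hT (-Real.pi - γ) volume) (fun θ => Φ (θ + γ)) ?_
    · rw [zero_add, show -Real.pi - γ + 2 * Real.pi = Real.pi - γ by ring] at this
      exact this
    · rintro ⟨g, hg⟩ x
      obtain ⟨n, rfl⟩ := AddSubgroup.mem_zmultiples_iff.1 hg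
      change Φ (n • (2 * Real.pi) + x + γ) = Φ (x + γ)
      rw [add_comm (n • _) x]
      exact hperiodic.zsmul n x
  have e2 : ∫⁻ θ in Ioc (-Real.pi - γ) (Real.pi - γ), Φ (θ + γ) =
      ∫⁻ s in Ioc (-Real.pi) Real.pi, Φ s := by
    have h := (measurePreserving_add_right volume γ).setLIntegral_comp_preimage_emb
      (measurableEmbedding_addRight γ) Φ (Ioc (-Real.pi) Real.pi)
    rwa [Set.preimage_add_const_Ioc] at h
  calc ∫⁻ z in Ioi 0 ×ˢ Icc 0 (2 * Real.pi), ENNReal.ofReal z.1 *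
        f (waveK γ z.1 z.2, waveM γ z.1 z.2)
      = ∫⁻ θ in Icc 0 (2 * Real.pi), Φ (θ + γ) := by
        rw [Measure.volume_eq_prod, ← Measure.prod_restrict, lintegral_prod_symm _ hm'.aemeasurable]
        rfl
    _ = ∫⁻ θ in Ioc 0 (2 * Real.pi), Φ (θ + γ) := (setLIntegral_congr Ioc_ae_eq_Icc).symm
    _ = ∫⁻ s in Ioo (-Real.pi) Real.pi, Φ s := by
        rw [e1, e2, setLIntegral_congr Ioo_ae_eq_Ioc]
    -- The sine belongs to k, the first coordinate, while polar coordinates put the cosine first;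
    -- hence the swap.
    _ = ∫⁻ p in polarCoord.target, ENNReal.ofReal p.1 • f (polarCoord.symm p).swap := by
        rw [polarCoord_target, Measure.volume_eq_prod, ← Measure.prod_restrict]
        exact (lintegral_prod_symm _ hm.aemeasurable).symm
    _ = ∫⁻ s : ℝ × ℝ, f s.swap := lintegral_comp_polarCoord_symm fun p => f p.swap
    _ = ∫⁻ s, f s := by
        rw [Measure.volume_eq_prod]
        exact lintegral_prod_swap _
    _ ≤ ∫⁻ s, f s := le_rfl

end

/-! ### Square integrability of beams -/

theorem eLpNorm_two_le {X : Type*} [MeasurableSpace X] {ν : Measure X} {f : X → ℂ} {K : ℝ}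
    (hK : 0 ≤ K) (h : ∫⁻ x, ‖f x‖ₑ ^ 2 ∂ν ≤ ENNReal.ofReal (K ^ 2)) :
    eLpNorm f 2 ν ≤ ENNReal.ofReal K := by
  rw [eLpNorm_eq_lintegral_rpow_enorm_toReal two_ne_zero ENNReal.ofNat_ne_top]
  simp only [ENNReal.toReal_ofNat, ENNReal.rpow_ofNat]
  refine (ENNReal.rpow_le_rpow h (by norm_num)).trans ?_
  rw [ENNReal.ofReal_rpow_of_nonneg (by positivity) (by norm_num), ← Real.sqrt_eq_rpow,
    Real.sqrt_sq hK]

theorem memLp_two {X : Type*} [MeasurableSpace X] {ν : Measure X} {f : X → ℂ}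
    (hf : AEStronglyMeasurable f ν) (h : ∫⁻ x, ‖f x‖ₑ ^ 2 ∂ν < ⊤) : MemLp f 2 ν := by
  have h' : ∫⁻ x, ‖f x‖ₑ ^ 2 ∂ν ≤
      ENNReal.ofReal (√((∫⁻ x, ‖f x‖ₑ ^ 2 ∂ν).toReal) ^ 2) := by
    rw [Real.sq_sqrt ENNReal.toReal_nonneg, ENNReal.ofReal_toReal h.ne]
  exact ⟨hf, (eLpNorm_two_le (Real.sqrt_nonneg _) h').trans_lt ENNReal.ofReal_lt_top⟩

section

variable {γ : ℝ} {w : Set (ℝ × ℝ)} {Y A : ℝ × ℝ → ℂ}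

/-- Restriction of a continuous amplitude to the wavenumbers of a beam. -/
theorem exists_measurable_extension (hw : IsCompact w) (hA : ContinuousOn A w) :
    Measurable (w.indicator A) ∧ ∃ M, ∀ z, ‖w.indicator A z‖ ≤ M := by
  classical
  refine ⟨?_, ?_⟩
  · rw [← Set.piecewise_eq_indicator]
    exact hA.measurable_piecewise continuousOn_const hw.measurableSet
  · obtain ⟨M, hM⟩ := hw.exists_bound_of_continuousOn hA
    refine ⟨max M 0, fun z => ?_⟩
    by_cases hz : z ∈ w
    · rw [indicator_of_mem hz]; exact (hM z hz).trans (le_max_left _ _)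
    · rw [indicator_of_notMem hz, norm_zero]; exact le_max_right _ _

theorem continuousOn_cexp_phase (hY : ContinuousOn Y w) (hA : ContinuousOn A w) (t y : ℝ) :
    ContinuousOn (fun z => Complex.exp (-Complex.I * Real.sin z.2 * t + Y z * y) * A z) w := by
  have h : ContinuousOn (fun z : ℝ × ℝ => -Complex.I * (Real.sin z.2 : ℂ) * t) w := by fun_prop
  exact (Complex.continuous_exp.comp_continuousOn (h.add (hY.mul continuousOn_const))).mul hA

/-- At a fixed height the factors in t and y are absorbed into the amplitude, and their modulus
squared is at most e^{−2cy}; what is left is a superposition in x alone. -/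
theorem lintegral_line_beam_le {s₀ : ℝ} (hs₀ : 0 < s₀) (hw : IsCompact w)
    (hwin : ∀ z ∈ w, z.2 ∈ Icc 0 (2 * Real.pi) ∧ s₀ ≤ |Real.sin (z.2 + γ)|)
    (hY : ContinuousOn Y w) (hA : ContinuousOn A w) {c : ℝ} (hc : ∀ z ∈ w, (Y z).re ≤ -c)
    (t : ℝ) {y : ℝ} (hy : 0 ≤ y) :
    ∫⁻ x, ‖beamIntegral γ w Y A t x y‖ₑ ^ 2 ≤
      ENNReal.ofReal (1 / s₀) * ENNReal.ofReal (2 * Real.pi) * ENNReal.ofReal (2 * Real.pi) *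
        (∫⁻ z in w, ‖A z‖ₑ ^ 2) * ENNReal.ofReal (Real.exp (-(2 * c) * y)) := by
  have : IsFiniteMeasure ((volume : Measure (ℝ × ℝ)).restrict w) :=
    isFiniteMeasure_restrict.2 hw.measure_lt_top.ne
  obtain ⟨hm, M, hM⟩ := exists_measurable_extension hw (continuousOn_cexp_phase hY hA t y)
  have h := lintegral_line_superposition_le (μ := volume.restrict w) hm hM
    (continuous_waveK γ).measurable (fun f hf => lintegral_waveK_le hs₀ hwin hf)
  have e : ∀ x, beamIntegral γ w Y A t x y = ∫ z in w, w.indicator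
      (fun z => Complex.exp (-Complex.I * Real.sin z.2 * t + Y z * y) * A z) z *
        Complex.exp (Complex.I * waveK γ z.1 z.2 * x) := fun x => by
    refine setIntegral_congr_fun hw.measurableSet fun z hz => ?_
    rw [indicator_of_mem hz, beamPhase_apply, mul_right_comm (Complex.exp _) (A z), ← Complex.exp_add]
    congr 2
    ring
  simp only [e]
  refine h.trans ?_
  rw [mul_assoc _ (∫⁻ z in w, ‖A z‖ₑ ^ 2)]
  gcongr
  rw [← lintegral_mul_const' _ _ ENNReal.ofReal_ne_top]
  refine setLIntegral_mono' hw.measurableSet fun z hz => ?_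
  rw [indicator_of_mem hz, enorm_mul, mul_pow, mul_comm]
  gcongr
  rw [← ofReal_norm, ← ENNReal.ofReal_pow (norm_nonneg _)]
  refine ENNReal.ofReal_le_ofReal ?_
  rw [Complex.norm_exp, ← Real.exp_nat_mul]
  refine Real.exp_le_exp.2 ?_
  have e1 : (-Complex.I * (Real.sin z.2 : ℂ) * t + Y z * y).re = (Y z).re * y := by
    rw [Complex.add_re, Complex.re_mul_ofReal, Complex.re_mul_ofReal, Complex.re_mul_ofReal]
    simp
  rw [e1]
  have := mul_le_mul_of_nonneg_right (hc z hz) hy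
  push_cast
  linarith

theorem lintegral_plane_beam_le (hw : IsCompact w)
    (hwin : ∀ z ∈ w, 0 < z.1 ∧ z.2 ∈ Icc 0 (2 * Real.pi)) (hA : ContinuousOn A w) (t : ℝ) :
    ∫⁻ p : ℝ × ℝ, ‖beamIntegral γ w (fun z => Complex.I * waveM γ z.1 z.2) A t p.1 p.2‖ₑ ^ 2 ≤
      ENNReal.ofReal (2 * Real.pi) * ENNReal.ofReal (2 * Real.pi) *
        ∫⁻ z in w, ‖A z‖ₑ ^ 2 / ENNReal.ofReal z.1 := by
  have : IsFiniteMeasure ((volume : Measure (ℝ × ℝ)).restrict w) :=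
    isFiniteMeasure_restrict.2 hw.measure_lt_top.ne
  obtain ⟨hm, M, hM⟩ := exists_measurable_extension hw
    (continuousOn_cexp_phase (Y := fun _ => 0) continuousOn_const hA t 0)
  -- The Schur weight is the Jacobian ρ; the value 1 elsewhere only serves to make it positive
  -- everywhere.
  set h : ℝ × ℝ → ℝ := fun z => if 0 < z.1 then z.1 else 1 with hh
  have hhm : Measurable h :=
    Measurable.ite (measurableSet_lt measurable_const measurable_fst) measurable_fst
      measurable_const
  have hh0 : ∀ z, 0 < h z := fun z => by
    simp only [hh]
    split_ifs with h1
    · exact h1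
    · exact one_pos
  have hhw : ∀ z ∈ w, h z = z.1 := fun z hz => if_pos (hwin z hz).1
  have key := lintegral_plane_superposition_le (μ := volume.restrict w) (C := 1) hm hM
    (continuous_waveK γ).measurable (continuous_waveM γ).measurable hhm hh0 fun f hf => by
      rw [one_mul]
      refine le_trans (le_of_eq ?_) (lintegral_wave_le (γ := γ) hwin hf)
      exact setLIntegral_congr_fun hw.measurableSet fun z hz => by simp only [hhw z hz]
  have e : ∀ p : ℝ × ℝ, beamIntegral γ w (fun z => Complex.I * waveM γ z.1 z.2) A t p.1 p.2 =
      ∫ z in w, w.indicator (fun z => Complex.exp (-Complex.I * Real.sin z.2 * t + 0 * (0 : ℝ))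
        * A z) z * (Complex.exp (Complex.I * waveK γ z.1 z.2 * p.1) *
          Complex.exp (Complex.I * waveM γ z.1 z.2 * p.2)) := fun p => by
    refine setIntegral_congr_fun hw.measurableSet fun z hz => ?_
    rw [indicator_of_mem hz, beamPhase_apply, mul_right_comm (Complex.exp _) (A z), ← Complex.exp_add, ← Complex.exp_add]
    congr 2
    ring
  simp only [e]
  refine key.trans ?_
  rw [one_mul]
  refine le_of_eq (congrArg _ (setLIntegral_congr_fun hw.measurableSet fun z hz => ?_))
  rw [indicator_of_mem hz, hhw z hz, enorm_mul]
  have e1 : ‖Complex.exp (-Complex.I * (Real.sin z.2 : ℂ) * t + 0 * (0 : ℝ))‖ₑ = 1 := by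
    rw [← ofReal_norm, zero_mul, add_zero, neg_mul, neg_mul, ← mul_neg, ← Complex.ofReal_neg,
      norm_exp_I_mul, ENNReal.ofReal_one]
  rw [e1, one_mul]

theorem lintegral_sq_lt_top (hw : IsCompact w) (hA : ContinuousOn A w) :
    ∫⁻ z in w, ‖A z‖ₑ ^ 2 < ⊤ := by
  obtain ⟨M, hM⟩ := hw.exists_bound_of_continuousOn hA
  calc ∫⁻ z in w, ‖A z‖ₑ ^ 2 ≤ ∫⁻ _ in w, ENNReal.ofReal M ^ 2 :=
        setLIntegral_mono' hw.measurableSet fun z hz => by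
          gcongr
          rw [← ofReal_norm]
          exact ENNReal.ofReal_le_ofReal (hM z hz)
    _ < ⊤ := by
        rw [setLIntegral_const]
        exact ENNReal.mul_lt_top (ENNReal.pow_lt_top ENNReal.ofReal_lt_top) hw.measure_lt_top

theorem continuous_beamIntegral (hw : IsCompact w) (hY : ContinuousOn Y w) (hA : ContinuousOn A w)
    (t : ℝ) : Continuous fun p : ℝ × ℝ => beamIntegral γ w Y A t p.1 p.2 := by
  have h : Continuous fun z : ℝ × ℝ × ℝ => beamIntegral γ w Y A z.1 z.2.1 z.2.2 :=
    (contDiff_beamIntegral hw hY hA 1).continuous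
  have h' : Continuous fun p : ℝ × ℝ => (t, p) := continuous_const.prodMk continuous_id
  have h2 := Continuous.comp h h'
  rwa [Function.comp_def] at h2

theorem halfPlane_eq : halfPlane = (volume : Measure ℝ).prod (volume.restrict (Ioi 0)) := by
  have h : {z : ℝ × ℝ | 0 < z.2} = univ ×ˢ Ioi (0 : ℝ) := by ext z; simp
  rw [halfPlane, h, Measure.volume_eq_prod, ← Measure.prod_restrict, Measure.restrict_univ]

/-- Tonelli: the bound on horizontal lines decays exponentially in y and is integrable. -/
theorem memLp_decaying_beam {s₀ : ℝ} (hs₀ : 0 < s₀) (hw : IsCompact w)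
    (hwin : ∀ z ∈ w, z.2 ∈ Icc 0 (2 * Real.pi) ∧ s₀ ≤ |Real.sin (z.2 + γ)|)
    (hY : ContinuousOn Y w) (hA : ContinuousOn A w) {c : ℝ} (hc0 : 0 < c)
    (hc : ∀ z ∈ w, (Y z).re ≤ -c) (t : ℝ) :
    MemLp (fun p : ℝ × ℝ => beamIntegral γ w Y A t p.1 p.2) 2 halfPlane := by
  have hcont := continuous_beamIntegral (γ := γ) hw hY hA t
  refine memLp_two hcont.aestronglyMeasurable ?_
  have hm : Measurable fun p : ℝ × ℝ => ‖beamIntegral γ w Y A t p.1 p.2‖ₑ ^ 2 :=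
    hcont.measurable.enorm.pow_const 2
  rw [halfPlane_eq, lintegral_prod_symm _ hm.aemeasurable]
  set D := ENNReal.ofReal (1 / s₀) * ENNReal.ofReal (2 * Real.pi) * ENNReal.ofReal (2 * Real.pi) *
    (∫⁻ z in w, ‖A z‖ₑ ^ 2) with hD
  have hDt : D < ⊤ := ENNReal.mul_lt_top (ENNReal.mul_lt_top (ENNReal.mul_lt_top
    ENNReal.ofReal_lt_top ENNReal.ofReal_lt_top) ENNReal.ofReal_lt_top) (lintegral_sq_lt_top hw hA)
  calc ∫⁻ y in Ioi (0 : ℝ), ∫⁻ x, ‖beamIntegral γ w Y A t x y‖ₑ ^ 2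
      ≤ ∫⁻ y in Ioi (0 : ℝ), D * ENNReal.ofReal (Real.exp (-(2 * c) * y)) :=
        setLIntegral_mono' measurableSet_Ioi fun y hy =>
          lintegral_line_beam_le hs₀ hw hwin hY hA hc t (le_of_lt hy)
    _ = D * ∫⁻ y in Ioi (0 : ℝ), ENNReal.ofReal (Real.exp (-(2 * c) * y)) :=
        lintegral_const_mul' _ _ hDt.ne
    _ < ⊤ := by
        refine ENNReal.mul_lt_top hDt ?_
        have hi : IntegrableOn (fun y : ℝ => Real.exp (-(2 * c) * y)) (Ioi 0) :=
          exp_neg_integrableOn_Ioi 0 (by positivity)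
        rw [← ofReal_integral_eq_lintegral_ofReal hi
          (Eventually.of_forall fun y => (Real.exp_pos _).le)]
        exact ENNReal.ofReal_lt_top

/-- An incident wave does not decay in y, so the half-plane is enlarged to the plane and the
two-dimensional Plancherel bound is used; its weight 1/ρ explains the form of the hypothesis on A.
-/
theorem memLp_plane_beam (hw : IsCompact w)
    (hwin : ∀ z ∈ w, 0 < z.1 ∧ z.2 ∈ Icc 0 (2 * Real.pi)) (hA : ContinuousOn A w) {K : ℝ}
    (hK : 0 ≤ K) (hAK : ∀ z ∈ w, ‖A z‖ ^ 2 ≤ K * z.1) (t : ℝ) :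
    MemLp (fun p : ℝ × ℝ => beamIntegral γ w (fun z => Complex.I * waveM γ z.1 z.2) A t p.1 p.2)
      2 halfPlane ∧
    eLpNorm (fun p : ℝ × ℝ => beamIntegral γ w (fun z => Complex.I * waveM γ z.1 z.2) A t p.1 p.2)
      2 halfPlane ≤ ENNReal.ofReal (2 * Real.pi * √(K * (volume w).toReal)) := by
  have hY : ContinuousOn (fun z : ℝ × ℝ => Complex.I * (waveM γ z.1 z.2 : ℂ)) w :=
    (continuous_const.mul (Complex.continuous_ofReal.comp (continuous_waveM γ))).continuousOn
  have hwt := hw.measure_lt_top (μ := (volume : Measure (ℝ × ℝ)))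
  have hle : ∫⁻ p, ‖beamIntegral γ w (fun z => Complex.I * waveM γ z.1 z.2) A t p.1 p.2‖ₑ ^ 2
      ∂halfPlane ≤ ENNReal.ofReal ((2 * Real.pi * √(K * (volume w).toReal)) ^ 2) := by
    refine (setLIntegral_le_lintegral _ _).trans ((lintegral_plane_beam_le hw hwin hA t).trans ?_)
    have hp : 0 ≤ 2 * Real.pi := by positivity
    rw [mul_pow, Real.sq_sqrt (by positivity), ENNReal.ofReal_mul (pow_nonneg hp 2), pow_two,
      ENNReal.ofReal_mul hp]
    refine mul_le_mul_right ?_ _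
    rw [ENNReal.ofReal_mul hK, ENNReal.ofReal_toReal hwt.ne, ← setLIntegral_const]
    refine setLIntegral_mono' hw.measurableSet fun z hz => ?_
    refine ENNReal.div_le_of_le_mul ?_
    rw [← ENNReal.ofReal_mul hK, ← ofReal_norm, ← ENNReal.ofReal_pow (norm_nonneg _)]
    exact ENNReal.ofReal_le_ofReal (hAK z hz)
  exact ⟨memLp_two (continuous_beamIntegral hw hY hA t).aestronglyMeasurable
    (hle.trans_lt ENNReal.ofReal_lt_top), eLpNorm_two_le (by positivity) hle⟩

/-- A beam inherits square integrability from its superpositions. -/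
theorem IsBeam.squareIntegrable {A : ℝ × ℝ → Fin 4 → ℂ} {W : Flow} (h : IsBeam γ w Y A W)
    (hL : ∀ i t, MemLp (fun p : ℝ × ℝ => beamIntegral γ w Y (fun z => A z i) t p.1 p.2)
      2 halfPlane) : SquareIntegrable W := by
  intro t i
  refine (hL i.castSucc t).ae_eq ?_
  have hm : MeasurableSet {z : ℝ × ℝ | 0 < z.2} :=
    measurableSet_lt measurable_const measurable_snd
  filter_upwards [ae_restrict_mem hm] with z hz
  exact (h t z.1 z.2 _ (le_of_lt hz)).symm

end

/-! ### The window and the amplitude -/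

theorem isClosed_angularWindow (γ R ε : ℝ) : IsClosed (angularWindow γ R ε) := by
  simp only [angularWindow, Set.ofPred_and, Set.ofPred_or]
  refine isClosed_Icc.inter (((isClosed_le (by fun_prop) (by fun_prop)).inter
    (isClosed_le (by fun_prop) (by fun_prop))).union
    ((isClosed_le (by fun_prop) (by fun_prop)).inter (isClosed_le (by fun_prop) (by fun_prop))))

theorem window_subset {γ η R ε σ : ℝ} (hσ : 0 < σ) :
    window γ η R ε σ ⊆ Icc η (R / σ) ×ˢ angularWindow γ R ε := fun z hz =>
  ⟨⟨hz.1, by rw [le_div_iff₀ hσ, mul_comm]; exact hz.2.1⟩, hz.2.2⟩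

theorem isCompact_window {γ η R ε σ : ℝ} (hσ : 0 < σ) : IsCompact (window γ η R ε σ) := by
  have hcl : IsClosed (window γ η R ε σ) := by
    simp only [window, Set.ofPred_and]
    exact (isClosed_le (by fun_prop) (by fun_prop)).inter
      ((isClosed_le (by fun_prop) (by fun_prop)).inter
      ((isClosed_angularWindow γ R ε).preimage continuous_snd))
  refine (isCompact_Icc.prod (isCompact_Icc (a := 0) (b := 2 * Real.pi))).of_isClosed_subset hcl
    ((window_subset hσ).trans (prod_mono_right fun θ hθ => hθ.1))

section

variable {γ η R B ε σ : ℝ} {χ ψ : ℝ → ℂ}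

theorem IsCutoff.eq_zero_of_scaled {e x : ℝ} (hψ : IsCutoff R B ψ) (he : 0 < e)
    (h : R * e < |x|) : ψ (x / e) = 0 := by
  refine hψ.2.1 _ ?_
  rwa [abs_div, abs_of_pos he, lt_div_iff₀ he]

theorem amplitude_eq_zero (hε : 0 < ε) (hσ : 0 < σ) (hη : 0 < η)
    (hχ : IsCutoff R B χ) (hψ : IsCutoff R B ψ) {ρ θ : ℝ} (hρ : η ≤ ρ)
    (hθ : θ ∈ Icc 0 (2 * Real.pi)) (hz : (ρ, θ) ∉ window γ η R ε σ) :
    amplitude γ ε σ χ ψ ρ θ = 0 := by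
  have he : 0 < ε ^ (1 / 3 : ℝ) := by positivity
  unfold amplitude
  by_cases h1 : σ * ρ ≤ R
  · have h2 : θ ∉ angularWindow γ R ε := fun h => hz ⟨hρ, h1, h⟩
    have h3 : ∀ {a b : ℝ}, ¬(|a| ≤ R * ε ^ (1 / 3 : ℝ) ∧ |b| ≤ R * ε ^ (1 / 3 : ℝ)) →
        ψ (a / ε ^ (1 / 3 : ℝ)) * ψ (b / ε ^ (1 / 3 : ℝ)) = 0 := by
      intro a b hab
      rcases not_and_or.1 hab with h | h
      · rw [hψ.eq_zero_of_scaled he (not_le.1 h), zero_mul]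
      · rw [hψ.eq_zero_of_scaled he (not_le.1 h), mul_zero]
    have h4 := fun h => h2 ⟨hθ, Or.inl h⟩
    have h5 := fun h => h2 ⟨hθ, Or.inr h⟩
    rw [h3 h4, h3 h5, add_zero, mul_zero]
  · have h2 : 0 < σ * ρ := mul_pos hσ (hη.trans_le hρ)
    rw [hχ.2.1 _ (by rw [abs_of_pos h2]; exact not_le.1 h1), zero_mul]

theorem norm_amplitude_le (hχ : IsCutoff R B χ) (hψ : IsCutoff R B ψ) (ρ θ : ℝ) :
    ‖amplitude γ ε σ χ ψ ρ θ‖ ≤ 2 * B ^ 3 := by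
  have hB : 0 ≤ B := (norm_nonneg _).trans (hχ.2.2 0)
  unfold amplitude
  rw [norm_mul]
  calc _ ≤ B * (B * B + B * B) := by
        gcongr
        · exact hχ.2.2 _
        · refine (norm_add_le _ _).trans ?_
          rw [norm_mul, norm_mul]
          gcongr <;> exact hψ.2.2 _
    _ = 2 * B ^ 3 := by ring

theorem continuous_amplitude (hχ : IsCutoff R B χ) (hψ : IsCutoff R B ψ) :
    Continuous fun z : ℝ × ℝ => amplitude γ ε σ χ ψ z.1 z.2 := by
  have h1 := hχ.1.continuous
  have h2 := hψ.1.continuous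
  unfold amplitude
  fun_prop

end

/-! ### Packets as superpositions over the window -/

/-- The amplitude of a wave packet, including its normalization, its center and the area element. -/
def packetAmplitude (γ ε σ x₀ : ℝ) (A : ℝ → ℝ → Fin 4 → ℂ) (z : ℝ × ℝ) (i : Fin 4) : ℂ :=
  ((σ / ε ^ (1 / 6 : ℝ) : ℝ) : ℂ) * Complex.exp (-(Complex.I * waveK γ z.1 z.2 * x₀)) * z.1 *
    A z.1 z.2 i

theorem continuousOn_packetAmplitude {γ ε σ x₀ : ℝ} {A : ℝ → ℝ → Fin 4 → ℂ} {w : Set (ℝ × ℝ)}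
    (hA : ContinuousOn (fun z : ℝ × ℝ => A z.1 z.2) w) :
    ContinuousOn (packetAmplitude γ ε σ x₀ A) w := by
  refine continuousOn_pi.2 fun i => ?_
  have h1 : Continuous fun z : ℝ × ℝ => ((σ / ε ^ (1 / 6 : ℝ) : ℝ) : ℂ) *
      Complex.exp (-(Complex.I * waveK γ z.1 z.2 * x₀)) * z.1 := by
    have := continuous_waveK γ
    fun_prop
  exact h1.continuousOn.mul (continuousOn_pi.1 hA i)

/-- The amplitude vanishes off the window, so the iterated improper integral is, by Fubini, an
integral over a compact set, and continuity of the data on the window suffices. -/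
theorem isBeam_wavePacket {γ ε σ η R x₀ : ℝ} (hη : 0 < η) (hσ : 0 < σ) {A : ℝ → ℝ → Fin 4 → ℂ}
    {Y : ℝ → ℝ → ℂ}
    (hA : ContinuousOn (fun z : ℝ × ℝ => A z.1 z.2) (window γ η R ε σ))
    (hY : ContinuousOn (fun z : ℝ × ℝ => Y z.1 z.2) (window γ η R ε σ))
    (hsupp : ∀ ρ θ, η ≤ ρ → θ ∈ Icc 0 (2 * Real.pi) → (ρ, θ) ∉ window γ η R ε σ → A ρ θ = 0) :
    IsBeam γ (window γ η R ε σ) (fun z => Y z.1 z.2) (packetAmplitude γ ε σ x₀ A)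
      (wavePacket γ ε σ η x₀ A Y) := by
  intro t x y i hy
  have hw := isCompact_window (γ := γ) (η := η) (R := R) (ε := ε) hσ
  set w := window γ η R ε σ with hwdef
  set f : ℝ × ℝ → ℂ := fun z => A z.1 z.2 i * Complex.exp (-Complex.I * freq γ z.1 z.2 * t
    + Complex.I * waveK γ z.1 z.2 * (x - x₀) + Y z.1 z.2 * y) * z.1 with hf
  have hfw : ∀ z ∈ w, ((σ / ε ^ (1 / 6 : ℝ) : ℝ) : ℂ) * f z =
      Complex.exp (beamPhase γ (fun z => Y z.1 z.2) z (t, x, y)) *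
        packetAmplitude γ ε σ x₀ A z i := fun z hz => by
    have hρ : 0 < z.1 := hη.trans_le hz.1
    have e : Complex.exp (-Complex.I * Real.sin z.2 * t + Complex.I * waveK γ z.1 z.2 * (x - x₀)
        + Y z.1 z.2 * y) = Complex.exp (-Complex.I * Real.sin z.2 * t +
          Complex.I * waveK γ z.1 z.2 * x + Y z.1 z.2 * y) *
          Complex.exp (-(Complex.I * waveK γ z.1 z.2 * x₀)) := by
      rw [← Complex.exp_add]
      congr 1
      ring
    simp only [hf, packetAmplitude, beamPhase_apply]
    rw [freq_eq_sin hρ, e]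
    ring
  have hc : ContinuousOn (fun z => ((σ / ε ^ (1 / 6 : ℝ) : ℝ) : ℂ) * f z) w :=
    (continuousOn_exp_smul (continuousOn_beamPhase hY)
      (continuousOn_pi.1 (continuousOn_packetAmplitude hA) i) (t, x, y)).congr hfw
  set S : Set (ℝ × ℝ) := Ici η ×ˢ Icc 0 (2 * Real.pi) with hS
  have hwS : w ⊆ S := fun z hz => ⟨hz.1, hz.2.2.1⟩
  have hzero : ∀ z ∈ S \ w, f z = 0 := fun z hz => by
    simp only [hf]
    rw [hsupp z.1 z.2 hz.1.1 hz.1.2 hz.2]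
    simp
  have hzero' : ∀ z ∈ S \ w, ((σ / ε ^ (1 / 6 : ℝ) : ℝ) : ℂ) * f z = 0 := fun z hz => by
    rw [hzero z hz, mul_zero]
  have hSm : MeasurableSet S := measurableSet_Ici.prod measurableSet_Icc
  have hint : IntegrableOn (fun z => ((σ / ε ^ (1 / 6 : ℝ) : ℝ) : ℂ) * f z) S :=
    (hc.integrableOn_compact hw).of_forall_sdiff_eq_zero hSm hzero'
  have e1 : beamIntegral γ w (fun z => Y z.1 z.2) (fun z => packetAmplitude γ ε σ x₀ A z i) t x y =
      ∫ z in S, ((σ / ε ^ (1 / 6 : ℝ) : ℝ) : ℂ) * f z := by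
    rw [setIntegral_eq_of_subset_of_forall_sdiff_eq_zero hSm hwS hzero']
    exact setIntegral_congr_fun hw.measurableSet fun z hz => (hfw z hz).symm
  rw [wavePacket, if_pos hy, e1, intervalIntegral.integral_of_le (by positivity),
    ← integral_Icc_eq_integral_Ioc]
  simp only [← integral_Ici_eq_integral_Ioi]
  rw [IntegrableOn] at hint
  rw [Measure.volume_eq_prod, hS, ← Measure.prod_restrict] at hint ⊢
  rw [integral_prod_symm _ hint, ← integral_const_mul]
  refine integral_congr_ae (Eventually.of_forall fun θ => ?_)
  simp only
  rw [← integral_const_mul]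

/-! ### The size of the window -/

theorem abs_le_of_cos_near {e t : ℝ} (he : 0 ≤ e) (ht : |t| ≤ Real.pi) (h : 1 - e ^ 2 ≤ Real.cos t) :
    |t| ≤ Real.pi * e := by
  have h1 := Real.cos_le_one_sub_mul_cos_sq ht
  have hπ := Real.pi_pos
  have h2 : 2 / Real.pi ^ 2 * t ^ 2 ≤ e ^ 2 := by linarith
  have h3 : t ^ 2 ≤ (Real.pi * e) ^ 2 := by
    have : t ^ 2 = Real.pi ^ 2 / 2 * (2 / Real.pi ^ 2 * t ^ 2) := by field_simp
    rw [this, mul_pow]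
    have h4 : Real.pi ^ 2 / 2 * (2 / Real.pi ^ 2 * t ^ 2) ≤ Real.pi ^ 2 / 2 * e ^ 2 := by gcongr
    have h5 : 0 ≤ Real.pi ^ 2 * e ^ 2 := by positivity
    linarith
  exact abs_le_of_sq_le_sq h3 (by positivity)

/-- The angles at distance at most `r` of `φ` or of its neighbours modulo `2π`. -/
def arcs (φ r : ℝ) : Set ℝ :=
  Icc (φ - r) (φ + r) ∪ (Icc (φ + 2 * Real.pi - r) (φ + 2 * Real.pi + r) ∪
    Icc (φ - 2 * Real.pi - r) (φ - 2 * Real.pi + r))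

theorem volume_arcs_le (φ : ℝ) {r : ℝ} (hr : 0 ≤ r) : volume (arcs φ r) ≤ ENNReal.ofReal (6 * r) := by
  have h : ∀ x, volume (Icc (x - r) (x + r)) = ENNReal.ofReal (2 * r) := fun x => by
    rw [Real.volume_Icc]; congr 1; ring
  calc volume (arcs φ r) ≤ ENNReal.ofReal (2 * r) + (ENNReal.ofReal (2 * r) + ENNReal.ofReal (2 * r)) := by
        refine (measure_union_le _ _).trans (add_le_add (h _).le
          ((measure_union_le _ _).trans (add_le_add (h _).le (h _).le)))
    _ = ENNReal.ofReal (6 * r) := by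
        rw [← ENNReal.ofReal_add (by positivity) (by positivity),
          ← ENNReal.ofReal_add (by positivity) (by positivity)]
        congr 1
        ring

/-- The squared chord 2 − 2 cos(θ − φ) is at most 2e², which bounds the distance of θ − φ to 2πℤ by
πe; since |θ − φ| ≤ 2π, only three multiples of 2π occur. -/
theorem mem_arcs {e φ θ : ℝ} (he : 0 ≤ e) (h2 : |θ - φ| ≤ 2 * Real.pi)
    (hs : |Real.sin θ - Real.sin φ| ≤ e) (hc : |Real.cos θ - Real.cos φ| ≤ e) :
    θ ∈ arcs φ (Real.pi * e) := by
  have hcos : 1 - e ^ 2 ≤ Real.cos (θ - φ) := by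
    have h3 : (Real.sin θ - Real.sin φ) ^ 2 ≤ e ^ 2 := sq_le_sq' (abs_le.1 hs).1 (abs_le.1 hs).2
    have h4 : (Real.cos θ - Real.cos φ) ^ 2 ≤ e ^ 2 := sq_le_sq' (abs_le.1 hc).1 (abs_le.1 hc).2
    rw [Real.cos_sub]
    have := Real.sin_sq_add_cos_sq θ
    have := Real.sin_sq_add_cos_sq φ
    linarith only [h3, h4, Real.sin_sq_add_cos_sq θ, Real.sin_sq_add_cos_sq φ]
  obtain ⟨hl, hu⟩ := abs_le.1 h2
  rcases le_total |θ - φ| Real.pi with h | h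
  · have := abs_le.1 (abs_le_of_cos_near he h hcos)
    exact Or.inl ⟨by linarith, by linarith⟩
  · rcases le_total 0 (θ - φ) with h0 | h0
    · rw [abs_of_nonneg h0] at h
      have h5 : |θ - φ - 2 * Real.pi| ≤ Real.pi := abs_le.2 ⟨by linarith, by linarith [Real.pi_pos]⟩
      have := abs_le.1 (abs_le_of_cos_near he h5 (by rwa [Real.cos_sub_two_pi]))
      exact Or.inr (Or.inl ⟨by linarith, by linarith⟩)
    · rw [abs_of_nonpos h0] at h
      have h5 : |θ - φ + 2 * Real.pi| ≤ Real.pi := abs_le.2 ⟨by linarith, by linarith [Real.pi_pos]⟩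
      have := abs_le.1 (abs_le_of_cos_near he h5 (by rwa [Real.cos_add_two_pi]))
      exact Or.inr (Or.inr ⟨by linarith, by linarith⟩)

/-- Two families of arcs, around γ and γ + π, each of total length at most 6πR ε^{1/3}, times radii
of length at most R/σ. -/
theorem volume_window_le {γ η R ε σ : ℝ} (hγ₀ : 0 < γ) (hγ₁ : γ < Real.pi / 2) (hη : 0 < η)
    (hR : 0 < R) (hε : 0 < ε) (hσ : 0 < σ) :
    (volume (window γ η R ε σ)).toReal ≤ 12 * Real.pi * R ^ 2 / σ * ε ^ (1 / 3 : ℝ) := by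
  have he : 0 ≤ R * ε ^ (1 / 3 : ℝ) := by positivity
  have hπ := Real.pi_pos
  have h1 : angularWindow γ R ε ⊆ arcs γ (Real.pi * (R * ε ^ (1 / 3 : ℝ))) ∪
      arcs (γ + Real.pi) (Real.pi * (R * ε ^ (1 / 3 : ℝ))) := by
    rintro θ ⟨hθ, ⟨h2, h3⟩ | ⟨h2, h3⟩⟩
    · exact Or.inl (mem_arcs he (abs_le.2 ⟨by linarith [hθ.1], by linarith [hθ.2]⟩) h2 h3)
    · refine Or.inr (mem_arcs he (abs_le.2 ⟨by linarith [hθ.1], by linarith [hθ.2]⟩) ?_ ?_)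
      · rwa [Real.sin_add_pi, sub_neg_eq_add]
      · rwa [Real.cos_add_pi, sub_neg_eq_add]
  have h2 : volume (angularWindow γ R ε) ≤
      ENNReal.ofReal (12 * (Real.pi * (R * ε ^ (1 / 3 : ℝ)))) := by
    have hr : 0 ≤ Real.pi * (R * ε ^ (1 / 3 : ℝ)) := by positivity
    refine (measure_mono h1).trans ((measure_union_le _ _).trans
      ((add_le_add (volume_arcs_le _ hr) (volume_arcs_le _ hr)).trans (le_of_eq ?_)))
    rw [← ENNReal.ofReal_add (by positivity) (by positivity)]
    congr 1
    ring
  have h3 : volume (window γ η R ε σ) ≤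
      ENNReal.ofReal (R / σ * (12 * (Real.pi * (R * ε ^ (1 / 3 : ℝ))))) := by
    refine (measure_mono (window_subset hσ)).trans ?_
    rw [Measure.volume_eq_prod, Measure.prod_prod, ENNReal.ofReal_mul (by positivity)]
    refine mul_le_mul' ?_ h2
    rw [Real.volume_Icc]
    exact ENNReal.ofReal_le_ofReal (by linarith)
  refine (ENNReal.toReal_le_of_le_ofReal (by positivity) h3).trans (le_of_eq ?_)
  ring

/-! ### The boundary layers and the incident beam -/

/-- `lam` is a root of the characteristic polynomial at which the kernel vector is regular. -/
structure IsLayerRoot (γ ν₀ κ₀ ε ρ θ : ℝ) (lam : ℂ) : Prop where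
  waveK_ne : waveK γ ρ θ ≠ 0
  ne_zero : lam ≠ 0
  denom_ne : Complex.I * Real.sin θ - ε * κ₀ * (waveK γ ρ θ ^ 2 - lam ^ 2) ≠ 0
  root : charPoly γ ν₀ κ₀ ε (Real.sin θ) (waveK γ ρ θ) lam = 0

theorem LayerPoint.isLayerRoot {γ ν₀ κ₀ c B C ε ρ θ : ℝ} {x₁ x₂ x₃ : ℂ}
    (hgap : 0 < criticalGap γ) (hc : 0 < c) (hε : 0 < ε) (hρ : 0 < ρ)
    (h : LayerPoint γ ν₀ κ₀ c B C ε ρ θ x₁ x₂ x₃) :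
    IsLayerRoot γ ν₀ κ₀ ε ρ θ (decay₁ γ ν₀ κ₀ c ε ρ θ) ∧
    IsLayerRoot γ ν₀ κ₀ ε ρ θ (decay₂ γ ν₀ κ₀ c ε ρ θ) ∧
    IsLayerRoot γ ν₀ κ₀ ε ρ θ (decay₃ γ ν₀ κ₀ c ε ρ θ) := by
  obtain ⟨n1, n2, n3⟩ := h.root_ne_zero hc
  obtain ⟨i1, i2, i3⟩ := h.isRoot
  have hd := (layerScale_pos hε hρ).ne'
  have hd' : (layerScale ε ρ : ℂ) ≠ 0 := by exact_mod_cast hd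
  have hρ' : (ρ : ℂ) ≠ 0 := by exact_mod_cast hρ.ne'
  have hk : waveK γ ρ θ ≠ 0 := mul_ne_zero hρ.ne' (h.ne_zero hgap).2.1
  have h6 := (layerScale_pow_six hε hρ).symm
  obtain ⟨e1, e2, e3⟩ := h.decay_eq hc hε hρ
  rw [e1, e2, e3]
  refine ⟨⟨hk, ?_, ?_, i1⟩, ⟨hk, ?_, ?_, i2⟩, ⟨hk, ?_, ?_, i3⟩⟩
  · exact mul_ne_zero hρ' (div_ne_zero n1 (pow_ne_zero _ hd'))
  · rw [waveK, midDenom_eq hd h6]; exact h.denom₁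
  · exact mul_ne_zero hρ' (div_ne_zero n2 (pow_ne_zero _ hd'))
  · rw [waveK, midDenom_eq hd h6]; exact h.denom₂
  · exact mul_ne_zero hρ' (div_ne_zero n3 (pow_ne_zero _ hd'))
  · rw [waveK, largeDenom_eq hd h6]; exact h.denom₃

/-- The amplitudes of the waves in a boundary layer. -/
def layerProfile (γ ν₀ κ₀ ε σ : ℝ) (χ ψ : ℝ → ℂ) (a lam : ℝ → ℝ → ℂ) (ρ θ : ℝ) (i : Fin 4) : ℂ :=
  a ρ θ * amplitude γ ε σ χ ψ ρ θ *
    layerVector γ ν₀ κ₀ ε (freq γ ρ θ) (waveK γ ρ θ) (lam ρ θ) i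

/-- The amplitudes of the waves in the incident beam. -/
def incidentProfile (γ ε σ : ℝ) (χ ψ : ℝ → ℂ) (ρ θ : ℝ) (i : Fin 4) : ℂ :=
  amplitude γ ε σ χ ψ ρ θ * incidentVector γ (waveK γ ρ θ) (waveM γ ρ θ) i

section

variable {γ ν₀ κ₀ ε : ℝ} {w : Set (ℝ × ℝ)} {lam : ℝ → ℝ → ℂ}

theorem continuousOn_layerVector (hρ : ∀ z ∈ w, 0 < z.1)
    (hl : ContinuousOn (fun z : ℝ × ℝ => lam z.1 z.2) w)
    (h : ∀ z ∈ w, IsLayerRoot γ ν₀ κ₀ ε z.1 z.2 (lam z.1 z.2)) :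
    ContinuousOn (fun z : ℝ × ℝ =>
      layerVector γ ν₀ κ₀ ε (freq γ z.1 z.2) (waveK γ z.1 z.2) (lam z.1 z.2)) w := by
  have hk : ContinuousOn (fun z : ℝ × ℝ => (waveK γ z.1 z.2 : ℂ)) w :=
    (Complex.continuous_ofReal.comp (continuous_waveK γ)).continuousOn
  have hk0 : ∀ z ∈ w, (waveK γ z.1 z.2 : ℂ) ≠ 0 := fun z hz => by
    exact_mod_cast (h z hz).waveK_ne
  have hs : ContinuousOn (fun z : ℝ × ℝ => (Real.sin z.2 : ℂ)) w := by fun_prop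
  have hden := fun z hz => (h z hz).denom_ne
  have hden' : ∀ z ∈ w, Complex.I * Real.sin z.2 + ε * κ₀ *
      (lam z.1 z.2 ^ 2 - waveK γ z.1 z.2 ^ 2) ≠ 0 := fun z hz => by
    convert hden z hz using 1
    ring
  have hl0 := fun z hz => (h z hz).ne_zero
  refine ContinuousOn.congr (f := fun z : ℝ × ℝ =>
    layerVector γ ν₀ κ₀ ε (Real.sin z.2) (waveK γ z.1 z.2) (lam z.1 z.2))
    (continuousOn_pi.2 fun i => ?_) fun z hz => by simp only [freq_eq_sin (hρ z hz)]
  fin_cases i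
  · exact continuousOn_const
  · exact (continuousOn_const.mul hk).div hl hl0
  · change ContinuousOn (fun z : ℝ × ℝ =>
      (lam z.1 z.2 * Real.sin γ + Complex.I * waveK γ z.1 z.2 * Real.cos γ) /
      (lam z.1 z.2 * (Complex.I * Real.sin z.2 - ε * κ₀ *
        (waveK γ z.1 z.2 ^ 2 - lam z.1 z.2 ^ 2)))) w
    exact ContinuousOn.div (by fun_prop) (by fun_prop)
      fun z hz => mul_ne_zero (hl0 z hz) (hden z hz)
  · change ContinuousOn (fun z : ℝ × ℝ =>
      1 / (Complex.I * waveK γ z.1 z.2) * (Complex.I * Real.sin z.2 + ε * ν₀ *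
        (lam z.1 z.2 ^ 2 - waveK γ z.1 z.2 ^ 2) + Real.sin γ * ((Real.sin γ + Complex.I *
          waveK γ z.1 z.2 * (lam z.1 z.2)⁻¹ * Real.cos γ) / (Complex.I * Real.sin z.2 + ε * κ₀ *
            (lam z.1 z.2 ^ 2 - waveK γ z.1 z.2 ^ 2))))) w
    have h1 : ContinuousOn (fun z : ℝ × ℝ => 1 / (Complex.I * (waveK γ z.1 z.2 : ℂ))) w :=
      continuousOn_const.div (continuousOn_const.mul hk)
        fun z hz => mul_ne_zero Complex.I_ne_zero (hk0 z hz)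
    have h2 : ContinuousOn (fun z : ℝ × ℝ => (lam z.1 z.2)⁻¹) w := hl.inv₀ hl0
    have h3 : ContinuousOn (fun z : ℝ × ℝ => (Real.sin γ + Complex.I *
          waveK γ z.1 z.2 * (lam z.1 z.2)⁻¹ * Real.cos γ) / (Complex.I * Real.sin z.2 + ε * κ₀ *
            (lam z.1 z.2 ^ 2 - waveK γ z.1 z.2 ^ 2))) w :=
      ContinuousOn.div (by fun_prop) (by fun_prop) hden'
    fun_prop

theorem continuousOn_incidentVector (hρ : ∀ z ∈ w, 0 < z.1)
    (h : ∀ z ∈ w, Real.sin z.2 ≠ 0 ∧ Real.sin (z.2 + γ) ≠ 0 ∧ Real.cos (z.2 + γ) ≠ 0) :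
    ContinuousOn (fun z : ℝ × ℝ => incidentVector γ (waveK γ z.1 z.2) (waveM γ z.1 z.2)) w := by
  have hk : ContinuousOn (fun z : ℝ × ℝ => (waveK γ z.1 z.2 : ℂ)) w :=
    (Complex.continuous_ofReal.comp (continuous_waveK γ)).continuousOn
  have hm : ContinuousOn (fun z : ℝ × ℝ => (waveM γ z.1 z.2 : ℂ)) w :=
    (Complex.continuous_ofReal.comp (continuous_waveM γ)).continuousOn
  have hs : ContinuousOn (fun z : ℝ × ℝ => (Real.sin z.2 : ℂ)) w := by fun_prop
  have hk0 : ∀ z ∈ w, (waveK γ z.1 z.2 : ℂ) ≠ 0 := fun z hz => by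
    exact_mod_cast mul_ne_zero (hρ z hz).ne' (h z hz).2.1
  have hm0 : ∀ z ∈ w, (waveM γ z.1 z.2 : ℂ) ≠ 0 := fun z hz => by
    exact_mod_cast mul_ne_zero (hρ z hz).ne' (h z hz).2.2
  have hs0 : ∀ z ∈ w, (Real.sin z.2 : ℂ) ≠ 0 := fun z hz => by exact_mod_cast (h z hz).1
  have hq : ContinuousOn (fun z : ℝ × ℝ => (waveK γ z.1 z.2 * Real.cos γ
      - waveM γ z.1 z.2 * Real.sin γ : ℂ) / (waveM γ z.1 z.2 * Real.sin z.2)) w :=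
    ContinuousOn.div (by fun_prop) (by fun_prop) fun z hz => mul_ne_zero (hm0 z hz) (hs0 z hz)
  have ho : ∀ z ∈ w, omega γ (waveK γ z.1 z.2) (waveM γ z.1 z.2) = Real.sin z.2 :=
    fun z hz => freq_eq_sin (hρ z hz)
  refine continuousOn_pi.2 fun i => ?_
  fin_cases i
  · exact continuousOn_const
  · exact hk.neg.div hm hm0
  · refine ContinuousOn.congr (f := fun z : ℝ × ℝ => Complex.I * ((waveK γ z.1 z.2 * Real.cos γ
      - waveM γ z.1 z.2 * Real.sin γ : ℂ) / (waveM γ z.1 z.2 * Real.sin z.2))) (by fun_prop)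
      fun z hz => ?_
    beta_reduce
    rw [← ho z hz]
    exact mul_div_assoc _ _ _
  · refine ContinuousOn.congr (f := fun z : ℝ × ℝ => 1 / (waveK γ z.1 z.2 : ℂ) *
      (Real.sin z.2 + Real.sin γ * ((waveK γ z.1 z.2 * Real.cos γ
      - waveM γ z.1 z.2 * Real.sin γ : ℂ) / (waveM γ z.1 z.2 * Real.sin z.2)))) ?_
      fun z hz => ?_
    · have h1 : ContinuousOn (fun z : ℝ × ℝ => 1 / (waveK γ z.1 z.2 : ℂ)) w :=
        continuousOn_const.div hk hk0
      fun_prop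
    · beta_reduce
      rw [← ho z hz]
      rfl

end

section

variable {γ ν₀ κ₀ ε σ η R B x₀ : ℝ} {χ ψ : ℝ → ℂ} {a lam : ℝ → ℝ → ℂ}

theorem continuousOn_layerProfile (hη : 0 < η) (hχ : IsCutoff R B χ) (hψ : IsCutoff R B ψ)
    (ha : ContinuousOn (fun z : ℝ × ℝ => a z.1 z.2) (window γ η R ε σ))
    (hl : ContinuousOn (fun z : ℝ × ℝ => lam z.1 z.2) (window γ η R ε σ))
    (h : ∀ z ∈ window γ η R ε σ, IsLayerRoot γ ν₀ κ₀ ε z.1 z.2 (lam z.1 z.2)) :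
    ContinuousOn (fun z : ℝ × ℝ => layerProfile γ ν₀ κ₀ ε σ χ ψ a lam z.1 z.2)
      (window γ η R ε σ) := by
  have hX := continuousOn_layerVector (fun z hz => hη.trans_le hz.1) hl h
  exact continuousOn_pi.2 fun i =>
    (ha.mul (continuous_amplitude hχ hψ).continuousOn).mul (continuousOn_pi.1 hX i)

theorem isBeam_layerBeam (hε : 0 < ε) (hσ : 0 < σ) (hη : 0 < η) (hχ : IsCutoff R B χ)
    (hψ : IsCutoff R B ψ)
    (ha : ContinuousOn (fun z : ℝ × ℝ => a z.1 z.2) (window γ η R ε σ))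
    (hl : ContinuousOn (fun z : ℝ × ℝ => lam z.1 z.2) (window γ η R ε σ))
    (h : ∀ z ∈ window γ η R ε σ, IsLayerRoot γ ν₀ κ₀ ε z.1 z.2 (lam z.1 z.2)) :
    IsBeam γ (window γ η R ε σ) (fun z => -lam z.1 z.2)
      (packetAmplitude γ ε σ x₀ (layerProfile γ ν₀ κ₀ ε σ χ ψ a lam))
      (layerBeam γ ν₀ κ₀ η x₀ ε σ χ ψ a lam) := by
  refine isBeam_wavePacket (A := layerProfile γ ν₀ κ₀ ε σ χ ψ a lam) hη hσ
    (continuousOn_layerProfile hη hχ hψ ha hl h) hl.neg fun ρ θ hρ hθ hz => ?_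
  funext i
  simp only [layerProfile, amplitude_eq_zero hε hσ hη hχ hψ hρ hθ hz, mul_zero, zero_mul,
    Pi.zero_apply]

theorem solvesLinear_layerBeam (hε : 0 < ε) (hσ : 0 < σ) (hη : 0 < η) (hχ : IsCutoff R B χ)
    (hψ : IsCutoff R B ψ)
    (ha : ContinuousOn (fun z : ℝ × ℝ => a z.1 z.2) (window γ η R ε σ))
    (hl : ContinuousOn (fun z : ℝ × ℝ => lam z.1 z.2) (window γ η R ε σ))
    (h : ∀ z ∈ window γ η R ε σ, IsLayerRoot γ ν₀ κ₀ ε z.1 z.2 (lam z.1 z.2)) :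
    SolvesLinear γ ν₀ κ₀ ε (layerBeam γ ν₀ κ₀ η x₀ ε σ χ ψ a lam) 0 := by
  have hw := isCompact_window (γ := γ) (η := η) (R := R) (ε := ε) hσ
  have hA := continuousOn_packetAmplitude (γ := γ) (ε := ε) (σ := σ) (x₀ := x₀)
    (continuousOn_layerProfile hη hχ hψ ha hl h)
  have hform : ∀ z ∈ window γ η R ε σ, ∃ b : ℂ,
      packetAmplitude γ ε σ x₀ (layerProfile γ ν₀ κ₀ ε σ χ ψ a lam) z = fun i =>
        b * layerVector γ ν₀ κ₀ ε (Real.sin z.2) (waveK γ z.1 z.2) (lam z.1 z.2) i := by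
    intro z hz
    refine ⟨((σ / ε ^ (1 / 6 : ℝ) : ℝ) : ℂ) * Complex.exp (-(Complex.I * waveK γ z.1 z.2 * x₀)) *
      z.1 * (a z.1 z.2 * amplitude γ ε σ χ ψ z.1 z.2), ?_⟩
    funext i
    rw [packetAmplitude, layerProfile, freq_eq_sin (hη.trans_le hz.1)]
    ring
  have hker := fun z hz => layerVector_kernel (h z hz).waveK_ne (h z hz).ne_zero
    (h z hz).denom_ne (h z hz).root
  have key := (isBeam_layerBeam (x₀ := x₀) hε hσ hη hχ hψ ha hl h).solvesLinear (ν₀ := ν₀)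
    (κ₀ := κ₀) (ε := ε) hw hl.neg hA fun z hz => by
      obtain ⟨b, hb⟩ := hform z hz
      rw [hb]
      linear_combination b * (hker z hz).2
  convert key using 1
  funext t x y i
  refine (beamIntegral_zero hw.measurableSet (fun z hz => ?_) t x y).symm
  obtain ⟨b, hb⟩ := hform z hz
  rw [hb, beamSymbol_smul, (hker z hz).1]
  simp

theorem squareIntegrable_layerBeam (hε : 0 < ε) (hσ : 0 < σ) (hη : 0 < η) (hχ : IsCutoff R B χ)
    (hψ : IsCutoff R B ψ)
    (ha : ContinuousOn (fun z : ℝ × ℝ => a z.1 z.2) (window γ η R ε σ))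
    (hl : ContinuousOn (fun z : ℝ × ℝ => lam z.1 z.2) (window γ η R ε σ))
    (h : ∀ z ∈ window γ η R ε σ, IsLayerRoot γ ν₀ κ₀ ε z.1 z.2 (lam z.1 z.2))
    {s₀ c : ℝ} (hs₀ : 0 < s₀) (hs : ∀ z ∈ window γ η R ε σ, s₀ ≤ |Real.sin (z.2 + γ)|)
    (hc : 0 < c) (hre : ∀ z ∈ window γ η R ε σ, c ≤ (lam z.1 z.2).re) :
    SquareIntegrable (layerBeam γ ν₀ κ₀ η x₀ ε σ χ ψ a lam) := by
  refine (isBeam_layerBeam hε hσ hη hχ hψ ha hl h).squareIntegrable fun i t => ?_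
  refine memLp_decaying_beam hs₀ (isCompact_window hσ) (fun z hz => ⟨hz.2.2.1, hs z hz⟩) hl.neg
    (continuousOn_pi.1 (continuousOn_packetAmplitude
      (continuousOn_layerProfile hη hχ hψ ha hl h)) i) hc (fun z hz => ?_) t
  exact neg_le_neg (hre z hz)

theorem continuousOn_incidentProfile (hη : 0 < η) (hχ : IsCutoff R B χ) (hψ : IsCutoff R B ψ)
    (h : ∀ z ∈ window γ η R ε σ, Real.sin z.2 ≠ 0 ∧ Real.sin (z.2 + γ) ≠ 0 ∧
      Real.cos (z.2 + γ) ≠ 0) :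
    ContinuousOn (fun z : ℝ × ℝ => incidentProfile γ ε σ χ ψ z.1 z.2) (window γ η R ε σ) := by
  have hX := continuousOn_incidentVector (fun z hz => hη.trans_le hz.1) h
  exact continuousOn_pi.2 fun i =>
    (continuous_amplitude hχ hψ).continuousOn.mul (continuousOn_pi.1 hX i)

theorem continuous_I_waveM (γ : ℝ) :
    Continuous fun z : ℝ × ℝ => Complex.I * (waveM γ z.1 z.2 : ℂ) :=
  continuous_const.mul (Complex.continuous_ofReal.comp (continuous_waveM γ))

theorem isBeam_incidentBeam (hε : 0 < ε) (hσ : 0 < σ) (hη : 0 < η) (hχ : IsCutoff R B χ)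
    (hψ : IsCutoff R B ψ)
    (h : ∀ z ∈ window γ η R ε σ, Real.sin z.2 ≠ 0 ∧ Real.sin (z.2 + γ) ≠ 0 ∧
      Real.cos (z.2 + γ) ≠ 0) :
    IsBeam γ (window γ η R ε σ) (fun z => Complex.I * waveM γ z.1 z.2)
      (packetAmplitude γ ε σ x₀ (incidentProfile γ ε σ χ ψ))
      (incidentBeam γ η x₀ ε σ χ ψ) := by
  refine isBeam_wavePacket (A := incidentProfile γ ε σ χ ψ)
    (Y := fun ρ θ => Complex.I * waveM γ ρ θ) hη hσ
    (continuousOn_incidentProfile hη hχ hψ h) (continuous_I_waveM γ).continuousOn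
    fun ρ θ hρ hθ hz => ?_
  funext i
  simp only [incidentProfile, amplitude_eq_zero hε hσ hη hχ hψ hρ hθ hz, zero_mul, Pi.zero_apply]

end

/-! ### The boundary conditions -/

/-- At y = 0 the vertical exponent disappears, so beams with different decays have the same phases
and their traces can be added under one integral. -/
theorem beamIntegral_at_boundary {γ : ℝ} {w : Set (ℝ × ℝ)} (Y A : ℝ × ℝ → ℂ) (t x : ℝ) :
    beamIntegral γ w Y A t x 0 = beamIntegral γ w 0 A t x 0 := by
  simp [beamIntegral, beamPhase_apply]

theorem boundaryConditions_of_beams {γ : ℝ} {w : Set (ℝ × ℝ)} (hw : IsCompact w)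
    {Y₀ Y₁ Y₂ Y₃ : ℝ × ℝ → ℂ} {A₀ A₁ A₂ A₃ : ℝ × ℝ → Fin 4 → ℂ} {W₀ W₁ W₂ W₃ : Flow}
    (h₀ : IsBeam γ w Y₀ A₀ W₀) (h₁ : IsBeam γ w Y₁ A₁ W₁) (h₂ : IsBeam γ w Y₂ A₂ W₂)
    (h₃ : IsBeam γ w Y₃ A₃ W₃) (hY₀ : ContinuousOn Y₀ w) (hY₁ : ContinuousOn Y₁ w)
    (hY₂ : ContinuousOn Y₂ w) (hY₃ : ContinuousOn Y₃ w) (hA₀ : ContinuousOn A₀ w)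
    (hA₁ : ContinuousOn A₁ w) (hA₂ : ContinuousOn A₂ w) (hA₃ : ContinuousOn A₃ w)
    (hu : ∀ z ∈ w, A₀ z 0 + A₁ z 0 + A₂ z 0 + A₃ z 0 = 0)
    (hv : ∀ z ∈ w, A₀ z 1 + A₁ z 1 + A₂ z 1 + A₃ z 1 = 0)
    (hb : ∀ z ∈ w, Y₀ z * A₀ z 2 + Y₁ z * A₁ z 2 + Y₂ z * A₂ z 2 + Y₃ z * A₃ z 2 = 0) :
    BoundaryConditions (W₀ + (W₁ + W₂) + W₃) := by
  have c := fun {A : ℝ × ℝ → Fin 4 → ℂ} (hA : ContinuousOn A w) => continuousOn_pi.1 hA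
  have sum : ∀ {B₀ B₁ B₂ B₃ : ℝ × ℝ → ℂ}, ContinuousOn B₀ w → ContinuousOn B₁ w →
      ContinuousOn B₂ w → ContinuousOn B₃ w → (∀ z ∈ w, B₀ z + B₁ z + B₂ z + B₃ z = 0) →
      ∀ t x, beamIntegral γ w Y₀ B₀ t x 0 + (beamIntegral γ w Y₁ B₁ t x 0 +
        beamIntegral γ w Y₂ B₂ t x 0) + beamIntegral γ w Y₃ B₃ t x 0 = 0 := by
    intro B₀ B₁ B₂ B₃ b₀ b₁ b₂ b₃ hB t x
    have h := beamIntegral_add_four (γ := γ) (Y := 0) hw continuousOn_const 1 1 1 1 t x 0 b₀ b₁ b₂ b₃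
    simp only [one_mul] at h
    rw [beamIntegral_at_boundary Y₀, beamIntegral_at_boundary Y₁, beamIntegral_at_boundary Y₂,
      beamIntegral_at_boundary Y₃, ← add_assoc, h, beamIntegral_zero hw.measurableSet hB]
  have hval : ∀ t x y i, 0 ≤ y → (W₀ + (W₁ + W₂) + W₃) t x y i =
      beamIntegral γ w Y₀ (fun z => A₀ z i) t x y + (beamIntegral γ w Y₁ (fun z => A₁ z i) t x y +
        beamIntegral γ w Y₂ (fun z => A₂ z i) t x y) +
          beamIntegral γ w Y₃ (fun z => A₃ z i) t x y := fun t x y i hy => by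
    rw [← h₀ t x y i hy, ← h₁ t x y i hy, ← h₂ t x y i hy, ← h₃ t x y i hy]
    rfl
  intro t x
  refine ⟨?_, ?_, ?_⟩
  · rw [hval t x 0 0 le_rfl]
    exact sum (c hA₀ 0) (c hA₁ 0) (c hA₂ 0) (c hA₃ 0) hu t x
  · rw [hval t x 0 1 le_rfl]
    exact sum (c hA₀ 1) (c hA₁ 1) (c hA₂ 1) (c hA₃ 1) hv t x
  · have hd := ((hasDerivAt_beamIntegral_y (γ := γ) hw hY₀ (c hA₀ 2) t x 0).add
      ((hasDerivAt_beamIntegral_y (γ := γ) hw hY₁ (c hA₁ 2) t x 0).add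
        (hasDerivAt_beamIntegral_y (γ := γ) hw hY₂ (c hA₂ 2) t x 0))).add
      (hasDerivAt_beamIntegral_y (γ := γ) hw hY₃ (c hA₃ 2) t x 0)
    have hd' := hd.congr_deriv (sum (hY₀.mul (c hA₀ 2)) (hY₁.mul (c hA₁ 2)) (hY₂.mul (c hA₂ 2))
      (hY₃.mul (c hA₃ 2)) hb t x)
    -- The integrals are differentiable across y = 0, but the flow coincides with them only for y ≥
    -- 0; hence a one-sided derivative.
    exact hd'.hasDerivWithinAt.congr (fun y hy => hval t x y 2 hy) (hval t x 0 2 le_rfl)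

/-! ### The remainder of the incident beam -/

/-- The right-hand side of the linear system for the incident beam. -/
def incidentRemainder (γ ν₀ κ₀ η x₀ R ε σ : ℝ) (χ ψ : ℝ → ℂ) (t x y : ℝ) (i : Fin 3) : ℂ :=
  beamIntegral γ (window γ η R ε σ) (fun z => Complex.I * waveM γ z.1 z.2)
    (fun z => ((![ν₀, ν₀, κ₀] i * (ε * z.1 ^ 2) : ℝ) : ℂ) *
      packetAmplitude γ ε σ x₀ (incidentProfile γ ε σ χ ψ) z i.castSucc) t x y

theorem norm_packetAmplitude {γ ε σ x₀ : ℝ} (hε : 0 < ε) (hσ : 0 < σ)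
    (A : ℝ → ℝ → Fin 4 → ℂ) {z : ℝ × ℝ} (hz : 0 < z.1) (i : Fin 4) :
    ‖packetAmplitude γ ε σ x₀ A z i‖ = σ / ε ^ (1 / 6 : ℝ) * z.1 * ‖A z.1 z.2 i‖ := by
  have e : ‖Complex.exp (-(Complex.I * waveK γ z.1 z.2 * x₀))‖ = 1 := by
    rw [Complex.norm_exp, Real.exp_eq_one_iff, Complex.neg_re, Complex.re_mul_ofReal,
      Complex.re_mul_ofReal, Complex.I_re, zero_mul, zero_mul, neg_zero]
  rw [packetAmplitude, norm_mul, norm_mul, norm_mul, e, mul_one, Complex.norm_real,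
    Complex.norm_real, Real.norm_eq_abs, Real.norm_eq_abs, abs_of_pos hz, abs_of_pos (by positivity)]

section

variable {γ ν₀ κ₀ ε σ η R B x₀ : ℝ} {χ ψ : ℝ → ℂ}

theorem solvesLinear_incidentBeam (hε : 0 < ε) (hσ : 0 < σ) (hη : 0 < η) (hχ : IsCutoff R B χ)
    (hψ : IsCutoff R B ψ)
    (h : ∀ z ∈ window γ η R ε σ, Real.sin z.2 ≠ 0 ∧ Real.sin (z.2 + γ) ≠ 0 ∧
      Real.cos (z.2 + γ) ≠ 0) :
    SolvesLinear γ ν₀ κ₀ ε (incidentBeam γ η x₀ ε σ χ ψ)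
      (incidentRemainder γ ν₀ κ₀ η x₀ R ε σ χ ψ) := by
  have hw := isCompact_window (γ := γ) (η := η) (R := R) (ε := ε) hσ
  have hform : ∀ z ∈ window γ η R ε σ, ∃ b : ℂ,
      packetAmplitude γ ε σ x₀ (incidentProfile γ ε σ χ ψ) z = fun i =>
        b * incidentVector γ (waveK γ z.1 z.2) (waveM γ z.1 z.2) i := by
    intro z hz
    refine ⟨((σ / ε ^ (1 / 6 : ℝ) : ℝ) : ℂ) * Complex.exp (-(Complex.I * waveK γ z.1 z.2 * x₀)) *
      z.1 * amplitude γ ε σ χ ψ z.1 z.2, ?_⟩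
    funext i
    rw [packetAmplitude, incidentProfile]
    ring
  have hsym := fun z (hz : z ∈ window γ η R ε σ) =>
    (incidentVector_symbol (ν₀ := ν₀) (κ₀ := κ₀) (ε := ε) (hη.trans_le hz.1).ne' (h z hz).1
      (h z hz).2.1 (h z hz).2.2 (freq_eq_sin (hη.trans_le hz.1))).2
  have key := (isBeam_incidentBeam (x₀ := x₀) hε hσ hη hχ hψ h).solvesLinear (ν₀ := ν₀)
    (κ₀ := κ₀) (ε := ε) hw (continuous_I_waveM γ).continuousOn
    (continuousOn_packetAmplitude (continuousOn_incidentProfile hη hχ hψ h)) fun z hz => by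
      obtain ⟨b, hb⟩ := hform z hz
      rw [hb]
      linear_combination b * (hsym z hz).2
  convert key using 1
  funext t x y i
  refine beamIntegral_congr hw.measurableSet (fun z hz => ?_) t x y
  obtain ⟨b, hb⟩ := hform z hz
  rw [hb, beamSymbol_smul, (hsym z hz).1]
  generalize incidentVector γ (waveK γ z.1 z.2) (waveM γ z.1 z.2) = X
  fin_cases i <;> simp <;> ring

theorem squareIntegrable_incidentBeam (hε : 0 < ε) (hσ : 0 < σ) (hη : 0 < η)
    (hχ : IsCutoff R B χ) (hψ : IsCutoff R B ψ)
    (h : ∀ z ∈ window γ η R ε σ, Real.sin z.2 ≠ 0 ∧ Real.sin (z.2 + γ) ≠ 0 ∧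
      Real.cos (z.2 + γ) ≠ 0) :
    SquareIntegrable (incidentBeam γ η x₀ ε σ χ ψ) := by
  have hw := isCompact_window (γ := γ) (η := η) (R := R) (ε := ε) hσ
  refine (isBeam_incidentBeam hε hσ hη hχ hψ h).squareIntegrable fun i t => ?_
  have hA := continuousOn_pi.1 (continuousOn_packetAmplitude (γ := γ) (ε := ε) (σ := σ) (x₀ := x₀)
    (continuousOn_incidentProfile hη hχ hψ h)) i
  obtain ⟨M, hM⟩ := hw.exists_bound_of_continuousOn hA
  refine (memLp_plane_beam hw (fun z hz => ⟨hη.trans_le hz.1, hz.2.2.1⟩) hA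
    (K := M ^ 2 / η) (by positivity) (fun z hz => ?_) t).1
  calc _ ≤ M ^ 2 := by have := hM z hz; gcongr
    _ = M ^ 2 / η * η := by field_simp
    _ ≤ M ^ 2 / η * z.1 := by have := hz.1; gcongr

theorem incidentRemainder_bound (hγ₀ : 0 < γ) (hγ₁ : γ < Real.pi / 2) (hν : 0 < ν₀) (hκ : 0 < κ₀)
    (hR : 0 < R) (hε : 0 < ε) (hσ : 0 < σ) (hη : 0 < η) (hχ : IsCutoff R B χ)
    (hψ : IsCutoff R B ψ)
    (h : ∀ z ∈ window γ η R ε σ, Real.sin z.2 ≠ 0 ∧ Real.sin (z.2 + γ) ≠ 0 ∧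
      Real.cos (z.2 + γ) ≠ 0) {g : ℝ} (hg : 0 < g)
    (hcos : ∀ z ∈ window γ η R ε σ, g ≤ |Real.cos (z.2 + γ)|) (t : ℝ) (i : Fin 3) :
    MemLp (fun z : ℝ × ℝ => incidentRemainder γ ν₀ κ₀ η x₀ R ε σ χ ψ t z.1 z.2 i) 2 halfPlane ∧
    eLpNorm (fun z : ℝ × ℝ => incidentRemainder γ ν₀ κ₀ η x₀ R ε σ χ ψ t z.1 z.2 i) 2 halfPlane ≤
      ENNReal.ofReal (2 * Real.pi * ((ν₀ + κ₀) * (2 * B ^ 3 / g)) * √(12 * Real.pi * R ^ 7) * ε *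
        σ ^ (-2 : ℝ)) := by
  have hw := isCompact_window (γ := γ) (η := η) (R := R) (ε := ε) hσ
  have hB : 0 ≤ B := (norm_nonneg _).trans (hχ.2.2 0)
  set D := (ν₀ + κ₀) * (2 * B ^ 3 / g) with hD
  have hD0 : 0 ≤ D := by positivity
  have hA : ContinuousOn (fun z : ℝ × ℝ => ((![ν₀, ν₀, κ₀] i * (ε * z.1 ^ 2) : ℝ) : ℂ) *
      packetAmplitude γ ε σ x₀ (incidentProfile γ ε σ χ ψ) z i.castSucc) (window γ η R ε σ) := by
    have h1 : Continuous fun z : ℝ × ℝ => ((![ν₀, ν₀, κ₀] i * (ε * z.1 ^ 2) : ℝ) : ℂ) := by fun_prop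
    exact h1.continuousOn.mul (continuousOn_pi.1 (continuousOn_packetAmplitude
      (continuousOn_incidentProfile hη hχ hψ h)) _)
  have hvec : ∀ z ∈ window γ η R ε σ,
      ‖incidentVector γ (waveK γ z.1 z.2) (waveM γ z.1 z.2) i.castSucc‖ ≤ 1 / g := by
    intro z hz
    obtain ⟨⟨e0, e1, e2⟩, -⟩ := incidentVector_symbol (ν₀ := ν₀) (κ₀ := κ₀) (ε := ε)
      (hη.trans_le hz.1).ne' (h z hz).1 (h z hz).2.1 (h z hz).2.2 (freq_eq_sin (hη.trans_le hz.1))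
    have hgz := hcos z hz
    have hg1 : 1 ≤ 1 / g := (one_le_div hg).2 (hgz.trans (Real.abs_cos_le_one _))
    fin_cases i
    · change ‖incidentVector γ (waveK γ z.1 z.2) (waveM γ z.1 z.2) 0‖ ≤ _
      rw [e0, norm_one]
      exact hg1
    · change ‖incidentVector γ (waveK γ z.1 z.2) (waveM γ z.1 z.2) 1‖ ≤ _
      rw [e1, norm_div, norm_neg, Complex.norm_real, Complex.norm_real, Real.norm_eq_abs,
        Real.norm_eq_abs]
      gcongr
      exact Real.abs_sin_le_one _
    · change ‖incidentVector γ (waveK γ z.1 z.2) (waveM γ z.1 z.2) 2‖ ≤ _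
      rw [e2, norm_div, Complex.norm_I, Complex.norm_real, Real.norm_eq_abs]
      gcongr
  have hcoef : |![ν₀, ν₀, κ₀] i| ≤ ν₀ + κ₀ := by
    fin_cases i
    · change |ν₀| ≤ _; rw [abs_of_pos hν]; linarith
    · change |ν₀| ≤ _; rw [abs_of_pos hν]; linarith
    · change |κ₀| ≤ _; rw [abs_of_pos hκ]; linarith
  -- The squared amplitude of the remainder is of order ε²(σ ε^{-1/6})² ρ⁶; one power of ρ is kept
  -- for the weight and ρ⁵ is bounded by (R/σ)⁵. Times the area of the window this is of order ε²
  -- σ^{-4}, the powers ε^{∓1/3} having cancelled.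
  set K := D ^ 2 * ε ^ 2 * (σ / ε ^ (1 / 6 : ℝ)) ^ 2 * (R / σ) ^ 5 with hK
  have hAK : ∀ z ∈ window γ η R ε σ, ‖((![ν₀, ν₀, κ₀] i * (ε * z.1 ^ 2) : ℝ) : ℂ) *
      packetAmplitude γ ε σ x₀ (incidentProfile γ ε σ χ ψ) z i.castSucc‖ ^ 2 ≤ K * z.1 := by
    intro z hz
    have hz0 : 0 < z.1 := hη.trans_le hz.1
    have hzR : z.1 ≤ R / σ := (window_subset hσ hz).1.2
    have h1 : ‖((![ν₀, ν₀, κ₀] i * (ε * z.1 ^ 2) : ℝ) : ℂ) *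
      packetAmplitude γ ε σ x₀ (incidentProfile γ ε σ χ ψ) z i.castSucc‖ ≤
        (ν₀ + κ₀) * (ε * z.1 ^ 2) * (σ / ε ^ (1 / 6 : ℝ) * z.1 * (2 * B ^ 3 * (1 / g))) := by
      rw [norm_mul, Complex.norm_real, Real.norm_eq_abs, abs_mul,
        abs_of_pos (show 0 < ε * z.1 ^ 2 by positivity), norm_packetAmplitude hε hσ _ hz0,
        incidentProfile, norm_mul]
      gcongr
      · exact norm_amplitude_le hχ hψ _ _
      · exact hvec z hz
    calc _ ≤ ((ν₀ + κ₀) * (ε * z.1 ^ 2) *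
          (σ / ε ^ (1 / 6 : ℝ) * z.1 * (2 * B ^ 3 * (1 / g)))) ^ 2 := by gcongr
      _ = D ^ 2 * ε ^ 2 * (σ / ε ^ (1 / 6 : ℝ)) ^ 2 * z.1 ^ 5 * z.1 := by rw [hD]; ring
      _ ≤ K * z.1 := by rw [hK]; gcongr
  obtain ⟨m1, m2⟩ := memLp_plane_beam hw (fun z hz => ⟨hη.trans_le hz.1, hz.2.2.1⟩) hA
    (K := K) (by positivity) hAK t
  refine ⟨m1, m2.trans (ENNReal.ofReal_le_ofReal ?_)⟩
  have hvol := volume_window_le (η := η) hγ₀ hγ₁ hη hR hε hσ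
  have h13 : ε ^ (1 / 3 : ℝ) = (ε ^ (1 / 6 : ℝ)) ^ 2 := by
    rw [← Real.rpow_natCast, ← Real.rpow_mul hε.le]; norm_num
  have hσ2 : σ ^ (-2 : ℝ) = 1 / σ ^ 2 := by
    rw [Real.rpow_neg hσ.le, one_div]; norm_num
  have hsq : √(K * (volume (window γ η R ε σ)).toReal) ≤
      D * √(12 * Real.pi * R ^ 7) * ε * σ ^ (-2 : ℝ) := by
    refine Real.sqrt_le_iff.2 ⟨by positivity, ?_⟩
    calc K * (volume (window γ η R ε σ)).toReal
        ≤ K * (12 * Real.pi * R ^ 2 / σ * ε ^ (1 / 3 : ℝ)) := by gcongr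
      _ = D ^ 2 * (12 * Real.pi * R ^ 7) * ε ^ 2 * (1 / σ ^ 2) ^ 2 := by
        have : ε ^ (1 / 6 : ℝ) ≠ 0 := by positivity
        rw [hK, h13]
        field_simp
      _ = (D * √(12 * Real.pi * R ^ 7) * ε * σ ^ (-2 : ℝ)) ^ 2 := by
        have hr := Real.sq_sqrt (show 0 ≤ 12 * Real.pi * R ^ 7 by positivity)
        rw [hσ2]
        linear_combination (-(D ^ 2 * ε ^ 2 * (1 / σ ^ 2) ^ 2)) * hr
  calc 2 * Real.pi * √(K * (volume (window γ η R ε σ)).toReal)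
      ≤ 2 * Real.pi * (D * √(12 * Real.pi * R ^ 7) * ε * σ ^ (-2 : ℝ)) := by gcongr
    _ = _ := by ring

end

/-! ### The reflected beam -/

theorem reflected_boundaryConditions {γ ν₀ κ₀ c B C ε σ η R M x₀ : ℝ} {χ ψ : ℝ → ℂ}
    (hgap : 0 < criticalGap γ) (hc : 0 < c) (hε : 0 < ε) (hσ : 0 < σ) (hη : 0 < η)
    (hχ : IsCutoff R M χ) (hψ : IsCutoff R M ψ)
    (hw : ∀ z ∈ window γ η R ε σ, 0 < z.1 ∧
      ∃ x₁ x₂ x₃, LayerPoint γ ν₀ κ₀ c B C ε z.1 z.2 x₁ x₂ x₃) :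
    BoundaryConditions (incidentBeam γ η x₀ ε σ χ ψ +
      (layerBeam γ ν₀ κ₀ η x₀ ε σ χ ψ (layerAmp₁ γ ν₀ κ₀ c ε) (decay₁ γ ν₀ κ₀ c ε) +
        layerBeam γ ν₀ κ₀ η x₀ ε σ χ ψ (layerAmp₂ γ ν₀ κ₀ c ε) (decay₂ γ ν₀ κ₀ c ε)) +
      layerBeam γ ν₀ κ₀ η x₀ ε σ χ ψ (layerAmp₃ γ ν₀ κ₀ c ε) (decay₃ γ ν₀ κ₀ c ε)) := by
  have hne : ∀ z ∈ window γ η R ε σ, Real.sin z.2 ≠ 0 ∧ Real.sin (z.2 + γ) ≠ 0 ∧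
      Real.cos (z.2 + γ) ≠ 0 := fun z hz => by
    obtain ⟨-, x₁, x₂, x₃, h⟩ := hw z hz
    exact h.ne_zero hgap
  have hroot : ∀ z ∈ window γ η R ε σ,
      IsLayerRoot γ ν₀ κ₀ ε z.1 z.2 (decay₁ γ ν₀ κ₀ c ε z.1 z.2) ∧
      IsLayerRoot γ ν₀ κ₀ ε z.1 z.2 (decay₂ γ ν₀ κ₀ c ε z.1 z.2) ∧
      IsLayerRoot γ ν₀ κ₀ ε z.1 z.2 (decay₃ γ ν₀ κ₀ c ε z.1 z.2) := fun z hz => by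
    obtain ⟨hρ, x₁, x₂, x₃, h⟩ := hw z hz
    exact h.isLayerRoot hgap hc hε hρ
  obtain ⟨s1, s2, s3⟩ := contDiffOn_decay hc hε hw
  obtain ⟨t1, t2, t3⟩ := contDiffOn_layerAmp hgap hc hε hw
  have b0 := isBeam_incidentBeam (x₀ := x₀) hε hσ hη hχ hψ hne
  have b1 := isBeam_layerBeam (x₀ := x₀) hε hσ hη hχ hψ t1.continuousOn s1.continuousOn
    fun z hz => (hroot z hz).1
  have b2 := isBeam_layerBeam (x₀ := x₀) hε hσ hη hχ hψ t2.continuousOn s2.continuousOn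
    fun z hz => (hroot z hz).2.1
  have b3 := isBeam_layerBeam (x₀ := x₀) hε hσ hη hχ hψ t3.continuousOn s3.continuousOn
    fun z hz => (hroot z hz).2.2
  have hcancel : ∀ z ∈ window γ η R ε σ,
      let a₁ := layerAmp₁ γ ν₀ κ₀ c ε z.1 z.2
      let a₂ := layerAmp₂ γ ν₀ κ₀ c ε z.1 z.2
      let a₃ := layerAmp₃ γ ν₀ κ₀ c ε z.1 z.2
      let l₁ := decay₁ γ ν₀ κ₀ c ε z.1 z.2
      let l₂ := decay₂ γ ν₀ κ₀ c ε z.1 z.2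
      let l₃ := decay₃ γ ν₀ κ₀ c ε z.1 z.2
      let k := waveK γ z.1 z.2
      let f := freq γ z.1 z.2
      1 + a₁ + a₂ + a₃ = 0 ∧
      -(k : ℂ) / waveM γ z.1 z.2 + a₁ * (Complex.I * k / l₁) + a₂ * (Complex.I * k / l₂)
        + a₃ * (Complex.I * k / l₃) = 0 ∧
      -(z.1 : ℂ) = a₁ * (l₁ * layerVector γ ν₀ κ₀ ε f k l₁ 2) +
        a₂ * (l₂ * layerVector γ ν₀ κ₀ ε f k l₂ 2) +
        a₃ * (l₃ * layerVector γ ν₀ κ₀ ε f k l₃ 2) := by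
    intro z hz
    obtain ⟨hρ, x₁, x₂, x₃, h⟩ := hw z hz
    obtain ⟨d1, d2, d3⟩ := h.decay_eq hc hε hρ
    obtain ⟨a1, a2, a3⟩ := h.amp_eq hc hε hρ
    obtain ⟨n1, n2, n3⟩ := h.root_ne_zero hc
    simp only [d1, d2, d3, a1, a2, a3, freq_eq_sin hρ]
    exact amplitudes_cancel (layerScale_pos hε hρ).ne' hρ.ne' (hne z hz).2.2 (hne z hz).2.1
      (layerScale_pow_six hε hρ).symm n1 n2 n3 h.denom₁ h.denom₂ h.denom₃ h.det
  refine boundaryConditions_of_beams (isCompact_window hσ) b0 b1 b2 b3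
    (continuous_I_waveM γ).continuousOn s1.continuousOn.neg s2.continuousOn.neg
    s3.continuousOn.neg
    (continuousOn_packetAmplitude (continuousOn_incidentProfile hη hχ hψ hne))
    (continuousOn_packetAmplitude (continuousOn_layerProfile hη hχ hψ t1.continuousOn
      s1.continuousOn fun z hz => (hroot z hz).1))
    (continuousOn_packetAmplitude (continuousOn_layerProfile hη hχ hψ t2.continuousOn
      s2.continuousOn fun z hz => (hroot z hz).2.1))
    (continuousOn_packetAmplitude (continuousOn_layerProfile hη hχ hψ t3.continuousOn
      s3.continuousOn fun z hz => (hroot z hz).2.2)) ?_ ?_ ?_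
  all_goals
    intro z hz
    obtain ⟨c0, c1, c2⟩ := hcancel z hz
    simp only [packetAmplitude, incidentProfile, layerProfile]
    generalize ((σ / ε ^ (1 / 6 : ℝ) : ℝ) : ℂ) * Complex.exp (-(Complex.I * waveK γ z.1 z.2 * x₀))
      = p
    generalize amplitude γ ε σ χ ψ z.1 z.2 = b
  · change p * z.1 * (b * 1) + p * z.1 * (_ * b * 1) + p * z.1 * (_ * b * 1)
      + p * z.1 * (_ * b * 1) = 0
    linear_combination (p * z.1 * b) * c0
  · change p * z.1 * (b * (-(waveK γ z.1 z.2 : ℂ) / waveM γ z.1 z.2)) +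
      p * z.1 * (_ * b * (Complex.I * waveK γ z.1 z.2 / _)) +
      p * z.1 * (_ * b * (Complex.I * waveK γ z.1 z.2 / _)) +
      p * z.1 * (_ * b * (Complex.I * waveK γ z.1 z.2 / _)) = 0
    linear_combination (p * z.1 * b) * c1
  · obtain ⟨⟨-, -, e2⟩, -⟩ := incidentVector_symbol (ν₀ := ν₀) (κ₀ := κ₀) (ε := ε)
      (hw z hz).1.ne' (hne z hz).1 (hne z hz).2.1 (hne z hz).2.2 (freq_eq_sin (hw z hz).1)
    have hm : (Real.cos (z.2 + γ) : ℂ) ≠ 0 := by exact_mod_cast (hne z hz).2.2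
    -- The incident buoyancy is i/cos(θ+γ), so its vertical derivative contributes i m · i/cos(θ+γ)
    -- = −ρ, the datum of the third equation for the amplitudes.
    have e3 : Complex.I * waveM γ z.1 z.2 *
        incidentVector γ (waveK γ z.1 z.2) (waveM γ z.1 z.2) 2 = -z.1 := by
      rw [e2, waveM, Complex.ofReal_mul]
      field_simp
      rw [Complex.I_sq, neg_one_mul]
    linear_combination (p * z.1 * b) * e3 + (p * z.1 * b) * c2

/-- Criterion for linear boundary layer beam waves. -/
theorem isLinearLayerBeam_layerBeam {γ ν₀ κ₀ η x₀ μ R B ε₀ α β p q s₀ c₀ C₀ C₁ : ℝ}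
    {χ ψ : ℝ → ℝ → ℝ → ℂ} {a lam : ℝ → ℝ → ℝ → ℂ} {ℓ : ℝ → ℂ} (hη : 0 < η) (hα : 0 < α)
    (hβ : 0 ≤ β) (hs₀ : 0 < s₀) (hc₀ : 0 < c₀) (hχ : ∀ ε σ, IsCutoff R B (χ ε σ))
    (hψ : ∀ ε σ, IsCutoff R B (ψ ε σ))
    (hsin : ∀ ε σ, Admissible μ ε₀ ε σ → ∀ z ∈ window γ η R ε σ, s₀ ≤ |Real.sin (z.2 + γ)|)
    (hlam : ∀ ε σ, Admissible μ ε₀ ε σ →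
      ContDiffOn ℝ ∞ (fun z : ℝ × ℝ => lam ε z.1 z.2) (window γ η R ε σ))
    (hamp : ∀ ε σ, Admissible μ ε₀ ε σ →
      ContDiffOn ℝ ∞ (fun z : ℝ × ℝ => a ε z.1 z.2) (window γ η R ε σ))
    (hroot : ∀ ε σ, Admissible μ ε₀ ε σ → ∀ z ∈ window γ η R ε σ,
      IsLayerRoot γ ν₀ κ₀ ε z.1 z.2 (lam ε z.1 z.2))
    (hsize : ∀ ε σ, Admissible μ ε₀ ε σ → ∀ ρ θ, (ρ, θ) ∈ window γ η R ε σ →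
      c₀ * ε ^ (-α) * ρ ^ β ≤ (lam ε ρ θ).re ∧ ‖lam ε ρ θ‖ ≤ C₀ * ε ^ (-α) * ρ ^ β)
    (hbound : ∀ ε σ, Admissible μ ε₀ ε σ → ∀ ρ θ, (ρ, θ) ∈ window γ η R ε σ →
      ‖a ε ρ θ‖ ≤ C₁ * ε ^ p * ρ ^ q)
    (hℓ : ∀ ε, 0 < ε → ε < ε₀ → ContDiffOn ℝ ∞ ℓ (angularWindow γ R ε))
    (hℓ0 : ∀ ε, 0 < ε → ε < ε₀ → ∀ θ ∈ angularWindow γ R ε, 0 < (ℓ θ).re)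
    (hlim : ∀ ρ θ, η ≤ ρ → (∀ᶠ ε in 𝓝[>] (0 : ℝ), θ ∈ angularWindow γ R ε) →
      Tendsto (fun ε : ℝ => ((ε ^ α : ℝ) : ℂ) * lam ε ρ θ) (𝓝[>] 0)
        (𝓝 (((ρ ^ β : ℝ) : ℂ) * ℓ θ))) :
    IsLinearLayerBeam γ ν₀ κ₀ η x₀ μ R ε₀ χ ψ α β p q lam ℓ
      (fun ε σ => layerBeam γ ν₀ κ₀ η x₀ ε σ (χ ε σ) (ψ ε σ) (a ε) (lam ε)) where
  alpha_pos := hα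
  decay_smooth := hlam
  decay_pos ε σ ha ρ θ hz := by
    have := ha.1
    have := hη.trans_le hz.1
    exact lt_of_lt_of_le (by positivity) (hsize ε σ ha ρ θ hz).1
  decay_size := ⟨c₀, C₀, hc₀, hsize⟩
  profile_smooth := hℓ
  profile_pos := hℓ0
  decay_limit := hlim
  packet := ⟨a, hamp, ⟨C₁, hbound⟩, fun _ _ _ => rfl⟩
  solves ε σ ha := solvesLinear_layerBeam ha.1 ((Real.rpow_nonneg ha.1.le μ).trans_lt ha.2.2.1) hη
    (hχ ε σ) (hψ ε σ) (hamp ε σ ha).continuousOn (hlam ε σ ha).continuousOn (hroot ε σ ha)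
  square_integrable ε σ ha := by
    have hε := ha.1
    refine squareIntegrable_layerBeam hε ((Real.rpow_nonneg hε.le μ).trans_lt ha.2.2.1) hη
      (hχ ε σ) (hψ ε σ) (hamp ε σ ha).continuousOn (hlam ε σ ha).continuousOn (hroot ε σ ha)
      hs₀ (hsin ε σ ha) (c := c₀ * ε ^ (-α) * η ^ β) (by positivity) fun z hz => ?_
    refine le_trans ?_ (hsize ε σ ha z.1 z.2 hz).1
    have := hz.1
    gcongr

end CriticalReflection
end

/-! ### The reflection theorem: assembly of roots, layers and remainder. -/

open CriticalReflection in
theorem proposition3p1 (γ ν₀ κ₀ : ℝ) (hγ₀ : 0 < γ) (hγ₁ : γ < Real.pi / 2)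
    (hγ₂ : γ ≠ Real.pi / 4) (hν : 0 < ν₀) (hκ : 0 < κ₀) :
    ∃ ℓ₁ ℓ₂ ℓ₃ : ℝ → ℂ,
      ∀ (η x₀ μ R B : ℝ) (χ ψ : ℝ → ℝ → ℝ → ℂ), 0 < η → 0 < μ → μ < 1 / 8 → 0 < R →
        (∀ ε σ, IsCutoff R B (χ ε σ)) → (∀ ε σ, IsCutoff R B (ψ ε σ)) →
        ∃ (ε₀ C : ℝ) (lam₁ lam₂ lam₃ : ℝ → ℝ → ℝ → ℂ)
          (W₁ W₂ W₃ Wthird Whalf W₀ : ℝ → ℝ → Flow)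
          (r : ℝ → ℝ → ℝ → ℝ → ℝ → Fin 3 → ℂ), 0 < ε₀ ∧
          -- exactly three roots with positive real part, and their asymptotics
          (∀ ε σ, Admissible μ ε₀ ε σ → ∀ ρ θ, (ρ, θ) ∈ window γ η R ε σ →
            (∀ z : ℂ, (charPoly γ ν₀ κ₀ ε (freq γ ρ θ) (waveK γ ρ θ) z = 0 ∧ 0 < z.re) ↔
              (z = lam₁ ε ρ θ ∨ z = lam₂ ε ρ θ ∨ z = lam₃ ε ρ θ)) ∧
            lam₁ ε ρ θ ≠ lam₂ ε ρ θ ∧ lam₁ ε ρ θ ≠ lam₃ ε ρ θ ∧ lam₂ ε ρ θ ≠ lam₃ ε ρ θ ∧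
            ‖lam₁ ε ρ θ - ((ε ^ (-(1 / 3) : ℝ) * ρ ^ (1 / 3 : ℝ) : ℝ) : ℂ) * ℓ₁ θ‖ ≤
              C * (ρ + |zeta γ ρ θ| * ε ^ (-(2 / 3) : ℝ) * ρ ^ (-(1 / 3) : ℝ)) ∧
            ‖lam₂ ε ρ θ - ((ε ^ (-(1 / 3) : ℝ) * ρ ^ (1 / 3 : ℝ) : ℝ) : ℂ) * ℓ₂ θ‖ ≤
              C * (ρ + |zeta γ ρ θ| * ε ^ (-(2 / 3) : ℝ) * ρ ^ (-(1 / 3) : ℝ)) ∧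
            ‖lam₃ ε ρ θ - ((ε ^ (-(1 / 2) : ℝ) : ℝ) : ℂ) * ℓ₃ θ‖ ≤ C * ε ^ (-(1 / 6) : ℝ)) ∧
          -- the boundary layer beam waves
          IsLinearLayerBeam γ ν₀ κ₀ η x₀ μ R ε₀ χ ψ (1 / 3) (1 / 3) (-(1 / 3)) (-(2 / 3))
            lam₁ ℓ₁ W₁ ∧
          IsLinearLayerBeam γ ν₀ κ₀ η x₀ μ R ε₀ χ ψ (1 / 3) (1 / 3) (-(1 / 3)) (-(2 / 3))
            lam₂ ℓ₂ W₂ ∧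
          IsLinearLayerBeam γ ν₀ κ₀ η x₀ μ R ε₀ χ ψ (1 / 2) 0 (-(1 / 6)) (-(1 / 3))
            lam₃ ℓ₃ W₃ ∧
          (∀ ε σ, Wthird ε σ = W₁ ε σ + W₂ ε σ) ∧ Whalf = W₃ ∧
          -- the approximate solution
          ∀ ε σ, Admissible μ ε₀ ε σ →
            W₀ ε σ = incidentBeam γ η x₀ ε σ (χ ε σ) (ψ ε σ) + Wthird ε σ + Whalf ε σ ∧
            SquareIntegrable (incidentBeam γ η x₀ ε σ (χ ε σ) (ψ ε σ)) ∧
            SolvesLinear γ ν₀ κ₀ ε (W₀ ε σ) (r ε σ) ∧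
            BoundaryConditions (W₀ ε σ) ∧
            ∀ t, ∀ i : Fin 3,
              MemLp (fun z : ℝ × ℝ => r ε σ t z.1 z.2 i) 2 halfPlane ∧
              eLpNorm (fun z : ℝ × ℝ => r ε σ t z.1 z.2 i) 2 halfPlane ≤
                ENNReal.ofReal (C * ε * σ ^ (-2 : ℝ)) := by
  have hgap := criticalGap_pos hγ₀ hγ₁ hγ₂
  have hs : 0 < κ₀ + ν₀ := by linarith
  refine ⟨fun θ => midProfile γ ν₀ κ₀ (Real.sin θ) (Real.sin (θ + γ)),
    fun θ => (starRingEnd ℂ) (midProfile γ ν₀ κ₀ (Real.sin θ) (Real.sin (θ + γ))),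
    fun θ => largeProfile ν₀ κ₀ (Real.sin θ), ?_⟩
  intro η x₀ μ R M χ ψ hη hμ hμ1 hR hχ hψ
  obtain ⟨ε₀, hε₀, hε₀1, hsm, c, hc, B, hB, C, hC, hpt⟩ :=
    exists_layerPoint hγ₀ hγ₁ hγ₂ hν hκ hη hμ1 hR
  have hw : ∀ ε σ, Admissible μ ε₀ ε σ → ∀ z ∈ window γ η R ε σ, 0 < z.1 ∧
      ∃ x₁ x₂ x₃, LayerPoint γ ν₀ κ₀ c B C ε z.1 z.2 x₁ x₂ x₃ := fun ε σ ha z hz =>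
    ⟨hη.trans_le hz.1, hpt ε σ ha z.1 z.2 hz⟩
  have hσ : ∀ ε σ, Admissible μ ε₀ ε σ → 0 < σ := fun ε σ ha =>
    (Real.rpow_nonneg ha.1.le μ).trans_lt ha.2.2.1
  have hroot : ∀ ε σ, Admissible μ ε₀ ε σ → ∀ z ∈ window γ η R ε σ,
      IsLayerRoot γ ν₀ κ₀ ε z.1 z.2 (decay₁ γ ν₀ κ₀ c ε z.1 z.2) ∧
      IsLayerRoot γ ν₀ κ₀ ε z.1 z.2 (decay₂ γ ν₀ κ₀ c ε z.1 z.2) ∧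
      IsLayerRoot γ ν₀ κ₀ ε z.1 z.2 (decay₃ γ ν₀ κ₀ c ε z.1 z.2) := fun ε σ ha z hz => by
    obtain ⟨hρ, x₁, x₂, x₃, h⟩ := hw ε σ ha z hz
    exact h.isLayerRoot hgap hc ha.1 hρ
  have hne : ∀ ε σ, Admissible μ ε₀ ε σ → ∀ z ∈ window γ η R ε σ, Real.sin z.2 ≠ 0 ∧
      Real.sin (z.2 + γ) ≠ 0 ∧ Real.cos (z.2 + γ) ≠ 0 := fun ε σ ha z hz => by
    obtain ⟨-, x₁, x₂, x₃, h⟩ := hw ε σ ha z hz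
    exact h.ne_zero hgap
  have hcos : ∀ ε σ, Admissible μ ε₀ ε σ → ∀ z ∈ window γ η R ε σ,
      criticalGap γ ≤ |Real.cos (z.2 + γ)| := fun ε σ ha z hz => by
    obtain ⟨-, x₁, x₂, x₃, h⟩ := hw ε σ ha z hz
    exact h.gap_cos
  have hsin : ∀ ε σ, Admissible μ ε₀ ε σ → ∀ z ∈ window γ η R ε σ,
      criticalGap γ ≤ |Real.sin (z.2 + γ)| := fun ε σ ha z hz => by
    obtain ⟨-, x₁, x₂, x₃, h⟩ := hw ε σ ha z hz
    refine h.gap.trans ((le_abs_self _).trans ?_)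
    rw [abs_mul]
    exact mul_le_of_le_one_left (abs_nonneg _) (Real.abs_sin_le_one _)
  have hang : ∀ ε, 0 < ε → ε < ε₀ → ∀ θ ∈ angularWindow γ R ε,
      0 < Real.sin θ * Real.sin (θ + γ) := fun ε h1 h2 θ hθ =>
    hgap.trans_le (angularWindow_near hθ (hsm ε h1 h2)).1
  have hang' : ∀ ε, 0 < ε → ε < ε₀ → ∀ θ ∈ angularWindow γ R ε, Real.sin θ ≠ 0 :=
    fun ε h1 h2 θ hθ => left_ne_zero_of_mul (hang ε h1 h2 θ hθ).ne'
  have hsmooth := fun ε σ (ha : Admissible μ ε₀ ε σ) => contDiffOn_decay hc ha.1 (hw ε σ ha)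
  have hamps := fun ε σ (ha : Admissible μ ε₀ ε σ) =>
    contDiffOn_layerAmp hgap hc ha.1 (hw ε σ ha)
  -- At a point that stays in the window ζ vanishes, so each of the three root estimates reduces to
  -- an error Bρ, which ε^α sends to zero.
  have hlim : ∀ {α β : ℝ} {lam : ℝ → ℝ → ℝ → ℂ} {ℓ : ℝ → ℂ}, 0 < α →
      (∀ ε σ, Admissible μ ε₀ ε σ → ∀ ρ θ, (ρ, θ) ∈ window γ η R ε σ →
        |Real.sin θ ^ 2 - Real.sin γ ^ 2| = 0 →
        ‖lam ε ρ θ - ((ε ^ (-α) * ρ ^ β : ℝ) : ℂ) * ℓ θ‖ ≤ B * ρ) →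
      ∀ ρ θ, η ≤ ρ → (∀ᶠ ε in 𝓝[>] (0 : ℝ), θ ∈ angularWindow γ R ε) →
        Tendsto (fun ε : ℝ => ((ε ^ α : ℝ) : ℂ) * lam ε ρ θ) (𝓝[>] 0)
          (𝓝 (((ρ ^ β : ℝ) : ℂ) * ℓ θ)) := by
    intro α β lam ℓ hα h ρ θ hρ hθ
    obtain ⟨σ, hev⟩ := exists_admissible_window hη hμ hR hε₀ hρ hθ
    have hZ := critical_of_eventually hε₀ hsm hθ
    exact tendsto_rescaled hα (hev.mono fun ε hε => h ε σ hε.1 ρ θ hε.2 hZ)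
  have hlay : ∀ ε σ, Admissible μ ε₀ ε σ → ∀ ρ θ, (ρ, θ) ∈ window γ η R ε σ →
      0 < ρ ∧ ∃ x₁ x₂ x₃, LayerPoint γ ν₀ κ₀ c B C ε ρ θ x₁ x₂ x₃ := fun ε σ ha ρ θ hz =>
    hw ε σ ha (ρ, θ) hz
  set D := 2 * Real.pi * ((ν₀ + κ₀) * (2 * M ^ 3 / criticalGap γ)) * √(12 * Real.pi * R ^ 7)
    with hD
  -- The three entries of the constant serve the two intermediate roots, the large root and the
  -- remainder of the incident beam, respectively.
  refine ⟨ε₀, max (max B (B * (3 * R))) D, decay₁ γ ν₀ κ₀ c, decay₂ γ ν₀ κ₀ c, decay₃ γ ν₀ κ₀ c,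
    fun ε σ => layerBeam γ ν₀ κ₀ η x₀ ε σ (χ ε σ) (ψ ε σ) (layerAmp₁ γ ν₀ κ₀ c ε)
      (decay₁ γ ν₀ κ₀ c ε),
    fun ε σ => layerBeam γ ν₀ κ₀ η x₀ ε σ (χ ε σ) (ψ ε σ) (layerAmp₂ γ ν₀ κ₀ c ε)
      (decay₂ γ ν₀ κ₀ c ε),
    fun ε σ => layerBeam γ ν₀ κ₀ η x₀ ε σ (χ ε σ) (ψ ε σ) (layerAmp₃ γ ν₀ κ₀ c ε)
      (decay₃ γ ν₀ κ₀ c ε),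
    fun ε σ => layerBeam γ ν₀ κ₀ η x₀ ε σ (χ ε σ) (ψ ε σ) (layerAmp₁ γ ν₀ κ₀ c ε)
      (decay₁ γ ν₀ κ₀ c ε) + layerBeam γ ν₀ κ₀ η x₀ ε σ (χ ε σ) (ψ ε σ)
        (layerAmp₂ γ ν₀ κ₀ c ε) (decay₂ γ ν₀ κ₀ c ε),
    fun ε σ => layerBeam γ ν₀ κ₀ η x₀ ε σ (χ ε σ) (ψ ε σ) (layerAmp₃ γ ν₀ κ₀ c ε)
      (decay₃ γ ν₀ κ₀ c ε),
    fun ε σ => incidentBeam γ η x₀ ε σ (χ ε σ) (ψ ε σ) +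
      (layerBeam γ ν₀ κ₀ η x₀ ε σ (χ ε σ) (ψ ε σ) (layerAmp₁ γ ν₀ κ₀ c ε)
      (decay₁ γ ν₀ κ₀ c ε) + layerBeam γ ν₀ κ₀ η x₀ ε σ (χ ε σ) (ψ ε σ)
        (layerAmp₂ γ ν₀ κ₀ c ε) (decay₂ γ ν₀ κ₀ c ε)) +
      layerBeam γ ν₀ κ₀ η x₀ ε σ (χ ε σ) (ψ ε σ) (layerAmp₃ γ ν₀ κ₀ c ε) (decay₃ γ ν₀ κ₀ c ε),
    fun ε σ => incidentRemainder γ ν₀ κ₀ η x₀ R ε σ (χ ε σ) (ψ ε σ),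
    hε₀, ?_, ?_, ?_, ?_, fun _ _ => rfl, rfl, ?_⟩
  · intro ε σ ha ρ θ hz
    obtain ⟨hρ, x₁, x₂, x₃, h⟩ := hlay ε σ ha ρ θ hz
    obtain ⟨⟨q1, -⟩, ⟨q2, -⟩, ⟨q3, -⟩⟩ := h.selects hc ha.1 hρ
    obtain ⟨a1, a2, a3⟩ := h.asymptotics hc ha.1 hρ
    obtain ⟨e1, e2, e3⟩ := h.decay_eq hc ha.1 hρ
    rw [zeta, freq_eq_sin hρ]
    have hle : ∀ {u v : ℝ}, u ≤ max (max B (B * (3 * R))) D → 0 ≤ v →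
        u * v ≤ max (max B (B * (3 * R))) D * v := fun h h' => mul_le_mul_of_nonneg_right h h'
    have hε := ha.1
    refine ⟨fun z => ?_, ?_, ?_, ?_, a1.trans (hle ((le_max_left _ _).trans (le_max_left _ _))
      (by positivity)), a2.trans (hle ((le_max_left _ _).trans (le_max_left _ _))
      (by positivity)), ?_⟩
    · rw [e1, e2, e3]
      exact h.roots z
    · exact fun e => quadrants_disjoint.1 q1 (e ▸ q2)
    · exact fun e => quadrants_disjoint.2.1 q1 (e ▸ q3)
    · exact fun e => quadrants_disjoint.2.2 q2 (e ▸ q3)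
    · exact (a3.trans (large_remainder_le hμ1 hR hε₀1 hB.le (hsm ε hε ha.2.1) ha hz)).trans
        (hle ((le_max_right _ _).trans (le_max_left _ _)) (by positivity))
  · refine isLinearLayerBeam_layerBeam (s₀ := criticalGap γ) (c₀ := c) (C₀ := B) (C₁ := C) hη
      (by norm_num) (by norm_num) hgap hc hχ hψ hsin (fun ε σ ha => (hsmooth ε σ ha).1)
      (fun ε σ ha => (hamps ε σ ha).1) (fun ε σ ha z hz => (hroot ε σ ha z hz).1) ?_ ?_
      (fun ε h1 h2 => contDiffOn_midProfile hγ₀ hγ₁ hs (hang ε h1 h2))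
      (fun ε h1 h2 θ hθ => midProfile_re_pos hγ₀ hγ₁ hs (hang ε h1 h2 θ hθ))
      (hlim (by norm_num) ?_)
    all_goals
      intro ε σ ha ρ θ hz
      obtain ⟨hρ, x₁, x₂, x₃, h⟩ := hlay ε σ ha ρ θ hz
    · exact (h.decay_size hc ha.1 hρ).1
    · exact (h.amp_bound hc ha.1 hρ).1
    · intro hZ
      simpa [hZ] using (h.asymptotics hc ha.1 hρ).1
  · refine isLinearLayerBeam_layerBeam (s₀ := criticalGap γ) (c₀ := c) (C₀ := B) (C₁ := C) hη
      (by norm_num) (by norm_num) hgap hc hχ hψ hsin (fun ε σ ha => (hsmooth ε σ ha).2.1)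
      (fun ε σ ha => (hamps ε σ ha).2.1) (fun ε σ ha z hz => (hroot ε σ ha z hz).2.1) ?_ ?_
      (fun ε h1 h2 => Complex.conjCLE.contDiff.comp_contDiffOn
        (contDiffOn_midProfile hγ₀ hγ₁ hs (hang ε h1 h2)))
      (fun ε h1 h2 θ hθ => midProfile_re_pos hγ₀ hγ₁ hs (hang ε h1 h2 θ hθ))
      (hlim (by norm_num) ?_)
    all_goals
      intro ε σ ha ρ θ hz
      obtain ⟨hρ, x₁, x₂, x₃, h⟩ := hlay ε σ ha ρ θ hz
    · exact (h.decay_size hc ha.1 hρ).2.1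
    · exact (h.amp_bound hc ha.1 hρ).2.1
    · intro hZ
      simpa [hZ] using (h.asymptotics hc ha.1 hρ).2.1
  · refine isLinearLayerBeam_layerBeam (s₀ := criticalGap γ) (c₀ := c) (C₀ := B) (C₁ := C) hη
      (by norm_num) le_rfl hgap hc hχ hψ hsin (fun ε σ ha => (hsmooth ε σ ha).2.2)
      (fun ε σ ha => (hamps ε σ ha).2.2) (fun ε σ ha z hz => (hroot ε σ ha z hz).2.2) ?_ ?_
      (fun ε h1 h2 => contDiffOn_largeProfile hν hκ (hang' ε h1 h2))
      (fun ε h1 h2 θ hθ => largeProfile_re hν hκ (hang' ε h1 h2 θ hθ))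
      (hlim (by norm_num) ?_)
    all_goals
      intro ε σ ha ρ θ hz
      obtain ⟨hρ, x₁, x₂, x₃, h⟩ := hlay ε σ ha ρ θ hz
    · simpa only [Real.rpow_zero, mul_one] using (h.decay_size hc ha.1 hρ).2.2
    · exact (h.amp_bound hc ha.1 hρ).2.2
    · intro hZ
      simpa [hZ] using (h.asymptotics hc ha.1 hρ).2.2
  · intro ε σ ha
    have hε := ha.1
    have solves := solvesLinear_incidentBeam (ν₀ := ν₀) (κ₀ := κ₀) (x₀ := x₀) hε (hσ ε σ ha) hη
      (hχ ε σ) (hψ ε σ) (hne ε σ ha)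
    have layer : ∀ {a lam : ℝ → ℝ → ℂ},
        ContDiffOn ℝ ∞ (fun z : ℝ × ℝ => a z.1 z.2) (window γ η R ε σ) →
        ContDiffOn ℝ ∞ (fun z : ℝ × ℝ => lam z.1 z.2) (window γ η R ε σ) →
        (∀ z ∈ window γ η R ε σ, IsLayerRoot γ ν₀ κ₀ ε z.1 z.2 (lam z.1 z.2)) →
        SolvesLinear γ ν₀ κ₀ ε (layerBeam γ ν₀ κ₀ η x₀ ε σ (χ ε σ) (ψ ε σ) a lam) 0 :=
      fun h1 h2 h3 => solvesLinear_layerBeam hε (hσ ε σ ha) hη (hχ ε σ) (hψ ε σ)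
        h1.continuousOn h2.continuousOn h3
    have l1 := layer (hamps ε σ ha).1 (hsmooth ε σ ha).1 fun z hz => (hroot ε σ ha z hz).1
    have l2 := layer (hamps ε σ ha).2.1 (hsmooth ε σ ha).2.1 fun z hz => (hroot ε σ ha z hz).2.1
    have l3 := layer (hamps ε σ ha).2.2 (hsmooth ε σ ha).2.2 fun z hz => (hroot ε σ ha z hz).2.2
    refine ⟨rfl, squareIntegrable_incidentBeam hε (hσ ε σ ha) hη (hχ ε σ) (hψ ε σ) (hne ε σ ha),
      by simpa only [add_zero] using (solves.add (l1.add l2)).add l3,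
      reflected_boundaryConditions hgap hc hε (hσ ε σ ha) hη (hχ ε σ) (hψ ε σ) (hw ε σ ha),
      fun t i => ?_⟩
    obtain ⟨m1, m2⟩ := incidentRemainder_bound (x₀ := x₀) hγ₀ hγ₁ hν hκ hR hε (hσ ε σ ha) hη
      (hχ ε σ) (hψ ε σ) (hne ε σ ha) hgap (hcos ε σ ha) t i
    refine ⟨m1, m2.trans (ENNReal.ofReal_le_ofReal ?_)⟩
    have := hσ ε σ ha
    gcongr
    exact le_max_right _ _
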